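/- Let $k\ge 2$. Let $\mathbf F=\mathbf R$ or $\mathbf C$, and equip $\mathbf F^{k+2}$ (coordinates $z_0,\dots,z_{k+1}$) with the form $\Psi(z,w)=\bar z_0w_{k+1}+\bar z_{k+1}w_0-\sum_{j=1}^k\bar z_jw_j$. Let $\mathsf{SU}(1,k+1)$ be the group of complex matrices of determinant $1$ preserving $\Psi$, and $\mathsf{SO}_0(1,k+1)$ the identity component of the corresponding real group; they act on the hyperbolic space of $\Psi$-positive lines. A representation is convex-cocompact if it has finite kernel and discrete image and acts cocompactly on a nonempty invariant closed convex subset of hyperbolic space. Algebraic convergence is pointwise convergence of representations; geometric convergence is convergence of the images in the Chabauty topology on closed subgroups. Sequences are indexed by integers $n\ge 1$, and $F_2=\langle a,b\rangle$ is free on $a,b$. For $x\in\mathbf F^k$ let $$u_x=\begin{pmatrix}1&\bar x^T&\tfrac12|x|^2\\0&1&x\\0&0&1\end{pmatrix},\qquad M(x,y,c,A)=u_x\begin{pmatrix}e^yc&0&0\\0&A&0\\0&0&e^{-y}c\end{pmatrix}u_x^{-1}.$$ *Real sequence:* with $l=\lfloor k/2\rfloor$, $g_n=M(x_n,n^{-(l+1)},1,A_n)\in\mathsf{SO}_0(1,k+1)$,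 where $x_n=(0,n,\dots,0,n)$ (followed by a last coordinate $0$ if $k$ is odd) and $A_n$ is block diagonal with the $2\times2$ blocks $\begin{pmatrix}\cos\theta_i&\sin\theta_i\\-\sin\theta_i&\cos\theta_i\end{pmatrix}$, $\theta_i=2\pi/n^i$, $1\le i\le l$ (followed by a last entry $1$ if $k$ is odd). *Complex sequence:* $h_n=M((n,\dots,n),n^{-(k+2)},e^{i\phi},\mathrm{diag}(e^{i\theta_1},\dots,e^{i\theta_k}))\in\mathsf{SU}(1,k+1)$ with $\theta_1=\frac{2\pi}{n}+\frac{2\pi}{n^{k+1}}$, $\theta_j=\frac{2\pi}{n^j}$ for $2\le j\le k-1$, $\theta_k=-\sum_{j=1}^{k-1}\frac{2\pi}{n^j}$ and $\phi=-\frac12(\theta_1+\dots+\theta_k)$. 1. For every $1\le l\le\lfloor k/2\rfloor$ there are convex-cocompact representations $\rho_n\colon F_2\to\mathsf{SO}_0(1,k+1)$ such that (i) the restrictions $\rho_n|_{\langle a\rangle}$ are convex-cocompact representations of $\mathbf Z$ with a discrete and faithful algebraic limit and with a discrete geometric limit isomorphic to $\mathbf Z^{l+1}$, and $\rho_n(a)=g_n$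 for all $n$ if $l=\lfloor k/2\rfloor$; (ii) $\rho_n$ converges algebraically to a representation $\rho_\infty$ and geometrically to a discrete group that is isomorphic to $\mathbf Z^{l+1}*\mathbf Z$ and properly contains $\rho_\infty(F_2)$. In particular, for $l=1$ the geometric limit is isomorphic to $\mathbf Z^2*\mathbf Z$. 2. The same holds for $\mathsf{SU}(1,k+1)$ and every $1\le l\le k$, with $\rho_n(a)=h_{(k+2)n}$ for all $n$ if $l=k$. 3. There are convex-cocompact representations $\rho_n\colon F_2\to\mathsf{SU}(1,k+1)$ with $\rho_n(a)=h_n$ for all $n\ge1$ that converge algebraically to a representation $\rho_\infty$, and such that for every $r\ge 0$ the subsequence $(\rho_{(k+2)m+r})_m$ converges geometrically to a discrete group (depending on $r$) that is isomorphic to $\mathbf Z^{k+1}*\mathbf Z$ and properly contains $\rho_\infty(F_2)$. -/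

import Mathlib

open Filter Topology
open scoped LinearAlgebra.Projectivization Matrix

noncomputable section

/-! ### The form of signature `(1, k+1)`, its unitary group, and hyperbolic space -/

/-- Index set of the coordinates `z₀, z₁, …, z_k, z_{k+1}`: the first coordinate is `first`,
the last one is `last`, and the `k` coordinates in between are `mid j`. -/
abbrev Idx (k : ℕ) : Type := Unit ⊕ Fin k ⊕ Unit

abbrev Idx.first {k : ℕ} : Idx k := Sum.inl ()
abbrev Idx.mid {k : ℕ} (j : Fin k) : Idx k := Sum.inr (Sum.inl j)
abbrev Idx.last {k : ℕ} : Idx k := Sum.inr (Sum.inr ())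

/-- `Ψ(z, w) = conj z₀ * w_{k+1} + conj z_{k+1} * w₀ - ∑_{j=1}^k conj z_j * w_j`. -/
def hermForm {F : Type*} [RCLike F] {k : ℕ} (z w : Idx k → F) : F :=
  star (z Idx.first) * w Idx.last + star (z Idx.last) * w Idx.first
    - ∑ j : Fin k, star (z (Idx.mid j)) * w (Idx.mid j)

/-- The group `SU(1, k+1; F)` of matrices of determinant one that preserve `Ψ`. -/
def unitaryGroup (F : Type*) [RCLike F] (k : ℕ) :
    Subgroup (Matrix.SpecialLinearGroup (Idx k) F) where
  carrier := {g | ∀ z w : Idx k → F, hermForm (g.1 *ᵥ z) (g.1 *ᵥ w) = hermForm z w}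
  one_mem' := by
    intro z w
    simp
  mul_mem' := by
    intro g h hg hh z w
    have e : ∀ v : Idx k → F, (g * h).1 *ᵥ v = g.1 *ᵥ (h.1 *ᵥ v) := fun v => by
      rw [Matrix.mulVec_mulVec]; rfl
    rw [e, e, hg, hh]
  inv_mem' := by
    intro g hg z w
    have e : ∀ v : Idx k → F, g.1 *ᵥ ((g⁻¹).1 *ᵥ v) = v := fun v => by
      have h1 : g.1 * (g⁻¹).1 = 1 := by
        rw [← Matrix.SpecialLinearGroup.coe_mul, mul_inv_cancel, Matrix.SpecialLinearGroup.coe_one]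
      rw [Matrix.mulVec_mulVec, h1, Matrix.one_mulVec]
    rw [← hg, e, e]

/-- `SU(1, k+1)`. -/
abbrev SU1 (k : ℕ) : Subgroup (Matrix.SpecialLinearGroup (Idx k) ℂ) := unitaryGroup ℂ k

/-- `SO₀(1, k+1)`, the identity component of `SO(1, k+1)`. -/
def SO1 (k : ℕ) : Subgroup (Matrix.SpecialLinearGroup (Idx k) ℝ) :=
  (Subgroup.connectedComponentOfOne (unitaryGroup ℝ k)).map (unitaryGroup ℝ k).subtype

/-- The quotient topology on a projective space. -/
instance projTopology {F V : Type*} [Field F] [AddCommGroup V] [Module F V]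
    [TopologicalSpace V] : TopologicalSpace (ℙ F V) :=
  TopologicalSpace.coinduced (Projectivization.mk' F : {v : V // v ≠ 0} → ℙ F V) inferInstance

/-- The hyperbolic space of dimension `k+1` over `F`: the lines on which `Ψ` is positive. -/
def hypSpace (F : Type*) [RCLike F] (k : ℕ) : Set (ℙ F (Idx k → F)) :=
  {p | 0 < RCLike.re (hermForm p.rep p.rep)}

/-- The expression in two vectors that defines the hyperbolic distance. -/
def vecDist {F : Type*} [RCLike F] {k : ℕ} (v w : Idx k → F) : ℝ :=
  Real.arcosh (‖hermForm v w‖ /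
    (√(RCLike.re (hermForm v v)) * √(RCLike.re (hermForm w w))))

/-- The hyperbolic distance,
`cosh d([v], [w]) = |Ψ(v, w)| / √(Ψ(v, v) Ψ(w, w))`. -/
def hypDist {F : Type*} [RCLike F] {k : ℕ} (p q : ℙ F (Idx k → F)) : ℝ :=
  vecDist p.rep q.rep

theorem hermForm_smul_smul {F : Type*} [RCLike F] {k : ℕ} (a b : F) (v w : Idx k → F) :
    hermForm (a • v) (b • w) = star a * b * hermForm v w := by
  simp only [hermForm, Pi.smul_apply, smul_eq_mul, star_mul', mul_sub, Finset.mul_sum]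
  congr 1
  · ring
  · exact Finset.sum_congr rfl fun _ _ => by ring

theorem re_hermForm_smul {F : Type*} [RCLike F] {k : ℕ} (a : F) (v : Idx k → F) :
    RCLike.re (hermForm (a • v) (a • v)) = ‖a‖ ^ 2 * RCLike.re (hermForm v v) := by
  rw [hermForm_smul_smul, RCLike.star_def, RCLike.conj_mul, ← RCLike.ofReal_pow,
    RCLike.re_ofReal_mul]

/-- Membership in hyperbolic space may be tested on any representative. -/
theorem mk_mem_hypSpace {F : Type*} [RCLike F] {k : ℕ} (v : Idx k → F) (hv : v ≠ 0) :
    Projectivization.mk F v hv ∈ hypSpace F k ↔ 0 < RCLike.re (hermForm v v) := by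
  obtain ⟨a, ha⟩ := Projectivization.exists_smul_eq_mk_rep F v hv
  have h0 : 0 < ‖(a : F)‖ ^ 2 := by
    have := norm_pos_iff.mpr a.ne_zero
    positivity
  rw [hypSpace, Set.mem_ofPred_eq, ← ha, Units.smul_def, re_hermForm_smul,
    mul_pos_iff_of_pos_left h0]

/-- The hyperbolic distance may be computed with any representatives. -/
theorem hypDist_mk {F : Type*} [RCLike F] {k : ℕ} (v w : Idx k → F) (hv : v ≠ 0) (hw : w ≠ 0) :
    hypDist (Projectivization.mk F v hv) (Projectivization.mk F w hw) = vecDist v w := by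
  obtain ⟨a, ha⟩ := Projectivization.exists_smul_eq_mk_rep F v hv
  obtain ⟨b, hb⟩ := Projectivization.exists_smul_eq_mk_rep F w hw
  have ha0 : ‖(a : F)‖ ≠ 0 := norm_ne_zero_iff.mpr a.ne_zero
  have hb0 : ‖(b : F)‖ ≠ 0 := norm_ne_zero_iff.mpr b.ne_zero
  rw [hypDist, ← ha, ← hb, Units.smul_def, Units.smul_def, vecDist, vecDist,
    re_hermForm_smul, re_hermForm_smul, hermForm_smul_smul, norm_mul, norm_mul, norm_star,
    Real.sqrt_mul (by positivity), Real.sqrt_mul (by positivity),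
    Real.sqrt_sq (norm_nonneg _), Real.sqrt_sq (norm_nonneg _)]
  congr 1
  rw [show ‖(a : F)‖ * √(RCLike.re (hermForm v v)) * (‖(b : F)‖ * √(RCLike.re (hermForm w w)))
    = (‖(a : F)‖ * ‖(b : F)‖) * (√(RCLike.re (hermForm v v)) * √(RCLike.re (hermForm w w)))
    by ring, mul_div_mul_left _ _ (mul_ne_zero ha0 hb0)]

/-- A set in hyperbolic space is convex if it contains the geodesic segment between any two of
its points, that is, all the points `z` with `d(x, z) + d(z, y) = d(x, y)`. -/
def IsHypConvex {F : Type*} [RCLike F] {k : ℕ} (C : Set (ℙ F (Idx k → F))) : Prop :=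
  ∀ x ∈ C, ∀ y ∈ C, ∀ z ∈ hypSpace F k, hypDist x z + hypDist z y = hypDist x y → z ∈ C

/-- A representation is convex-cocompact if it has finite kernel and discrete image and
preserves a nonempty closed convex subset of hyperbolic space on which it acts cocompactly. -/
def IsConvexCocompact {F : Type*} [RCLike F] {k : ℕ}
    {G : Subgroup (Matrix.SpecialLinearGroup (Idx k) F)} {Γ : Type*} [Group Γ] (ρ : Γ →* G) : Prop :=
  Finite ρ.ker ∧ DiscreteTopology ρ.range ∧
  ∃ C : Set (ℙ F (Idx k → F)), C ⊆ hypSpace F k ∧ C.Nonempty ∧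
    IsClosed ((↑) ⁻¹' C : Set (hypSpace F k)) ∧ IsHypConvex C ∧
    (∀ γ : Γ, ∀ x ∈ C, (ρ γ : Matrix.SpecialLinearGroup (Idx k) F) • x ∈ C) ∧
    ∃ K : Set (ℙ F (Idx k → F)), K ⊆ C ∧ IsCompact K ∧
      ∀ x ∈ C, ∃ γ : Γ, ∃ y ∈ K, (ρ γ : Matrix.SpecialLinearGroup (Idx k) F) • y = x

/-! ### Algebraic and geometric convergence -/

/-- Algebraic convergence: pointwise convergence of representations. -/
def ConvergesAlgebraically {Γ G : Type*} [Group Γ] [Group G] [TopologicalSpace G]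
    (ρ : ℕ → Γ →* G) (ρlim : Γ →* G) : Prop :=
  ∀ γ : Γ, Tendsto (fun n => ρ n γ) atTop (𝓝 (ρlim γ))

/-- The Chabauty topology on the set of closed subgroups. -/
abbrev chabautyTopology (G : Type*) [Group G] [TopologicalSpace G] :
    TopologicalSpace (ClosedSubgroup G) :=
  TopologicalSpace.generateFrom
    ({S | ∃ K : Set G, IsCompact K ∧ S = {H : ClosedSubgroup G | (H.carrier ∩ K) = ∅}} ∪
     {S | ∃ U : Set G, IsOpen U ∧ S = {H : ClosedSubgroup G | (H.carrier ∩ U).Nonempty}})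

/-- Geometric convergence: the subgroups `H n` (closed for large `n`) converge to the closed
subgroup `L` in the Chabauty topology. -/
def ConvergesGeometrically {G : Type*} [Group G] [TopologicalSpace G]
    (H : ℕ → Subgroup G) (L : Subgroup G) : Prop :=
  ∃ (C : ℕ → ClosedSubgroup G) (D : ClosedSubgroup G),
    (∀ᶠ n in atTop, (C n).toSubgroup = H n) ∧ D.toSubgroup = L ∧
    Tendsto C atTop (@nhds _ (chabautyTopology G) D)

/-! ### The sequences -/

/-- The restriction of a representation of `F₂ = ⟨a, b⟩` to `⟨a⟩ ≅ ℤ`, with `a = of 0`. -/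
def restrictToA {G : Type*} [Group G] (ρ : FreeGroup (Fin 2) →* G) : Multiplicative ℤ →* G :=
  ρ.comp (zpowersHom (FreeGroup (Fin 2)) (FreeGroup.of 0))

/-- A sequence (indexed by `n ≥ 1`) of convex-cocompact representations of `ℤ` with a discrete
and faithful algebraic limit, and with a discrete geometric limit isomorphic to `ℤ^(l+1)`. -/
def IsJorgensenSequence {F : Type*} [RCLike F] {k : ℕ}
    {G : Subgroup (Matrix.SpecialLinearGroup (Idx k) F)} (l : ℕ) (σ : ℕ → Multiplicative ℤ →* G) : Prop :=
  (∀ n, 1 ≤ n → IsConvexCocompact (σ n)) ∧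
  (∃ σlim : Multiplicative ℤ →* G, ConvergesAlgebraically σ σlim ∧
    Function.Injective σlim ∧ DiscreteTopology σlim.range) ∧
  ∃ D : Subgroup G, ConvergesGeometrically (fun n => (σ n).range) D ∧ DiscreteTopology D ∧
    Nonempty (D ≃* Multiplicative (Fin (l + 1) → ℤ))

/-- The images of the representations `ρ n` converge geometrically to a discrete group that is
isomorphic to `ℤ^(l+1) ∗ ℤ` and properly contains the image of `ρlim`. -/
def HasFreeProductLimit {Γ G : Type*} [Group Γ] [Group G] [TopologicalSpace G] (l : ℕ)
    (ρ : ℕ → Γ →* G) (ρlim : Γ →* G) : Prop :=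
  ∃ L : Subgroup G, ConvergesGeometrically (fun n => (ρ n).range) L ∧ DiscreteTopology L ∧
    Nonempty (L ≃* Monoid.Coprod (Multiplicative (Fin (l + 1) → ℤ)) (Multiplicative ℤ)) ∧
    ρlim.range < L

/-- The unipotent matrix that fixes `∞ = [e₀]` and maps the origin `[e_{k+1}]` to the point of
the boundary with coordinates `(x, t)`; over `ℝ` the number `t` plays no role. -/
def unipotent {F : Type*} [RCLike F] {k : ℕ} (x : Fin k → F) (t : ℝ) :
    Matrix (Idx k) (Idx k) F :=
  Matrix.of fun
    | .inl _, .inl _ => 1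
    | .inl _, .inr (.inl j) => star (x j)
    | .inl _, .inr (.inr _) => ((∑ j, ‖x j‖ ^ 2) / 2 : ℝ) + (t : F) * RCLike.I
    | .inr (.inl _), .inl _ => 0
    | .inr (.inl i), .inr (.inl j) => if i = j then 1 else 0
    | .inr (.inl i), .inr (.inr _) => x i
    | .inr (.inr _), .inl _ => 0
    | .inr (.inr _), .inr (.inl _) => 0
    | .inr (.inr _), .inr (.inr _) => 1

/-- The block diagonal matrix with blocks `e^y c`, `A`, `e^(-y) c`. -/
def leviMatrix {F : Type*} [RCLike F] {k : ℕ} (y : ℝ) (c : F) (A : Matrix (Fin k) (Fin k) F) :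
    Matrix (Idx k) (Idx k) F :=
  Matrix.of fun
    | .inl _, .inl _ => (Real.exp y : F) * c
    | .inr (.inl i), .inr (.inl j) => A i j
    | .inr (.inr _), .inr (.inr _) => (Real.exp (-y) : F) * c
    | _, _ => 0

/-- The loxodromic matrix with attracting fixed point `∞`, repelling fixed point `(x, t)`,
translation length `y` and elliptic part given by `c` and `A`. -/
def loxodromicMatrix {F : Type*} [RCLike F] {k : ℕ} (x : Fin k → F) (t y : ℝ) (c : F)
    (A : Matrix (Fin k) (Fin k) F) : Matrix (Idx k) (Idx k) F :=
  unipotent x t * leviMatrix y c A * unipotent (-x) (-t)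

/-- The block diagonal rotation of `ℝ^k` whose `i`-th block (`i = 1, …, ⌊k/2⌋`) is
`(cos θ_i, sin θ_i; -sin θ_i, cos θ_i)`, with a last diagonal entry `1` if `k` is odd.
Rows and columns are numbered from `0` here, so block `i` has the indices `2i-2` and `2i-1`. -/
def rotationBlocks (k : ℕ) (θ : ℕ → ℝ) : Matrix (Fin k) (Fin k) ℝ :=
  Matrix.of fun p q =>
    if (p : ℕ) / 2 ≠ (q : ℕ) / 2 then 0
    else if (p : ℕ) / 2 = k / 2 then 1
    else if p = q then Real.cos (θ ((p : ℕ) / 2 + 1))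
    else if p < q then Real.sin (θ ((p : ℕ) / 2 + 1))
    else -Real.sin (θ ((p : ℕ) / 2 + 1))

/-- The matrices of the real sequence: with `l = ⌊k/2⌋`, the repelling fixed point is
`(0, n, 0, n, …)` (with a last coordinate `0` if `k` is odd), the translation length is
`n^(-(l+1))`, and the rotation angles are `2π/n, …, 2π/n^l`. -/
def realJorgensenMatrix (k n : ℕ) : Matrix (Idx k) (Idx k) ℝ :=
  loxodromicMatrix (fun p : Fin k => if (p : ℕ) % 2 = 1 then (n : ℝ) else 0) 0
    (1 / (n : ℝ) ^ (k / 2 + 1)) 1 (rotationBlocks k fun i => 2 * Real.pi / (n : ℝ) ^ i)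

/-- The angles of the complex sequence: `θ₁ = 2π/n + 2π/n^(k+1)`, `θ_j = 2π/n^j` for
`2 ≤ j ≤ k-1`, and `θ_k = -∑_{j=1}^{k-1} 2π/n^j`. Coordinates are numbered from `0` here. -/
def complexAngle (k n : ℕ) (p : Fin k) : ℝ :=
  if (p : ℕ) + 1 = k then -∑ j ∈ Finset.Ico 1 k, 2 * Real.pi / (n : ℝ) ^ j
  else if (p : ℕ) = 0 then 2 * Real.pi / n + 2 * Real.pi / (n : ℝ) ^ (k + 1)
  else 2 * Real.pi / (n : ℝ) ^ ((p : ℕ) + 1)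

/-- The matrices of the complex sequence: the repelling fixed point is `((n, …, n), 0)`, the
translation length is `n^(-(k+2))`, the elliptic part is given by the angles `complexAngle` and
by `exp(iφ)` with `φ = -(θ₁ + ⋯ + θ_k)/2`. -/
def complexJorgensenMatrix (k n : ℕ) : Matrix (Idx k) (Idx k) ℂ :=
  loxodromicMatrix (fun _ : Fin k => (n : ℂ)) 0 (1 / (n : ℝ) ^ (k + 2))
    (Complex.exp (((-(∑ p : Fin k, complexAngle k n p) / 2 : ℝ) : ℂ) * Complex.I))
    (Matrix.diagonal fun p => Complex.exp ((complexAngle k n p : ℂ) * Complex.I))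

end

/-! ### Algebra of the Hermitian form -/

section HermForm

variable {F : Type*} [RCLike F] {k : ℕ}

/-! The argument works with vectors instead of points. For unit positive vectors `|Ψ(x, y)|` is the
hyperbolic cosine of the distance, and Gromov hyperbolicity becomes the quasi-ultrametric inequality
`norm_hermForm_mul_le`.

Why the limits of the cyclic groups grow. A power of `g_n` is a loxodromic matrix fixing `∞` and a
point `x_n` of size `n`. Away from the corner (first row, last column) its entries are constants,
multipliers, or of the form `n (e^z - 1)`; the corner consists of terms `n² (e^z - 1)`. So a power
`g_n^j` stays bounded only if its translation length and its angles modulo `2π` are `O(1/n)`. For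
translation length `n^(-(l+1))` and angles `2π/n^i` this forces `j = ∑ a_t n^t` with bounded digits
`a_0, …, a_l` (`exists_digits`). Conversely, modulo integers `j / n^i` is asymptotic to `a_(i-1) /
n`, so `g_n^j` converges for fixed digits, and the corner of the limit is a sum of squares that
vanishes only if all digits do. The limits form a group `ℤ^(l+1)`.

In the complex case the corner has an imaginary part `-n² ∑ sin u_p`. It drops out in the limit if
the angles sum to zero, which costs one coordinate and gives every `l < k`. For `l = k` the angles
are perturbed, and the imaginary part carries information. Boundedness forces `(k+2)/2 · j/n^(k+1)`
to lie within `O(1/n²)` of an integer `Q`. The new generator `Q = 1` is an exponent close to `2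
n^(k+1)/(k+2)`; it has to be an integer with prescribed quotients, so it depends on the residue of
`n` modulo `k + 2`.

Why free products appear. Nontrivial powers of `g_n` have corner at least some `κ > 0`, uniformly in
large `n`, and a base point `p` at small height `t` is moved by roughly corner divided by `t`. For
small `t` the powers of `g_n` and of a fixed long translation `b` through `p` move `p` far and in
different directions (`IsLoxodromicMatrix.pingPong`). Hence displacement grows exponentially with
the length of an alternating word, with constants independent of `n`. Elements of bounded
displacement are words of bounded length in finitely many letters, so the groups `⟨g_n, b⟩` converge
to the limit of the cyclic groups times `⟨b⟩` (free product), because the ping-pong inequalities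
survive in the limit (`PowersConverge.isFreeProductLimit`).

Why the representations are convex-cocompact. Ping-pong makes orbits quasi-convex
(`AltWord.quasiconvex`). The invariant convex set is an intersection of closed convex regions
containing the orbit. Half-spaces bounded by bisectors are not convex in complex hyperbolic space,
so the regions `InRegion`, given in horospherical coordinates by `Re z₁ ≤ √Ψ(x, x)`, are used
instead. They are convex over both fields and there are enough of them to cut off every point far
from the orbit (`exists_separating_region`). -/

theorem star_hermForm (z w : Idx k → F) : star (hermForm z w) = hermForm w z := by
  simp only [hermForm, star_sub, star_add, star_mul', star_star, star_sum]
  congr 1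
  · ring
  · exact Finset.sum_congr rfl fun _ _ => by ring

theorem hermForm_add_right (z w w' : Idx k → F) :
    hermForm z (w + w') = hermForm z w + hermForm z w' := by
  simp only [hermForm, Pi.add_apply, mul_add, Finset.sum_add_distrib]
  ring

theorem hermForm_smul_right (a : F) (z w : Idx k → F) :
    hermForm z (a • w) = a * hermForm z w := by
  have := hermForm_smul_smul (1 : F) a z w
  simpa using this

theorem hermForm_smul_left (a : F) (z w : Idx k → F) :
    hermForm (a • z) w = star a * hermForm z w := by
  have := hermForm_smul_smul a (1 : F) z w
  simpa using this

theorem hermForm_add_left (z z' w : Idx k → F) :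
    hermForm (z + z') w = hermForm z w + hermForm z' w := by
  rw [← star_hermForm, hermForm_add_right, star_add, star_hermForm, star_hermForm]

theorem hermForm_neg_right (z w : Idx k → F) : hermForm z (-w) = -hermForm z w := by
  rw [← neg_one_smul F w, hermForm_smul_right]; ring

theorem hermForm_neg_left (z w : Idx k → F) : hermForm (-z) w = -hermForm z w := by
  rw [← neg_one_smul F z, hermForm_smul_left]; simp

theorem hermForm_sub_right (z w w' : Idx k → F) :
    hermForm z (w - w') = hermForm z w - hermForm z w' := by
  rw [sub_eq_add_neg, hermForm_add_right, hermForm_neg_right, sub_eq_add_neg]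

theorem hermForm_sub_left (z z' w : Idx k → F) :
    hermForm (z - z') w = hermForm z w - hermForm z' w := by
  rw [sub_eq_add_neg, hermForm_add_left, hermForm_neg_left, sub_eq_add_neg]

theorem hermForm_zero_left (z : Idx k → F) : hermForm 0 z = 0 := by simp [hermForm]

theorem norm_hermForm_comm (z w : Idx k → F) : ‖hermForm z w‖ = ‖hermForm w z‖ := by
  rw [← star_hermForm, norm_star]

theorem hermForm_self_eq (z : Idx k → F) :
    hermForm z z = ((RCLike.re (hermForm z z) : ℝ) : F) := by
  have h := star_hermForm z z
  rw [RCLike.star_def, RCLike.conj_eq_iff_re] at h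
  exact h.symm

theorem star_mul_self_eq (a : F) : star a * a = ((‖a‖ ^ 2 : ℝ) : F) := by
  rw [RCLike.star_def, RCLike.conj_mul]; norm_cast

/-- A nonzero vector that is orthogonal to a positive vector is negative. -/
theorem re_hermForm_neg_of_orthogonal {p x : Idx k → F} (hp : 0 < RCLike.re (hermForm p p))
    (h : hermForm p x = 0) (hx : x ≠ 0) : RCLike.re (hermForm x x) < 0 := by
  by_contra! hpos
  -- On the hyperplane `w₀ + w_{k+1} = 0` the form is negative definite. The combination `ux • p -
  -- up • x` lies in it, while orthogonality would make its self-product nonnegative.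
  have key : ∀ w : Idx k → F, w Idx.first + w Idx.last = 0 →
      RCLike.re (hermForm w w) = -(2 * ‖w Idx.first‖ ^ 2 + ∑ j, ‖w (Idx.mid j)‖ ^ 2) := by
    intro w hw
    have hl : w Idx.last = -w Idx.first := by linear_combination hw
    have : hermForm w w = ((-(2 * ‖w Idx.first‖ ^ 2 + ∑ j, ‖w (Idx.mid j)‖ ^ 2) : ℝ) : F) := by
      have e1 := star_mul_self_eq (w Idx.first)
      simp only [hermForm, hl, star_mul_self_eq]
      rw [star_neg, mul_neg, neg_mul, e1]
      push_cast
      ring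
    rw [this, RCLike.ofReal_re]
  set up := p Idx.first + p Idx.last with hup
  set ux := x Idx.first + x Idx.last with hux
  have hxp : hermForm x p = 0 := by rw [← star_hermForm, h, star_zero]
  have e1 : RCLike.re (hermForm (ux • p - up • x) (ux • p - up • x)) =
      ‖ux‖ ^ 2 * RCLike.re (hermForm p p) + ‖up‖ ^ 2 * RCLike.re (hermForm x x) := by
    have : hermForm (ux • p - up • x) (ux • p - up • x) =
        hermForm (ux • p) (ux • p) + hermForm (up • x) (up • x) := by
      simp only [hermForm_sub_left, hermForm_sub_right, hermForm_smul_left, hermForm_smul_right,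
        h, hxp]
      ring
    rw [this, map_add, re_hermForm_smul, re_hermForm_smul]
  have e2 := key (ux • p - up • x) (by
    simp only [Pi.sub_apply, Pi.smul_apply, smul_eq_mul, hup, hux]; ring)
  have s1 : 0 ≤ ∑ j, ‖(ux • p - up • x) (Idx.mid j)‖ ^ 2 :=
    Finset.sum_nonneg fun _ _ => by positivity
  have hux0 : ux = 0 := by
    by_contra hne
    have : 0 < ‖ux‖ ^ 2 := by have := norm_pos_iff.mpr hne; positivity
    have := mul_pos this hp
    have := mul_nonneg (sq_nonneg ‖up‖) hpos
    have := sq_nonneg ‖(ux • p - up • x) Idx.first‖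
    linarith
  have e3 := key x hux0
  have s2 : 0 ≤ ∑ j, ‖x (Idx.mid j)‖ ^ 2 := Finset.sum_nonneg fun _ _ => by positivity
  have hf : ‖x Idx.first‖ ^ 2 = 0 := by nlinarith [sq_nonneg ‖x Idx.first‖]
  have hs : ∑ j, ‖x (Idx.mid j)‖ ^ 2 = 0 := by nlinarith [sq_nonneg ‖x Idx.first‖]
  have hf' : x Idx.first = 0 := by simpa using hf
  rw [Finset.sum_eq_zero_iff_of_nonneg (fun _ _ => by positivity)] at hs
  apply hx
  funext i
  rcases i with _ | j | _
  · exact hf'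
  · simpa using hs j (Finset.mem_univ j)
  · have : x Idx.last = 0 := by rw [hux] at hux0; linear_combination hux0 - hf'
    exact this

theorem re_hermForm_nonpos_of_orthogonal {p x : Idx k → F} (hp : 0 < RCLike.re (hermForm p p))
    (h : hermForm p x = 0) : RCLike.re (hermForm x x) ≤ 0 := by
  rcases eq_or_ne x 0 with rfl | hx
  · simp [hermForm_zero_left]
  · exact (re_hermForm_neg_of_orthogonal hp h hx).le

/-- The reversed Cauchy–Schwarz inequality. -/
theorem re_hermForm_le_norm_sq {p : Idx k → F} (hp : hermForm p p = 1) (x : Idx k → F) :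
    RCLike.re (hermForm x x) ≤ ‖hermForm p x‖ ^ 2 := by
  have h0 : hermForm p (x - hermForm p x • p) = 0 := by
    rw [hermForm_sub_right, hermForm_smul_right, hp]; ring
  have h1 := re_hermForm_nonpos_of_orthogonal (by rw [hp]; simp) h0
  have h2 : hermForm (x - hermForm p x • p) (x - hermForm p x • p) =
      hermForm x x - ((‖hermForm p x‖ ^ 2 : ℝ) : F) := by
    rw [hermForm_sub_left, h_smul_zero h0, hermForm_sub_right, hermForm_smul_right,
      ← star_mul_self_eq, star_hermForm]
    ring
  rw [h2, map_sub, RCLike.ofReal_re] at h1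
  linarith
where
  h_smul_zero {p y : Idx k → F} {a b : F} (h : hermForm p y = 0) :
    b - hermForm (a • p) y = b := by rw [hermForm_smul_left, h]; ring

/-- The Cauchy–Schwarz inequality for a positive semidefinite sesquilinear form. -/
theorem norm_sq_le_of_posSemidef {V : Type*} [AddCommGroup V] [Module F V] (B : V → V → F)
    (symm : ∀ x y, star (B y x) = B x y) (nonneg : ∀ x, 0 ≤ RCLike.re (B x x))
    (add_left : ∀ x y z, B (x + y) z = B x z + B y z)
    (smul_left : ∀ x y a, B (a • x) y = star a * B x y) (x y : V) :
    ‖B x y‖ ^ 2 ≤ RCLike.re (B x x) * RCLike.re (B y y) := by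
  let _ : PreInnerProductSpace.Core F V :=
    { inner := B
      conj_inner_symm := symm
      re_inner_nonneg := nonneg
      add_left := add_left
      smul_left := smul_left }
  have := InnerProductSpace.Core.inner_mul_inner_self_le (𝕜 := F) x y
  have e : ‖B y x‖ = ‖B x y‖ := by rw [← symm x y, norm_star]
  have : ‖B x y‖ * ‖B y x‖ ≤ RCLike.re (B x x) * RCLike.re (B y y) := this
  rw [e, ← sq] at this
  exact this

/-- The form `Ψ(x, p) Ψ(p, y) - Ψ(x, y)`, which is positive semidefinite if `Ψ(p, p) = 1`. -/
def perpForm (p x y : Idx k → F) : F := hermForm x p * hermForm p y - hermForm x y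

theorem star_perpForm (p x y : Idx k → F) : star (perpForm p y x) = perpForm p x y := by
  simp only [perpForm, star_sub, star_mul', star_hermForm]; ring

theorem re_perpForm_self (p x : Idx k → F) :
    RCLike.re (perpForm p x x) = ‖hermForm p x‖ ^ 2 - RCLike.re (hermForm x x) := by
  rw [perpForm, ← star_hermForm p x, star_mul_self_eq, map_sub, RCLike.ofReal_re]

theorem perpForm_add_left (p x x' y : Idx k → F) :
    perpForm p (x + x') y = perpForm p x y + perpForm p x' y := by
  simp only [perpForm, hermForm_add_left]; ring

theorem perpForm_smul_left (p x y : Idx k → F) (a : F) :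
    perpForm p (a • x) y = star a * perpForm p x y := by
  simp only [perpForm, hermForm_smul_left]; ring

theorem norm_perpForm_sq_le {p : Idx k → F} (hp : hermForm p p = 1) (x y : Idx k → F) :
    ‖perpForm p x y‖ ^ 2 ≤ (‖hermForm p x‖ ^ 2 - RCLike.re (hermForm x x)) *
      (‖hermForm p y‖ ^ 2 - RCLike.re (hermForm y y)) := by
  have := norm_sq_le_of_posSemidef (perpForm p) (star_perpForm p)
    (fun x => by rw [re_perpForm_self]; linarith [re_hermForm_le_norm_sq hp x])
    (perpForm_add_left p) (fun x y a => perpForm_smul_left p x y a) x y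
  rwa [re_perpForm_self, re_perpForm_self] at this

/-- The multiplicative triangle inequality. -/
theorem norm_hermForm_le_two_mul {p x y : Idx k → F} (hp : hermForm p p = 1)
    (hx : 0 ≤ RCLike.re (hermForm x x)) (hy : 0 ≤ RCLike.re (hermForm y y)) :
    ‖hermForm x y‖ ≤ 2 * ‖hermForm x p‖ * ‖hermForm p y‖ := by
  have h1 : ‖perpForm p x y‖ ≤ ‖hermForm x p‖ * ‖hermForm p y‖ := by
    rw [norm_hermForm_comm x p]
    refine abs_le_of_sq_le_sq' ?_ (by positivity) |>.2
    refine (norm_perpForm_sq_le hp x y).trans ?_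
    rw [mul_pow]
    have := re_hermForm_le_norm_sq hp y
    gcongr <;> linarith
  have h2 : hermForm x y = hermForm x p * hermForm p y - perpForm p x y := by
    rw [perpForm]; ring
  rw [h2]
  calc _ ≤ ‖hermForm x p * hermForm p y‖ + ‖perpForm p x y‖ := norm_sub_le _ _
    _ ≤ _ := by rw [norm_mul]; linarith

/-- The quasi-ultrametric inequality for vectors normalised by `Ψ(p, ·) = 1`. -/
theorem norm_hermForm_le_add_of_normalized {p x y z : Idx k → F} (hp : hermForm p p = 1)
    (hx : 0 ≤ RCLike.re (hermForm x x)) (hy : 0 ≤ RCLike.re (hermForm y y))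
    (hz : 0 ≤ RCLike.re (hermForm z z))
    (hpx : hermForm p x = 1) (hpy : hermForm p y = 1) (hpz : hermForm p z = 1) :
    ‖hermForm x y‖ ≤ 2 * (‖hermForm x z‖ + ‖hermForm z y‖) := by
  set B := perpForm p with hB
  have hBz : RCLike.re (B z z) ≤ 1 := by
    rw [hB, re_perpForm_self, hpz]; simpa using hz
  have hBx : ∀ x, 0 ≤ RCLike.re (B x x) := fun x => by
    rw [hB, re_perpForm_self]; linarith [re_hermForm_le_norm_sq hp x]
  have hcs : ∀ x y, ‖B x y‖ ^ 2 ≤ RCLike.re (B x x) * RCLike.re (B y y) := fun x y => by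
    rw [hB, re_perpForm_self, re_perpForm_self]; exact norm_perpForm_sq_le hp x y
  -- `S` is a Schur complement of `B` with respect to `z`; it is positive semidefinite because `B z
  -- z ≤ 1`. Its diagonal is small: `S x x ≤ 1 - ‖B x z‖² ≤ 2 (1 - ‖B x z‖) ≤ 2 ‖Ψ(x, z)‖`.
  -- Cauchy–Schwarz for `S` then controls `Ψ(x, y)`.
  let S : (Idx k → F) → (Idx k → F) → F := fun x y => B x y - B x z * B z y
  have hSself : ∀ x, RCLike.re (S x x) = RCLike.re (B x x) - ‖B x z‖ ^ 2 := fun x => by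
    have : B x z * B z x = ((‖B x z‖ ^ 2 : ℝ) : F) := by
      rw [hB, ← star_perpForm p z x, mul_comm, star_mul_self_eq]
    simp only [S, this, map_sub, RCLike.ofReal_re]
  have hS := norm_sq_le_of_posSemidef S
    (fun x y => by simp only [S, star_sub, star_mul', hB, star_perpForm]; ring)
    (fun x => by
      rw [hSself]
      have := hcs x z
      nlinarith [hBx x])
    (fun x y w => by simp only [S, hB, perpForm_add_left]; ring)
    (fun x y a => by simp only [S, hB, perpForm_smul_left]; ring) x y
  have hbd : ∀ x, 0 ≤ RCLike.re (hermForm x x) → hermForm p x = 1 →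
      RCLike.re (S x x) ≤ 2 * ‖hermForm x z‖ := by
    intro x hx hpx
    have e : B x z = 1 - hermForm x z := by
      rw [hB, perpForm, ← star_hermForm p x, hpx, hpz]; simp
    have e2 : 1 - ‖hermForm x z‖ ≤ ‖B x z‖ := by
      rw [e]; simpa using norm_sub_norm_le (1 : F) (hermForm x z)
    have e3 : RCLike.re (B x x) ≤ 1 := by
      rw [hB, re_perpForm_self, hpx]; simpa using hx
    have e4 : ‖B x z‖ ^ 2 ≤ 1 := (hcs x z).trans (mul_le_one₀ e3 (hBx z) hBz)
    have e5 : ‖B x z‖ ≤ 1 := by nlinarith [norm_nonneg (B x z)]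
    rw [hSself]
    nlinarith [norm_nonneg (B x z)]
  have hone : ∀ u v, hermForm p u = 1 → hermForm p v = 1 → hermForm u v = 1 - B u v := by
    intro u v hu hv
    rw [hB, perpForm, ← star_hermForm p u, hu, hv]; simp
  have hle1 : ‖B z y‖ ≤ 1 := by
    have e3 : RCLike.re (B y y) ≤ 1 := by
      rw [hB, re_perpForm_self, hpy]; simpa using hy
    have e4 : ‖B z y‖ ^ 2 ≤ 1 := (hcs z y).trans (mul_le_one₀ hBz (hBx y) e3)
    nlinarith [norm_nonneg (B z y)]
  set a := ‖hermForm x z‖ with ha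
  set b := ‖hermForm z y‖ with hb
  have hSle : ‖S x y‖ ≤ a + b := by
    refine abs_le_of_sq_le_sq' ?_ (by positivity) |>.2
    have h1 := hbd x hx hpx
    have h2 := hbd y hy hpy
    rw [norm_hermForm_comm y z] at h2
    have h3 : 0 ≤ RCLike.re (S y y) := by
      rw [hSself]; have := hcs y z; nlinarith [hBx y]
    calc _ ≤ _ := hS
      _ ≤ (2 * a) * (2 * b) := by gcongr
      _ ≤ _ := by nlinarith [sq_nonneg (a - b)]
  have e : hermForm x y = hermForm x z * B z y + hermForm z y - S x y := by
    rw [hone x y hpx hpy, hone x z hpx hpz, hone z y hpz hpy]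
    simp only [S]; ring
  rw [e]
  calc _ ≤ ‖hermForm x z * B z y + hermForm z y‖ + ‖S x y‖ := norm_sub_le _ _
    _ ≤ ‖hermForm x z * B z y‖ + b + (a + b) := by
        gcongr; exact norm_add_le _ _
    _ ≤ a + b + (a + b) := by
        rw [norm_mul]
        have := mul_le_of_le_one_right (norm_nonneg (hermForm x z)) hle1
        linarith
    _ = _ := by ring

theorem hermForm_ne_zero_of_pos {p x : Idx k → F} (hp : 0 < RCLike.re (hermForm p p))
    (hx : 0 < RCLike.re (hermForm x x)) : hermForm p x ≠ 0 := fun h =>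
  absurd (re_hermForm_nonpos_of_orthogonal hp h) (not_le.mpr hx)

/-- The quasi-ultrametric inequality. -/
theorem norm_hermForm_mul_le {p x y z : Idx k → F} (hp : hermForm p p = 1)
    (hx : 0 < RCLike.re (hermForm x x)) (hy : 0 < RCLike.re (hermForm y y))
    (hz : 0 < RCLike.re (hermForm z z)) :
    ‖hermForm x y‖ * ‖hermForm p z‖ ≤
      2 * (‖hermForm x z‖ * ‖hermForm p y‖ + ‖hermForm z y‖ * ‖hermForm p x‖) := by
  have hp' : 0 < RCLike.re (hermForm p p) := by rw [hp]; simp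
  have hX := hermForm_ne_zero_of_pos hp' hx
  have hY := hermForm_ne_zero_of_pos hp' hy
  have hZ := hermForm_ne_zero_of_pos hp' hz
  have h := norm_hermForm_le_add_of_normalized hp (x := (hermForm p x)⁻¹ • x)
    (y := (hermForm p y)⁻¹ • y) (z := (hermForm p z)⁻¹ • z)
    (by rw [re_hermForm_smul]; positivity) (by rw [re_hermForm_smul]; positivity)
    (by rw [re_hermForm_smul]; positivity)
    (by rw [hermForm_smul_right, inv_mul_cancel₀ hX])
    (by rw [hermForm_smul_right, inv_mul_cancel₀ hY])
    (by rw [hermForm_smul_right, inv_mul_cancel₀ hZ])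
  simp only [hermForm_smul_smul, norm_mul, norm_star, norm_inv] at h
  have hX' := norm_pos_iff.mpr hX
  have hY' := norm_pos_iff.mpr hY
  have hZ' := norm_pos_iff.mpr hZ
  have := mul_le_mul_of_nonneg_left h
    (by positivity : 0 ≤ ‖hermForm p x‖ * ‖hermForm p y‖ * ‖hermForm p z‖)
  field_simp at this
  linarith

end HermForm

/-! ### Convex regions bounded by bisector-like hypersurfaces -/

section HalfSpace

variable {F : Type*} [RCLike F] {k : ℕ}

/-- The vector `x` lies in the region attached to the null vector `n` and the unit negative
vector `e` orthogonal to `n`. In suitable coordinates with `n = ∞` the region is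
`{Re z₁ ≤ √Ψ(x, x)}`. -/
def InRegion (n e x : Idx k → F) : Prop :=
  RCLike.re (star (hermForm e x) * hermForm n x) ≤ ‖hermForm n x‖ * √(RCLike.re (hermForm x x))

theorem inRegion_smul_iff (n e x : Idx k → F) {a : F} (ha : a ≠ 0) :
    InRegion n e (a • x) ↔ InRegion n e x := by
  have h0 : 0 < ‖a‖ := norm_pos_iff.mpr ha
  rw [InRegion, InRegion, re_hermForm_smul, hermForm_smul_right, hermForm_smul_right,
    Real.sqrt_mul (by positivity), Real.sqrt_sq h0.le, norm_mul]
  have : star (a * hermForm e x) * (a * hermForm n x) =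
      ((‖a‖ ^ 2 : ℝ) : F) * (star (hermForm e x) * hermForm n x) := by
    rw [← star_mul_self_eq, star_mul']; ring
  rw [this, RCLike.re_ofReal_mul]
  have e : ‖a‖ * ‖hermForm n x‖ * (‖a‖ * √(RCLike.re (hermForm x x))) =
      ‖a‖ ^ 2 * (‖hermForm n x‖ * √(RCLike.re (hermForm x x))) := by ring
  rw [e]
  exact mul_le_mul_iff_right₀ (by positivity)

/-- This is the analytic core of convexity. With `d = (C + pσ) + i qσ` and `w = w₁ - i w₂`, the
quantity `f(σ) = r |d| + σ Re(w d) / |d|` has value `r > 1` and derivative `p r + w₁` at `σ = 0`. So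
`hσ` selects a direction in which `f` does not decrease to first order, and the conclusion says that
`f > 1` persists all along that side. The bound `hb` comes from `region_bessel`. -/
theorem region_real_inequality {r p q w₁ w₂ C σ : ℝ} (hr : 1 < r)
    (hb : p ^ 2 + q ^ 2 + w₁ ^ 2 + w₂ ^ 2 ≤ 1) (hC : 0 < C) (hCσ : C ^ 2 - σ ^ 2 = 1)
    (hσ : 0 ≤ σ * (p * r + w₁)) :
    √((C + p * σ) ^ 2 + (q * σ) ^ 2) <
      r * ((C + p * σ) ^ 2 + (q * σ) ^ 2) + σ * (w₁ * (C + p * σ) + w₂ * (q * σ)) := by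
  set c := C + p * σ with hc
  have hp1 : p ^ 2 ≤ 1 := by linarith [sq_nonneg q, sq_nonneg w₁, sq_nonneg w₂]
  have hCge : 1 ≤ C := by nlinarith [sq_nonneg σ]
  have hlow : ∀ s : ℝ, 0 < s → p ^ 2 ≤ s ^ 2 → 0 < s * C + p * σ := by
    intro s hs hps
    have : (p * σ) ^ 2 < (s * C) ^ 2 := by
      have : σ ^ 2 < C ^ 2 := by linarith
      calc _ = p ^ 2 * σ ^ 2 := by ring
        _ ≤ s ^ 2 * σ ^ 2 := by gcongr
        _ < s ^ 2 * C ^ 2 := by gcongr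
        _ = _ := by ring
    have h2 := abs_lt_of_sq_lt_sq this (by positivity)
    have := neg_abs_le (p * σ)
    linarith
  have hcpos : 0 < c := by simpa [hc] using hlow 1 one_pos (by simpa using hp1)
  set t := r⁻¹ with ht
  have htr : r * t = 1 := mul_inv_cancel₀ (by positivity)
  have ht0 : 0 < t := by positivity
  have ht1 : t < 1 := inv_lt_one_of_one_lt₀ hr
  -- With this `u`, the upper bound `r (c C + u σ²)` reproduces the terms of the right-hand side in
  -- `q`, and the remaining difference is exactly `c σ (p r + w₁) ≥ 0`.
  set u := q ^ 2 + q * w₂ * t with hu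
  have h2u : p ^ 2 + q ^ 2 ≤ 1 + 2 * u := by
    have e : 1 + 2 * u - (p ^ 2 + q ^ 2) =
        (w₂ + q * t) ^ 2 + q ^ 2 * (2 - t ^ 2) + (1 - p ^ 2 - q ^ 2 - w₂ ^ 2) := by rw [hu]; ring
    have := mul_nonneg (sq_nonneg q) (by nlinarith : (0 : ℝ) ≤ 2 - t ^ 2)
    linarith [sq_nonneg (w₂ + q * t), sq_nonneg w₁]
  have hu1 : 0 < 1 + u := by
    have e : 1 + u = (q + w₂ * t / 2) ^ 2 + w₂ ^ 2 * (1 - t ^ 2) / 4 + (1 - w₂ ^ 2 / 4) := by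
      rw [hu]; ring
    have := mul_nonneg (sq_nonneg w₂) (by nlinarith : (0 : ℝ) ≤ 1 - t ^ 2)
    linarith [sq_nonneg p, sq_nonneg q, sq_nonneg (q + w₂ * t / 2), sq_nonneg w₁]
  have hexp : (1 + u) ^ 2 = 1 + 2 * u + u ^ 2 := by ring
  have hpu : p ^ 2 ≤ (1 + u) ^ 2 := by linarith [sq_nonneg q, sq_nonneg u]
  have hpos := hlow (1 + u) hu1 hpu
  have hsq : (1 + u) ^ 2 - p ^ 2 ≤ (c + u * C) ^ 2 := by
    have : (c + u * C) ^ 2 - ((1 + u) ^ 2 - p ^ 2) * (C ^ 2 - σ ^ 2) =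
        ((1 + u) * σ + p * C) ^ 2 := by rw [hc]; ring
    rw [hCσ] at this
    linarith [sq_nonneg ((1 + u) * σ + p * C)]
  have hge : q ^ 2 + u ^ 2 ≤ (c + u * C) ^ 2 := by linarith
  have hpos' : 0 < c + u * C := by rw [hc]; linarith
  have hX0 : 0 ≤ c * C + u * σ ^ 2 := by
    have h1 : |u| ≤ c + u * C := abs_le_of_sq_le_sq (by linarith [sq_nonneg q]) hpos'.le
    have h2 : u ≤ |u| := le_abs_self u
    have : c * C + u * σ ^ 2 = (c + u * C) * C - u := by
      have : σ ^ 2 = C ^ 2 - 1 := by linarith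
      rw [this]; ring
    rw [this]
    have := le_mul_of_one_le_right hpos'.le hCge
    linarith
  have hsqrt : √(c ^ 2 + (q * σ) ^ 2) ≤ c * C + u * σ ^ 2 := by
    apply Real.sqrt_le_iff.mpr ⟨hX0, ?_⟩
    have : (c * C + u * σ ^ 2) ^ 2 - (c ^ 2 + (q * σ) ^ 2) =
        σ ^ 2 * ((c + u * C) ^ 2 - (q ^ 2 + u ^ 2)) +
        (c ^ 2 - u ^ 2 * σ ^ 2) * (C ^ 2 - σ ^ 2 - 1) := by ring
    rw [hCσ, sub_self, mul_zero, add_zero] at this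
    linarith [mul_nonneg (sq_nonneg σ) (sub_nonneg.mpr hge)]
  have hspos : 0 < √(c ^ 2 + (q * σ) ^ 2) := Real.sqrt_pos.mpr (by positivity)
  calc √(c ^ 2 + (q * σ) ^ 2) < r * √(c ^ 2 + (q * σ) ^ 2) := lt_mul_of_one_lt_left hspos hr
    _ ≤ r * (c * C + u * σ ^ 2) := by gcongr
    _ = r * (c * C) + r * q ^ 2 * σ ^ 2 + (r * t) * (q * w₂) * σ ^ 2 := by rw [hu]; ring
    _ ≤ r * c ^ 2 + σ * w₁ * c + r * q ^ 2 * σ ^ 2 + (r * t) * (q * w₂) * σ ^ 2 := by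
        have : r * c ^ 2 + σ * w₁ * c - r * (c * C) = c * (σ * (p * r + w₁)) := by
          rw [hc]; ring
        linarith [mul_nonneg hcpos.le hσ]
    _ = _ := by rw [htr]; ring

/-- The Bessel inequality used for the convexity of the regions. -/
theorem region_bessel {n e z τ : Idx k → F} (hn : hermForm n n = 0) (hne : hermForm n e = 0)
    (he : hermForm e e = -1) (hz : hermForm z z = 1) (hzτ : hermForm z τ = 0)
    (hτ : hermForm τ τ = -1) (ha : hermForm n z ≠ 0) :
    ‖hermForm n τ / hermForm n z‖ ^ 2 +
      ‖hermForm e τ - hermForm e z * (hermForm n τ / hermForm n z)‖ ^ 2 ≤ 1 := by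
  set a := hermForm n z with haa
  set E := hermForm e z with hE
  set m := hermForm n τ / a with hm
  set ω := hermForm e τ - E * m with hω
  have hnτ : hermForm n τ = a * m := by rw [hm]; field_simp
  have heτ : hermForm e τ = E * m + ω := by rw [hω]; ring
  have hen : hermForm e n = 0 := by rw [← star_hermForm, hne, star_zero]
  have hzn : hermForm z n = star a := by rw [← star_hermForm]
  have hze : hermForm z e = star E := by rw [← star_hermForm]
  have hτz : hermForm τ z = 0 := by rw [← star_hermForm, hzτ, star_zero]
  have hτn : hermForm τ n = star a * star m := by rw [← star_hermForm, hnτ, star_mul']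
  have hτe : hermForm τ e = star E * star m + star ω := by
    rw [← star_hermForm, heτ, star_add, star_mul']
  have hsa : star a ≠ 0 := star_ne_zero.mpr ha
  -- The vectors `e - (Ē/ā) n` and `n - ā z` are orthogonal to `z` and to each other, and both are
  -- negative. Here `v` is `τ` minus its projections to them, so the claim is Bessel's inequality in
  -- the negative definite complement of `z`.
  set v := τ + ω • (e - (star E / star a) • n) + (m / star a) • (n - star a • z) with hv
  have hzv : hermForm z v = 0 := by
    simp only [hv, hermForm_add_right, hermForm_sub_right, hermForm_smul_right, hzτ, hze, hzn, hz]
    field_simp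
    ring
  have hvv : hermForm v v = ((‖m‖ ^ 2 + ‖ω‖ ^ 2 - 1 : ℝ) : F) := by
    have e1 : hermForm v v = -1 + star ω * ω + star m * m := by
      simp only [hv, hermForm_add_right, hermForm_sub_right, hermForm_smul_right,
        hermForm_add_left, hermForm_sub_left, hermForm_smul_left, star_div₀, star_star,
        hzτ, hze, hzn, hz, hn, hne, he, hen, hτ, hτz, hτn, hτe, hnτ, heτ, ← haa, ← hE]
      field_simp
      ring
    rw [e1, star_mul_self_eq, star_mul_self_eq]
    push_cast
    ring
  have := re_hermForm_nonpos_of_orthogonal (by rw [hz]; simp) hzv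
  rw [hvv, RCLike.ofReal_re] at this
  linarith

/-- Key step for convexity: if `f > 1` at `z`, then `f > 1` on one side of `z`. -/
theorem inRegion_of_between {n e z τ : Idx k → F} (hn0 : n ≠ 0) (hn : hermForm n n = 0)
    (hne : hermForm n e = 0) (he : hermForm e e = -1) (hz : hermForm z z = 1)
    (hzτ : hermForm z τ = 0) (hτ : hermForm τ τ = -1) {C σ C' σ' : ℝ} (hC : 0 < C) (hC' : 0 < C')
    (hσ : 0 < σ) (hσ' : 0 < σ') (h1 : C ^ 2 - σ ^ 2 = 1) (h1' : C' ^ 2 - σ' ^ 2 = 1)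
    (hx : InRegion n e ((C : F) • z - (σ : F) • τ)) (hy : InRegion n e ((C' : F) • z + (σ' : F) • τ)) :
    InRegion n e z := by
  have ha : hermForm n z ≠ 0 := by
    intro h
    have h' : hermForm z n = 0 := by rw [← star_hermForm, h, star_zero]
    have := re_hermForm_neg_of_orthogonal (by rw [hz]; simp) h' hn0
    rw [hn] at this; simp at this
  have hb := region_bessel hn hne he hz hzτ hτ ha
  set a := hermForm n z with haa
  set E := hermForm e z with hE
  set m := hermForm n τ / a with hm
  set ω := hermForm e τ - E * m with hω
  have hnτ : hermForm n τ = a * m := by rw [hm]; field_simp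
  have heτ : hermForm e τ = E * m + ω := by rw [hω]; ring
  have hτz : hermForm τ z = 0 := by rw [← star_hermForm, hzτ, star_zero]
  have hapos : 0 < ‖a‖ := norm_pos_iff.mpr ha
  by_contra hcon
  set r := RCLike.re (star E * a) / ‖a‖ with hr
  have hr1 : 1 < r := by
    rw [InRegion, hz, ← haa, ← hE] at hcon
    rw [hr, lt_div_iff₀ hapos]
    simpa using hcon
  set w := star ω * a / ((‖a‖ : ℝ) : F) with hw
  have haF : ((‖a‖ : ℝ) : F) ≠ 0 := by exact_mod_cast hapos.ne'
  have hwn : ‖w‖ = ‖ω‖ := by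
    rw [hw, norm_div, norm_mul, norm_star, RCLike.norm_ofReal, abs_of_pos hapos]
    field_simp
  set p := RCLike.re m with hp
  set q := RCLike.im m with hq
  set w₁ := RCLike.re w with hw₁
  set w₂ := -RCLike.im w with hw₂
  have hbd : p ^ 2 + q ^ 2 + w₁ ^ 2 + w₂ ^ 2 ≤ 1 := by
    have e1 := RCLike.norm_sq_eq_def (z := m)
    have e2 := RCLike.norm_sq_eq_def (z := w)
    rw [hwn] at e2
    rw [e1, e2] at hb
    rw [hp, hq, hw₁, hw₂]
    nlinarith
  have hwa : star ω * a = ((‖a‖ : ℝ) : F) * w := by rw [hw]; field_simp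
  have hmre : m = (p : F) + (q : F) * RCLike.I := by rw [hp, hq]; exact (RCLike.re_add_im m).symm
  -- the value of the defining expression at `c z + s τ`
  have key : ∀ c s : ℝ, c ^ 2 - s ^ 2 = 1 → InRegion n e ((c : F) • z + (s : F) • τ) →
      r * ((c + p * s) ^ 2 + (q * s) ^ 2) + s * (w₁ * (c + p * s) + w₂ * (q * s)) ≤
        √((c + p * s) ^ 2 + (q * s) ^ 2) := by
    intro c s hcs hreg
    have hself : RCLike.re (hermForm ((c : F) • z + (s : F) • τ) ((c : F) • z + (s : F) • τ)) = 1 := by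
      have : hermForm ((c : F) • z + (s : F) • τ) ((c : F) • z + (s : F) • τ) =
          ((c ^ 2 - s ^ 2 : ℝ) : F) := by
        simp only [hermForm_add_right, hermForm_add_left, hermForm_smul_right, hermForm_smul_left,
          hz, hzτ, hτz, hτ, RCLike.star_def, RCLike.conj_ofReal]
        push_cast
        ring
      rw [this, RCLike.ofReal_re, hcs]
    set d : F := (c : F) + m * (s : F) with hd
    have hdre : RCLike.re d = c + p * s := by
      rw [hd, map_add, RCLike.ofReal_re, mul_comm m, RCLike.re_ofReal_mul]; ring
    have hdim : RCLike.im d = q * s := by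
      rw [hd, map_add, RCLike.ofReal_im, mul_comm m, RCLike.im_ofReal_mul]; ring
    have hdn : ‖d‖ ^ 2 = (c + p * s) ^ 2 + (q * s) ^ 2 := by
      rw [RCLike.norm_sq_eq_def, hdre, hdim]; ring
    have hN : hermForm n ((c : F) • z + (s : F) • τ) = a * d := by
      rw [hermForm_add_right, hermForm_smul_right, hermForm_smul_right, hnτ, ← haa, hd]; ring
    have hEd : hermForm e ((c : F) • z + (s : F) • τ) = E * d + (s : F) * ω := by
      rw [hermForm_add_right, hermForm_smul_right, hermForm_smul_right, heτ, ← hE, hd]; ring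
    rw [InRegion, hself, hN, hEd, Real.sqrt_one, mul_one, norm_mul] at hreg
    have e1 : star (E * d + (s : F) * ω) * (a * d) =
        ((‖d‖ ^ 2 : ℝ) : F) * (star E * a) + ((s * ‖a‖ : ℝ) : F) * (w * d) := by
      rw [← star_mul_self_eq, star_add, star_mul', star_mul', show star (s : F) = s from RCLike.conj_ofReal s]
      push_cast
      linear_combination (s : F) * d * hwa
    have e2 : RCLike.re (star E * a) = r * ‖a‖ := by rw [hr]; field_simp
    have e3 : RCLike.re (w * d) = w₁ * (c + p * s) + w₂ * (q * s) := by
      rw [RCLike.mul_re, hdre, hdim, hw₁, hw₂]; ring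
    rw [e1, map_add, RCLike.re_ofReal_mul, RCLike.re_ofReal_mul, e2, e3, hdn] at hreg
    have e4 : ‖d‖ = √((c + p * s) ^ 2 + (q * s) ^ 2) := by
      rw [← hdn, Real.sqrt_sq (norm_nonneg _)]
    rw [e4] at hreg
    refine le_of_mul_le_mul_left ?_ hapos
    linarith
  -- The derivative at `z` of the defining function is nonnegative in one of the two directions;
  -- following that direction, the endpoint would lie outside the region.
  rcases le_total 0 (p * r + w₁) with hs | hs
  · have := region_real_inequality hr1 hbd hC' h1' (mul_nonneg hσ'.le hs)
    exact absurd (key C' σ' h1' hy) (not_le.mpr this)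
  · have := region_real_inequality (σ := -σ) hr1 hbd hC (by linarith [neg_sq σ])
      (by nlinarith)
    refine absurd (key C (-σ) (by linarith [neg_sq σ]) ?_) (not_le.mpr this)
    convert hx using 1
    push_cast
    rw [neg_smul, sub_eq_add_neg]

/-! ### Geodesic segments -/

theorem vecDist_smul_smul {a b : F} (ha : a ≠ 0) (hb : b ≠ 0) (v w : Idx k → F) :
    vecDist (a • v) (b • w) = vecDist v w := by
  have ha0 : ‖(a : F)‖ ≠ 0 := norm_ne_zero_iff.mpr ha
  have hb0 : ‖(b : F)‖ ≠ 0 := norm_ne_zero_iff.mpr hb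
  rw [vecDist, vecDist, re_hermForm_smul, re_hermForm_smul, hermForm_smul_smul, norm_mul, norm_mul,
    norm_star, Real.sqrt_mul (by positivity), Real.sqrt_mul (by positivity),
    Real.sqrt_sq (norm_nonneg _), Real.sqrt_sq (norm_nonneg _)]
  congr 1
  rw [show ‖(a : F)‖ * √(RCLike.re (hermForm v v)) * (‖(b : F)‖ * √(RCLike.re (hermForm w w)))
    = (‖(a : F)‖ * ‖(b : F)‖) * (√(RCLike.re (hermForm v v)) * √(RCLike.re (hermForm w w)))
    by ring, mul_div_mul_left _ _ (mul_ne_zero ha0 hb0)]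

theorem exists_smul_unit {x : Idx k → F} (hx : 0 < RCLike.re (hermForm x x)) :
    ∃ a : F, a ≠ 0 ∧ hermForm (a • x) (a • x) = 1 := by
  set t := RCLike.re (hermForm x x) with ht
  have hs : 0 < √t := Real.sqrt_pos.mpr hx
  refine ⟨(((√t)⁻¹ : ℝ) : F), by exact_mod_cast (inv_pos.mpr hs).ne', ?_⟩
  rw [hermForm_smul_smul, hermForm_self_eq, ← ht, RCLike.star_def, RCLike.conj_ofReal]
  norm_cast
  rw [← mul_inv, Real.mul_self_sqrt hx.le, inv_mul_cancel₀ hx.ne']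

theorem one_le_norm_hermForm {z x : Idx k → F} (hz : hermForm z z = 1) (hx : hermForm x x = 1) :
    1 ≤ ‖hermForm z x‖ := by
  have := re_hermForm_le_norm_sq hz x
  rw [hx, RCLike.one_re] at this
  nlinarith [norm_nonneg (hermForm z x)]

theorem exists_smul_unit_real {z x : Idx k → F} (hz : hermForm z z = 1)
    (hx : 0 < RCLike.re (hermForm x x)) :
    ∃ (a : F) (A : ℝ), a ≠ 0 ∧ hermForm (a • x) (a • x) = 1 ∧ 1 ≤ A ∧
      hermForm z (a • x) = (A : F) := by
  obtain ⟨b, hb, hbx⟩ := exists_smul_unit hx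
  set w := hermForm z (b • x) with hw
  have h1 := one_le_norm_hermForm hz hbx
  rw [← hw] at h1
  have hw0 : ((‖w‖ : ℝ) : F) ≠ 0 := by exact_mod_cast (by linarith : (‖w‖ : ℝ) ≠ 0)
  have hw0' : w ≠ 0 := norm_pos_iff.mp (by linarith)
  refine ⟨(star w / ((‖w‖ : ℝ) : F)) * b, ‖w‖,
    mul_ne_zero (div_ne_zero (star_ne_zero.mpr hw0') hw0) hb, ?_, h1, ?_⟩
  · rw [mul_smul, hermForm_smul_smul, hbx, mul_one, star_div₀, star_star, RCLike.star_def,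
      RCLike.conj_ofReal]
    have := star_mul_self_eq w
    rw [RCLike.star_def] at this
    field_simp
    rw [mul_comm, this]; push_cast; ring
  · rw [mul_smul, hermForm_smul_right, ← hw, div_mul_eq_mul_div, star_mul_self_eq]
    field_simp
    push_cast
    ring

/-- Points on a geodesic segment are linear combinations of the end points. -/
theorem smul_add_smul_eq_of_dist_add {x y z : Idx k → F} (hx : hermForm x x = 1)
    (hy : hermForm y y = 1) (hz : hermForm z z = 1) {A B : ℝ} (hA : 1 ≤ A) (hB : 1 ≤ B)
    (hzx : hermForm z x = (A : F)) (hzy : hermForm z y = (B : F))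
    (hd : vecDist x z + vecDist z y = vecDist x y) :
    (√(B ^ 2 - 1) : F) • x + (√(A ^ 2 - 1) : F) • y =
      ((√(A ^ 2 - 1) * B + √(B ^ 2 - 1) * A : ℝ) : F) • z := by
  have hxz : hermForm x z = (A : F) := by
    rw [← star_hermForm, hzx, RCLike.star_def, RCLike.conj_ofReal]
  have hyz : hermForm y z = (B : F) := by
    rw [← star_hermForm, hzy, RCLike.star_def, RCLike.conj_ofReal]
  set s := √(A ^ 2 - 1) with hs
  set t := √(B ^ 2 - 1) with ht
  have hs2 : s ^ 2 = A ^ 2 - 1 := Real.sq_sqrt (by nlinarith)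
  have ht2 : t ^ 2 = B ^ 2 - 1 := Real.sq_sqrt (by nlinarith)
  have hs0 : 0 ≤ s := Real.sqrt_nonneg _
  have ht0 : 0 ≤ t := Real.sqrt_nonneg _
  set W := hermForm x y with hW
  -- The addition theorem for `cosh` applied to `d(x, z) + d(z, y) = d(x, y)`; here `s` and `t` are
  -- the hyperbolic sines of the two distances.
  have hnW : ‖W‖ = A * B + s * t := by
    have h1 := one_le_norm_hermForm hx hy
    rw [vecDist, vecDist, vecDist, hx, hy, hz, hxz, hzy, ← hW] at hd
    simp only [RCLike.one_re, Real.sqrt_one, mul_one, div_one, RCLike.norm_ofReal,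
      abs_of_nonneg (zero_le_one.trans hA), abs_of_nonneg (zero_le_one.trans hB)] at hd
    rw [← Real.cosh_arcosh h1, ← hd, Real.cosh_add, Real.cosh_arcosh hA, Real.cosh_arcosh hB,
      Real.sinh_arcosh hA, Real.sinh_arcosh hB]
  -- This is the equality case of Cauchy–Schwarz in the complement of `z`: it forces the phase of
  -- `Ψ(x, y)` to be trivial.
  have hre : RCLike.re W = A * B + s * t := by
    have h1 := norm_perpForm_sq_le hz x y
    rw [perpForm, hxz, hzy, hzx, hx, hy, ← hW] at h1
    simp only [RCLike.norm_ofReal, RCLike.one_re, sq_abs] at h1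
    have e1 := RCLike.norm_sq_eq_def (z := W)
    have e2 := RCLike.norm_sq_eq_def (z := (A : F) * (B : F) - W)
    have e3 : RCLike.re ((A : F) * (B : F) - W) = A * B - RCLike.re W := by
      rw [map_sub, ← RCLike.ofReal_mul, RCLike.ofReal_re]
    have e4 : RCLike.im ((A : F) * (B : F) - W) = - RCLike.im W := by
      rw [map_sub, ← RCLike.ofReal_mul, RCLike.ofReal_im]; ring
    rw [e2, e3, e4] at h1
    rw [hnW] at e1
    have hle : RCLike.re W ≤ ‖W‖ := RCLike.re_le_norm W
    rw [hnW] at hle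
    refine le_antisymm hle ?_
    have hAB : 0 < A * B := by positivity
    have : A * B * (A * B + s * t) ≤ A * B * RCLike.re W := by nlinarith
    exact le_of_mul_le_mul_left this hAB
  have hre' : RCLike.re (hermForm y x) = A * B + s * t := by
    rw [← star_hermForm, ← hW, RCLike.star_def, RCLike.conj_re, hre]
  -- The difference of the two sides is orthogonal to the positive vector `z` and has self-product
  -- zero, so it vanishes.
  rw [← sub_eq_zero]
  by_contra hne
  have h0 : hermForm z ((t : F) • x + (s : F) • y - ((s * B + t * A : ℝ) : F) • z) = 0 := by
    simp only [hermForm_add_right, hermForm_sub_right, hermForm_smul_right, hzx, hzy, hz]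
    push_cast; ring
  have hneg := re_hermForm_neg_of_orthogonal (by rw [hz]; simp) h0 hne
  have hval : RCLike.re (hermForm ((t : F) • x + (s : F) • y - ((s * B + t * A : ℝ) : F) • z)
      ((t : F) • x + (s : F) • y - ((s * B + t * A : ℝ) : F) • z)) = 0 := by
    rw [hermForm_sub_left _ _ (_ - _), hermForm_smul_left _ z, h0, mul_zero, sub_zero]
    have : hermForm ((t : F) • x + (s : F) • y)
        ((t : F) • x + (s : F) • y - ((s * B + t * A : ℝ) : F) • z) =
        ((t ^ 2 + s ^ 2 - (s * B + t * A) ^ 2 : ℝ) : F) + ((t * s : ℝ) : F) * W +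
          ((t * s : ℝ) : F) * hermForm y x := by
      simp only [hermForm_add_right, hermForm_sub_right, hermForm_smul_right, hermForm_add_left,
        hermForm_smul_left, hxz, hyz, hx, hy, RCLike.star_def, RCLike.conj_ofReal, ← hW]
      push_cast; ring
    rw [this, map_add, map_add, RCLike.ofReal_re, RCLike.re_ofReal_mul, RCLike.re_ofReal_mul,
      hre, hre']
    nlinarith
  linarith

/-- The region as a set of points of hyperbolic space. -/
def region (n e : Idx k → F) : Set (ℙ F (Idx k → F)) :=
  {P | P ∈ hypSpace F k ∧ InRegion n e P.rep}

theorem eq_of_hermForm_eq_one {z y : Idx k → F} (hz : hermForm z z = 1) (hy : hermForm y y = 1)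
    (hzy : hermForm z y = 1) : y = z := by
  rw [← sub_eq_zero]
  by_contra hne
  have hyz : hermForm y z = 1 := by rw [← star_hermForm, hzy, star_one]
  have := re_hermForm_neg_of_orthogonal (p := z) (by rw [hz]; simp)
    (by rw [hermForm_sub_right, hzy, hz, sub_self]) hne
  simp [hermForm_sub_left, hermForm_sub_right, hz, hy, hzy, hyz] at this

/-- After rescaling, `Ψ(z, x) = A` and `Ψ(z, y) = B` are real and at least `1`. Then `x = A z - s τ`
and `y = B z + t τ` for one unit tangent vector `τ` at `z`, which is the situation of
`inRegion_of_between`. If `A = 1` or `B = 1`, the point is an endpoint. -/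
theorem isHypConvex_region {n e : Idx k → F} (hn0 : n ≠ 0) (hn : hermForm n n = 0)
    (hne : hermForm n e = 0) (he : hermForm e e = -1) : IsHypConvex (region n e) := by
  rintro X ⟨hX, hXr⟩ Y ⟨hY, hYr⟩ Z hZ hd
  refine ⟨hZ, ?_⟩
  obtain ⟨c, hc, hcz⟩ := exists_smul_unit (x := Z.rep) hZ
  obtain ⟨a, A, ha, hax, hA, hzx⟩ := exists_smul_unit_real hcz (x := X.rep) hX
  obtain ⟨b, B, hb, hby, hB, hzy⟩ := exists_smul_unit_real hcz (x := Y.rep) hY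
  rw [← inRegion_smul_iff n e _ ha] at hXr
  rw [← inRegion_smul_iff n e _ hb] at hYr
  rw [← inRegion_smul_iff n e _ hc]
  have hd' : vecDist (a • X.rep) (c • Z.rep) + vecDist (c • Z.rep) (b • Y.rep) =
      vecDist (a • X.rep) (b • Y.rep) := by
    rw [vecDist_smul_smul ha hc, vecDist_smul_smul hc hb, vecDist_smul_smul ha hb]; exact hd
  generalize a • X.rep = x at *
  generalize b • Y.rep = y at *
  generalize c • Z.rep = z at *
  have key := smul_add_smul_eq_of_dist_add hax hby hcz hA hB hzx hzy hd'
  rcases hA.eq_or_lt with hA1 | hA1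
  · rw [← hA1] at hzx
    rwa [← eq_of_hermForm_eq_one hcz hax (by simpa using hzx)]
  rcases hB.eq_or_lt with hB1 | hB1
  · rw [← hB1] at hzy
    rwa [← eq_of_hermForm_eq_one hcz hby (by simpa using hzy)]
  set s := √(A ^ 2 - 1) with hs
  set t := √(B ^ 2 - 1) with ht
  have hs2 : s ^ 2 = A ^ 2 - 1 := Real.sq_sqrt (by nlinarith)
  have ht2 : t ^ 2 = B ^ 2 - 1 := Real.sq_sqrt (by nlinarith)
  have hs0 : 0 < s := Real.sqrt_pos.mpr (by nlinarith)
  have ht0 : 0 < t := Real.sqrt_pos.mpr (by nlinarith)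
  have htF : (t : F) ≠ 0 := by exact_mod_cast ht0.ne'
  have hyz : hermForm y z = (B : F) := by
    rw [← star_hermForm, hzy, RCLike.star_def, RCLike.conj_ofReal]
  have ht2F : (t : F) ^ 2 = (B : F) ^ 2 - 1 := by exact_mod_cast congrArg (fun r : ℝ => (r : F)) ht2
  set τ := (t : F)⁻¹ • (y - (B : F) • z) with hτ
  have hyτ : (B : F) • z + (t : F) • τ = y := by
    rw [hτ, smul_smul, mul_inv_cancel₀ htF, one_smul]; abel
  have hxτ : (A : F) • z - (s : F) • τ = x := by
    have : (t : F) • ((A : F) • z - (s : F) • τ) = (t : F) • x := by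
      rw [eq_sub_of_add_eq key, ← hyτ]
      push_cast
      module
    have h2 := congrArg (fun v => (t : F)⁻¹ • v) this
    simpa only [smul_smul, inv_mul_cancel₀ htF, one_smul] using h2
  refine inRegion_of_between (τ := τ) hn0 hn hne he hcz ?_ ?_ (C := A) (σ := s) (C' := B) (σ' := t)
    (by linarith) (by linarith) hs0 ht0 (by linarith) (by linarith) ?_ ?_
  · rw [hτ, hermForm_smul_right, hermForm_sub_right, hermForm_smul_right, hzy, hcz]; ring
  · rw [hτ, hermForm_smul_smul, RCLike.star_def, map_inv₀, RCLike.conj_ofReal]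
    simp only [hermForm_sub_left, hermForm_sub_right, hermForm_smul_right, hermForm_smul_left, hzy,
      hcz, hby, hyz, RCLike.star_def, RCLike.conj_ofReal]
    field_simp
    rw [ht2F]
    ring
  · rwa [hxτ]
  · rwa [hyτ]

end HalfSpace

/-! ### A criterion for convex-cocompactness -/

section Criterion

variable {F : Type*} [RCLike F] {k : ℕ}

theorem exists_unit_negative_orthogonal (hk : 1 ≤ k) {p : Idx k → F} (hp : hermForm p p = 1)
    (e : Idx k → F) : ∃ w : Idx k → F, hermForm w w = -1 ∧ hermForm p w = 0 ∧ hermForm e w = 0 := by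
  let L : (Idx k → F) →ₗ[F] F × F :=
    { toFun := fun x => (hermForm p x, hermForm e x)
      map_add' := fun x y => by simp only [hermForm_add_right, Prod.mk_add_mk]
      map_smul' := fun a x => by
        simp only [hermForm_smul_right, Prod.smul_mk, smul_eq_mul, RingHom.id_apply] }
  have hker : LinearMap.ker L ≠ ⊥ := by
    apply LinearMap.ker_ne_bot_of_finrank_lt
    simp only [Module.finrank_prod, Module.finrank_self, Module.finrank_fintype_fun_eq_card,
      Fintype.card_sum, Fintype.card_unit, Fintype.card_fin]
    omega
  obtain ⟨x, hx, hx0⟩ := (Submodule.ne_bot_iff _).mp hker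
  have hLx : (hermForm p x, hermForm e x) = 0 := LinearMap.mem_ker.mp hx
  obtain ⟨h1, h2⟩ := Prod.mk.inj hLx
  have hneg := re_hermForm_neg_of_orthogonal (by rw [hp]; simp) h1 hx0
  set t := -RCLike.re (hermForm x x) with ht
  have ht0 : 0 < t := by rw [ht]; linarith
  refine ⟨(((√t)⁻¹ : ℝ) : F) • x, ?_, by rw [hermForm_smul_right, h1]; simp,
    by rw [hermForm_smul_right, h2]; simp⟩
  rw [hermForm_smul_smul, hermForm_self_eq, show RCLike.re (hermForm x x) = -t by rw [ht]; ring,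
    RCLike.star_def, RCLike.conj_ofReal, ← RCLike.ofReal_mul, ← RCLike.ofReal_mul, ← mul_inv,
    Real.mul_self_sqrt ht0.le, mul_neg, inv_mul_cancel₀ ht0.ne', RCLike.ofReal_neg,
    RCLike.ofReal_one]

/-- The pair `(n, e)` defines a region. -/
def IsRegionPair (n e : Idx k → F) : Prop :=
  n ≠ 0 ∧ hermForm n n = 0 ∧ hermForm n e = 0 ∧ hermForm e e = -1

theorem norm_hermForm_le_of_orthogonal {p e x : Idx k → F} (hp : hermForm p p = 1)
    (hpe : hermForm p e = 0) (he : hermForm e e = -1) (hx : 0 ≤ RCLike.re (hermForm x x)) :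
    ‖hermForm e x‖ ≤ ‖hermForm p x‖ := by
  have h := norm_perpForm_sq_le hp e x
  have hep : hermForm e p = 0 := by rw [← star_hermForm, hpe, star_zero]
  rw [perpForm, hep, hpe, he, zero_mul, zero_sub, norm_neg] at h
  simp only [norm_zero, map_neg, RCLike.one_re] at h
  refine abs_le_of_sq_le_sq' ?_ (norm_nonneg _) |>.2
  linarith

-- The region is placed on the ray from `p` to `y`, at distance `log L` from `p`: the frame `(p,
-- e₀)` of the plane through `p` and `y` is boosted by `log L`, and the null vector is completed by
-- a unit vector `w` orthogonal to that plane. The point `y` lies much further out. A point `x`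
-- satisfying the inequality is not seen from `p` in the direction of `y`, so for large `L` it lies
-- behind the region's boundary.
set_option maxHeartbeats 800000 in
theorem exists_separating_region_of_real (hk : 1 ≤ k) {c : ℝ} (hc : 0 < c) {p y : Idx k → F}
    (hp : hermForm p p = 1) (hay : hermForm y y = 1) {A : ℝ} (hpy : hermForm p y = (A : F))
    (hR : 24 / c + 3 < A) :
    ∃ n e : Idx k → F, IsRegionPair n e ∧ ¬ InRegion n e y ∧
      ∀ x, 0 < RCLike.re (hermForm x x) →
        c * ‖hermForm p x‖ * A ≤ ‖hermForm y x‖ → InRegion n e x := by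
  -- The choice gives `L c ≥ 8`, which makes `α` below dominate, while `3 L = 24 / c + 3 < A` places
  -- `y` beyond the region.
  set L := 8 / c + 1 with hL
  have hL1 : 1 < L := by rw [hL]; have : 0 < 8 / c := by positivity
                         linarith
  have hLc : 8 ≤ L * c := by rw [hL, add_mul, div_mul_cancel₀ _ hc.ne']; linarith
  have hAL : 3 * L < A := by rw [hL]; calc _ = 24 / c + 3 := by ring
                                        _ < A := hR
  have hL0 : 0 < L := by linarith
  have hA0 : 0 < A := by linarith
  set s := √(A ^ 2 - 1) with hs
  have hs2 : s ^ 2 = A ^ 2 - 1 := Real.sq_sqrt (by nlinarith)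
  have hs0 : 0 < s := Real.sqrt_pos.mpr (by nlinarith)
  have hsA : s ≤ A := by nlinarith
  have hAs : A * (A - s) ≤ 1 := by nlinarith
  have hsF : (s : F) ≠ 0 := by exact_mod_cast hs0.ne'
  have hs2F : (s : F) ^ 2 = (A : F) ^ 2 - 1 := by exact_mod_cast congrArg (fun r : ℝ => (r : F)) hs2
  have hyp : hermForm y p = (A : F) := by
    rw [← star_hermForm, hpy, RCLike.star_def, RCLike.conj_ofReal]
  set e₀ := (s : F)⁻¹ • (y - (A : F) • p) with he₀
  have hye₀ : y = (A : F) • p + (s : F) • e₀ := by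
    rw [he₀, smul_smul, mul_inv_cancel₀ hsF, one_smul]; abel
  have hpe : hermForm p e₀ = 0 := by
    rw [he₀, hermForm_smul_right, hermForm_sub_right, hermForm_smul_right, hpy, hp]; ring
  have hee : hermForm e₀ e₀ = -1 := by
    rw [he₀, hermForm_smul_smul, RCLike.star_def, map_inv₀, RCLike.conj_ofReal]
    simp only [hermForm_sub_left, hermForm_sub_right, hermForm_smul_right, hermForm_smul_left, hpy,
      hp, hay, hyp, RCLike.star_def, RCLike.conj_ofReal]
    field_simp
    rw [hs2F]
    ring
  have hep : hermForm e₀ p = 0 := by rw [← star_hermForm, hpe, star_zero]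
  obtain ⟨w, hww, hpw, hew⟩ := exists_unit_negative_orthogonal hk hp e₀
  have hwp : hermForm w p = 0 := by rw [← star_hermForm, hpw, star_zero]
  have hwe : hermForm w e₀ = 0 := by rw [← star_hermForm, hew, star_zero]
  set ch := (L + L⁻¹) / 2 with hch
  set sh := (L - L⁻¹) / 2 with hsh
  have hLL : L * L⁻¹ = 1 := mul_inv_cancel₀ hL0.ne'
  have hLi0 : 0 < L⁻¹ := by positivity
  have hLi1 : L⁻¹ < 1 := inv_lt_one_of_one_lt₀ hL1
  have hcs : ch ^ 2 - sh ^ 2 = 1 := by rw [hch, hsh]; linear_combination hLL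
  have hsh0 : 0 ≤ sh := by rw [hsh]; linarith
  have hcsF : (ch : F) ^ 2 - (sh : F) ^ 2 = 1 := by
    exact_mod_cast congrArg (fun r : ℝ => (r : F)) hcs
  set n := (ch : F) • p + (sh : F) • e₀ + w with hn
  set e := -((sh : F) • p + (ch : F) • e₀) with he
  have hnx : ∀ x, hermForm n x = (ch : F) * hermForm p x + (sh : F) * hermForm e₀ x + hermForm w x := by
    intro x
    simp only [hn, hermForm_add_left, hermForm_smul_left, RCLike.star_def, RCLike.conj_ofReal]
  have hex : ∀ x, hermForm e x = -((sh : F) * hermForm p x + (ch : F) * hermForm e₀ x) := by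
    intro x
    simp only [he, hermForm_add_left, hermForm_neg_left, hermForm_smul_left, RCLike.star_def,
      RCLike.conj_ofReal]
  refine ⟨n, e, ⟨?_, ?_, ?_, ?_⟩, ?_, ?_⟩
  · intro h0
    have h1 := hnx p
    rw [h0, hermForm_zero_left, hp, hep, hwp] at h1
    have : (ch : F) = 0 := by linear_combination -h1
    have : ch = 0 := by exact_mod_cast this
    rw [hch] at this; linarith
  · rw [hnx, hn]
    simp only [hermForm_add_right, hermForm_smul_right, hp, hpe, hep, hee, hpw, hwp, hew, hwe, hww]
    linear_combination hcsF
  · rw [hnx, he]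
    simp only [hermForm_add_right, hermForm_smul_right, hermForm_neg_right, hp, hpe, hep, hee, hwp,
      hwe]
    ring
  · rw [hex, he]
    simp only [hermForm_add_right, hermForm_smul_right, hermForm_neg_right, hp, hpe, hep, hee]
    linear_combination -hcsF
  · have e1 : hermForm n y = ((ch * A - sh * s : ℝ) : F) := by
      rw [hnx, hye₀]
      simp only [hermForm_add_right, hermForm_smul_right, hp, hpe, hep, hee, hwp, hwe]
      push_cast; ring
    have e2 : hermForm e y = ((ch * s - sh * A : ℝ) : F) := by
      rw [hex, hye₀]
      simp only [hermForm_add_right, hermForm_smul_right, hp, hpe, hep, hee]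
      push_cast; ring
    have h1 : 0 < ch * A - sh * s := by
      have : sh * s ≤ sh * A := by gcongr
      have h3 : ch * A - sh * A = L⁻¹ * A := by rw [hch, hsh]; ring
      have := mul_pos hLi0 hA0
      linarith
    have h2 : 1 < ch * s - sh * A := by
      have e3 : ch * s - sh * A = L⁻¹ * A - ch * (A - s) := by rw [hch, hsh]; ring
      have h4 : 3 < L⁻¹ * A := by
        calc (3 : ℝ) = L⁻¹ * (3 * L) := by field_simp
          _ < _ := by gcongr
      have h5 : ch * (A - s) ≤ 1 := by
        have : ch ≤ A := by rw [hch]; linarith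
        calc _ ≤ A * (A - s) := mul_le_mul_of_nonneg_right this (by linarith)
          _ ≤ 1 := hAs
      linarith
    rw [InRegion, hay, e1, e2, not_le, RCLike.star_def, RCLike.conj_ofReal, ← RCLike.ofReal_mul,
      RCLike.ofReal_re, RCLike.norm_ofReal, abs_of_pos h1]
    simp only [RCLike.one_re, Real.sqrt_one]
    nlinarith
  · intro x hx hcx
    set X := hermForm p x with hX
    set E := hermForm e₀ x with hE
    set W := hermForm w x with hW
    have hEX : ‖E‖ ≤ ‖X‖ := norm_hermForm_le_of_orthogonal hp hpe hee hx.le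
    have hWX : ‖W‖ ≤ ‖X‖ := norm_hermForm_le_of_orthogonal hp hpw hww hx.le
    have hyX : hermForm y x = (A : F) * (X + E) - ((A - s : ℝ) : F) * E := by
      rw [hye₀]
      simp only [hermForm_add_left, hermForm_smul_left, RCLike.star_def, RCLike.conj_ofReal, ← hX,
        ← hE]
      push_cast; ring
    -- Up to the small error `A - s ≤ 1 / A`, the vector `y` is `A (p + e₀)`, so a lower bound on
    -- `Ψ(y, x)` is a lower bound on `X + E`.
    have hP : c / 2 * ‖X‖ ≤ ‖X + E‖ := by
      rw [hyX] at hcx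
      have h1 := hcx.trans (norm_sub_le _ _)
      rw [norm_mul, norm_mul, RCLike.norm_ofReal, RCLike.norm_ofReal, abs_of_pos hA0,
        abs_of_nonneg (by linarith : 0 ≤ A - s)] at h1
      have h2 : A * ((A - s) * ‖E‖) ≤ ‖X‖ := by
        calc _ = (A * (A - s)) * ‖E‖ := by ring
          _ ≤ 1 * ‖E‖ := by gcongr
          _ ≤ ‖X‖ := by linarith
      have h3 : 2 ≤ c * A ^ 2 := by
        have h31 : 3 ≤ A := by linarith
        have h32 : 24 ≤ c * A := by
          have : c * (24 / c + 3) ≤ c * A := by gcongr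
          rw [mul_add, mul_div_cancel₀ _ hc.ne'] at this
          linarith
        nlinarith
      have h4 : c * ‖X‖ * A ^ 2 ≤ A ^ 2 * ‖X + E‖ + ‖X‖ := by
        have := mul_le_mul_of_nonneg_left h1 hA0.le
        linarith
      have h5 : ‖X‖ ≤ c / 2 * A ^ 2 * ‖X‖ := by
        have := mul_le_mul_of_nonneg_right h3 (norm_nonneg X)
        linarith
      have h6 : A ^ 2 * (c / 2 * ‖X‖) ≤ A ^ 2 * ‖X + E‖ := by linarith
      exact le_of_mul_le_mul_left h6 (by positivity)
    -- These are the two null coordinates of `x` in the boosted plane. The boost stretches the one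
    -- seen from `y` by `L` and shrinks the other, so `‖α‖ ≥ 4 ‖X‖` beats `‖β‖ + 2 ‖W‖ ≤ 4 ‖X‖`.
    set α : F := (L : F) * (X + E) with hα
    set β : F := ((L⁻¹ : ℝ) : F) * (X - E) with hβ
    have hαn : 4 * ‖X‖ ≤ ‖α‖ := by
      rw [hα, norm_mul, RCLike.norm_ofReal, abs_of_pos hL0]
      calc 4 * ‖X‖ ≤ (L * c) / 2 * ‖X‖ := by gcongr; linarith
        _ = L * (c / 2 * ‖X‖) := by ring
        _ ≤ _ := by gcongr
    have hβn : ‖β‖ ≤ 2 * ‖X‖ := by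
      rw [hβ, norm_mul, RCLike.norm_ofReal, abs_of_pos hLi0]
      calc L⁻¹ * ‖X - E‖ ≤ 1 * (‖X‖ + ‖E‖) := by gcongr; exact norm_sub_le _ _
        _ ≤ _ := by linarith
    have e1 : hermForm e x = -((α - β) / 2) := by
      rw [hex, hα, hβ, hch, hsh, ← hX, ← hE]; push_cast; ring
    have e2 : hermForm n x = (α + β) / 2 + W := by
      rw [hnx, hα, hβ, hch, hsh, ← hX, ← hE, ← hW]; push_cast; ring
    have e3 : RCLike.re (star (hermForm e x) * hermForm n x) ≤
        -((‖α‖ ^ 2 - ‖β‖ ^ 2) / 4) + (‖α‖ + ‖β‖) / 2 * ‖W‖ := by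
      have h1 : star (hermForm e x) * hermForm n x =
          -(((((‖α‖ ^ 2 - ‖β‖ ^ 2) / 4 : ℝ) : F) + (star α * β - star (star α * β)) / 4)) +
            star (hermForm e x) * W := by
        have q1 := star_mul_self_eq α
        have q2 := star_mul_self_eq β
        push_cast at q1 q2 ⊢
        rw [← q1, ← q2, e1, e2]
        simp only [star_neg, star_div₀, star_sub, star_mul', star_star, star_ofNat]
        ring
      have h2 : RCLike.re ((star α * β - star (star α * β)) / 4) = 0 := by
        have : (star α * β - star (star α * β)) / 4 =
            (((1 / 4 : ℝ) : F)) * (star α * β - star (star α * β)) := by push_cast; ring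
        rw [this, RCLike.re_ofReal_mul, map_sub, RCLike.star_def, RCLike.conj_re]; simp
      have h3 : RCLike.re (star (hermForm e x) * W) ≤ (‖α‖ + ‖β‖) / 2 * ‖W‖ := by
        refine (RCLike.re_le_norm _).trans ?_
        rw [norm_mul, norm_star, e1, norm_neg, norm_div, RCLike.norm_ofNat]
        gcongr
        exact norm_sub_le _ _
      rw [h1, map_add, map_neg, map_add, RCLike.ofReal_re, h2]
      linarith
    have e4 : -((‖α‖ ^ 2 - ‖β‖ ^ 2) / 4) + (‖α‖ + ‖β‖) / 2 * ‖W‖ ≤ 0 := by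
      have : -((‖α‖ ^ 2 - ‖β‖ ^ 2) / 4) + (‖α‖ + ‖β‖) / 2 * ‖W‖ =
        -((‖α‖ + ‖β‖) * (‖α‖ - ‖β‖ - 2 * ‖W‖) / 4) := by ring
      rw [this, neg_nonpos]
      have h1 : 0 ≤ ‖α‖ - ‖β‖ - 2 * ‖W‖ := by linarith
      positivity
    rw [InRegion]
    exact (e3.trans e4).trans (by positivity)

/-- A point far away from `p` can be separated by a region from the points that are not seen
from `p` in the same direction. -/
theorem exists_separating_region (hk : 1 ≤ k) {c : ℝ} (hc : 0 < c) {p y : Idx k → F}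
    (hp : hermForm p p = 1) (hy : hermForm y y = 1) (hR : 24 / c + 3 < ‖hermForm p y‖) :
    ∃ n e : Idx k → F, IsRegionPair n e ∧ ¬ InRegion n e y ∧
      ∀ x, 0 < RCLike.re (hermForm x x) →
        c * ‖hermForm p x‖ * ‖hermForm p y‖ ≤ ‖hermForm y x‖ → InRegion n e x := by
  obtain ⟨a, A, ha, hay, hA1, hpy⟩ := exists_smul_unit_real hp (x := y) (by rw [hy]; simp)
  have han : ‖a‖ = 1 := by
    rw [hermForm_smul_smul, hy, mul_one, star_mul_self_eq] at hay
    have : ‖a‖ ^ 2 = 1 := by exact_mod_cast hay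
    nlinarith [norm_nonneg a]
  have hnorm : ‖hermForm p y‖ = A := by
    have := congrArg norm hpy
    rwa [hermForm_smul_right, norm_mul, han, one_mul, RCLike.norm_ofReal,
      abs_of_nonneg (zero_le_one.trans hA1)] at this
  have hyx : ∀ x, ‖hermForm y x‖ = ‖hermForm (a • y) x‖ := fun x => by
    rw [hermForm_smul_left, norm_mul, norm_star, han, one_mul]
  rw [hnorm] at hR
  simp only [hnorm, hyx, ← inRegion_smul_iff _ _ y ha]
  exact exists_separating_region_of_real hk hc hp hay hpy hR

/-! ### The action on vectors and on projective space -/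

variable {G : Subgroup (Matrix.SpecialLinearGroup (Idx k) F)}

theorem hermForm_smul_smul_of_le (hG : G ≤ unitaryGroup F k) (g : G) (z w : Idx k → F) :
    hermForm (g • z) (g • w) = hermForm z w := hG g.2 z w

theorem hermForm_smul_left_of_le (hG : G ≤ unitaryGroup F k) (g : G) (z w : Idx k → F) :
    hermForm (g • z) w = hermForm z (g⁻¹ • w) := by
  rw [← hermForm_smul_smul_of_le hG g⁻¹, inv_smul_smul]

theorem continuous_hermForm_right (z : Idx k → F) : Continuous fun w => hermForm z w := by
  simp only [hermForm]; fun_prop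

theorem continuous_hermForm_self : Continuous fun w : Idx k → F => hermForm w w := by
  simp only [hermForm]; fun_prop

theorem continuous_hermForm_smul (z w : Idx k → F) : Continuous fun g : G => hermForm z (g • w) := by
  have h : ∀ i, Continuous fun g : G => (g • w) i := by
    intro i
    have : (fun g : G => (g • w) i) = fun g : G => ∑ j, g.1.1 i j * w j := rfl
    rw [this]
    have hv : Continuous fun g : G => g.1.1 := continuous_subtype_val.comp continuous_subtype_val
    exact continuous_finsetSum _ fun j _ =>
      ((continuous_apply j).comp ((continuous_apply i).comp hv)).mul continuous_const
  exact (continuous_hermForm_right z).comp (continuous_pi h)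

theorem smul_inRegion_iff (hG : G ≤ unitaryGroup F k) (g : G) (n e x : Idx k → F) :
    InRegion n e (g • x) ↔ InRegion (g⁻¹ • n) (g⁻¹ • e) x := by
  rw [InRegion, InRegion, hermForm_smul_smul_of_le hG, hermForm_smul_left_of_le hG,
    hermForm_smul_left_of_le hG, inv_inv]

theorem IsRegionPair.smul (hG : G ≤ unitaryGroup F k) (g : G) {n e : Idx k → F}
    (h : IsRegionPair n e) : IsRegionPair (g • n) (g • e) := by
  obtain ⟨h0, h1, h2, h3⟩ := h
  refine ⟨fun h => h0 ?_, ?_, ?_, ?_⟩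
  · exact (smul_eq_zero_iff_eq (g : Matrix.SpecialLinearGroup (Idx k) F)).mp h
  all_goals rwa [hermForm_smul_smul_of_le hG]

theorem inRegion_rep_mk_iff (n e v : Idx k → F) (hv : v ≠ 0) :
    InRegion n e (Projectivization.mk F v hv).rep ↔ InRegion n e v := by
  obtain ⟨a, ha⟩ := Projectivization.exists_smul_eq_mk_rep F v hv
  rw [← ha]
  exact inRegion_smul_iff n e v a.ne_zero

theorem isClosed_inRegion (n e : Idx k → F) : IsClosed {v | InRegion n e v} := by
  refine isClosed_le ?_ ?_
  · exact RCLike.continuous_re.comp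
      ((continuous_hermForm_right e).star.mul (continuous_hermForm_right n))
  · exact (continuous_hermForm_right n).norm.mul
      (Real.continuous_sqrt.comp (RCLike.continuous_re.comp continuous_hermForm_self))

theorem isClosed_inRegion_rep (n e : Idx k → F) :
    IsClosed {P : ℙ F (Idx k → F) | InRegion n e P.rep} := by
  rw [isClosed_coinduced]
  have : (Projectivization.mk' F : {v : Idx k → F // v ≠ 0} → ℙ F (Idx k → F)) ⁻¹'
      {P | InRegion n e P.rep} = Subtype.val ⁻¹' {v | InRegion n e v} := by
    ext v
    exact inRegion_rep_mk_iff n e v.1 v.2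
  rw [this]
  exact (isClosed_inRegion n e).preimage continuous_subtype_val

/-- This provides compactness of balls. Every coordinate is a pairing `Ψ(f, v)`, which differs from
`Ψ(f, p) Ψ(p, v)` by a value of the semidefinite form `perpForm p`, to which Cauchy–Schwarz applies.
-/
theorem exists_norm_apply_le {p : Idx k → F} (hp : hermForm p p = 1) (R : ℝ) :
    ∃ M : ℝ, ∀ v : Idx k → F, 0 ≤ RCLike.re (hermForm v v) → ‖hermForm p v‖ ≤ R → ‖v‖ ≤ M := by
  have hR : ∀ f : Idx k → F, ∃ M : ℝ, ∀ v : Idx k → F, 0 ≤ RCLike.re (hermForm v v) →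
      ‖hermForm p v‖ ≤ R → ‖hermForm f v‖ ≤ M := by
    intro f
    set D := ‖hermForm p f‖ ^ 2 - RCLike.re (hermForm f f) with hD
    have hD0 : 0 ≤ D := by have := re_hermForm_le_norm_sq hp f; linarith
    refine ⟨‖hermForm f p‖ * R + √D * R, fun v hv hvR => ?_⟩
    have h1 := norm_perpForm_sq_le hp f v
    have h2 : ‖perpForm p f v‖ ≤ √D * R := by
      have hR0 := (norm_nonneg _).trans hvR
      refine abs_le_of_sq_le_sq' ?_ (by positivity) |>.2
      rw [mul_pow, Real.sq_sqrt hD0]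
      refine h1.trans ?_
      gcongr
      nlinarith [norm_nonneg (hermForm p v)]
    have h3 : hermForm f v = hermForm f p * hermForm p v - perpForm p f v := by rw [perpForm]; ring
    rw [h3]
    refine (norm_sub_le _ _).trans ?_
    rw [norm_mul]
    gcongr
  choose M hM using hR
  refine ⟨∑ i, |M (Pi.single i 1)|, fun v hv hvR => ?_⟩
  refine (pi_norm_le_iff_of_nonneg (Finset.sum_nonneg fun _ _ => abs_nonneg _)).mpr fun i => ?_
  have : ∃ i', ‖v i‖ = ‖hermForm (Pi.single i' 1) v‖ := by
    rcases i with _ | j | _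
    · exact ⟨Idx.last, by simp [hermForm]⟩
    · refine ⟨Idx.mid j, ?_⟩
      have : hermForm (Pi.single (Idx.mid j) 1) v = -v (Idx.mid j) := by
        simp only [hermForm]
        rw [Finset.sum_eq_single j]
        · simp
        · intro b _ hb; simp [hb]
        · simp
      rw [this, norm_neg]
    · exact ⟨Idx.first, by simp [hermForm]⟩
  obtain ⟨i', hi'⟩ := this
  rw [hi']
  refine (hM _ v hv hvR).trans ((le_abs_self _).trans ?_)
  exact Finset.single_le_sum (f := fun i => |M (Pi.single i 1)|) (fun _ _ => abs_nonneg _)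
    (Finset.mem_univ i')

theorem discreteTopology_of_finite_le {G : Type*} [Group G] [TopologicalSpace G]
    [IsTopologicalGroup G] [T1Space G] (H : Subgroup G) {f : G → ℝ} (hf : Continuous f) {B : ℝ}
    (hB : f 1 < B) (hfin : {h | h ∈ H ∧ f h ≤ B}.Finite) : DiscreteTopology H := by
  rw [discreteTopology_iff_isOpen_singleton_one]
  set T : Set G := {h | h ∈ H ∧ f h ≤ B} \ {1} with hT
  have hTc : IsClosed T := (hfin.subset Set.sdiff_subset).isClosed
  have hopen : IsOpen ({g | f g < B} ∩ Tᶜ) := (isOpen_lt hf continuous_const).inter hTc.isOpen_compl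
  have : ({1} : Set H) = Subtype.val ⁻¹' ({g | f g < B} ∩ Tᶜ) := by
    ext h
    simp only [Set.mem_singleton_iff, Set.mem_preimage, Set.mem_inter_iff, Set.mem_compl_iff]
    constructor
    · rintro rfl
      exact ⟨hB, fun h => h.2 rfl⟩
    · rintro ⟨h1, h2⟩
      by_contra hne
      exact h2 ⟨⟨h.2, h1.le⟩, fun h' => hne (Subtype.ext h')⟩
  rw [this]
  exact hopen.preimage continuous_subtype_val

/-- A representation is convex-cocompact if its orbits are proper and quasi-convex. -/
theorem isConvexCocompact_of_orbit (hk : 1 ≤ k) (hG : G ≤ unitaryGroup F k) {Γ : Type*} [Group Γ]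
    (ρ : Γ →* G) {p : Idx k → F} (hp : hermForm p p = 1)
    (hfin : ∀ B : ℝ, {γ : Γ | ‖hermForm p (ρ γ • p)‖ ≤ B}.Finite) {c : ℝ} (hc : 0 < c)
    (hqc : ∀ y : Idx k → F, hermForm y y = 1 → (∀ γ, ‖hermForm y p‖ ≤ ‖hermForm y (ρ γ • p)‖) →
      ∀ γ, c * ‖hermForm y p‖ * ‖hermForm p (ρ γ • p)‖ ≤ ‖hermForm y (ρ γ • p)‖) :
    IsConvexCocompact ρ := by
  have hp0 : p ≠ 0 := by rintro rfl; simp [hermForm_zero_left] at hp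
  have horb : ∀ γ, hermForm (ρ γ • p) (ρ γ • p) = 1 := fun γ => by
    rw [hermForm_smul_smul_of_le hG, hp]
  refine ⟨?_, ?_, ?_⟩
  · refine Set.Finite.subset (hfin 1) fun γ hγ => ?_
    have : ρ γ = 1 := hγ
    simp [this, hp]
  · refine discreteTopology_of_finite_le (f := fun g : G => ‖hermForm p (g • p)‖) _
      (continuous_hermForm_smul p p).norm (B := 2) (by simp [hp]) ?_
    refine ((hfin 2).image ρ).subset ?_
    rintro _ ⟨⟨γ, rfl⟩, h⟩
    exact ⟨γ, h, rfl⟩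
  -- A substitute for the convex hull of the orbit: the intersection of all regions that contain it.
  set InC : (Idx k → F) → Prop := fun v => ∀ n e, IsRegionPair n e →
    (∀ γ, InRegion n e (ρ γ • p)) → InRegion n e v with hInC
  have hInCmk : ∀ (v : Idx k → F) (hv : v ≠ 0), InC (Projectivization.mk F v hv).rep ↔ InC v := by
    intro v hv
    simp only [hInC, inRegion_rep_mk_iff]
  have hInCsmul : ∀ (v : Idx k → F) (a : F), a ≠ 0 → (InC (a • v) ↔ InC v) := by
    intro v a ha
    simp only [hInC, inRegion_smul_iff _ _ _ ha]
  have hInCγ : ∀ (v : Idx k → F) γ, InC v → InC (ρ γ • v) := by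
    intro v γ h n e hne hγ
    rw [smul_inRegion_iff hG]
    refine h _ _ (hne.smul hG _) fun γ' => ?_
    rw [← smul_inRegion_iff hG, smul_smul, ← map_mul]
    exact hγ _
  set C : Set (ℙ F (Idx k → F)) := {P | P ∈ hypSpace F k ∧ InC P.rep} with hC
  have hCmk : ∀ (v : Idx k → F) (hv : v ≠ 0), Projectivization.mk F v hv ∈ C ↔
      0 < RCLike.re (hermForm v v) ∧ InC v := by
    intro v hv
    change _ ∧ _ ↔ _
    rw [mk_mem_hypSpace, hInCmk]
  refine ⟨C, fun P hP => hP.1, ⟨Projectivization.mk F p hp0, ?_⟩, ?_, ?_, ?_, ?_⟩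
  · rw [hCmk, hp]
    refine ⟨by simp, fun n e _ h => ?_⟩
    simpa using h 1
  · have : (Subtype.val ⁻¹' C : Set (hypSpace F k)) = ⋂ (n : Idx k → F) (e : Idx k → F)
        (_ : IsRegionPair n e) (_ : ∀ γ, InRegion n e (ρ γ • p)),
          Subtype.val ⁻¹' {P : ℙ F (Idx k → F) | InRegion n e P.rep} := by
      ext P
      simp only [Set.mem_preimage, Set.mem_iInter]
      exact ⟨fun h n e h1 h2 => h.2 n e h1 h2, fun h => ⟨P.2, fun n e h1 h2 => h n e h1 h2⟩⟩
    rw [this]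
    exact isClosed_iInter fun n => isClosed_iInter fun e => isClosed_iInter fun _ =>
      isClosed_iInter fun _ => (isClosed_inRegion_rep n e).preimage continuous_subtype_val
  · intro X hX Y hY Z hZ hd
    refine ⟨hZ, fun n e hne hγ => ?_⟩
    exact (isHypConvex_region hne.1 hne.2.1 hne.2.2.1 hne.2.2.2 X ⟨hX.1, hX.2 n e hne hγ⟩ Y
      ⟨hY.1, hY.2 n e hne hγ⟩ Z hZ hd).2
  · intro γ X hX
    induction X using Projectivization.ind with
    | h v hv =>
      rw [hCmk] at hX
      rw [Projectivization.smul_mk, hCmk]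
      refine ⟨?_, hInCγ v γ hX.2⟩
      have := hermForm_smul_smul_of_le hG (ρ γ) v v
      exact lt_of_lt_of_eq hX.1 (congrArg RCLike.re this.symm)
  -- Beyond this threshold `exists_separating_region` applies, so points of the hull whose nearest
  -- orbit point is `p` form a set within bounded distance of `p`.
  · set R := 24 / c + 3 with hR
    set D : Set {v : Idx k → F // v ≠ 0} :=
      {v | hermForm v.1 v.1 = 1 ∧ ‖hermForm p v.1‖ ≤ R ∧ InC v.1} with hD
    refine ⟨Projectivization.mk' F '' D, ?_, ?_, ?_⟩
    · rintro _ ⟨v, hv, rfl⟩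
      refine (hCmk v.1 v.2).mpr ⟨by rw [hv.1]; simp, hv.2.2⟩
    · refine IsCompact.image ?_ continuous_coinduced_rng
      rw [Subtype.isCompact_iff]
      have himg : Subtype.val '' D = {v : Idx k → F | hermForm v v = 1} ∩
          ({v | ‖hermForm p v‖ ≤ R} ∩ {v | InC v}) := by
        ext v
        constructor
        · rintro ⟨v, hv, rfl⟩; exact hv
        · intro hv
          refine ⟨⟨v, ?_⟩, hv, rfl⟩
          rintro rfl
          have := hv.1
          simp [hermForm_zero_left] at this
      rw [himg]
      obtain ⟨M, hM⟩ := exists_norm_apply_le hp R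
      refine Metric.isCompact_of_isClosed_isBounded ?_ ?_
      · refine (isClosed_eq continuous_hermForm_self continuous_const).inter
          ((isClosed_le (continuous_hermForm_right p).norm continuous_const).inter ?_)
        have : {v | InC v} = ⋂ (n : Idx k → F) (e : Idx k → F)
            (_ : IsRegionPair n e) (_ : ∀ γ, InRegion n e (ρ γ • p)), {v | InRegion n e v} := by
          ext v
          simp only [Set.mem_iInter]
          rfl
        rw [this]
        exact isClosed_iInter fun n => isClosed_iInter fun e => isClosed_iInter fun _ =>
          isClosed_iInter fun _ => isClosed_inRegion n e
      · refine (Metric.isBounded_iff_subset_closedBall 0).mpr ⟨M, fun v hv => ?_⟩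
        rw [mem_closedBall_zero_iff]
        refine hM v ?_ hv.2.1
        have := hv.1
        simp only [Set.mem_ofPred_eq] at this
        rw [this]; simp
    · intro X hX
      induction X using Projectivization.ind with
      | h v₀ hv₀ =>
        rw [hCmk] at hX
        obtain ⟨a, ha, hav⟩ := exists_smul_unit hX.1
        have hvC := (hInCsmul v₀ a ha).mpr hX.2
        set v := a • v₀ with hv
        have hne : {γ | ‖hermForm v (ρ γ • p)‖ ≤ ‖hermForm v p‖}.Nonempty := ⟨1, by simp⟩
        have hfinv : {γ | ‖hermForm v (ρ γ • p)‖ ≤ ‖hermForm v p‖}.Finite := by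
          refine (hfin (2 * ‖hermForm p v‖ * ‖hermForm v p‖)).subset fun γ hγ => ?_
          have := norm_hermForm_le_two_mul hav (x := p) (y := ρ γ • p) (by rw [hp]; simp)
            (by rw [horb]; simp)
          exact this.trans (by
            have : ‖hermForm v (ρ γ • p)‖ ≤ ‖hermForm v p‖ := hγ
            gcongr)
        -- A nearest orbit point exists by properness; moving it back to `p` yields a representative
        -- `y` of the orbit of `v` to which `hqc` applies.
        obtain ⟨γ₀, hγ₀, hmin⟩ := Set.exists_min_image _ (fun γ => ‖hermForm v (ρ γ • p)‖) hfinv hne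
        have hmin' : ∀ γ, ‖hermForm v (ρ γ₀ • p)‖ ≤ ‖hermForm v (ρ γ • p)‖ := by
          intro γ
          rcases le_total ‖hermForm v (ρ γ • p)‖ ‖hermForm v p‖ with h | h
          · exact hmin γ h
          · exact le_trans hγ₀ h
        set y := ρ γ₀⁻¹ • v with hy
        have hyy : hermForm y y = 1 := by rw [hy, hermForm_smul_smul_of_le hG, hav]
        have hyγ : ∀ γ, hermForm y (ρ γ • p) = hermForm v (ρ (γ₀ * γ) • p) := fun γ => by
          rw [hy, hermForm_smul_left_of_le hG, ← map_inv, inv_inv, smul_smul, ← map_mul]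
        have hy1 : hermForm y p = hermForm v (ρ γ₀ • p) := by
          have := hyγ 1; simpa using this
        have hyC : InC y := hInCγ v _ hvC
        have hy0 : y ≠ 0 := by rintro h; rw [h, hermForm_zero_left] at hyy; simp at hyy
        have hyR : ‖hermForm p y‖ ≤ R := by
          by_contra hcon
          obtain ⟨n, e, hne, hny, hin⟩ := exists_separating_region hk hc hp hyy (not_le.mp hcon)
          refine hny (hyC n e hne fun γ => hin _ (by rw [horb]; simp) ?_)
          have := hqc y hyy (fun γ => by rw [hyγ, hy1]; exact hmin' _) γ
          rw [norm_hermForm_comm p y]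
          linarith
        refine ⟨γ₀, Projectivization.mk F y hy0, ⟨⟨y, hy0⟩, ⟨hyy, hyR, hyC⟩, rfl⟩, ?_⟩
        rw [Projectivization.smul_mk, Projectivization.mk_eq_mk_iff']
        refine ⟨a, ?_⟩
        have : (ρ γ₀ : Matrix.SpecialLinearGroup (Idx k) F) • y = ρ γ₀ • ρ γ₀⁻¹ • v := rfl
        rw [this, smul_smul, ← map_mul, mul_inv_cancel, map_one, one_smul]

end Criterion

/-! ### Cyclic groups generated by a loxodromic element -/

section Loxodromic

variable {F : Type*} [RCLike F] {k : ℕ} {G : Subgroup (Matrix.SpecialLinearGroup (Idx k) F)}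

/-- The element `g` is loxodromic with fixed null vectors `ξ`, `η`, translation length `y` and
multiplier `c`. -/
structure IsLoxodromic (g : G) (ξ η : Idx k → F) (y : ℝ) (c : F) : Prop where
  pos : 0 < y
  norm_eq : ‖c‖ = 1
  null_left : hermForm ξ ξ = 0
  null_right : hermForm η η = 0
  pairing : hermForm ξ η = 1
  smul_left : g • ξ = ((Real.exp y : F) * c) • ξ
  smul_right : g • η = ((Real.exp (-y) : F) * c) • η

theorem smul_comm_of_subgroup (g : G) (a : F) (v : Idx k → F) : g • (a • v) = a • (g • v) :=
  smul_comm (g : Matrix.SpecialLinearGroup (Idx k) F) a v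

theorem smul_add_of_subgroup (g : G) (v w : Idx k → F) : g • (v + w) = g • v + g • w :=
  smul_add (g : Matrix.SpecialLinearGroup (Idx k) F) v w

theorem zpow_smul_eq_of_smul_eq {g : G} {a : F} {v : Idx k → F} (ha : a ≠ 0) (h : g • v = a • v)
    (m : ℤ) : g ^ m • v = a ^ m • v := by
  have hinv : g⁻¹ • v = a⁻¹ • v := by
    rw [inv_smul_eq_iff, smul_comm_of_subgroup, h, smul_smul, inv_mul_cancel₀ ha, one_smul]
  induction m using Int.induction_on with
  | zero => simp
  | succ i ih =>
    rw [zpow_add_one, mul_smul, h, smul_comm_of_subgroup, ih, smul_smul, zpow_add_one₀ ha, mul_comm]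
  | pred i ih =>
    rw [zpow_sub_one, mul_smul, hinv, smul_comm_of_subgroup, ih, smul_smul, zpow_sub_one₀ ha,
      mul_comm]

theorem real_exp_int_mul (m : ℤ) (y : ℝ) : Real.exp (m * y) = Real.exp y ^ m := by
  rw [mul_comm, Real.exp_mul, Real.rpow_intCast]

namespace IsLoxodromic

variable {g : G} {ξ η : Idx k → F} {y : ℝ} {c : F}

theorem zpow_smul (h : IsLoxodromic g ξ η y c) (m : ℤ) :
    g ^ m • ξ = ((Real.exp (m * y) : F) * c ^ m) • ξ ∧
      g ^ m • η = ((Real.exp (-(m * y)) : F) * c ^ m) • η := by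
  have hc : c ≠ 0 := norm_ne_zero_iff.mp (by rw [h.norm_eq]; simp)
  have he : ∀ t : ℝ, ((Real.exp t : ℝ) : F) ≠ 0 := fun t => by
    exact_mod_cast (Real.exp_pos t).ne'
  constructor
  · rw [zpow_smul_eq_of_smul_eq (mul_ne_zero (he y) hc) h.smul_left, mul_zpow,
      ← RCLike.ofReal_zpow, ← real_exp_int_mul]
  · rw [zpow_smul_eq_of_smul_eq (mul_ne_zero (he (-y)) hc) h.smul_right, mul_zpow,
      ← RCLike.ofReal_zpow, ← real_exp_int_mul, mul_neg]

theorem norm_hermForm_zpow_smul_eq (h : IsLoxodromic g ξ η y c) (z : Idx k → F) (m : ℤ) :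
    ‖hermForm z (g ^ m • (ξ + η))‖ =
      ‖(Real.exp (m * y) : F) * hermForm z ξ + (Real.exp (-(m * y)) : F) * hermForm z η‖ := by
  obtain ⟨h1, h2⟩ := h.zpow_smul m
  rw [smul_add_of_subgroup, h1, h2, hermForm_add_right, hermForm_smul_right, hermForm_smul_right]
  have : (Real.exp (m * y) : F) * c ^ m * hermForm z ξ +
      (Real.exp (-(m * y)) : F) * c ^ m * hermForm z η =
      c ^ m * ((Real.exp (m * y) : F) * hermForm z ξ +
        (Real.exp (-(m * y)) : F) * hermForm z η) := by ring
  rw [this, norm_mul, norm_zpow, h.norm_eq, one_zpow, one_mul]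

theorem hermForm_sum_self (h : IsLoxodromic g ξ η y c) : hermForm (ξ + η) (ξ + η) = 2 := by
  have : hermForm η ξ = 1 := by rw [← star_hermForm, h.pairing, star_one]
  rw [hermForm_add_left, hermForm_add_right, hermForm_add_right, h.null_left, h.null_right,
    h.pairing, this]
  norm_num

/-- Removing from `z` its component in the plane of `ξ` and `η` leaves a vector `v` orthogonal to
the positive vector `ξ + η`. Its self-product `Ψ(z, z) - 2 Re(…)` is therefore at most zero. -/
theorem re_mul_pos (h : IsLoxodromic g ξ η y c) {z : Idx k → F}
    (hz : 0 < RCLike.re (hermForm z z)) :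
    0 < RCLike.re (star (hermForm z ξ) * hermForm z η) := by
  have hηξ : hermForm η ξ = 1 := by rw [← star_hermForm, h.pairing, star_one]
  set v := z - hermForm η z • ξ - hermForm ξ z • η with hv
  have h1 : hermForm (ξ + η) v = 0 := by
    simp only [hv, hermForm_add_left, hermForm_sub_right, hermForm_smul_right, h.null_left,
      h.null_right, h.pairing, hηξ]
    ring
  have h2 := re_hermForm_nonpos_of_orthogonal (by rw [h.hermForm_sum_self]; simp) h1
  have h3 : hermForm v v = hermForm z z - (star (hermForm z ξ) * hermForm z η +
      star (star (hermForm z ξ) * hermForm z η)) := by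
    simp only [hv, hermForm_sub_left, hermForm_sub_right, hermForm_smul_right, hermForm_smul_left,
      h.null_left, h.null_right, h.pairing, hηξ, star_mul', star_hermForm]
    ring
  rw [h3, map_sub, map_add, RCLike.star_def, RCLike.conj_re] at h2
  rw [RCLike.star_def]
  linarith

theorem norm_hermForm_zpow_smul_le (h : IsLoxodromic g ξ η y c) (z : Idx k → F) (m : ℤ) :
    ‖hermForm z (g ^ m • (ξ + η))‖ ≤
      Real.exp (m * y) * ‖hermForm z ξ‖ + Real.exp (-(m * y)) * ‖hermForm z η‖ := by
  rw [h.norm_hermForm_zpow_smul_eq]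
  refine (norm_add_le _ _).trans ?_
  rw [norm_mul, norm_mul, RCLike.norm_ofReal, RCLike.norm_ofReal, abs_of_pos (Real.exp_pos _),
    abs_of_pos (Real.exp_pos _)]

/-- By `re_mul_pos` the two terms of `Ψ(z, gᵐ(ξ + η))` do not cancel, so the modulus is comparable
to the sum of the moduli, each of which is an explicit exponential in `m`. -/
theorem le_norm_hermForm_zpow_smul (h : IsLoxodromic g ξ η y c) {z : Idx k → F}
    (hz : 0 < RCLike.re (hermForm z z)) (m : ℤ) :
    Real.exp (m * y) * ‖hermForm z ξ‖ + Real.exp (-(m * y)) * ‖hermForm z η‖ ≤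
      2 * ‖hermForm z (g ^ m • (ξ + η))‖ := by
  rw [h.norm_hermForm_zpow_smul_eq]
  set a := Real.exp (m * y) with ha
  set b := Real.exp (-(m * y)) with hb
  have ha0 : 0 < a := Real.exp_pos _
  have hb0 : 0 < b := Real.exp_pos _
  set A := hermForm z ξ with hA
  set B := hermForm z η with hB
  have h0 := h.re_mul_pos hz
  rw [← hA, ← hB] at h0
  have h1 : ‖(a : F) * A + (b : F) * B‖ ^ 2 =
      (a * ‖A‖) ^ 2 + (b * ‖B‖) ^ 2 + 2 * (a * b) * RCLike.re (star A * B) := by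
    have e1 := star_mul_self_eq A
    have e2 := star_mul_self_eq B
    have : ((‖(a : F) * A + (b : F) * B‖ ^ 2 : ℝ) : F) =
        (((a * ‖A‖) ^ 2 + (b * ‖B‖) ^ 2 : ℝ) : F) +
          ((a * b : ℝ) : F) * (star A * B + star (star A * B)) := by
      rw [← star_mul_self_eq]
      simp only [star_add, star_mul', star_star, show star (a : F) = a from RCLike.conj_ofReal a,
        show star (b : F) = b from RCLike.conj_ofReal b]
      push_cast at e1 e2 ⊢
      linear_combination (a : F) ^ 2 * e1 + (b : F) ^ 2 * e2
    have h2 := congrArg RCLike.re this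
    rw [RCLike.ofReal_re, map_add, RCLike.ofReal_re, RCLike.re_ofReal_mul, map_add, RCLike.star_def,
      RCLike.conj_re] at h2
    rw [RCLike.star_def]
    linarith
  have h2 : 0 < a * b * RCLike.re (star A * B) := by positivity
  refine abs_le_of_sq_le_sq' ?_ (by positivity) |>.2
  nlinarith [sq_nonneg (a * ‖A‖ - b * ‖B‖)]

theorem zpow_eq_one_iff (h : IsLoxodromic g ξ η y c) {m : ℤ} : g ^ m = 1 ↔ m = 0 := by
  refine ⟨fun hm => ?_, fun hm => by rw [hm, zpow_zero]⟩
  have h1 := (h.zpow_smul m).1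
  have hξ0 : ξ ≠ 0 := by
    rintro rfl
    have := h.pairing
    simp [hermForm_zero_left] at this
  rw [hm, one_smul] at h1
  have h2 := congrArg (fun v => hermForm v η) h1
  simp only [hermForm_smul_left, h.pairing, mul_one] at h2
  have h3 := congrArg norm h2
  rw [norm_one, norm_star, norm_mul, norm_zpow, h.norm_eq, one_zpow, mul_one, RCLike.norm_ofReal,
    abs_of_pos (Real.exp_pos _), eq_comm, Real.exp_eq_one_iff] at h3
  have := h.pos
  rcases mul_eq_zero.mp h3 with h4 | h4
  · exact_mod_cast h4
  · linarith

theorem exp_abs_mul_le {m : ℤ} {a b : ℝ} (ha : 0 ≤ a) (hb : 0 ≤ b) (y : ℝ) :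
    Real.exp (|(m : ℝ)| * y) * min a b ≤ Real.exp (m * y) * a + Real.exp (-(m * y)) * b := by
  rcases abs_cases (m : ℝ) with ⟨h, _⟩ | ⟨h, _⟩
  · rw [h]
    have := mul_le_mul_of_nonneg_left (min_le_left a b) (Real.exp_pos (m * y)).le
    have := mul_nonneg (Real.exp_pos (-(m * y))).le hb
    linarith
  · rw [h, neg_mul]
    have := mul_le_mul_of_nonneg_left (min_le_right a b) (Real.exp_pos (-(m * y))).le
    have := mul_nonneg (Real.exp_pos ((m * y))).le ha
    linarith

variable {p : Idx k → F}

/-- Together with the next lemma this passes between the base point `p` and the point `ξ + η` of the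
axis, whose orbit is explicit, at the cost of a constant factor. -/
theorem norm_hermForm_smul_sum_le (hG : G ≤ unitaryGroup F k) (hp : hermForm p p = 1)
    (h : IsLoxodromic g ξ η y c) {z : Idx k → F} (hz : 0 < RCLike.re (hermForm z z)) (m : ℤ) :
    ‖hermForm z (g ^ m • (ξ + η))‖ ≤ 2 * ‖hermForm p (ξ + η)‖ * ‖hermForm z (g ^ m • p)‖ := by
  have := norm_hermForm_le_two_mul (p := g ^ m • p) (x := z) (y := g ^ m • (ξ + η))
    (by rw [hermForm_smul_smul_of_le hG, hp]) hz.le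
    (by rw [hermForm_smul_smul_of_le hG, h.hermForm_sum_self]; simp)
  rw [hermForm_smul_smul_of_le hG] at this
  linarith

theorem norm_hermForm_smul_le_sum (hG : G ≤ unitaryGroup F k) (hp : hermForm p p = 1)
    (h : IsLoxodromic g ξ η y c) {z : Idx k → F} (hz : 0 < RCLike.re (hermForm z z)) (m : ℤ) :
    ‖hermForm z (g ^ m • p)‖ ≤ ‖hermForm p (ξ + η)‖ * ‖hermForm z (g ^ m • (ξ + η))‖ := by
  have hq := h.hermForm_sum_self
  obtain ⟨a, ha, haq⟩ := exists_smul_unit (x := ξ + η) (by rw [hq]; simp)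
  have ha2 : ‖a‖ ^ 2 * 2 = 1 := by
    rw [hermForm_smul_smul, hq, star_mul_self_eq] at haq
    exact_mod_cast haq
  have := norm_hermForm_le_two_mul (p := g ^ m • (a • (ξ + η))) (x := z) (y := g ^ m • p)
    (by rw [hermForm_smul_smul_of_le hG, haq]) hz.le
    (by rw [hermForm_smul_smul_of_le hG, hp]; simp)
  rw [hermForm_smul_smul_of_le hG, smul_comm_of_subgroup, hermForm_smul_right, hermForm_smul_left,
    norm_mul, norm_mul, norm_star, norm_hermForm_comm (ξ + η) p] at this
  have e : 2 * (‖a‖ * ‖hermForm z (g ^ m • (ξ + η))‖) * (‖a‖ * ‖hermForm p (ξ + η)‖) =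
    (‖a‖ ^ 2 * 2) * (‖hermForm p (ξ + η)‖ * ‖hermForm z (g ^ m • (ξ + η))‖) := by ring
  rw [e, ha2, one_mul] at this
  exact this

theorem finite_norm_le (hG : G ≤ unitaryGroup F k) (hp : hermForm p p = 1)
    (h : IsLoxodromic g ξ η y c) (B : ℝ) :
    {m : ℤ | ‖hermForm p (g ^ m • p)‖ ≤ B}.Finite := by
  have hp0 : 0 < RCLike.re (hermForm p p) := by rw [hp]; simp
  have hre := h.re_mul_pos hp0
  set κ := ‖hermForm p (ξ + η)‖ with hκ
  set μ := min ‖hermForm p ξ‖ ‖hermForm p η‖ with hμ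
  have hμ0 : 0 < μ := by
    apply lt_min <;> refine norm_pos_iff.mpr fun h0 => ?_ <;> simp [h0] at hre
  set D := 4 * κ * B / μ with hD
  refine (Set.finite_Icc (-⌈D / y⌉) ⌈D / y⌉).subset fun m hm => ?_
  have h1 := exp_abs_mul_le (m := m) (norm_nonneg (hermForm p ξ)) (norm_nonneg (hermForm p η)) y
  have h2 := h.le_norm_hermForm_zpow_smul hp0 m
  have h3 := norm_hermForm_smul_sum_le hG hp h hp0 m
  have hm' : ‖hermForm p (g ^ m • p)‖ ≤ B := hm
  have h4 : Real.exp (|(m : ℝ)| * y) * μ ≤ 4 * κ * B := by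
    have : 2 * κ * ‖hermForm p (g ^ m • p)‖ ≤ 2 * κ * B := by gcongr
    linarith
  have h5 : |(m : ℝ)| * y ≤ D := by
    rw [hD, le_div_iff₀ hμ0]
    refine le_trans ?_ h4
    gcongr
    have := Real.add_one_le_exp (|(m : ℝ)| * y)
    linarith
  have h6 : |(m : ℝ)| ≤ ⌈D / y⌉ := ((le_div_iff₀ h.pos).mpr h5).trans (Int.le_ceil _)
  have h7 : |m| ≤ ⌈D / y⌉ := by exact_mod_cast h6
  exact Set.mem_Icc.mpr (abs_le.mp h7)

/-- The orbit of a point under a loxodromic cyclic group is quasi-convex. -/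
theorem exists_quasiconvex (hG : G ≤ unitaryGroup F k) (hp : hermForm p p = 1)
    (h : IsLoxodromic g ξ η y c) :
    ∃ δ : ℝ, 0 < δ ∧ ∀ z : Idx k → F, hermForm z z = 1 →
      (∀ m : ℤ, ‖hermForm z p‖ ≤ ‖hermForm z (g ^ m • p)‖) →
      ∀ m : ℤ, δ * ‖hermForm z p‖ * ‖hermForm p (g ^ m • p)‖ ≤ ‖hermForm z (g ^ m • p)‖ := by
  have hp0 : 0 < RCLike.re (hermForm p p) := by rw [hp]; simp
  have hre := h.re_mul_pos hp0
  set κ := ‖hermForm p (ξ + η)‖ with hκ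
  have hκ0 : 0 < κ := norm_pos_iff.mpr
    (hermForm_ne_zero_of_pos hp0 (by rw [h.hermForm_sum_self]; simp))
  set N := ‖hermForm p ξ‖ + ‖hermForm p η‖ with hN
  have hN0 : 0 < N := by
    have : 0 < ‖hermForm p ξ‖ := norm_pos_iff.mpr fun h0 => by simp [h0] at hre
    positivity
  set K := 4 * κ ^ 2 with hK
  have hK0 : 0 < K := by positivity
  -- Comparing `p` with its translates by `g^J` and `g^(-J)` bounds `a / b` and `b / a` by `Q`: a
  -- point whose nearest orbit point is `p` projects to the axis near `p`. The index `J` is taken so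
  -- large that the shrinking term in the comparison can be absorbed on the left.
  obtain ⟨J, hJ⟩ : ∃ J : ℕ, 2 * K ≤ Real.exp (J * y) := by
    obtain ⟨J, hJ⟩ := exists_nat_gt (2 * K / y)
    refine ⟨J, ?_⟩
    have := Real.add_one_le_exp (J * y)
    rw [div_lt_iff₀ h.pos] at hJ
    linarith
  set Q := 2 * K * Real.exp (J * y) with hQ
  have hQ0 : 0 < Q := by positivity
  have hexpJ : K * Real.exp (-(J * y)) ≤ 1 / 2 := by
    rw [Real.exp_neg, ← div_eq_mul_inv, div_le_iff₀ (Real.exp_pos _)]; linarith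
  refine ⟨1 / (4 * κ ^ 3 * N * (1 + Q)), by positivity, fun z hz hmin m => ?_⟩
  have hz0 : 0 < RCLike.re (hermForm z z) := by rw [hz]; simp
  set a := ‖hermForm z ξ‖ with ha
  set b := ‖hermForm z η‖ with hb
  have ha0 : 0 ≤ a := norm_nonneg _
  have hb0 : 0 ≤ b := norm_nonneg _
  have hcomp : ∀ j : ℤ, a + b ≤ K * (Real.exp (j * y) * a + Real.exp (-(j * y)) * b) := by
    intro j
    have h1 := h.le_norm_hermForm_zpow_smul hz0 0
    have h2 := norm_hermForm_smul_sum_le hG hp h hz0 0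
    have h3 := norm_hermForm_smul_le_sum hG hp h hz0 j
    have h4 := h.norm_hermForm_zpow_smul_le z j
    simp only [Int.cast_zero, zero_mul, neg_zero, Real.exp_zero, one_mul, zpow_zero, one_smul]
      at h1 h2
    calc a + b ≤ 2 * ‖hermForm z (ξ + η)‖ := h1
      _ ≤ 2 * (2 * κ * ‖hermForm z p‖) := by gcongr
      _ ≤ 2 * (2 * κ * ‖hermForm z (g ^ j • p)‖) := by gcongr; exact hmin j
      _ ≤ 2 * (2 * κ * (κ * ‖hermForm z (g ^ j • (ξ + η))‖)) := by gcongr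
      _ ≤ 2 * (2 * κ * (κ * (Real.exp (j * y) * a + Real.exp (-(j * y)) * b))) := by gcongr
      _ = _ := by rw [hK]; ring
  have hba : b ≤ Q * a := by
    have := hcomp J
    have h2 := mul_le_mul_of_nonneg_right hexpJ hb0
    push_cast at this
    rw [hQ]; linarith
  have hab : a ≤ Q * b := by
    have := hcomp (-J)
    have h2 := mul_le_mul_of_nonneg_right hexpJ ha0
    push_cast at this
    rw [neg_mul, neg_neg] at this
    rw [hQ]; linarith
  have hminab : a + b ≤ (1 + Q) * min a b := by
    rcases le_total a b with hle | hle
    · rw [min_eq_left hle]; linarith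
    · rw [min_eq_right hle]; linarith
  have e0 : 0 < Real.exp (|(m : ℝ)| * y) := Real.exp_pos _
  have l1 : Real.exp (|(m : ℝ)| * y) * (a + b) ≤ (1 + Q) * (4 * κ * ‖hermForm z (g ^ m • p)‖) := by
    have h1 := exp_abs_mul_le (m := m) ha0 hb0 y
    have h2 := h.le_norm_hermForm_zpow_smul hz0 m
    have h3 := norm_hermForm_smul_sum_le hG hp h hz0 m
    calc _ ≤ Real.exp (|(m : ℝ)| * y) * ((1 + Q) * min a b) := by gcongr
      _ = (1 + Q) * (Real.exp (|(m : ℝ)| * y) * min a b) := by ring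
      _ ≤ _ := by
        refine mul_le_mul_of_nonneg_left ?_ (by positivity)
        linarith
  have l2 : ‖hermForm p (g ^ m • p)‖ ≤ κ * (Real.exp (|(m : ℝ)| * y) * N) := by
    refine (norm_hermForm_smul_le_sum hG hp h hp0 m).trans ?_
    refine mul_le_mul_of_nonneg_left ((h.norm_hermForm_zpow_smul_le p m).trans ?_) hκ0.le
    have hy := h.pos
    have m1 : Real.exp (m * y) ≤ Real.exp (|(m : ℝ)| * y) :=
      Real.exp_le_exp.mpr (mul_le_mul_of_nonneg_right (le_abs_self _) hy.le)
    have m2 : Real.exp (-(m * y)) ≤ Real.exp (|(m : ℝ)| * y) := by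
      rw [← neg_mul]
      exact Real.exp_le_exp.mpr (mul_le_mul_of_nonneg_right (neg_le_abs _) hy.le)
    rw [hN, mul_add]
    gcongr
  have l3 : ‖hermForm z p‖ ≤ κ * (a + b) := by
    have h1 := norm_hermForm_smul_le_sum hG hp h hz0 0
    have h2 := h.norm_hermForm_zpow_smul_le z 0
    simp only [Int.cast_zero, zero_mul, neg_zero, Real.exp_zero, one_mul, zpow_zero, one_smul]
      at h1 h2
    exact h1.trans (mul_le_mul_of_nonneg_left h2 hκ0.le)
  rw [one_div, mul_assoc, inv_mul_le_iff₀ (by positivity)]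
  calc _ ≤ (κ * (a + b)) * (κ * (Real.exp (|(m : ℝ)| * y) * N)) := by gcongr
    _ = κ ^ 2 * N * (Real.exp (|(m : ℝ)| * y) * (a + b)) := by ring
    _ ≤ κ ^ 2 * N * ((1 + Q) * (4 * κ * ‖hermForm z (g ^ m • p)‖)) := by gcongr
    _ = _ := by ring

end IsLoxodromic

end Loxodromic

/-! ### Alternating words -/

section Words

/-- Alternating words in nontrivial elements of two subgroups, the first letter being in `A`. -/
inductive AltWord {G : Type*} [Group G] : Subgroup G → Subgroup G → List G → Prop
  | single {A B : Subgroup G} {a : G} : a ∈ A → a ≠ 1 → AltWord A B [a]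
  | cons {A B : Subgroup G} {a : G} {w : List G} : a ∈ A → a ≠ 1 → AltWord B A w →
      AltWord A B (a :: w)

variable {G : Type*} [Group G]

/-- The element `g` is trivial or the value of an alternating word. -/
def IsAltProd (A B : Subgroup G) (g : G) : Prop :=
  g = 1 ∨ ∃ w, (AltWord A B w ∨ AltWord B A w) ∧ w.prod = g

theorem IsAltProd.symm {A B : Subgroup G} {g : G} (h : IsAltProd A B g) : IsAltProd B A g :=
  h.imp_right fun ⟨w, hw, e⟩ => ⟨w, hw.symm, e⟩

theorem IsAltProd.mul_left {A B : Subgroup G} {a g : G} (ha : a ∈ A) (h : IsAltProd A B g) :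
    IsAltProd A B (a * g) := by
  rcases eq_or_ne a 1 with rfl | ha1
  · rwa [one_mul]
  rcases h with rfl | ⟨w, hw | hw, rfl⟩
  · exact Or.inr ⟨[a], Or.inl (.single ha ha1), by simp⟩
  · cases hw with
    | @single _ _ a' ha' ha1' =>
      by_cases h1 : a * a' = 1
      · exact Or.inl (by simpa using h1)
      · exact Or.inr ⟨[a * a'], Or.inl (.single (mul_mem ha ha') h1), by simp⟩
    | @cons _ _ a' w ha' ha1' hw' =>
      by_cases h1 : a * a' = 1
      · exact Or.inr ⟨w, Or.inr hw', by rw [List.prod_cons, ← mul_assoc, h1, one_mul]⟩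
      · exact Or.inr ⟨a * a' :: w, Or.inl (.cons (mul_mem ha ha') h1 hw'), by simp [mul_assoc]⟩
  · exact Or.inr ⟨a :: w, Or.inl (.cons ha ha1 hw), by simp⟩

theorem isAltProd_of_mem_sup {A B : Subgroup G} {g : G} (hg : g ∈ A ⊔ B) : IsAltProd A B g := by
  rw [Subgroup.sup_eq_closure] at hg
  induction hg using Subgroup.closure_induction_left with
  | one => exact Or.inl rfl
  | mul_left x hx y _ ih =>
    rcases hx with hx | hx
    · exact ih.mul_left hx
    · exact (ih.symm.mul_left hx).symm
  | inv_mul_cancel x hx y _ ih =>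
    rcases hx with hx | hx
    · exact ih.mul_left (inv_mem hx)
    · exact (ih.symm.mul_left (inv_mem hx)).symm

theorem AltWord.map {H : Type*} [Group H] (φ : G →* H) {A B : Subgroup G} {w : List G}
    (h : AltWord A B w) (hA : ∀ a ∈ A, a ≠ 1 → φ a ≠ 1) (hB : ∀ b ∈ B, b ≠ 1 → φ b ≠ 1) :
    AltWord (A.map φ) (B.map φ) (w.map φ) := by
  induction h with
  | single ha ha1 => exact .single (Subgroup.mem_map_of_mem φ ha) (hA _ ha ha1)
  | cons ha ha1 _ ih => exact .cons (Subgroup.mem_map_of_mem φ ha) (hA _ ha ha1) (ih hB hA)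

theorem AltWord.mem_or_mem {A B : Subgroup G} {w : List G} (h : AltWord A B w) :
    ∀ s ∈ w, (s ∈ A ∨ s ∈ B) ∧ s ≠ 1 := by
  induction h with
  | single ha ha1 =>
    intro s hs
    rw [List.mem_singleton] at hs
    exact ⟨Or.inl (hs ▸ ha), hs ▸ ha1⟩
  | cons ha ha1 _ ih =>
    intro s hs
    rcases List.mem_cons.mp hs with rfl | hs
    · exact ⟨Or.inl ha, ha1⟩
    · exact ⟨(ih s hs).1.symm, (ih s hs).2⟩

end Words

/-! ### Ping-pong -/

section PingPong

variable {F : Type*} [RCLike F] {k : ℕ} {G : Subgroup (Matrix.SpecialLinearGroup (Idx k) F)}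

/-- Quantitative ping-pong: nontrivial elements of `A` and of `B` move `p` far and in different
directions. -/
structure PingPong (p : Idx k → F) (A B : Subgroup G) : Prop where
  left : ∀ a ∈ A, a ≠ 1 → 64 ≤ ‖hermForm p (a • p)‖
  right : ∀ b ∈ B, b ≠ 1 → 64 ≤ ‖hermForm p (b • p)‖
  apart : ∀ a ∈ A, a ≠ 1 → ∀ b ∈ B, b ≠ 1 →
    ‖hermForm p (a • p)‖ * ‖hermForm p (b • p)‖ ≤ 2 * ‖hermForm (a • p) (b • p)‖

theorem PingPong.symm {p : Idx k → F} {A B : Subgroup G} (h : PingPong p A B) : PingPong p B A where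
  left := h.right
  right := h.left
  apart := fun a ha ha1 b hb hb1 => by
    rw [norm_hermForm_comm (a • p), mul_comm]
    exact h.apart b hb hb1 a ha ha1

variable {p : Idx k → F} {A B : Subgroup G}

theorem norm_hermForm_inv_smul (hG : G ≤ unitaryGroup F k) (g : G) :
    ‖hermForm p (g⁻¹ • p)‖ = ‖hermForm p (g • p)‖ := by
  rw [← hermForm_smul_left_of_le hG, norm_hermForm_comm]

/-- Prepending a letter costs only a factor `8`. By induction `T • p`, for the remaining word `T`,
is seen from `p` nearly in the direction of `b • p`, where `b` is its first letter; `apart` says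
that `a⁻¹ • p` is not seen in that direction. By the quasi-ultrametric inequality `a⁻¹ • p` and `T •
p` are then seen in different directions, so little is lost in the product. -/
theorem norm_hermForm_cons (hG : G ≤ unitaryGroup F k) (hp : hermForm p p = 1) {w : List G}
    (hw : AltWord A B w) (h : PingPong p A B) : ∀ a t, w = a :: t →
      ‖hermForm p (a • p)‖ * ‖hermForm p (t.prod • p)‖ ≤ 8 * ‖hermForm p (w.prod • p)‖ := by
  induction hw with
  | @single _ _ s ha ha1 =>
    intro a t hat
    obtain ⟨rfl, rfl⟩ := List.cons.inj hat
    simp only [List.prod_nil, one_smul, hp, norm_one, mul_one, List.prod_cons]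
    linarith [norm_nonneg (hermForm p (s • p))]
  | @cons A B a w ha ha1 hw ih =>
    intro a' t hat
    obtain ⟨rfl, rfl⟩ := List.cons.inj hat
    obtain ⟨b, t, rfl, hb, hb1⟩ : ∃ b t, w = b :: t ∧ b ∈ B ∧ b ≠ 1 := by
      cases hw with
      | single hb hb1 => exact ⟨_, _, rfl, hb, hb1⟩
      | cons hb hb1 _ => exact ⟨_, _, rfl, hb, hb1⟩
    have ihb := ih h.symm b t rfl
    set T := (b :: t).prod with hT
    have hpos : ∀ g : G, 0 < RCLike.re (hermForm (g • p) (g • p)) := fun g => by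
      rw [hermForm_smul_smul_of_le hG, hp]; simp
    -- The second term on the right is small by induction. It is absorbed because `y² ≥ 64`, which
    -- leaves the factor `8`.
    have h4 := norm_hermForm_mul_le hp (hpos a⁻¹) (hpos b) (hpos T)
    have e1 : hermForm (a⁻¹ • p) (T • p) = hermForm p ((a :: b :: t).prod • p) := by
      rw [hermForm_smul_left_of_le hG, inv_inv, smul_smul, List.prod_cons]
    have e2 : ‖hermForm (T • p) (b • p)‖ = ‖hermForm p (t.prod • p)‖ := by
      rw [norm_hermForm_comm, hermForm_smul_left_of_le hG, smul_smul, hT, List.prod_cons,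
        inv_mul_cancel_left]
    rw [e1, e2, norm_hermForm_inv_smul hG] at h4
    have h5 := h.apart a⁻¹ (inv_mem ha) (inv_ne_one.mpr ha1) b hb hb1
    rw [norm_hermForm_inv_smul hG] at h5
    have hbn := h.right b hb hb1
    have hTn := norm_nonneg (hermForm p (T • p))
    set x := ‖hermForm p (a • p)‖
    set y := ‖hermForm p (b • p)‖
    set u := ‖hermForm p (T • p)‖
    set v := ‖hermForm p (t.prod • p)‖
    set W := ‖hermForm p ((a :: b :: t).prod • p)‖
    have hx0 : 0 ≤ x := norm_nonneg _
    have h6 : x * y * u ≤ 2 * (2 * (W * y + v * x)) := by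
      have := mul_le_mul_of_nonneg_right h5 hTn
      linarith
    have hy0 : 0 < y := by linarith
    have h7 : y * v * x ≤ 8 * u * x := mul_le_mul_of_nonneg_right ihb hx0
    have h8 : y ^ 2 * (x * u) ≤ 4 * (W * y ^ 2) + 32 * (x * u) := by
      have := mul_le_mul_of_nonneg_left h6 hy0.le
      linarith
    have h9 : 64 * (x * u) ≤ y ^ 2 * (x * u) := by
      have : (64 : ℝ) ≤ y ^ 2 := by nlinarith
      exact mul_le_mul_of_nonneg_right this (by positivity)
    have h10 : y ^ 2 * (x * u) ≤ y ^ 2 * (8 * W) := by linarith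
    exact le_of_mul_le_mul_left h10 (by positivity)

theorem one_le_norm_hermForm_smul (hG : G ≤ unitaryGroup F k) (hp : hermForm p p = 1) (g : G) :
    1 ≤ ‖hermForm p (g • p)‖ :=
  one_le_norm_hermForm hp (by rw [hermForm_smul_smul_of_le hG, hp])

/-- Each letter contributes at least `64`, of which `8` is lost by `norm_hermForm_cons`.
Consequently the displacement of a word bounds its length and the displacement of each letter, with
constants that depend on nothing; this gives freeness, properness and uniform control along
sequences. -/
theorem AltWord.norm_bounds (hG : G ≤ unitaryGroup F k) (hp : hermForm p p = 1) {w : List G}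
    (hw : AltWord A B w) (h : PingPong p A B) : 8 ^ w.length ≤ ‖hermForm p (w.prod • p)‖ ∧
      ∀ s ∈ w, ‖hermForm p (s • p)‖ ≤ 8 * ‖hermForm p (w.prod • p)‖ := by
  have hcons := fun a t e => norm_hermForm_cons hG hp hw h a t e
  induction hw with
  | single ha ha1 =>
    have := h.left _ ha ha1
    simp only [List.length_singleton, pow_one, List.prod_singleton, List.mem_singleton, forall_eq]
    exact ⟨by linarith, by linarith⟩
  | @cons A B a w ha ha1 hw ih =>
    have h1 := hcons a w rfl
    obtain ⟨h2, h3⟩ := ih h.symm fun a t e => norm_hermForm_cons hG hp hw h.symm a t e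
    have h4 := h.left a ha ha1
    have h5 := one_le_norm_hermForm_smul hG hp w.prod
    have h6 : 8 * ‖hermForm p (w.prod • p)‖ ≤ ‖hermForm p ((a :: w).prod • p)‖ := by nlinarith
    refine ⟨?_, ?_⟩
    · rw [List.length_cons, pow_succ]; linarith
    · intro s hs
      rcases List.mem_cons.mp hs with rfl | hs
      · nlinarith
      · have := h3 s hs
        linarith

theorem AltWord.prod_ne_one (hG : G ≤ unitaryGroup F k) (hp : hermForm p p = 1) {w : List G}
    (hw : AltWord A B w) (h : PingPong p A B) : w.prod ≠ 1 := by
  intro h1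
  have h2 := (hw.norm_bounds hG hp h).1
  rw [h1, one_smul, hp, norm_one] at h2
  have h3 : 1 ≤ w.length := by cases hw <;> simp
  have : (8 : ℝ) ^ 1 ≤ 8 ^ w.length := pow_le_pow_right₀ (by norm_num) h3
  linarith

/-- The quasi-ultrametric inequality is applied to `a⁻¹ • p`, `t.prod • p` and `a⁻¹ • y`, where `a`
is the first letter. Minimality of `p` and `‖Ψ(p, a p)‖ ≥ 64` absorb one term and give `‖Ψ(y, a p)‖
‖Ψ(p, t p)‖ ≤ 32 ‖Ψ(y, w p)‖`. Quasi-convexity is thus needed only for the subgroup that contains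
the first letter; the triangle inequality accounts for the last factor `2` in `64`. -/
theorem AltWord.quasiconvex (hG : G ≤ unitaryGroup F k) (hp : hermForm p p = 1) {w : List G}
    (hw : AltWord A B w) (h : PingPong p A B) {δ : ℝ} (hδ : 0 < δ) {y : Idx k → F}
    (hy : hermForm y y = 1) (hmin : ∀ a ∈ A, ‖hermForm y p‖ ≤ ‖hermForm y (a • p)‖)
    (hqc : ∀ a ∈ A, δ * ‖hermForm y p‖ * ‖hermForm p (a • p)‖ ≤ ‖hermForm y (a • p)‖) :
    δ / 64 * ‖hermForm y p‖ * ‖hermForm p (w.prod • p)‖ ≤ ‖hermForm y (w.prod • p)‖ := by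
  have hcons := fun a t e => norm_hermForm_cons hG hp hw h a t e
  obtain ⟨a, t, rfl, ha, ha1⟩ : ∃ b t, w = b :: t ∧ b ∈ A ∧ b ≠ 1 := by
    cases hw with
    | single hb hb1 => exact ⟨_, _, rfl, hb, hb1⟩
    | cons hb hb1 _ => exact ⟨_, _, rfl, hb, hb1⟩
  have h1 := hcons a t rfl
  have hpos : ∀ (g : G) (v : Idx k → F), hermForm v v = 1 →
      0 < RCLike.re (hermForm (g • v) (g • v)) := fun g v hv => by
    rw [hermForm_smul_smul_of_le hG, hv]; simp
  have h2 := norm_hermForm_mul_le hp (hpos a⁻¹ p hp) (hpos t.prod p hp) (hpos a⁻¹ y hy)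
  have e1 : hermForm (a⁻¹ • p) (t.prod • p) = hermForm p ((a :: t).prod • p) := by
    rw [hermForm_smul_left_of_le hG, inv_inv, smul_smul, List.prod_cons]
  have e2 : hermForm (a⁻¹ • y) (t.prod • p) = hermForm y ((a :: t).prod • p) := by
    rw [hermForm_smul_left_of_le hG, inv_inv, smul_smul, List.prod_cons]
  have e3 : ‖hermForm p (a⁻¹ • y)‖ = ‖hermForm y (a • p)‖ := by
    rw [← hermForm_smul_left_of_le hG, norm_hermForm_comm]
  rw [e1, e2, e3, hermForm_smul_smul_of_le hG, norm_hermForm_inv_smul hG, norm_hermForm_comm p y]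
    at h2
  have h3 := hmin a ha
  have h4 := hqc a ha
  have h5 := h.left a ha ha1
  have h6 : ‖hermForm p ((a :: t).prod • p)‖ ≤
      2 * ‖hermForm p (a • p)‖ * ‖hermForm p (t.prod • p)‖ := by
    have := norm_hermForm_le_two_mul hp (hpos a⁻¹ p hp).le (hpos t.prod p hp).le
    rwa [e1, norm_hermForm_comm (a⁻¹ • p), norm_hermForm_inv_smul hG] at this
  set M := ‖hermForm y (a • p)‖
  set x := ‖hermForm p (a • p)‖
  set u := ‖hermForm p (t.prod • p)‖
  set W := ‖hermForm p ((a :: t).prod • p)‖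
  set V := ‖hermForm y ((a :: t).prod • p)‖
  set M₀ := ‖hermForm y p‖
  have hu0 : 0 ≤ u := norm_nonneg _
  have hM0 : 0 ≤ M := norm_nonneg _
  have hM₀ : 0 ≤ M₀ := norm_nonneg _
  have hx0 : 0 < x := by linarith
  have h7 : x * u * M ≤ 8 * W * M := mul_le_mul_of_nonneg_right h1 hM0
  have h8 : M₀ * u ≤ M * u := mul_le_mul_of_nonneg_right h3 hu0
  have h9 : 64 * (M * u) ≤ x * (M * u) := mul_le_mul_of_nonneg_right h5 (by positivity)
  have h10 : x * (M * u) ≤ x * (32 * V) := by nlinarith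
  have h11 : M * u ≤ 32 * V := le_of_mul_le_mul_left h10 hx0
  have h12 : δ * M₀ * x * u ≤ 32 * V := (mul_le_mul_of_nonneg_right h4 hu0).trans h11
  have h13 : δ * M₀ * W ≤ δ * M₀ * (2 * x * u) := mul_le_mul_of_nonneg_left h6 (by positivity)
  linarith

theorem finite_lists {α : Type*} {S : Set α} (hS : S.Finite) (n : ℕ) :
    {l : List α | l.length ≤ n ∧ ∀ x ∈ l, x ∈ S}.Finite := by
  have := hS.to_subtype
  refine ((List.finite_length_le S n).image (List.map Subtype.val)).subset ?_
  rintro l ⟨hl, hS'⟩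
  exact ⟨l.attachWith _ hS', by simpa using hl, by simp⟩

theorem PingPong.exists_list (hG : G ≤ unitaryGroup F k) (hp : hermForm p p = 1)
    (h : PingPong p A B) {g : G} (hg : g ∈ A ⊔ B) {D : ℝ} {N : ℕ}
    (hD : ‖hermForm p (g • p)‖ ≤ D) (hN : D < 8 ^ N) :
    ∃ w : List G, w.length ≤ N ∧
      (∀ s ∈ w, (s ∈ A ∨ s ∈ B) ∧ ‖hermForm p (s • p)‖ ≤ 8 * D) ∧ w.prod = g := by
  have key : ∀ {A B : Subgroup G} {w : List G}, PingPong p A B → AltWord A B w → w.prod = g →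
      w.length ≤ N ∧ ∀ s ∈ w, (s ∈ A ∨ s ∈ B) ∧ ‖hermForm p (s • p)‖ ≤ 8 * D := by
    intro A B w h hw hwg
    obtain ⟨h1, h2⟩ := hw.norm_bounds hG hp h
    rw [hwg] at h1 h2
    refine ⟨?_, fun s hs => ⟨(hw.mem_or_mem s hs).1, (h2 s hs).trans (by linarith)⟩⟩
    exact ((pow_lt_pow_iff_right₀ (by norm_num : (1 : ℝ) < 8)).mp
      ((h1.trans hD).trans_lt hN)).le
  rcases isAltProd_of_mem_sup hg with rfl | ⟨w, hw | hw, hwg⟩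
  · exact ⟨[], by simp, by simp, rfl⟩
  · obtain ⟨h1, h2⟩ := key h hw hwg
    exact ⟨w, h1, h2, hwg⟩
  · obtain ⟨h1, h2⟩ := key h.symm hw hwg
    exact ⟨w, h1, fun s hs => ⟨(h2 s hs).1.symm, (h2 s hs).2⟩, hwg⟩

theorem PingPong.finite_norm_le (hG : G ≤ unitaryGroup F k) (hp : hermForm p p = 1)
    (h : PingPong p A B) (hA : ∀ D : ℝ, {a | a ∈ A ∧ ‖hermForm p (a • p)‖ ≤ D}.Finite)
    (hB : ∀ D : ℝ, {b | b ∈ B ∧ ‖hermForm p (b • p)‖ ≤ D}.Finite) (D : ℝ) :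
    {g | g ∈ A ⊔ B ∧ ‖hermForm p (g • p)‖ ≤ D}.Finite := by
  obtain ⟨N, hN⟩ := pow_unbounded_of_one_lt D (by norm_num : (1 : ℝ) < 8)
  refine ((finite_lists ((hA (8 * D)).union (hB (8 * D))) N).image List.prod).subset ?_
  rintro g ⟨hg, hgD⟩
  obtain ⟨w, h1, h2, hwg⟩ := h.exists_list hG hp hg hgD hN
  exact ⟨w, ⟨h1, fun s hs => (h2 s hs).1.imp (fun h' => ⟨h', (h2 s hs).2⟩)
    (fun h' => ⟨h', (h2 s hs).2⟩)⟩, hwg⟩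

theorem sup_zpowers_of_eq_top :
    Subgroup.zpowers (FreeGroup.of (0 : Fin 2)) ⊔ Subgroup.zpowers (FreeGroup.of (1 : Fin 2)) = ⊤ := by
  rw [eq_top_iff, ← FreeGroup.closure_range_of, Subgroup.closure_le]
  rintro _ ⟨i, rfl⟩
  fin_cases i
  · exact Subgroup.mem_sup_left (Subgroup.mem_zpowers _)
  · exact Subgroup.mem_sup_right (Subgroup.mem_zpowers _)

theorem IsLoxodromic.isConvexCocompact (hk : 1 ≤ k) (hG : G ≤ unitaryGroup F k)
    (hp : hermForm p p = 1) {g : G} {ξ η : Idx k → F} {y : ℝ} {c : F} (hg : IsLoxodromic g ξ η y c)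
    (σ : Multiplicative ℤ →* G) (hσ : ∀ m, σ m = g ^ m.toAdd) : IsConvexCocompact σ := by
  obtain ⟨δ, hδ, hqc⟩ := hg.exists_quasiconvex hG hp
  refine isConvexCocompact_of_orbit hk hG σ hp (fun B => ?_) hδ fun z hz hmin m => ?_
  · simp only [hσ]
    exact (hg.finite_norm_le hG hp B)
  · simp only [hσ] at hmin ⊢
    exact hqc z hz (fun m => hmin (Multiplicative.ofAdd m)) m.toAdd

/-- A free product of two loxodromic cyclic groups in ping-pong position is convex-cocompact. -/
theorem PingPong.isConvexCocompact (hk : 1 ≤ k) (hG : G ≤ unitaryGroup F k) (hp : hermForm p p = 1)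
    {g b : G} (h : PingPong p (Subgroup.zpowers g) (Subgroup.zpowers b))
    {ξ η ξ' η' : Idx k → F} {y y' : ℝ} {c c' : F} (hg : IsLoxodromic g ξ η y c)
    (hb : IsLoxodromic b ξ' η' y' c') (ρ : FreeGroup (Fin 2) →* G)
    (hρg : ρ (FreeGroup.of 0) = g) (hρb : ρ (FreeGroup.of 1) = b) : IsConvexCocompact ρ := by
  have hmapg : (Subgroup.zpowers (FreeGroup.of (0 : Fin 2))).map ρ = Subgroup.zpowers g := by
    rw [MonoidHom.map_zpowers, hρg]
  have hmapb : (Subgroup.zpowers (FreeGroup.of (1 : Fin 2))).map ρ = Subgroup.zpowers b := by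
    rw [MonoidHom.map_zpowers, hρb]
  have hneg : ∀ a ∈ Subgroup.zpowers (FreeGroup.of (0 : Fin 2)), a ≠ 1 → ρ a ≠ 1 := by
    rintro _ ⟨m, rfl⟩ hm h1
    simp only [map_zpow, hρg, hg.zpow_eq_one_iff] at h1
    exact hm (by simp [h1])
  have hneb : ∀ a ∈ Subgroup.zpowers (FreeGroup.of (1 : Fin 2)), a ≠ 1 → ρ a ≠ 1 := by
    rintro _ ⟨m, rfl⟩ hm h1
    simp only [map_zpow, hρb, hb.zpow_eq_one_iff] at h1
    exact hm (by simp [h1])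
  have hword : ∀ γ : FreeGroup (Fin 2), γ ≠ 1 → ∃ w : List G, w.prod = ρ γ ∧
      (AltWord (Subgroup.zpowers g) (Subgroup.zpowers b) w ∨
        AltWord (Subgroup.zpowers b) (Subgroup.zpowers g) w) := by
    intro γ hγ
    have hmem : γ ∈ Subgroup.zpowers (FreeGroup.of (0 : Fin 2)) ⊔
        Subgroup.zpowers (FreeGroup.of (1 : Fin 2)) := by rw [sup_zpowers_of_eq_top]; trivial
    rcases isAltProd_of_mem_sup hmem with h1 | ⟨w, hw, rfl⟩
    · exact absurd h1 hγ
    · refine ⟨w.map ρ, (map_list_prod ρ w).symm, ?_⟩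
      rw [← hmapg, ← hmapb]
      exact hw.imp (fun hw => hw.map ρ hneg hneb) (fun hw => hw.map ρ hneb hneg)
  have hinj : Function.Injective ρ := by
    rw [injective_iff_map_eq_one]
    intro γ hγ
    by_contra hne
    obtain ⟨w, hw1, hw2 | hw2⟩ := hword γ hne
    · exact hw2.prod_ne_one hG hp h (hw1.trans hγ)
    · exact hw2.prod_ne_one hG hp h.symm (hw1.trans hγ)
  have hrange : ∀ γ, ρ γ ∈ Subgroup.zpowers g ⊔ Subgroup.zpowers b := by
    intro γ
    rw [← hmapg, ← hmapb, ← Subgroup.map_sup, sup_zpowers_of_eq_top]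
    exact Subgroup.mem_map_of_mem ρ trivial
  obtain ⟨δ₁, hδ₁, hqc₁⟩ := hg.exists_quasiconvex hG hp
  obtain ⟨δ₂, hδ₂, hqc₂⟩ := hb.exists_quasiconvex hG hp
  have hfincyc : ∀ {g : G} {ξ η : Idx k → F} {y : ℝ} {c : F}, IsLoxodromic g ξ η y c →
      ∀ D : ℝ, {a | a ∈ Subgroup.zpowers g ∧ ‖hermForm p (a • p)‖ ≤ D}.Finite := by
    intro g ξ η y c hg D
    refine ((hg.finite_norm_le hG hp D).image fun m => g ^ m).subset ?_
    rintro _ ⟨⟨m, rfl⟩, hm⟩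
    exact ⟨m, hm, rfl⟩
  -- The two factor groups contribute `δ₁ / 64` and `δ₂ / 64`, according to the first letter, and
  -- the empty word contributes `1`.
  have hδ : 0 < min (min δ₁ δ₂ / 64) 1 := by positivity
  refine isConvexCocompact_of_orbit hk hG ρ hp (fun D => ?_) hδ fun z hz hmin γ => ?_
  · refine ((h.finite_norm_le hG hp (hfincyc hg) (hfincyc hb) D).preimage
      hinj.injOn).subset fun γ hγ => ?_
    exact ⟨hrange γ, hγ⟩
  · have hming : ∀ m : ℤ, ‖hermForm z p‖ ≤ ‖hermForm z (g ^ m • p)‖ := fun m => by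
      have := hmin (FreeGroup.of 0 ^ m)
      rwa [map_zpow, hρg] at this
    have hminb : ∀ m : ℤ, ‖hermForm z p‖ ≤ ‖hermForm z (b ^ m • p)‖ := fun m => by
      have := hmin (FreeGroup.of 1 ^ m)
      rwa [map_zpow, hρb] at this
    have hle : ∀ t : ℝ, min (min δ₁ δ₂ / 64) 1 ≤ t →
        t * ‖hermForm z p‖ * ‖hermForm p (ρ γ • p)‖ ≤ ‖hermForm z (ρ γ • p)‖ →
        min (min δ₁ δ₂ / 64) 1 * ‖hermForm z p‖ * ‖hermForm p (ρ γ • p)‖ ≤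
          ‖hermForm z (ρ γ • p)‖ := fun t ht h' => le_trans (by gcongr) h'
    rcases eq_or_ne γ 1 with rfl | hne
    · refine hle 1 (min_le_right _ _) ?_
      simp [hp]
    obtain ⟨w, hw1, hw2 | hw2⟩ := hword γ hne
    · refine hle (δ₁ / 64) ((min_le_left _ _).trans (by gcongr; exact min_le_left _ _)) ?_
      rw [← hw1]
      refine hw2.quasiconvex hG hp h hδ₁ hz ?_ ?_
      · rintro _ ⟨m, rfl⟩; exact hming m
      · rintro _ ⟨m, rfl⟩; exact hqc₁ z hz hming m
    · refine hle (δ₂ / 64) ((min_le_left _ _).trans (by gcongr; exact min_le_right _ _)) ?_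
      rw [← hw1]
      refine hw2.quasiconvex hG hp h.symm hδ₂ hz ?_ ?_
      · rintro _ ⟨m, rfl⟩; exact hminb m
      · rintro _ ⟨m, rfl⟩; exact hqc₂ z hz hminb m

end PingPong

/-! ### Geometric limits -/

section GeometricLimit

variable {G : Type*} [Group G] [TopologicalSpace G] [T2Space G] {Δ : Type*} [Group Δ]

/-- A limit element that differs from all `φlim w`, `w ∈ W`, would by the Hausdorff property have
approximants that differ from all `φ n w`. The bound `B + 1` leaves room, since the approximants of
an element with `f ≤ B` only satisfy `f < B + 1`. -/
theorem finite_range_le_of_tendsto {φ : ℕ → Δ →* G} {φlim : Δ →* G} {H : ℕ → Subgroup G}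
    (hφ : ∀ δ, Tendsto (fun n => φ n δ) atTop (𝓝 (φlim δ)))
    (hH : ∀ᶠ n in atTop, ∀ δ, φ n δ ∈ H n) {f : G → ℝ} (hf : Continuous f)
    (hfin : ∀ B : ℝ, ∃ W : Set Δ, W.Finite ∧
      ∀ᶠ n in atTop, ∀ γ ∈ H n, f γ ≤ B → γ ∈ φ n '' W) (B : ℝ) :
    {h | h ∈ φlim.range ∧ f h ≤ B}.Finite := by
  obtain ⟨W, hW, hev⟩ := hfin (B + 1)
  refine (hW.image φlim).subset ?_
  rintro _ ⟨⟨δ, rfl⟩, hδ⟩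
  by_contra hne
  have h1 : ∀ᶠ n in atTop, ∀ w ∈ W, φ n δ ≠ φ n w := by
    rw [Filter.eventually_all_finite hW]
    intro w hw
    have hne' : φlim δ ≠ φlim w := fun h => hne ⟨w, hw, h.symm⟩
    exact ((hφ δ).prodMk_nhds (hφ w)).eventually
      (isClosed_diagonal.isOpen_compl.mem_nhds (by exact hne'))
  have h2 : ∀ᶠ n in atTop, f (φ n δ) < B + 1 :=
    ((hf.tendsto _).comp (hφ δ)).eventually_lt_const (by linarith)
  obtain ⟨n, h1, h2, h3, h4⟩ := (h1.and (h2.and (hev.and hH))).exists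
  obtain ⟨w, hw, hwe⟩ := h3 _ (h4 δ) h2.le
  exact h1 w hw hwe.symm

variable [IsTopologicalGroup G]

/-- Pointwise convergent parametrizations of discrete groups whose elements of bounded size are
controlled uniformly converge geometrically. -/
theorem convergesGeometrically_of_tendsto {φ : ℕ → Δ →* G} {φlim : Δ →* G} {H : ℕ → Subgroup G}
    (hφ : ∀ δ, Tendsto (fun n => φ n δ) atTop (𝓝 (φlim δ)))
    (hH : ∀ᶠ n in atTop, ∀ δ, φ n δ ∈ H n) {f : G → ℝ} (hf : Continuous f)
    (hfin : ∀ B : ℝ, ∃ W : Set Δ, W.Finite ∧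
      ∀ᶠ n in atTop, ∀ γ ∈ H n, f γ ≤ B → γ ∈ φ n '' W)
    (hdisc : ∀ᶠ n in atTop, DiscreteTopology (H n)) :
    DiscreteTopology φlim.range ∧ ConvergesGeometrically H φlim.range := by
  have hd : DiscreteTopology φlim.range := discreteTopology_of_finite_le _ hf (lt_add_one (f 1))
    (finite_range_le_of_tendsto hφ hH hf hfin (f 1 + 1))
  refine ⟨hd, ?_⟩
  classical
  have hclosed : ∀ {L : Subgroup G}, DiscreteTopology L → IsClosed (L : Set G) := fun h =>
    Subgroup.isClosed_of_discrete
  -- The groups `H n` are closed only for large `n`; for the others the whole group is a harmless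
  -- default.
  set C : ℕ → ClosedSubgroup G := fun n =>
    if h : IsClosed (H n : Set G) then ⟨H n, h⟩ else ⟨⊤, isClosed_univ⟩ with hC
  have hCn : ∀ᶠ n in atTop, (C n).toSubgroup = H n := by
    filter_upwards [hdisc] with n hn
    have := hclosed hn
    simp only [hC, dif_pos this]
  refine ⟨C, ⟨φlim.range, hclosed hd⟩, hCn, rfl, ?_⟩
  rw [TopologicalSpace.tendsto_nhds_generateFrom_iff]
  rintro s (⟨K, hK, rfl⟩ | ⟨U, hU, rfl⟩) hs
  · have hs : (φlim.range : Set G) ∩ K = ∅ := hs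
    obtain ⟨B, hB⟩ := (hK.image hf).bddAbove
    obtain ⟨W, hW, hev⟩ := hfin B
    have h1 : ∀ᶠ n in atTop, ∀ w ∈ W, φ n w ∉ K := by
      rw [Filter.eventually_all_finite hW]
      intro w _
      refine (hφ w).eventually (hK.isClosed.isOpen_compl.mem_nhds fun hmem => ?_)
      exact Set.eq_empty_iff_forall_notMem.mp hs _ ⟨⟨w, rfl⟩, hmem⟩
    filter_upwards [hCn, hev, h1] with n hn h2 h3
    change ((C n).toSubgroup : Set G) ∩ K = ∅
    rw [hn, Set.eq_empty_iff_forall_notMem]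
    rintro γ ⟨hγ, hγK⟩
    obtain ⟨w, hw, rfl⟩ := h2 γ hγ (hB ⟨γ, hγK, rfl⟩)
    exact h3 w hw hγK
  · obtain ⟨_, ⟨δ, rfl⟩, hδ⟩ := hs
    filter_upwards [hCn, hH, (hφ δ).eventually (hU.mem_nhds hδ)] with n hn h1 h2
    change (((C n).toSubgroup : Set G) ∩ U).Nonempty
    rw [hn]
    exact ⟨_, h1 δ, h2⟩

/-- A pointwise limit of homomorphisms is a homomorphism. -/
theorem exists_monoidHom_of_tendsto (φ : ℕ → Δ →* G)
    (h : ∀ δ, ∃ g, Tendsto (fun n => φ n δ) atTop (𝓝 g)) :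
    ∃ φlim : Δ →* G, ∀ δ, Tendsto (fun n => φ n δ) atTop (𝓝 (φlim δ)) := by
  choose L hL using h
  refine ⟨MonoidHom.mk' L fun a b => tendsto_nhds_unique (hL (a * b)) ?_, hL⟩
  simpa using (hL a).mul (hL b)

theorem exists_map_eq_of_forall_mem {α β : Type*} {f : α → β} {S : Set α} (w : List β)
    (h : ∀ x ∈ w, x ∈ f '' S) :
    ∃ v : List α, v.length = w.length ∧ (∀ x ∈ v, x ∈ S) ∧ v.map f = w := by
  induction w with
  | nil => exact ⟨[], rfl, by simp, rfl⟩
  | cons a w ih =>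
    obtain ⟨v, h1, h2, h3⟩ := ih fun x hx => h x (List.mem_cons_of_mem _ hx)
    obtain ⟨b, hb, hba⟩ := h a List.mem_cons_self
    refine ⟨b :: v, by simp [h1], ?_, by simp [h3, hba]⟩
    intro x hx
    rcases List.mem_cons.mp hx with rfl | hx
    · exact hb
    · exact h2 x hx

end GeometricLimit

/-! ### Limits of cyclic groups and of free products -/

section FreeProductLimit

variable {F : Type*} [RCLike F] {k l : ℕ} {G : Subgroup (Matrix.SpecialLinearGroup (Idx k) F)}

/-- The powers of the elements `s n` converge, along the exponents `m n w`, to the values of a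
homomorphism `L`, and every bounded power of `s n` is one of finitely many of these. -/
structure PowersConverge (p : Idx k → F) (s : ℕ → G) (m : ℕ → (Fin (l + 1) → ℤ) →+ ℤ)
    (L : Multiplicative (Fin (l + 1) → ℤ) →* G) : Prop where
  apply_single : ∀ n, m n (Pi.single 0 1) = 1
  tendsto : ∀ w, Tendsto (fun n => s n ^ m n w) atTop (𝓝 (L (Multiplicative.ofAdd w)))
  injective : Function.Injective L
  finite : ∀ B : ℝ, ∃ W : Set (Fin (l + 1) → ℤ), W.Finite ∧ ∀ᶠ n in atTop, ∀ j : ℤ,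
    ‖hermForm p (s n ^ j • p)‖ ≤ B → ∃ w ∈ W, s n ^ j = s n ^ m n w

namespace PowersConverge

variable {p : Idx k → F} {s : ℕ → G} {m : ℕ → (Fin (l + 1) → ℤ) →+ ℤ}
  {L : Multiplicative (Fin (l + 1) → ℤ) →* G}

/-- The homomorphism `w ↦ (s n)^(m n w)`. -/
def hom (s : ℕ → G) (m : ℕ → (Fin (l + 1) → ℤ) →+ ℤ) (n : ℕ) :
    Multiplicative (Fin (l + 1) → ℤ) →* G :=
  (zpowersHom G (s n)).comp (AddMonoidHom.toMultiplicative (m n))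

theorem hom_apply (n : ℕ) (w : Multiplicative (Fin (l + 1) → ℤ)) :
    hom s m n w = s n ^ m n w.toAdd := rfl

theorem range_hom (h : PowersConverge p s m L) (n : ℕ) :
    (hom s m n).range = Subgroup.zpowers (s n) := by
  apply le_antisymm
  · rintro _ ⟨w, rfl⟩
    exact ⟨_, rfl⟩
  · rw [Subgroup.zpowers_le]
    exact ⟨Multiplicative.ofAdd (Pi.single 0 1), by
      rw [hom_apply, toAdd_ofAdd, h.apply_single, zpow_one]⟩

theorem apply_single_int (h : PowersConverge p s m L) (n : ℕ) (j : ℤ) :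
    m n (Pi.single 0 j) = j := by
  have : (Pi.single 0 j : Fin (l + 1) → ℤ) = j • Pi.single 0 1 := by
    rw [← Pi.single_smul, smul_eq_mul, mul_one]
  rw [this, map_zsmul, h.apply_single, smul_eq_mul, mul_one]

theorem isJorgensenSequence (h : PowersConverge p s m L) {σ : ℕ → Multiplicative ℤ →* G}
    (hσ : ∀ n, 1 ≤ n → ∀ j, σ n j = s n ^ j.toAdd)
    (hcc : ∀ n, 1 ≤ n → IsConvexCocompact (σ n)) : IsJorgensenSequence l σ := by
  have hrange : ∀ᶠ n in atTop, (σ n).range = Subgroup.zpowers (s n) := by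
    filter_upwards [eventually_ge_atTop 1] with n hn
    apply le_antisymm
    · rintro _ ⟨j, rfl⟩
      exact ⟨j.toAdd, (hσ n hn j).symm⟩
    · rw [Subgroup.zpowers_le]
      exact ⟨Multiplicative.ofAdd 1, by rw [hσ n hn]; simp⟩
  obtain ⟨hd, hgeom⟩ := convergesGeometrically_of_tendsto (φ := hom s m) (φlim := L)
    (H := fun n => (σ n).range) (fun w => h.tendsto w.toAdd)
    (by filter_upwards [hrange] with n hn w; rw [hn]; exact ⟨_, rfl⟩)
    (f := fun g : G => ‖hermForm p (g • p)‖) (continuous_hermForm_smul p p).norm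
    (fun B => by
      obtain ⟨W, hW, hev⟩ := h.finite B
      refine ⟨Multiplicative.toAdd ⁻¹' W, hW.preimage Multiplicative.toAdd.injective.injOn, ?_⟩
      filter_upwards [hrange, hev] with n hn h1 γ hγ hB
      rw [hn] at hγ
      obtain ⟨j, rfl⟩ := hγ
      obtain ⟨w, hw, e⟩ := h1 j hB
      exact ⟨Multiplicative.ofAdd w, hw, e.symm⟩)
    (by filter_upwards [eventually_ge_atTop 1] with n hn; exact (hcc n hn).2.1)
  refine ⟨hcc, ⟨L.comp (AddMonoidHom.toMultiplicative
    (AddMonoidHom.single (fun _ : Fin (l + 1) => ℤ) 0)), fun j => ?_, ?_, ?_⟩,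
    L.range, hgeom, hd, ⟨(MonoidHom.ofInjective h.injective).symm⟩⟩
  · refine (h.tendsto (Pi.single 0 j.toAdd)).congr' ?_
    filter_upwards [eventually_ge_atTop 1] with n hn
    rw [hσ n hn, h.apply_single_int]
  · exact h.injective.comp (Multiplicative.ofAdd.injective.comp
      ((Pi.single_injective 0).comp Multiplicative.toAdd.injective))
  · refine DiscreteTopology.of_subset (s := (L.range : Set G)) hd ?_
    rintro _ ⟨j, rfl⟩
    exact ⟨_, rfl⟩

/-- For large `n` the ping-pong constants do not depend on `n`. An element of displacement at most
`B` is a word of bounded length in letters of displacement at most `8 B`, of which `h.finite` and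
`hb` leave finitely many, so `convergesGeometrically_of_tendsto` applies to the free product.
Faithfulness of the limit comes from ping-pong in the limit. -/
theorem isFreeProductLimit (hG : G ≤ unitaryGroup F k) (hp : hermForm p p = 1) (hl : 1 ≤ l)
    (h : PowersConverge p s m L) {b : G}
    (hPP : ∀ᶠ n in atTop, PingPong p (Subgroup.zpowers (s n)) (Subgroup.zpowers b))
    (hb1 : ∀ j : ℤ, b ^ j = 1 → j = 0)
    (hb : ∀ B : ℝ, {j : ℤ | ‖hermForm p (b ^ j • p)‖ ≤ B}.Finite)
    {ρ : ℕ → FreeGroup (Fin 2) →* G} {ρlim : FreeGroup (Fin 2) →* G}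
    (hρs : ∀ᶠ n in atTop, ρ n (FreeGroup.of 0) = s n)
    (hρb : ∀ᶠ n in atTop, ρ n (FreeGroup.of 1) = b)
    (hρd : ∀ᶠ n in atTop, DiscreteTopology (ρ n).range)
    (hs : ρlim (FreeGroup.of 0) = L (Multiplicative.ofAdd (Pi.single 0 1)))
    (hlb : ρlim (FreeGroup.of 1) = b) : HasFreeProductLimit l ρ ρlim := by
  set φ : ℕ → Monoid.Coprod (Multiplicative (Fin (l + 1) → ℤ)) (Multiplicative ℤ) →* G := fun n =>
    Monoid.Coprod.lift (hom s m n) (zpowersHom G b) with hφ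
  set φlim : Monoid.Coprod (Multiplicative (Fin (l + 1) → ℤ)) (Multiplicative ℤ) →* G :=
    Monoid.Coprod.lift L (zpowersHom G b) with hφlim
  have hrb : (zpowersHom G b).range = Subgroup.zpowers b := rfl
  have hrange : ∀ n, (φ n).range = Subgroup.zpowers (s n) ⊔ Subgroup.zpowers b := fun n => by
    rw [hφ, Monoid.Coprod.range_lift, h.range_hom, hrb]
  have hH : ∀ᶠ n in atTop, (ρ n).range = (φ n).range := by
    filter_upwards [hρs, hρb] with n h1 h2
    rw [hrange, MonoidHom.range_eq_map, ← sup_zpowers_of_eq_top, Subgroup.map_sup,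
      MonoidHom.map_zpowers, MonoidHom.map_zpowers, h1, h2]
  have htend : ∀ δ, Tendsto (fun n => φ n δ) atTop (𝓝 (φlim δ)) := by
    intro δ
    induction δ using Monoid.Coprod.induction_on with
    | inl w => simp only [hφ, hφlim, Monoid.Coprod.lift_apply_inl]; exact h.tendsto w.toAdd
    | inr j => simp only [hφ, hφlim, Monoid.Coprod.lift_apply_inr]; exact tendsto_const_nhds
    | mul x y hx hy => simp only [map_mul]; exact hx.mul hy
  have hfin : ∀ B : ℝ, ∃ W : Set (Monoid.Coprod (Multiplicative (Fin (l + 1) → ℤ))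
      (Multiplicative ℤ)), W.Finite ∧ ∀ᶠ n in atTop, ∀ γ ∈ (ρ n).range,
        ‖hermForm p (γ • p)‖ ≤ B → γ ∈ φ n '' W := by
    intro B
    obtain ⟨N, hN⟩ := pow_unbounded_of_one_lt B (by norm_num : (1 : ℝ) < 8)
    obtain ⟨W, hW, hev⟩ := h.finite (8 * B)
    set S : Set (Monoid.Coprod (Multiplicative (Fin (l + 1) → ℤ)) (Multiplicative ℤ)) :=
      (fun w => Monoid.Coprod.inl (Multiplicative.ofAdd w)) '' W ∪
        (fun j => Monoid.Coprod.inr (Multiplicative.ofAdd j)) ''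
          {j : ℤ | ‖hermForm p (b ^ j • p)‖ ≤ 8 * B}
    have hS : S.Finite := (hW.image _).union ((hb (8 * B)).image _)
    refine ⟨List.prod '' {v | v.length ≤ N ∧ ∀ x ∈ v, x ∈ S}, (finite_lists hS N).image _, ?_⟩
    filter_upwards [hPP, hev, hH] with n h1 h2 h3 γ hγ hB
    rw [h3, hrange] at hγ
    obtain ⟨w, hw1, hw2, rfl⟩ := h1.exists_list hG hp hγ hB hN
    obtain ⟨v, hv1, hv2, rfl⟩ := exists_map_eq_of_forall_mem (f := φ n) (S := S) w fun x hx => by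
      obtain ⟨⟨j, rfl⟩ | ⟨j, rfl⟩, hxB⟩ := hw2 x hx
      · obtain ⟨w, hw, e⟩ := h2 j hxB
        exact ⟨_, Or.inl ⟨w, hw, rfl⟩, by
          simp only [hφ, Monoid.Coprod.lift_apply_inl]; exact e.symm⟩
      · exact ⟨_, Or.inr ⟨j, hxB, rfl⟩, by simp only [hφ, Monoid.Coprod.lift_apply_inr]; rfl⟩
    exact ⟨v.prod, ⟨v, ⟨hv1 ▸ hw1, hv2⟩, rfl⟩, map_list_prod _ _⟩
  obtain ⟨hd, hgeom⟩ := convergesGeometrically_of_tendsto htend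
    (by filter_upwards [hH] with n hn δ; rw [hn]; exact ⟨δ, rfl⟩)
    (f := fun g : G => ‖hermForm p (g • p)‖) (continuous_hermForm_smul p p).norm hfin hρd
  have hne : ∀ w, L w ≠ 1 → ∀ᶠ n in atTop, s n ^ m n w.toAdd ≠ 1 := fun w hw =>
    (h.tendsto w.toAdd).eventually_ne hw
  have hnorm : ∀ w : Multiplicative (Fin (l + 1) → ℤ),
      Tendsto (fun n => ‖hermForm p (s n ^ m n w.toAdd • p)‖) atTop (𝓝 ‖hermForm p (L w • p)‖) :=
    fun w => (((continuous_hermForm_smul p p).norm.tendsto _).comp (h.tendsto w.toAdd))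
  have hcont : ∀ z : Idx k → F, Continuous fun g : G => ‖hermForm (g • p) z‖ := fun z => by
    simp only [norm_hermForm_comm _ z]
    exact (continuous_hermForm_smul z p).norm
  -- The ping-pong inequalities are closed conditions, and if `L w` is nontrivial, so are the powers
  -- converging to it from some index on.
  have hPPlim : PingPong p L.range (Subgroup.zpowers b) := by
    refine ⟨?_, ?_, ?_⟩
    · rintro _ ⟨w, rfl⟩ hw
      refine ge_of_tendsto (hnorm w) ?_
      filter_upwards [hne w hw, hPP] with n h1 h2 using h2.left _ ⟨_, rfl⟩ h1
    · obtain ⟨n, hn⟩ := hPP.exists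
      exact hn.right
    · rintro _ ⟨w, rfl⟩ hw c hc hc1
      refine le_of_tendsto_of_tendsto ((hnorm w).mul_const _)
        ((((hcont (c • p)).tendsto _).comp (h.tendsto w.toAdd)).const_mul 2) ?_
      filter_upwards [hne w hw, hPP] with n h1 h2 using h2.apart _ ⟨_, rfl⟩ h1 c hc hc1
  have hinj : Function.Injective φlim := by
    rw [injective_iff_map_eq_one]
    intro δ hδ
    by_contra hδ1
    have hmem : δ ∈ (Monoid.Coprod.inl : _ →* Monoid.Coprod (Multiplicative (Fin (l + 1) → ℤ))
        (Multiplicative ℤ)).range ⊔ (Monoid.Coprod.inr : _ →* Monoid.Coprod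
          (Multiplicative (Fin (l + 1) → ℤ)) (Multiplicative ℤ)).range := by
      rw [Monoid.Coprod.range_inl_sup_range_inr]; trivial
    have hA : (Monoid.Coprod.inl : _ →* Monoid.Coprod (Multiplicative (Fin (l + 1) → ℤ))
        (Multiplicative ℤ)).range.map φlim = L.range := by
      rw [MonoidHom.map_range, hφlim, Monoid.Coprod.lift_comp_inl]
    have hB : (Monoid.Coprod.inr : _ →* Monoid.Coprod (Multiplicative (Fin (l + 1) → ℤ))
        (Multiplicative ℤ)).range.map φlim = Subgroup.zpowers b := by
      rw [MonoidHom.map_range, hφlim, Monoid.Coprod.lift_comp_inr, hrb]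
    have h1 : ∀ a ∈ (Monoid.Coprod.inl : _ →* Monoid.Coprod (Multiplicative (Fin (l + 1) → ℤ))
        (Multiplicative ℤ)).range, a ≠ 1 → φlim a ≠ 1 := by
      rintro _ ⟨w, rfl⟩ hw hw1
      rw [hφlim, Monoid.Coprod.lift_apply_inl, ← map_one L] at hw1
      exact hw (by rw [h.injective hw1, map_one])
    have h2 : ∀ a ∈ (Monoid.Coprod.inr : _ →* Monoid.Coprod (Multiplicative (Fin (l + 1) → ℤ))
        (Multiplicative ℤ)).range, a ≠ 1 → φlim a ≠ 1 := by
      rintro _ ⟨j, rfl⟩ hj hj1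
      rw [hφlim, Monoid.Coprod.lift_apply_inr] at hj1
      have h0 : j = 1 := hb1 j.toAdd hj1
      exact hj (by rw [h0, map_one])
    rcases isAltProd_of_mem_sup hmem with h0 | ⟨w, hw | hw, rfl⟩
    · exact hδ1 h0
    · refine AltWord.prod_ne_one hG hp (hw.map φlim h1 h2) (by rwa [hA, hB]) ?_
      rw [← map_list_prod, hδ]
    · refine AltWord.prod_ne_one hG hp (hw.map φlim h2 h1) (by rw [hA, hB]; exact hPPlim.symm) ?_
      rw [← map_list_prod, hδ]
  have hgeom' : ConvergesGeometrically (fun n => (ρ n).range) φlim.range := hgeom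
  refine ⟨φlim.range, hgeom', hd, ⟨(MonoidHom.ofInjective hinj).symm⟩, ?_⟩
  set ψ : FreeGroup (Fin 2) →* Monoid.Coprod (Multiplicative (Fin (l + 1) → ℤ))
    (Multiplicative ℤ) := FreeGroup.lift ![Monoid.Coprod.inl (Multiplicative.ofAdd (Pi.single 0 1)),
      Monoid.Coprod.inr (Multiplicative.ofAdd 1)] with hψ
  have hcomp : φlim.comp ψ = ρlim := by
    refine FreeGroup.ext_hom _ _ fun i => ?_
    fin_cases i
    · simp [hψ, hφlim, hs]
    · simp [hψ, hφlim, hlb]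
  refine lt_of_le_of_ne ?_ fun heq => ?_
  · rw [← hcomp]
    rintro _ ⟨γ, rfl⟩
    exact ⟨ψ γ, rfl⟩
  · set e : Fin (l + 1) := ⟨1, by omega⟩ with he
    -- The coordinate of index `1` of `ℤ^(l+1)` kills the images of both generators of `F₂` but not
    -- the corresponding basis vector, so this vector lies outside the image of the algebraic limit.
    -- This is where `1 ≤ l` is used.
    set π : Monoid.Coprod (Multiplicative (Fin (l + 1) → ℤ)) (Multiplicative ℤ) →*
      Multiplicative ℤ := Monoid.Coprod.lift
        (AddMonoidHom.toMultiplicative (Pi.evalAddMonoidHom (fun _ => ℤ) e)) 1 with hπ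
    have hmem : φlim (Monoid.Coprod.inl (Multiplicative.ofAdd (Pi.single e 1))) ∈ ρlim.range := by
      rw [heq]; exact ⟨_, rfl⟩
    obtain ⟨γ, hγ⟩ := hmem
    rw [← hcomp, MonoidHom.comp_apply] at hγ
    have h1 := congrArg π (hinj hγ)
    have h2 : π.comp ψ = 1 := by
      refine FreeGroup.ext_hom _ _ fun i => ?_
      fin_cases i
      · have : (0 : Fin (l + 1)) ≠ e := by simp [he, Fin.ext_iff]
        simp [hψ, hπ, this.symm]
      · simp [hψ, hπ]
    have h3 := DFunLike.congr_fun h2 γ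
    rw [MonoidHom.comp_apply, h1, hπ, Monoid.Coprod.lift_apply_inl] at h3
    have h4 : (1 : ℤ) = 0 := by
      simpa using congrArg Multiplicative.toAdd h3
    exact one_ne_zero h4

end PowersConverge

end FreeProductLimit

/-! ### Loxodromic matrices -/

section LoxodromicMatrix

variable {F : Type*} [RCLike F] {k : ℕ}

theorem sum_idx {M : Type*} [AddCommMonoid M] (f : Idx k → M) :
    ∑ i, f i = f Idx.first + ((∑ j, f (Idx.mid j)) + f Idx.last) := by
  simp [Fintype.sum_sum_type]

theorem idx_cases {P : Idx k → Prop} (h1 : P Idx.first) (h2 : ∀ j, P (Idx.mid j))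
    (h3 : P Idx.last) : ∀ i, P i := by
  rintro (_ | j | _)
  exacts [h1, h2 j, h3]

section Entries

variable (x : Fin k → F) (y : ℝ) (c : F) (A : Matrix (Fin k) (Fin k) F) (v : Idx k → F)

theorem unipotent_mulVec_first : (unipotent x 0 *ᵥ v) Idx.first =
    v Idx.first + ∑ j, star (x j) * v (Idx.mid j) +
      ((∑ j, ‖x j‖ ^ 2 : ℝ) : F) / 2 * v Idx.last := by
  simp [Matrix.mulVec, dotProduct, unipotent, add_assoc, map_ofNat]

theorem unipotent_mulVec_mid (i : Fin k) : (unipotent x 0 *ᵥ v) (Idx.mid i) =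
    v (Idx.mid i) + x i * v Idx.last := by
  simp [Matrix.mulVec, dotProduct, unipotent]

theorem unipotent_mulVec_last : (unipotent x 0 *ᵥ v) Idx.last = v Idx.last := by
  simp [Matrix.mulVec, dotProduct, unipotent]

theorem leviMatrix_mulVec_first : (leviMatrix y c A *ᵥ v) Idx.first =
    (Real.exp y : F) * c * v Idx.first := by
  simp [Matrix.mulVec, dotProduct, leviMatrix]

theorem leviMatrix_mulVec_mid (i : Fin k) : (leviMatrix y c A *ᵥ v) (Idx.mid i) =
    ∑ j, A i j * v (Idx.mid j) := by
  simp [Matrix.mulVec, dotProduct, leviMatrix]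

theorem leviMatrix_mulVec_last : (leviMatrix y c A *ᵥ v) Idx.last =
    (Real.exp (-y) : F) * c * v Idx.last := by
  simp [Matrix.mulVec, dotProduct, leviMatrix]

end Entries

theorem ofReal_sum_norm_sq (x : Fin k → F) :
    ((∑ j, ‖x j‖ ^ 2 : ℝ) : F) = ∑ j, star (x j) * x j := by
  rw [RCLike.ofReal_sum]
  exact Finset.sum_congr rfl fun j _ => (star_mul_self_eq _).symm

theorem unipotent_mul_unipotent_neg (x : Fin k → F) : unipotent x 0 * unipotent (-x) 0 = 1 := by
  refine Matrix.toLin'.injective (LinearMap.ext fun v => ?_)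
  simp only [Matrix.toLin'_mul, Matrix.toLin'_one, LinearMap.comp_apply, Matrix.toLin'_apply,
    LinearMap.id_apply]
  funext i
  have h := ofReal_sum_norm_sq x
  induction i using idx_cases with
  | h1 =>
    simp only [unipotent_mulVec_first, unipotent_mulVec_mid, unipotent_mulVec_last, Pi.neg_apply,
      norm_neg, star_neg, neg_mul, mul_add, mul_neg, Finset.sum_add_distrib, Finset.sum_neg_distrib,
      ← mul_assoc, ← Finset.sum_mul, ← h]
    ring
  | h2 j => simp only [unipotent_mulVec_mid, unipotent_mulVec_last, Pi.neg_apply]; ring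
  | h3 => simp only [unipotent_mulVec_last]

theorem hermForm_unipotent_mulVec (x : Fin k → F) (v w : Idx k → F) :
    hermForm (unipotent x 0 *ᵥ v) (unipotent x 0 *ᵥ w) = hermForm v w := by
  have h := ofReal_sum_norm_sq x
  have e : ∑ j, star (v (Idx.mid j)) * x j = star (∑ j, star (x j) * v (Idx.mid j)) := by
    simp [star_sum, mul_comm]
  have e2 : star (((∑ j, ‖x j‖ ^ 2 : ℝ) : F) / 2) = ((∑ j, ‖x j‖ ^ 2 : ℝ) : F) / 2 := by
    rw [RCLike.star_def, map_div₀, RCLike.conj_ofReal, map_ofNat]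
  have e3 : ∑ j, star (v (Idx.mid j) + x j * v Idx.last) * (w (Idx.mid j) + x j * w Idx.last) =
      ∑ j, star (v (Idx.mid j)) * w (Idx.mid j) + (∑ j, star (v (Idx.mid j)) * x j) * w Idx.last +
      star (v Idx.last) * (∑ j, star (x j) * w (Idx.mid j)) +
      star (v Idx.last) * w Idx.last * ∑ j, star (x j) * x j := by
    simp only [Finset.sum_mul, Finset.mul_sum, ← Finset.sum_add_distrib]
    refine Finset.sum_congr rfl fun j _ => ?_
    simp only [star_add, star_mul']
    ring
  simp only [hermForm, unipotent_mulVec_first, unipotent_mulVec_mid, unipotent_mulVec_last]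
  rw [e3, e, ← h, star_add, star_add, star_mul', e2]
  ring

theorem hermForm_leviMatrix_mulVec (y : ℝ) {c : F} (hc : ‖c‖ = 1) {A : Matrix (Fin k) (Fin k) F}
    (hA : Aᴴ * A = 1) (v w : Idx k → F) :
    hermForm (leviMatrix y c A *ᵥ v) (leviMatrix y c A *ᵥ w) = hermForm v w := by
  have hcc : star c * c = 1 := by rw [star_mul_self_eq, hc]; simp
  have hy : (Real.exp y : F) * (Real.exp (-y) : F) = 1 := by
    rw [← RCLike.ofReal_mul, ← Real.exp_add, add_neg_cancel, Real.exp_zero, RCLike.ofReal_one]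
  have h3 : ∑ i, star ((A *ᵥ fun j => v (Idx.mid j)) i) * (A *ᵥ fun j => w (Idx.mid j)) i =
      ∑ i, star (v (Idx.mid i)) * w (Idx.mid i) := by
    change star (A *ᵥ fun j => v (Idx.mid j)) ⬝ᵥ (A *ᵥ fun j => w (Idx.mid j)) = _
    rw [Matrix.star_mulVec, Matrix.dotProduct_mulVec, Matrix.vecMul_vecMul, hA, Matrix.vecMul_one]
    rfl
  have hs : ∀ t : ℝ, star (t : F) = t := fun t => RCLike.conj_ofReal t
  simp only [hermForm, leviMatrix_mulVec_first, leviMatrix_mulVec_mid, leviMatrix_mulVec_last]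
  change _ - ∑ i, star ((A *ᵥ fun j => v (Idx.mid j)) i) * (A *ᵥ fun j => w (Idx.mid j)) i = _
  rw [h3]
  simp only [star_mul', hs]
  linear_combination (star (v Idx.first) * w Idx.last + star (v Idx.last) * w Idx.first) *
    (star c * c * hy + hcc)

theorem leviMatrix_mul (y y' : ℝ) (c c' : F) (A A' : Matrix (Fin k) (Fin k) F) :
    leviMatrix y c A * leviMatrix y' c' A' = leviMatrix (y + y') (c * c') (A * A') := by
  refine Matrix.toLin'.injective (LinearMap.ext fun v => ?_)
  simp only [Matrix.toLin'_mul, LinearMap.comp_apply, Matrix.toLin'_apply]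
  funext i
  induction i using idx_cases with
  | h1 =>
    simp only [leviMatrix_mulVec_first, Real.exp_add, RCLike.ofReal_mul]; ring
  | h2 j =>
    simp only [leviMatrix_mulVec_mid, Matrix.mul_apply, Finset.sum_mul, Finset.mul_sum]
    rw [Finset.sum_comm]
    simp only [mul_assoc]
  | h3 => simp only [leviMatrix_mulVec_last, neg_add, Real.exp_add, RCLike.ofReal_mul]; ring

theorem leviMatrix_one : leviMatrix 0 (1 : F) (1 : Matrix (Fin k) (Fin k) F) = 1 := by
  refine Matrix.toLin'.injective (LinearMap.ext fun v => ?_)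
  simp only [Matrix.toLin'_one, Matrix.toLin'_apply, LinearMap.id_apply]
  funext i
  induction i using idx_cases with
  | h1 => simp [leviMatrix_mulVec_first]
  | h2 j => simp [leviMatrix_mulVec_mid, Matrix.one_apply]
  | h3 => simp [leviMatrix_mulVec_last]

theorem loxodromicMatrix_mul (x : Fin k → F) (y y' : ℝ) (c c' : F)
    (A A' : Matrix (Fin k) (Fin k) F) :
    loxodromicMatrix x 0 y c A * loxodromicMatrix x 0 y' c' A' =
      loxodromicMatrix x 0 (y + y') (c * c') (A * A') := by
  have h : unipotent (-x) 0 * unipotent x 0 = 1 := by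
    have := unipotent_mul_unipotent_neg (-x)
    rwa [neg_neg] at this
  simp only [loxodromicMatrix, neg_zero, ← leviMatrix_mul]
  calc _ = unipotent x 0 * leviMatrix y c A * (unipotent (-x) 0 * unipotent x 0) *
      leviMatrix y' c' A' * unipotent (-x) 0 := by simp only [mul_assoc]
    _ = _ := by rw [h]; simp only [mul_assoc, mul_one]

theorem loxodromicMatrix_one (x : Fin k → F) : loxodromicMatrix x 0 0 1 1 = 1 := by
  rw [loxodromicMatrix, leviMatrix_one, mul_one, neg_zero, unipotent_mul_unipotent_neg]

theorem hermForm_loxodromicMatrix_mulVec (x : Fin k → F) (y : ℝ) {c : F} (hc : ‖c‖ = 1)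
    {A : Matrix (Fin k) (Fin k) F} (hA : Aᴴ * A = 1) (v w : Idx k → F) :
    hermForm (loxodromicMatrix x 0 y c A *ᵥ v) (loxodromicMatrix x 0 y c A *ᵥ w) =
      hermForm v w := by
  simp only [loxodromicMatrix, neg_zero, ← Matrix.mulVec_mulVec, hermForm_unipotent_mulVec,
    hermForm_leviMatrix_mulVec y hc hA]

theorem det_leviMatrix (y : ℝ) (c : F) (A : Matrix (Fin k) (Fin k) F) :
    (leviMatrix y c A).det = c ^ 2 * A.det := by
  have h : leviMatrix y c A = Matrix.fromBlocks (Matrix.of fun _ _ => (Real.exp y : F) * c) 0 0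
      (Matrix.fromBlocks A 0 0 (Matrix.of fun _ _ => (Real.exp (-y) : F) * c)) := by
    ext i j
    rcases i with _ | i | _ <;> rcases j with _ | j | _ <;> rfl
  have hy : (Real.exp y : F) * (Real.exp (-y) : F) = 1 := by
    rw [← RCLike.ofReal_mul, ← Real.exp_add, add_neg_cancel, Real.exp_zero, RCLike.ofReal_one]
  have hd : ∀ a : F, (Matrix.of fun (_ _ : Unit) => a).det = a := fun a => by
    rw [Matrix.det_unique, Matrix.of_apply]
  rw [h, Matrix.det_fromBlocks_zero₁₂, Matrix.det_fromBlocks_zero₁₂, hd, hd]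
  linear_combination c ^ 2 * A.det * hy

theorem det_loxodromicMatrix (x : Fin k → F) (y : ℝ) (c : F) (A : Matrix (Fin k) (Fin k) F) :
    (loxodromicMatrix x 0 y c A).det = c ^ 2 * A.det := by
  have h := congrArg Matrix.det (unipotent_mul_unipotent_neg x)
  rw [Matrix.det_mul, Matrix.det_one] at h
  rw [loxodromicMatrix, Matrix.det_mul, Matrix.det_mul, det_leviMatrix, neg_zero]
  linear_combination c ^ 2 * A.det * h

/-! Entries of loxodromic matrices -/

section Apply

variable (x : Fin k → F) (y : ℝ) (c : F) (A : Matrix (Fin k) (Fin k) F)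

theorem loxodromicMatrix_apply (i j : Idx k) : loxodromicMatrix x 0 y c A i j =
    (unipotent x 0 *ᵥ (leviMatrix y c A *ᵥ (unipotent (-x) 0 *ᵥ Pi.single j 1))) i := by
  rw [loxodromicMatrix, Matrix.mulVec_mulVec, Matrix.mulVec_mulVec, Matrix.mulVec_single_one,
    neg_zero, mul_assoc]
  rfl

theorem loxodromicMatrix_first_first :
    loxodromicMatrix x 0 y c A Idx.first Idx.first = (Real.exp y : F) * c := by
  simp only [loxodromicMatrix_apply, unipotent_mulVec_first, unipotent_mulVec_mid,
    unipotent_mulVec_last, leviMatrix_mulVec_first, leviMatrix_mulVec_mid, leviMatrix_mulVec_last]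
  simp

theorem loxodromicMatrix_mid_first (i : Fin k) :
    loxodromicMatrix x 0 y c A (Idx.mid i) Idx.first = 0 := by
  simp only [loxodromicMatrix_apply, unipotent_mulVec_mid,
    unipotent_mulVec_last, leviMatrix_mulVec_mid, leviMatrix_mulVec_last]
  simp

theorem loxodromicMatrix_last_first :
    loxodromicMatrix x 0 y c A Idx.last Idx.first = 0 := by
  simp only [loxodromicMatrix_apply,
    unipotent_mulVec_last, leviMatrix_mulVec_last]
  simp

theorem loxodromicMatrix_first_mid (j : Fin k) :
    loxodromicMatrix x 0 y c A Idx.first (Idx.mid j) =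
      ∑ i, star (x i) * A i j - (Real.exp y : F) * c * star (x j) := by
  simp only [loxodromicMatrix_apply, unipotent_mulVec_first, unipotent_mulVec_mid,
    unipotent_mulVec_last, leviMatrix_mulVec_first, leviMatrix_mulVec_mid, leviMatrix_mulVec_last]
  simp [Pi.single_apply]
  ring

theorem loxodromicMatrix_mid_mid (i j : Fin k) :
    loxodromicMatrix x 0 y c A (Idx.mid i) (Idx.mid j) = A i j := by
  simp only [loxodromicMatrix_apply, unipotent_mulVec_mid,
    unipotent_mulVec_last, leviMatrix_mulVec_mid, leviMatrix_mulVec_last]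
  simp [Pi.single_apply]

theorem loxodromicMatrix_last_mid (j : Fin k) :
    loxodromicMatrix x 0 y c A Idx.last (Idx.mid j) = 0 := by
  simp only [loxodromicMatrix_apply,
    unipotent_mulVec_last, leviMatrix_mulVec_last]
  simp

theorem loxodromicMatrix_first_last :
    loxodromicMatrix x 0 y c A Idx.first Idx.last =
      c * (Real.cosh y : F) * ((∑ j, ‖x j‖ ^ 2 : ℝ) : F) -
        ∑ i, star (x i) * ∑ j, A i j * x j := by
  simp only [loxodromicMatrix_apply, unipotent_mulVec_first, unipotent_mulVec_mid,
    unipotent_mulVec_last, leviMatrix_mulVec_first, leviMatrix_mulVec_mid, leviMatrix_mulVec_last]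
  simp [Real.cosh_eq, map_ofNat]
  ring

theorem loxodromicMatrix_mid_last (i : Fin k) :
    loxodromicMatrix x 0 y c A (Idx.mid i) Idx.last =
      (Real.exp (-y) : F) * c * x i - ∑ j, A i j * x j := by
  simp only [loxodromicMatrix_apply, unipotent_mulVec_mid,
    unipotent_mulVec_last, leviMatrix_mulVec_mid, leviMatrix_mulVec_last]
  simp
  ring

theorem loxodromicMatrix_last_last :
    loxodromicMatrix x 0 y c A Idx.last Idx.last = (Real.exp (-y) : F) * c := by
  simp only [loxodromicMatrix_apply,
    unipotent_mulVec_last, leviMatrix_mulVec_last]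
  simp

end Apply

end LoxodromicMatrix

/-! ### Translations along a geodesic -/

section Translation

variable {F : Type*} [RCLike F] {k : ℕ}

/-- The row vector of the linear form `Ψ(z, ·)`. -/
def dualVec (z : Idx k → F) : Idx k → F :=
  Sum.elim (fun _ => star (z Idx.last))
    (Sum.elim (fun j => -star (z (Idx.mid j))) fun _ => star (z Idx.first))

theorem dualVec_dotProduct (z v : Idx k → F) : dualVec z ⬝ᵥ v = hermForm z v := by
  simp only [dotProduct, sum_idx, dualVec, hermForm, Sum.elim_inl, Sum.elim_inr, neg_mul,
    Finset.sum_neg_distrib]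
  ring

/-- The translation by `t` in the plane spanned by the unit vectors `p` (positive) and `e`
(negative), which is the identity on the orthogonal complement. -/
noncomputable def translationMatrix (p e : Idx k → F) (t : ℝ) : Matrix (Idx k) (Idx k) F :=
  1 + (Matrix.of ![p, e])ᵀ * Matrix.of
    ![((Real.cosh t - 1 : ℝ) : F) • dualVec p - (Real.sinh t : F) • dualVec e,
      (Real.sinh t : F) • dualVec p - ((Real.cosh t - 1 : ℝ) : F) • dualVec e]

theorem translationMatrix_mulVec (p e : Idx k → F) (t : ℝ) (v : Idx k → F) :
    translationMatrix p e t *ᵥ v = v +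
      (((Real.cosh t - 1 : ℝ) : F) * hermForm p v - (Real.sinh t : F) * hermForm e v) • p +
      ((Real.sinh t : F) * hermForm p v - ((Real.cosh t - 1 : ℝ) : F) * hermForm e v) • e := by
  rw [translationMatrix, Matrix.add_mulVec, Matrix.one_mulVec, ← Matrix.mulVec_mulVec, add_assoc]
  congr 1
  funext i
  simp only [Matrix.mulVec, dotProduct, Fin.sum_univ_two, Matrix.transpose_apply, Matrix.of_apply,
    Matrix.cons_val_zero, Matrix.cons_val_one, Pi.add_apply, Pi.smul_apply, smul_eq_mul]
  have h : ∀ (a b : F), ∑ j, (a • dualVec p - b • dualVec e) j * v j =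
      a * hermForm p v - b * hermForm e v := fun a b => by
    change (a • dualVec p - b • dualVec e) ⬝ᵥ v = _
    rw [sub_dotProduct, smul_dotProduct, smul_dotProduct, dualVec_dotProduct, dualVec_dotProduct]
    rfl
  rw [h, h]
  ring

/-- An orthonormal pair of a positive and a negative vector. -/
structure IsFrame (p e : Idx k → F) : Prop where
  pos : hermForm p p = 1
  orth : hermForm p e = 0
  neg : hermForm e e = -1

namespace IsFrame

variable {p e : Idx k → F}

theorem orth' (h : IsFrame p e) : hermForm e p = 0 := by
  rw [← star_hermForm, h.orth, star_zero]

theorem hermForm_translationMatrix (h : IsFrame p e) (t : ℝ) (v w : Idx k → F) :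
    hermForm (translationMatrix p e t *ᵥ v) (translationMatrix p e t *ᵥ w) = hermForm v w := by
  have hs : ∀ r : ℝ, star (r : F) = r := fun r => RCLike.conj_ofReal r
  have hct : ((Real.cosh t : ℝ) : F) ^ 2 - ((Real.sinh t : ℝ) : F) ^ 2 = 1 := by
    rw [← RCLike.ofReal_pow, ← RCLike.ofReal_pow, ← RCLike.ofReal_sub, Real.cosh_sq_sub_sinh_sq,
      RCLike.ofReal_one]
  simp only [translationMatrix_mulVec, hermForm_add_left, hermForm_add_right, hermForm_smul_left,
    hermForm_smul_right, h.pos, h.orth, h.neg, h.orth', star_sub, star_mul', hs, star_hermForm]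
  push_cast
  linear_combination (hermForm v p * hermForm p w - hermForm v e * hermForm e w) * hct

theorem det_translationMatrix (h : IsFrame p e) (t : ℝ) : (translationMatrix p e t).det = 1 := by
  have hct : ((Real.cosh t : ℝ) : F) ^ 2 - ((Real.sinh t : ℝ) : F) ^ 2 = 1 := by
    rw [← RCLike.ofReal_pow, ← RCLike.ofReal_pow, ← RCLike.ofReal_sub, Real.cosh_sq_sub_sinh_sq,
      RCLike.ofReal_one]
  have hm : ∀ (a b : F) (v : Idx k → F), ∑ j, (a • dualVec p + b • dualVec e) j * v j =
      a * hermForm p v + b * hermForm e v := fun a b v => by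
    change (a • dualVec p + b • dualVec e) ⬝ᵥ v = _
    rw [add_dotProduct, smul_dotProduct, smul_dotProduct, dualVec_dotProduct, dualVec_dotProduct]
    rfl
  rw [translationMatrix, Matrix.det_one_add_mul_comm, Matrix.det_fin_two]
  simp only [Matrix.add_apply, Matrix.mul_apply, Matrix.one_apply, Matrix.transpose_apply,
    Matrix.of_apply, Matrix.cons_val_zero, Matrix.cons_val_one, sub_eq_add_neg, ← neg_smul, hm,
    h.pos, h.orth, h.neg, h.orth']
  simp
  linear_combination hct

/-- The translation by `t` as an element of the special linear group. -/
noncomputable def translation (h : IsFrame p e) (t : ℝ) : Matrix.SpecialLinearGroup (Idx k) F :=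
  ⟨translationMatrix p e t, h.det_translationMatrix t⟩

theorem translation_mem (h : IsFrame p e) (t : ℝ) : h.translation t ∈ unitaryGroup F k :=
  h.hermForm_translationMatrix t

theorem translation_zero (h : IsFrame p e) : h.translation 0 = 1 := by
  refine Subtype.ext (Matrix.toLin'.injective (LinearMap.ext fun v => ?_))
  change translationMatrix p e 0 *ᵥ v = (1 : Matrix (Idx k) (Idx k) F) *ᵥ v
  rw [translationMatrix_mulVec]
  simp

theorem continuous_translation (h : IsFrame p e) : Continuous h.translation := by
  refine Continuous.subtype_mk (continuous_pi fun i => continuous_pi fun j => ?_) _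
  simp only [translationMatrix, Matrix.add_apply, Matrix.mul_apply, Matrix.of_apply,
    Fin.sum_univ_two, Matrix.transpose_apply, Matrix.cons_val_zero, Matrix.cons_val_one,
    Pi.sub_apply, Pi.smul_apply, smul_eq_mul]
  have h1 : Continuous fun t : ℝ => ((Real.cosh t - 1 : ℝ) : F) :=
    RCLike.continuous_ofReal.comp (Real.continuous_cosh.sub continuous_const)
  have h2 : Continuous fun t : ℝ => ((Real.sinh t : ℝ) : F) :=
    RCLike.continuous_ofReal.comp Real.continuous_sinh
  fun_prop

theorem exists_isLoxodromic {G : Subgroup (Matrix.SpecialLinearGroup (Idx k) F)}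
    (h : IsFrame p e) {t : ℝ} (ht : 0 < t) {b : G} (hb : b.1 = h.translation t) :
    ∃ ξ η, IsLoxodromic b ξ η t 1 ∧ ∀ j : ℤ,
      b ^ j • p = (Real.cosh (j * t) : F) • p + (Real.sinh (j * t) : F) • e := by
  -- The fixed null vectors are `(p ± e) / √2`; the scaling normalises their pairing to `1`.
  set r : F := (((√2)⁻¹ : ℝ) : F) with hr
  have hrr : star r * r = 1 / 2 := by
    rw [star_mul_self_eq, hr, RCLike.norm_ofReal, sq_abs, inv_pow, Real.sq_sqrt (by norm_num)]
    simp [map_ofNat]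
  have hact : ∀ v : Idx k → F, b • v = translationMatrix p e t *ᵥ v := fun v => by
    change b.1 • v = _
    rw [hb]
    rfl
  have hco : ((Real.cosh t : ℝ) : F) = ((Real.exp t : ℝ) : F) - ((Real.sinh t : ℝ) : F) := by
    rw [← RCLike.ofReal_sub, ← Real.cosh_add_sinh t]; ring_nf
  have hco' : ((Real.cosh t : ℝ) : F) = ((Real.exp (-t) : ℝ) : F) + ((Real.sinh t : ℝ) : F) := by
    rw [← RCLike.ofReal_add, ← Real.cosh_sub_sinh t]; ring_nf
  have hlox : IsLoxodromic b (r • (p + e)) (r • (p - e)) t (1 : F) := by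
    refine ⟨ht, norm_one, ?_, ?_, ?_, ?_, ?_⟩
    · simp only [hermForm_smul_smul, hermForm_add_left, hermForm_add_right, h.pos, h.orth, h.neg,
        h.orth']
      ring
    · simp only [hermForm_smul_smul, hermForm_sub_left, hermForm_sub_right, h.pos, h.orth, h.neg,
        h.orth']
      ring
    · simp only [hermForm_smul_smul, hermForm_add_left, hermForm_sub_right, h.pos, h.orth, h.neg,
        h.orth', hrr]
      norm_num
    · rw [hact, Matrix.mulVec_smul, translationMatrix_mulVec]
      simp only [hermForm_add_right, h.pos, h.orth, h.neg, h.orth', RCLike.ofReal_sub, hco,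
        RCLike.ofReal_one]
      module
    · rw [hact, Matrix.mulVec_smul, translationMatrix_mulVec]
      simp only [hermForm_sub_right, h.pos, h.orth, h.neg, h.orth', RCLike.ofReal_sub, hco',
        RCLike.ofReal_one]
      module
  refine ⟨_, _, hlox, fun j => ?_⟩
  obtain ⟨h1, h2⟩ := hlox.zpow_smul j
  have h3 : p = star r • (r • (p + e)) + star r • (r • (p - e)) := by
    rw [← smul_add, ← smul_add, smul_smul, hrr]
    module
  have h4 : b ^ j • p = star r • (b ^ j • r • (p + e)) + star r • (b ^ j • r • (p - e)) := by
    conv_lhs => rw [h3]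
    rw [smul_add_of_subgroup, smul_comm_of_subgroup _ (star r) (r • (p + e)),
      smul_comm_of_subgroup _ (star r) (r • (p - e))]
  have h5 : ∀ u : F, ∀ v : Idx k → F, star r • u • r • v = (u * (1 / 2)) • v := fun u v => by
    rw [← hrr]; module
  rw [h4, h1, h2, h5, h5, Real.cosh_eq, Real.sinh_eq]
  simp only [RCLike.ofReal_div, RCLike.ofReal_add, RCLike.ofReal_sub, RCLike.ofReal_ofNat, one_zpow]
  module

end IsFrame

end Translation

/-! ### The groups are closed -/

section Closed

theorem isClosed_unitaryGroup (F : Type*) [RCLike F] (k : ℕ) :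
    IsClosed (unitaryGroup F k : Set (Matrix.SpecialLinearGroup (Idx k) F)) := by
  have h : (unitaryGroup F k : Set (Matrix.SpecialLinearGroup (Idx k) F)) =
      ⋂ (z : Idx k → F) (w : Idx k → F), {g | hermForm (g.1 *ᵥ z) (g.1 *ᵥ w) = hermForm z w} := by
    ext g
    simp only [Set.mem_iInter]
    rfl
  rw [h]
  refine isClosed_iInter fun z => isClosed_iInter fun w => isClosed_eq ?_ continuous_const
  have hv : ∀ v : Idx k → F, Continuous fun g : Matrix.SpecialLinearGroup (Idx k) F => g.1 *ᵥ v :=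
    fun v => Continuous.matrix_mulVec continuous_subtype_val continuous_const
  have hi : ∀ (v : Idx k → F) i,
      Continuous fun g : Matrix.SpecialLinearGroup (Idx k) F => (g.1 *ᵥ v) i :=
    fun v i => (continuous_apply i).comp (hv v)
  simp only [hermForm]
  exact (((hi z _).star.mul (hi w _)).add ((hi z _).star.mul (hi w _))).sub
    (continuous_finsetSum _ fun j _ => (hi z _).star.mul (hi w _))

theorem isClosed_SO1 (k : ℕ) :
    IsClosed (SO1 k : Set (Matrix.SpecialLinearGroup (Idx k) ℝ)) := by
  rw [SO1, Subgroup.coe_map]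
  exact (isClosed_unitaryGroup ℝ k).isClosedEmbedding_subtypeVal.isClosedMap _
    isClosed_connectedComponent

theorem SO1_le_unitaryGroup (k : ℕ) : SO1 k ≤ unitaryGroup ℝ k := by
  rintro _ ⟨g, _, rfl⟩
  exact g.2

/-- A path through the identity stays in the identity component; this avoids any description of that
component by signs of entries. -/
theorem mem_SO1_of_continuous {k : ℕ} {γ : ℝ → Matrix.SpecialLinearGroup (Idx k) ℝ}
    (hγ : Continuous γ) (hmem : ∀ t, γ t ∈ unitaryGroup ℝ k) (h0 : γ 0 = 1) (t : ℝ) :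
    γ t ∈ SO1 k := by
  set γ' : ℝ → unitaryGroup ℝ k := fun t => ⟨γ t, hmem t⟩ with hγ'
  have hc : Continuous γ' := hγ.subtype_mk _
  have h1 : (1 : unitaryGroup ℝ k) ∈ Set.range γ' := ⟨0, Subtype.ext h0⟩
  exact ⟨γ' t, (isPreconnected_range hc).subset_connectedComponent h1 ⟨t, rfl⟩, rfl⟩

theorem exists_tendsto_of_tendsto_val {F : Type*} [RCLike F] {k : ℕ}
    {G : Subgroup (Matrix.SpecialLinearGroup (Idx k) F)}
    (hG : IsClosed (G : Set (Matrix.SpecialLinearGroup (Idx k) F))) {g : ℕ → G}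
    {T : Matrix (Idx k) (Idx k) F} (hT : Tendsto (fun n => (g n).1.1) atTop (𝓝 T)) :
    ∃ g' : G, g'.1.1 = T ∧ Tendsto g atTop (𝓝 g') := by
  have hdet : T.det = 1 := by
    have h1 : Tendsto (fun n => (g n).1.1.det) atTop (𝓝 T.det) :=
      ((continuous_id.matrix_det).tendsto T).comp hT
    refine tendsto_nhds_unique h1 ?_
    simp only [(g _).1.2]
    exact tendsto_const_nhds
  have h2 : Tendsto (fun n => (g n).1) atTop (𝓝 ⟨T, hdet⟩) := tendsto_subtype_rng.mpr hT
  exact ⟨⟨⟨T, hdet⟩, hG.mem_of_tendsto h2 (Eventually.of_forall fun n => (g n).2)⟩, rfl,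
    tendsto_subtype_rng.mpr h2⟩

end Closed

/-! ### Ping-pong for loxodromic matrices -/

section BasePoint

variable {F : Type*} [RCLike F] {k : ℕ}

/-- The point at height `h` above the origin of the horospherical coordinates. -/
noncomputable def basePoint (F : Type*) [RCLike F] (k : ℕ) (h : ℝ) : Idx k → F :=
  Sum.elim (fun _ => ((√h / 2 : ℝ) : F)) (Sum.elim (fun _ => 0) fun _ => (((√h)⁻¹ : ℝ) : F))

theorem isFrame_basePoint {h : ℝ} (hh : 0 < h) (i : Fin k) :
    IsFrame (basePoint F k h) (Pi.single (Idx.mid i) 1) := by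
  have h1 : (√h / 2 : ℝ) * (√h)⁻¹ = 1 / 2 := by
    have := (Real.sqrt_pos.mpr hh).ne'
    field_simp
  have h2 : (((√h / 2 : ℝ) : ℝ) : F) * (((√h)⁻¹ : ℝ) : F) = 1 / 2 := by
    rw [← RCLike.ofReal_mul, h1]; simp [map_ofNat]
  have hs : ∀ t : ℝ, star (t : F) = t := fun t => RCLike.conj_ofReal t
  refine ⟨?_, ?_, ?_⟩
  · simp only [hermForm, basePoint, Sum.elim_inl, Sum.elim_inr, hs, mul_zero, Finset.sum_const_zero]
    linear_combination 2 * h2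
  · simp [hermForm, basePoint, Pi.single_apply]
  · simp [hermForm, Pi.single_apply]

/-- The displacement of the base point sees the corner entry divided by the height. Lowering the
base point therefore makes all elements with corner bounded away from zero move it far. -/
theorem hermForm_basePoint_loxodromicMatrix {h : ℝ} (hh : 0 < h) (x : Fin k → F) (y : ℝ) (c : F)
    (A : Matrix (Fin k) (Fin k) F) :
    hermForm (basePoint F k h) (loxodromicMatrix x 0 y c A *ᵥ basePoint F k h) =
      c * (Real.cosh y : F) + loxodromicMatrix x 0 y c A Idx.first Idx.last / (h : F) := by
  have h1 : (√h / 2 : ℝ) * (√h)⁻¹ = 1 / 2 := by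
    have := (Real.sqrt_pos.mpr hh).ne'
    field_simp
  have h2 : (((√h / 2 : ℝ) : ℝ) : F) * (((√h)⁻¹ : ℝ) : F) = 1 / 2 := by
    rw [← RCLike.ofReal_mul, h1]; simp [map_ofNat]
  have h3 : (((√h)⁻¹ : ℝ) : F) * (((√h)⁻¹ : ℝ) : F) = (h : F)⁻¹ := by
    rw [← RCLike.ofReal_mul, ← mul_inv, Real.mul_self_sqrt hh.le, RCLike.ofReal_inv]
  have hs : ∀ t : ℝ, star (t : F) = t := fun t => RCLike.conj_ofReal t
  have h4 : ((Real.cosh y : ℝ) : F) = ((Real.exp y : ℝ) + (Real.exp (-y) : ℝ)) / 2 := by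
    rw [Real.cosh_eq]; simp [map_ofNat]
  simp only [hermForm, Matrix.mulVec, dotProduct, sum_idx, basePoint, Sum.elim_inl, Sum.elim_inr,
    hs, mul_zero, zero_mul, star_zero, Finset.sum_const_zero, loxodromicMatrix_first_first,
    loxodromicMatrix_last_first, loxodromicMatrix_last_last, h4]
  rw [div_eq_mul_inv (loxodromicMatrix x 0 y c A Idx.first Idx.last)]
  linear_combination (((Real.exp y : ℝ) : F) + ((Real.exp (-y) : ℝ) : F)) * c * h2 +
    loxodromicMatrix x 0 y c A Idx.first Idx.last * h3

theorem hermForm_loxodromicMatrix_basePoint_single {h : ℝ} (x : Fin k → F) (y : ℝ) (c : F)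
    (A : Matrix (Fin k) (Fin k) F) (i : Fin k) :
    hermForm (loxodromicMatrix x 0 y c A *ᵥ basePoint F k h) (Pi.single (Idx.mid i) 1) =
      -star (loxodromicMatrix x 0 y c A (Idx.mid i) Idx.last * (((√h)⁻¹ : ℝ) : F)) := by
  simp [hermForm, Matrix.mulVec, dotProduct, basePoint, loxodromicMatrix_mid_first,
    Pi.single_apply]

theorem sum_norm_mulVec_sq {A : Matrix (Fin k) (Fin k) F} (hA : Aᴴ * A = 1) (x : Fin k → F) :
    ∑ i, ‖(A *ᵥ x) i‖ ^ 2 = ∑ i, ‖x i‖ ^ 2 := by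
  have h : star (A *ᵥ x) ⬝ᵥ (A *ᵥ x) = star x ⬝ᵥ x := by
    rw [Matrix.star_mulVec, Matrix.dotProduct_mulVec, Matrix.vecMul_vecMul, hA, Matrix.vecMul_one]
  have h2 : ((∑ i, ‖(A *ᵥ x) i‖ ^ 2 : ℝ) : F) = ((∑ i, ‖x i‖ ^ 2 : ℝ) : F) := by
    rw [ofReal_sum_norm_sq, ofReal_sum_norm_sq]
    exact h
  exact_mod_cast h2

variable (x : Fin k → F) (y : ℝ) {c : F} {A : Matrix (Fin k) (Fin k) F}

/-- The corner entry of a loxodromic matrix bounds its translation length. -/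
theorem cosh_sub_one_mul_le_norm (hc : ‖c‖ = 1) (hA : Aᴴ * A = 1) :
    (Real.cosh y - 1) * ∑ i, ‖x i‖ ^ 2 ≤ ‖loxodromicMatrix x 0 y c A Idx.first Idx.last‖ := by
  have h1 : ‖∑ i, star (x i) * ∑ j, A i j * x j‖ ≤ ∑ i, ‖x i‖ ^ 2 := by
    calc ‖∑ i, star (x i) * ∑ j, A i j * x j‖ ≤ ∑ i, ‖star (x i) * (A *ᵥ x) i‖ := norm_sum_le _ _
      _ ≤ ∑ i, (‖x i‖ ^ 2 + ‖(A *ᵥ x) i‖ ^ 2) / 2 := by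
        refine Finset.sum_le_sum fun i _ => ?_
        rw [norm_mul, norm_star]
        nlinarith [sq_nonneg (‖x i‖ - ‖(A *ᵥ x) i‖)]
      _ = ∑ i, ‖x i‖ ^ 2 := by
        rw [← Finset.sum_div, Finset.sum_add_distrib, sum_norm_mulVec_sq hA]
        ring
  have h0 : (0 : ℝ) ≤ ∑ i, ‖x i‖ ^ 2 := Finset.sum_nonneg fun i _ => by positivity
  have h2 : ‖c * (Real.cosh y : F) * ((∑ j, ‖x j‖ ^ 2 : ℝ) : F)‖ =
      Real.cosh y * ∑ i, ‖x i‖ ^ 2 := by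
    rw [norm_mul, norm_mul, hc, one_mul, RCLike.norm_ofReal, RCLike.norm_ofReal,
      abs_of_pos (Real.cosh_pos y), abs_of_nonneg h0]
  rw [loxodromicMatrix_first_last]
  have h3 := norm_sub_norm_le (c * (Real.cosh y : F) * ((∑ j, ‖x j‖ ^ 2 : ℝ) : F))
    (∑ i, star (x i) * ∑ j, A i j * x j)
  rw [h2] at h3
  linarith

/-- The last column is the image of a null vector, hence null; this expresses the squares of its
middle entries through its first and last entries. -/
theorem norm_sq_mid_last_le (hc : ‖c‖ = 1) (hA : Aᴴ * A = 1) (i : Fin k) :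
    ‖loxodromicMatrix x 0 y c A (Idx.mid i) Idx.last‖ ^ 2 ≤
      2 * Real.exp (-y) * ‖loxodromicMatrix x 0 y c A Idx.first Idx.last‖ := by
  set M := loxodromicMatrix x 0 y c A with hM
  have h := hermForm_loxodromicMatrix_mulVec x y hc hA (Pi.single Idx.last 1) (Pi.single Idx.last 1)
  rw [← hM] at h
  simp only [hermForm, Matrix.mulVec_single_one, Matrix.col_apply] at h
  rw [show M Idx.last Idx.last = (Real.exp (-y) : F) * c from loxodromicMatrix_last_last x y c A,
    ← ofReal_sum_norm_sq fun i => M (Idx.mid i) Idx.last] at h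
  have h1 : ((∑ i, ‖M (Idx.mid i) Idx.last‖ ^ 2 : ℝ) : F) = star (M Idx.first Idx.last) *
      ((Real.exp (-y) : F) * c) + star ((Real.exp (-y) : F) * c) * M Idx.first Idx.last := by
    simp at h
    rw [sub_eq_zero] at h
    simpa using h.symm
  have h2 := congrArg norm h1
  have h0 : (0 : ℝ) ≤ ∑ i, ‖M (Idx.mid i) Idx.last‖ ^ 2 := Finset.sum_nonneg fun i _ => by positivity
  rw [RCLike.norm_ofReal, abs_of_nonneg h0] at h2
  have hab : ∀ a b : F, ‖star a * b + star b * a‖ ≤ 2 * ‖b‖ * ‖a‖ := fun a b => by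
    refine (norm_add_le _ _).trans (le_of_eq ?_)
    rw [norm_mul, norm_mul, norm_star, norm_star]
    ring
  have h3 := hab (M Idx.first Idx.last) ((Real.exp (-y) : F) * c)
  rw [norm_mul, hc, mul_one, RCLike.norm_ofReal, abs_of_pos (Real.exp_pos _)] at h3
  have h4 := Finset.single_le_sum (f := fun i => ‖M (Idx.mid i) Idx.last‖ ^ 2)
    (fun i _ => by positivity) (Finset.mem_univ i)
  linarith

/-- At a height this small compared with the repelling point, `cosh y - 1` is at most `1/32` of
`‖corner‖ / h`. The displacement is therefore `‖corner‖ / h` up to the factor `31/32` and an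
additive constant. -/
theorem norm_corner_le (hc : ‖c‖ = 1) (hA : Aᴴ * A = 1) {h : ℝ} (hh : 0 < h)
    (hx : 32 * h ≤ ∑ i, ‖x i‖ ^ 2) :
    ‖loxodromicMatrix x 0 y c A Idx.first Idx.last‖ ≤ h * (32 / 31 * (‖hermForm (basePoint F k h)
      (loxodromicMatrix x 0 y c A *ᵥ basePoint F k h)‖ + 1)) ∧
    Real.cosh y ≤ 1 + ‖loxodromicMatrix x 0 y c A Idx.first Idx.last‖ / h / 32 := by
  have h1 := cosh_sub_one_mul_le_norm x y hc hA
  rw [hermForm_basePoint_loxodromicMatrix hh]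
  set τ := loxodromicMatrix x 0 y c A Idx.first Idx.last with hτ
  have h2 := Real.one_le_cosh y
  have h3 : (Real.cosh y - 1) * (32 * h) ≤ ‖τ‖ :=
    (mul_le_mul_of_nonneg_left hx (by linarith)).trans h1
  have h4 : Real.cosh y ≤ 1 + ‖τ‖ / h / 32 := by
    rw [div_div, ← sub_le_iff_le_add', le_div_iff₀ (by positivity)]
    linarith
  refine ⟨?_, h4⟩
  have h5 := norm_sub_norm_le (τ / (h : F)) (-(c * (Real.cosh y : F)))
  rw [norm_neg, norm_mul, hc, one_mul, RCLike.norm_ofReal, abs_of_pos (Real.cosh_pos y), norm_div,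
    RCLike.norm_ofReal, abs_of_pos hh, sub_neg_eq_add, add_comm (τ / (h : F))] at h5
  have h6 : ‖τ‖ / h ≤ 32 / 31 * (‖c * (Real.cosh y : F) + τ / (h : F)‖ + 1) := by linarith
  rw [div_le_iff₀ hh] at h6
  linarith

end BasePoint

/-! ### Sequences of loxodromic cyclic groups with limits of larger rank -/

section Sequence

variable {F : Type*} [RCLike F] {k l : ℕ} {G : Subgroup (Matrix.SpecialLinearGroup (Idx k) F)}

/-- The corner entry of a matrix. -/
def corner (g : G) : F := g.1.1 Idx.first Idx.last

/-- The powers of `g` are loxodromic matrices that fix `∞` and `(x, 0)`. -/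
structure IsLoxodromicMatrix (g : G) (x : Fin k → F) (y : ℝ) : Prop where
  pos : 0 < y
  one_le : 1 ≤ ∑ i, ‖x i‖ ^ 2
  zpow : ∀ j : ℤ, ∃ (c : F) (A : Matrix (Fin k) (Fin k) F), ‖c‖ = 1 ∧ Aᴴ * A = 1 ∧
    (g ^ j).1.1 = loxodromicMatrix x 0 (j * y) c A

namespace IsLoxodromicMatrix

variable {g : G} {x : Fin k → F} {y : ℝ}

theorem exists_isLoxodromic (h : IsLoxodromicMatrix g x y) :
    ∃ ξ η c, IsLoxodromic g ξ η y c := by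
  obtain ⟨c, A, hc, hA, hg⟩ := h.zpow 1
  rw [zpow_one, Int.cast_one, one_mul] at hg
  have hact : ∀ v : Idx k → F, g • v = loxodromicMatrix x 0 y c A *ᵥ v := fun v => by
    rw [← hg]; rfl
  have hinv : unipotent (-x) 0 * unipotent x 0 = 1 := by
    have := unipotent_mul_unipotent_neg (-x)
    rwa [neg_neg] at this
  have h1 : unipotent x 0 *ᵥ Pi.single Idx.first 1 = Pi.single Idx.first (1 : F) := by
    funext i
    induction i using idx_cases with
    | h1 => rw [unipotent_mulVec_first]; simp
    | h2 j => rw [unipotent_mulVec_mid]; simp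
    | h3 => rw [unipotent_mulVec_last]
  have h2 : leviMatrix y c A *ᵥ Pi.single Idx.first 1 =
      ((Real.exp y : F) * c) • Pi.single Idx.first (1 : F) := by
    funext i
    induction i using idx_cases with
    | h1 => rw [leviMatrix_mulVec_first]; simp
    | h2 j => rw [leviMatrix_mulVec_mid]; simp
    | h3 => rw [leviMatrix_mulVec_last]; simp
  have h3 : leviMatrix y c A *ᵥ Pi.single Idx.last 1 =
      ((Real.exp (-y) : F) * c) • Pi.single Idx.last (1 : F) := by
    funext i
    induction i using idx_cases with
    | h1 => rw [leviMatrix_mulVec_first]; simp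
    | h2 j => rw [leviMatrix_mulVec_mid]; simp
    | h3 => rw [leviMatrix_mulVec_last]; simp
  have hM : ∀ v, loxodromicMatrix x 0 y c A *ᵥ (unipotent x 0 *ᵥ v) =
      unipotent x 0 *ᵥ (leviMatrix y c A *ᵥ v) := fun v => by
    rw [loxodromicMatrix, Matrix.mulVec_mulVec, neg_zero, mul_assoc, hinv, mul_one,
      Matrix.mulVec_mulVec]
  refine ⟨unipotent x 0 *ᵥ Pi.single Idx.first 1, unipotent x 0 *ᵥ Pi.single Idx.last 1, c,
    h.pos, hc, ?_, ?_, ?_, ?_, ?_⟩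
  · rw [hermForm_unipotent_mulVec]; simp [hermForm]
  · rw [hermForm_unipotent_mulVec]; simp [hermForm]
  · rw [hermForm_unipotent_mulVec]; simp [hermForm]
  · rw [hact, hM, h2, Matrix.mulVec_smul]
  · rw [hact, hM, h3, Matrix.mulVec_smul]

theorem cosh_sub_one_le_norm_corner (h : IsLoxodromicMatrix g x y) {j : ℤ} (hj : j ≠ 0) :
    Real.cosh y - 1 ≤ ‖corner (g ^ j)‖ := by
  obtain ⟨c, A, hc, hA, hg⟩ := h.zpow j
  have h1 := cosh_sub_one_mul_le_norm x (j * y) hc hA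
  rw [corner, hg]
  have h2 : Real.cosh y ≤ Real.cosh (j * y) := by
    rw [Real.cosh_le_cosh, abs_mul]
    have : (1 : ℝ) ≤ |(j : ℝ)| := by exact_mod_cast Int.one_le_abs hj
    exact le_mul_of_one_le_left (abs_nonneg y) this
  have h3 := Real.one_le_cosh y
  nlinarith [h.one_le]

theorem norm_corner_le (h : IsLoxodromicMatrix g x y) {t : ℝ} (ht : 0 < t) (ht' : t ≤ 1 / 32)
    (j : ℤ) : ‖corner (g ^ j)‖ ≤
      t * (32 / 31 * (‖hermForm (basePoint F k t) (g ^ j • basePoint F k t)‖ + 1)) := by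
  obtain ⟨c, A, hc, hA, hg⟩ := h.zpow j
  have hact : g ^ j • basePoint F k t = loxodromicMatrix x 0 (j * y) c A *ᵥ basePoint F k t := by
    rw [← hg]; rfl
  rw [corner, hg, hact]
  exact (_root_.norm_corner_le x (j * y) hc hA ht (by linarith [h.one_le])).1

/-- A corner of at least `128 t` gives displacement at least `64`. The element `b` moves `p` in the
direction of the `i`-th middle vector; the pairing of `g^j • p` with that vector is of size
`√(e^(-jy) ‖corner‖ / t)`, which is at most half the displacement. Hence the `sinh` term cannot
cancel the `cosh` term in `Ψ(g^j p, b^j' p)`. -/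
theorem pingPong (h : IsLoxodromicMatrix g x y) {t : ℝ} (ht : 0 < t)
    (ht' : t ≤ 1 / 32) (hτ : ∀ j : ℤ, j ≠ 0 → 128 * t ≤ ‖corner (g ^ j)‖) (i : Fin k) {b : G}
    {u : ℝ} (hu : 64 ≤ Real.cosh u)
    (hb : ∀ j : ℤ, b ^ j • basePoint F k t = (Real.cosh (j * u) : F) • basePoint F k t +
      (Real.sinh (j * u) : F) • Pi.single (Idx.mid i) 1) :
    PingPong (basePoint F k t) (Subgroup.zpowers g) (Subgroup.zpowers b) := by
  set p := basePoint F k t with hp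
  have hfr := isFrame_basePoint (F := F) ht i
  rw [← hp] at hfr
  have hbn : ∀ j : ℤ, ‖hermForm p (b ^ j • p)‖ = Real.cosh (j * u) := fun j => by
    rw [hb, hermForm_add_right, hermForm_smul_right, hermForm_smul_right, hfr.pos, hfr.orth,
      mul_one, mul_zero, add_zero, RCLike.norm_ofReal, abs_of_pos (Real.cosh_pos _)]
  have hne : ∀ (a : G) (j : ℤ), a ^ j ≠ 1 → j ≠ 0 := by
    rintro a _ hj rfl
    exact hj (zpow_zero a)
  have hmain : ∀ j : ℤ, j ≠ 0 → 64 ≤ ‖hermForm p (g ^ j • p)‖ ∧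
      ‖hermForm (g ^ j • p) (Pi.single (Idx.mid i) 1)‖ ≤ ‖hermForm p (g ^ j • p)‖ / 2 := by
    intro j hj
    obtain ⟨c, A, hc, hA, hg⟩ := h.zpow j
    have hact : g ^ j • p = loxodromicMatrix x 0 (j * y) c A *ᵥ p := by rw [← hg]; rfl
    obtain ⟨h1, h2⟩ := _root_.norm_corner_le x (j * y) hc hA ht (by linarith [h.one_le])
    have h3 := norm_sq_mid_last_le x (j * y) hc hA i
    have h4 := hτ j hj
    rw [corner, hg] at h4
    have h6 := Real.cosh_eq (j * y)
    have h7 := Real.exp_pos (j * y)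
    rw [hact]
    rw [hp, hermForm_loxodromicMatrix_basePoint_single, ← hp, norm_neg, norm_star, norm_mul,
      RCLike.norm_ofReal]
    rw [← hp] at h1
    set N := ‖hermForm p (loxodromicMatrix x 0 (j * y) c A *ᵥ p)‖
    set T := ‖loxodromicMatrix x 0 (j * y) c A Idx.first Idx.last‖ / t with hT
    set E := Real.exp (-(j * y))
    set W := ‖loxodromicMatrix x 0 (j * y) c A (Idx.mid i) Idx.last‖
    have e1 : ‖loxodromicMatrix x 0 (j * y) c A Idx.first Idx.last‖ = t * T := by
      rw [hT]; field_simp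
    rw [e1] at h1 h3 h4
    have h8 : 128 ≤ T := by nlinarith
    have h9 : T ≤ 32 / 31 * (N + 1) := le_of_mul_le_mul_left h1 ht
    have h10 : E ≤ 2 * (1 + T / 32) := by linarith
    refine ⟨by linarith, ?_⟩
    have h11 : (W * |(√t)⁻¹|) ^ 2 ≤ 2 * E * T := by
      rw [mul_pow, sq_abs, inv_pow, Real.sq_sqrt ht.le, ← div_eq_mul_inv, div_le_iff₀ ht]
      linarith
    have h12 : 2 * E * T ≤ (N / 2) ^ 2 := by
      have : E * T ≤ 2 * (1 + T / 32) * T := mul_le_mul_of_nonneg_right h10 (by linarith)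
      nlinarith
    exact abs_le_of_sq_le_sq' (h11.trans h12) (by linarith) |>.2
  refine ⟨?_, ?_, ?_⟩
  · rintro _ ⟨j, rfl⟩ hj
    exact (hmain j (hne g j hj)).1
  · rintro _ ⟨j, rfl⟩ hj
    refine hu.trans ?_
    simp only [hbn]
    rw [Real.cosh_le_cosh, abs_mul]
    have : (1 : ℝ) ≤ |(j : ℝ)| := by exact_mod_cast Int.one_le_abs (hne b j hj)
    exact le_mul_of_one_le_left (abs_nonneg u) this
  · rintro _ ⟨j, rfl⟩ hj _ ⟨j', rfl⟩ hj'
    simp only [hbn]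
    obtain ⟨h1, h2⟩ := hmain j (hne g j hj)
    rw [hb, hermForm_add_right, hermForm_smul_right, hermForm_smul_right]
    have h3 := norm_sub_norm_le ((Real.cosh (j' * u) : F) * hermForm (g ^ j • p) p)
      (-((Real.sinh (j' * u) : F) * hermForm (g ^ j • p) (Pi.single (Idx.mid i) 1)))
    rw [sub_neg_eq_add, norm_neg, norm_mul, norm_mul, RCLike.norm_ofReal, RCLike.norm_ofReal,
      abs_of_pos (Real.cosh_pos _), norm_hermForm_comm (g ^ j • p) p] at h3
    have h4 : |Real.sinh (j' * u)| ≤ Real.cosh (j' * u) := by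
      refine abs_le_of_sq_le_sq ?_ (Real.cosh_pos _).le
      linarith [Real.cosh_sq (j' * u)]
    have h5 : |Real.sinh (j' * u)| * ‖hermForm (g ^ j • p) (Pi.single (Idx.mid i) 1)‖ ≤
        Real.cosh (j' * u) * (‖hermForm p (g ^ j • p)‖ / 2) :=
      mul_le_mul h4 h2 (norm_nonneg _) (Real.cosh_pos _).le
    linarith

end IsLoxodromicMatrix

theorem continuous_corner : Continuous (corner : G → F) := by
  have h : Continuous fun g : G => g.1.1 := continuous_subtype_val.comp continuous_subtype_val
  exact (continuous_apply _).comp ((continuous_apply _).comp h)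

/-- Ping-pong is needed for every `n ≥ 1`, but the uniform bound `κ` holds only eventually. For an
exceptional `n` the height, and with it the second generator, is chosen from the translation length
of `s n` alone; from some index on both are constant. -/
theorem exists_freeGroup_representations (i : Fin k) (hG : G ≤ unitaryGroup F k)
    (htr : ∀ (p e : Idx k → F) (h : IsFrame p e) (u : ℝ), h.translation u ∈ G)
    {s : ℕ → G} {x : ℕ → Fin k → F} {y : ℕ → ℝ}
    (hs : ∀ n, 1 ≤ n → IsLoxodromicMatrix (s n) (x n) (y n)) {κ : ℝ} (hκ : 0 < κ)
    (hev : ∀ᶠ n in atTop, ∀ j : ℤ, j ≠ 0 → κ ≤ ‖corner (s n ^ j)‖) :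
    ∃ (t : ℝ) (b : G) (ρ : ℕ → FreeGroup (Fin 2) →* G), 0 < t ∧ t ≤ 1 / 32 ∧
      (∀ j : ℤ, b ^ j = 1 → j = 0) ∧
      (∀ B : ℝ, {j : ℤ | ‖hermForm (basePoint F k t) (b ^ j • basePoint F k t)‖ ≤ B}.Finite) ∧
      (∀ n, 1 ≤ n → ρ n (FreeGroup.of 0) = s n ∧ IsConvexCocompact (ρ n) ∧
        IsConvexCocompact (restrictToA (ρ n))) ∧
      ∀ᶠ n in atTop, ρ n (FreeGroup.of 1) = b ∧
        PingPong (basePoint F k t) (Subgroup.zpowers (s n)) (Subgroup.zpowers b) := by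
  classical
  have hk : 1 ≤ k := i.pos
  -- `cosh (log 128) ≥ 64`, the constant required by ping-pong.
  set u := Real.log 128 with hu
  have hu0 : 0 < u := Real.log_pos (by norm_num)
  have hcosh : 64 ≤ Real.cosh u := by
    rw [Real.cosh_eq, hu, Real.exp_log (by norm_num)]
    have := Real.exp_pos (-Real.log 128)
    linarith
  have hb : ∀ t : ℝ, ∃ b : G, 0 < t → ∃ ξ η, IsLoxodromic b ξ η u 1 ∧ ∀ j : ℤ,
      b ^ j • basePoint F k t = (Real.cosh (j * u) : F) • basePoint F k t +
        (Real.sinh (j * u) : F) • Pi.single (Idx.mid i) 1 := by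
    intro t
    by_cases ht : 0 < t
    · exact ⟨⟨_, htr _ _ (isFrame_basePoint ht i) u⟩, fun _ =>
        (isFrame_basePoint ht i).exists_isLoxodromic hu0 rfl⟩
    · exact ⟨1, fun h => absurd h ht⟩
  choose β hβ using hb
  -- The bound `1/32` is the height condition relative to `‖x‖² ≥ 1`, and `κ/128` turns the corner
  -- bound into displacement `64`.
  set t₀ := min (1 / 32) (κ / 128) with ht₀
  set t : ℕ → ℝ := fun n => if ∀ j : ℤ, j ≠ 0 → κ ≤ ‖corner (s n ^ j)‖ then t₀ else
    min (1 / 32) ((Real.cosh (y n) - 1) / 128) with ht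
  have ht₀pos : 0 < t₀ := by positivity
  have htn : ∀ n, 1 ≤ n → 0 < t n ∧ t n ≤ 1 / 32 ∧
      ∀ j : ℤ, j ≠ 0 → 128 * t n ≤ ‖corner (s n ^ j)‖ := by
    intro n hn
    simp only [ht]
    split_ifs with h
    · refine ⟨ht₀pos, min_le_left _ _, fun j hj => ?_⟩
      have := min_le_right (1 / 32) (κ / 128)
      linarith [h j hj]
    · have h1 := Real.one_lt_cosh.mpr (hs n hn).pos.ne'
      refine ⟨lt_min (by norm_num) (by linarith), min_le_left _ _, fun j hj => ?_⟩
      have := min_le_right (1 / 32) ((Real.cosh (y n) - 1) / 128)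
      linarith [(hs n hn).cosh_sub_one_le_norm_corner hj]
  have hPP : ∀ n, 1 ≤ n → PingPong (basePoint F k (t n)) (Subgroup.zpowers (s n))
      (Subgroup.zpowers (β (t n))) := by
    intro n hn
    obtain ⟨h1, h2, h3⟩ := htn n hn
    obtain ⟨ξ, η, -, hact⟩ := hβ _ h1
    exact (hs n hn).pingPong h1 h2 h3 i hcosh hact
  have hp : ∀ r : ℝ, 0 < r → hermForm (basePoint F k r) (basePoint F k r) = 1 := fun r hr =>
    (isFrame_basePoint hr i).pos
  obtain ⟨ξ₀, η₀, hlox₀, hact₀⟩ := hβ t₀ ht₀pos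
  refine ⟨t₀, β t₀, fun n => FreeGroup.lift ![s n, β (t n)], ht₀pos, min_le_left _ _,
    fun j hj => hlox₀.zpow_eq_one_iff.mp hj, hlox₀.finite_norm_le hG (hp t₀ ht₀pos),
    fun n hn => ⟨by simp, ?_, ?_⟩, ?_⟩
  · obtain ⟨ξ, η, hlox, -⟩ := hβ _ (htn n hn).1
    obtain ⟨ξ', η', c, hlox'⟩ := (hs n hn).exists_isLoxodromic
    exact (hPP n hn).isConvexCocompact hk hG (hp _ (htn n hn).1) hlox' hlox _ (by simp) (by simp)
  · obtain ⟨ξ', η', c, hlox'⟩ := (hs n hn).exists_isLoxodromic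
    exact hlox'.isConvexCocompact hk hG (hp _ (htn n hn).1) _ fun m => by
      simp [restrictToA, zpowersHom_apply]
  · filter_upwards [hev, eventually_ge_atTop 1] with n hn hn1
    have h1 : t n = t₀ := by simp only [ht, if_pos hn]
    have h2 := hPP n hn1
    rw [h1] at h2
    exact ⟨by simp [h1], h2⟩

/-- The analogue of `PowersConverge` in which the size of the elements is measured by their corner
entries. -/
structure CornersConverge (s : ℕ → G) (m : ℕ → (Fin (l + 1) → ℤ) →+ ℤ)
    (L : Multiplicative (Fin (l + 1) → ℤ) →* G) : Prop where
  apply_single : ∀ n, m n (Pi.single 0 1) = 1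
  tendsto : ∀ w, Tendsto (fun n => s n ^ m n w) atTop (𝓝 (L (Multiplicative.ofAdd w)))
  corner_ne_zero : ∀ w, w ≠ 0 → corner (L (Multiplicative.ofAdd w)) ≠ 0
  finite : ∀ B : ℝ, ∃ W : Set (Fin (l + 1) → ℤ), W.Finite ∧ ∀ᶠ n in atTop, ∀ j : ℤ,
    ‖corner (s n ^ j)‖ ≤ B → ∃ w ∈ W, j = m n w

namespace CornersConverge

variable {s : ℕ → G} {m : ℕ → (Fin (l + 1) → ℤ) →+ ℤ} {L : Multiplicative (Fin (l + 1) → ℤ) →* G}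

/-- For large `n`, the powers with corner at most `1` have exponents `m n w` with `w` in a fixed
finite set, and each nonzero `w` has a nonzero limiting corner. -/
theorem exists_le (h : CornersConverge s m L) :
    ∃ κ : ℝ, 0 < κ ∧ ∀ᶠ n in atTop, ∀ j : ℤ, j ≠ 0 → κ ≤ ‖corner (s n ^ j)‖ := by
  obtain ⟨W, hW, hev⟩ := h.finite 1
  obtain ⟨κ, hκ, hκW⟩ : ∃ κ : ℝ, 0 < κ ∧ ∀ w ∈ W, w ≠ 0 →
      κ < ‖corner (L (Multiplicative.ofAdd w))‖ := by
    have hfin : (W \ {0}).Finite := hW.subset Set.sdiff_subset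
    obtain ⟨κ, hκ, h1⟩ := (hfin.eventually_all (l := 𝓝[>] (0 : ℝ))
      (p := fun w κ => κ < ‖corner (L (Multiplicative.ofAdd w))‖)).mpr (fun w hw => by
        have := norm_pos_iff.mpr (h.corner_ne_zero w hw.2)
        exact nhdsWithin_le_nhds (eventually_lt_nhds this)) |>.and
          (eventually_mem_nhdsWithin) |>.exists
    exact ⟨κ, h1, fun w hw hw0 => hκ w ⟨hw, hw0⟩⟩
  have hlim : ∀ᶠ n in atTop, ∀ w ∈ W, w ≠ 0 → κ < ‖corner (s n ^ m n w)‖ := by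
    rw [Filter.eventually_all_finite hW]
    intro w hw
    by_cases hw0 : w = 0
    · exact Eventually.of_forall fun n h0 => absurd hw0 h0
    · have := ((continuous_corner.norm.tendsto _).comp (h.tendsto w)).eventually_const_lt
        (hκW w hw hw0)
      filter_upwards [this] with n hn _ using hn
  refine ⟨min κ 1, by positivity, ?_⟩
  filter_upwards [hev, hlim] with n h1 h2 j hj
  by_contra! hlt
  obtain ⟨w, hw, rfl⟩ := h1 j (hlt.le.trans (min_le_right _ _))
  have hw0 : w ≠ 0 := by
    rintro rfl
    exact hj (map_zero _)
  have := h2 w hw hw0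
  linarith [min_le_left κ 1]

theorem powersConverge (h : CornersConverge s m L) {x : ℕ → Fin k → F} {y : ℕ → ℝ}
    (hs : ∀ᶠ n in atTop, IsLoxodromicMatrix (s n) (x n) (y n)) {t : ℝ} (ht : 0 < t)
    (ht' : t ≤ 1 / 32) : PowersConverge (basePoint F k t) s m L where
  apply_single := h.apply_single
  tendsto := h.tendsto
  injective := by
    rw [injective_iff_map_eq_one]
    intro w hw
    by_contra hne
    refine h.corner_ne_zero w.toAdd hne ?_
    rw [ofAdd_toAdd, hw]
    simp [corner]
  finite := fun B => by
    obtain ⟨W, hW, hev⟩ := h.finite (t * (32 / 31 * (B + 1)))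
    refine ⟨W, hW, ?_⟩
    filter_upwards [hev, hs] with n h1 h2 j hj
    obtain ⟨w, hw, rfl⟩ := h1 j ((h2.norm_corner_le ht ht' j).trans (by gcongr))
    exact ⟨w, hw, rfl⟩

end CornersConverge

end Sequence

/-! ### Asymptotics of exponentials -/

section Asymptotics

variable {N : ℕ → ℝ}

theorem tendsto_zero_of_tendsto_mul (hN : Tendsto N atTop atTop) {z : ℕ → ℂ} {Z : ℂ}
    (hz : Tendsto (fun n => (N n : ℂ) * z n) atTop (𝓝 Z)) : Tendsto z atTop (𝓝 0) := by
  have h1 : Tendsto (fun n => ((N n)⁻¹ : ℂ)) atTop (𝓝 0) := by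
    have := (Complex.continuous_ofReal.tendsto 0).comp (tendsto_inv_atTop_zero.comp hN)
    simpa [Function.comp_def] using this
  have h2 := h1.mul hz
  rw [zero_mul] at h2
  refine h2.congr' ?_
  filter_upwards [hN.eventually_gt_atTop 0] with n hn
  have : (N n : ℂ) ≠ 0 := by exact_mod_cast hn.ne'
  field_simp

/-- Corner entries carry the factor `N²`, so the second-order term of the exponential survives. The
third-order error is at most `‖N z‖² ‖z‖`, which tends to zero. -/
theorem tendsto_sq_mul_exp_sub (hN : Tendsto N atTop atTop) {z : ℕ → ℂ} {Z : ℂ}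
    (hz : Tendsto (fun n => (N n : ℂ) * z n) atTop (𝓝 Z)) :
    Tendsto (fun n => (N n : ℂ) ^ 2 * (Complex.exp (z n) - 1 - z n)) atTop (𝓝 (Z ^ 2 / 2)) := by
  have h0 := tendsto_zero_of_tendsto_mul hN hz
  have h1 : Tendsto (fun n => (N n : ℂ) ^ 2 * (Complex.exp (z n) - 1 - z n) -
      ((N n : ℂ) * z n) ^ 2 / 2) atTop (𝓝 0) := by
    have h2 : Tendsto (fun n => ‖(N n : ℂ) * z n‖ ^ 2 * ‖z n‖) atTop (𝓝 0) := by
      simpa using (hz.norm.pow 2).mul h0.norm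
    refine squeeze_zero_norm' ?_ h2
    have h3 : ∀ᶠ n in atTop, ‖z n‖ ≤ 1 := by
      have := h0.norm
      rw [norm_zero] at this
      exact (this.eventually_lt_const zero_lt_one).mono fun n hn => hn.le
    filter_upwards [h3] with n hn
    have h4 := Complex.exp_bound hn (n := 3) (by norm_num)
    have h5 : ‖Complex.exp (z n) - 1 - z n - z n ^ 2 / 2‖ ≤ ‖z n‖ ^ 3 := by
      rw [Finset.sum_range_succ, Finset.sum_range_succ, Finset.sum_range_one] at h4
      norm_num [Nat.factorial] at h4
      calc _ = ‖Complex.exp (z n) - (1 + z n + z n ^ 2 / 2)‖ := by congr 1; ring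
        _ ≤ _ := h4
        _ ≤ _ := by nlinarith [pow_nonneg (norm_nonneg (z n)) 3]
    have h6 : (N n : ℂ) ^ 2 * (Complex.exp (z n) - 1 - z n) - ((N n : ℂ) * z n) ^ 2 / 2 =
        (N n : ℂ) ^ 2 * (Complex.exp (z n) - 1 - z n - z n ^ 2 / 2) := by ring
    rw [h6, norm_mul, norm_mul, norm_pow, mul_pow]
    calc _ ≤ ‖(N n : ℂ)‖ ^ 2 * ‖z n‖ ^ 3 := by gcongr
      _ = _ := by ring
  have h7 := h1.add ((hz.pow 2).div_const 2)
  simpa using h7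

theorem tendsto_mul_exp_sub_one (hN : Tendsto N atTop atTop) {z : ℕ → ℂ} {Z : ℂ}
    (hz : Tendsto (fun n => (N n : ℂ) * z n) atTop (𝓝 Z)) :
    Tendsto (fun n => (N n : ℂ) * (Complex.exp (z n) - 1)) atTop (𝓝 Z) := by
  have h1 : Tendsto (fun n => ((N n)⁻¹ : ℂ)) atTop (𝓝 0) := by
    have := (Complex.continuous_ofReal.tendsto 0).comp (tendsto_inv_atTop_zero.comp hN)
    simpa [Function.comp_def] using this
  have h2 := (h1.mul (tendsto_sq_mul_exp_sub hN hz)).add hz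
  rw [zero_mul, zero_add] at h2
  refine h2.congr' ?_
  filter_upwards [hN.eventually_gt_atTop 0] with n hn
  have : (N n : ℂ) ≠ 0 := by exact_mod_cast hn.ne'
  field_simp
  ring

variable {u Y : ℕ → ℝ} {U V : ℝ}

theorem tendsto_ofReal_mul {z : ℕ → ℝ} {Z : ℝ} (hz : Tendsto (fun n => N n * z n) atTop (𝓝 Z)) :
    Tendsto (fun n => (N n : ℂ) * (z n : ℂ)) atTop (𝓝 (Z : ℂ)) := by
  simpa [Function.comp_def] using (Complex.continuous_ofReal.tendsto _).comp hz

theorem tendsto_ofReal_mul_I {z : ℕ → ℝ} {Z : ℝ} (hz : Tendsto (fun n => N n * z n) atTop (𝓝 Z)) :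
    Tendsto (fun n => (N n : ℂ) * ((z n : ℂ) * Complex.I)) atTop (𝓝 ((Z : ℂ) * Complex.I)) := by
  simpa [mul_assoc] using (tendsto_ofReal_mul hz).mul_const Complex.I

theorem tendsto_mul_real_exp_sub_one (hN : Tendsto N atTop atTop)
    (hY : Tendsto (fun n => N n * Y n) atTop (𝓝 V)) :
    Tendsto (fun n => N n * (Real.exp (Y n) - 1)) atTop (𝓝 V) := by
  have h := (Complex.continuous_re.tendsto _).comp
    (tendsto_mul_exp_sub_one hN (tendsto_ofReal_mul hY))
  refine h.congr fun n => ?_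
  simp only [Function.comp_apply]
  rw [← Complex.ofReal_exp, ← Complex.ofReal_one, ← Complex.ofReal_sub, ← Complex.ofReal_mul,
    Complex.ofReal_re]

theorem tendsto_sq_mul_cosh_sub_one (hN : Tendsto N atTop atTop)
    (hY : Tendsto (fun n => N n * Y n) atTop (𝓝 V)) :
    Tendsto (fun n => N n ^ 2 * (Real.cosh (Y n) - 1)) atTop (𝓝 (V ^ 2 / 2)) := by
  have hY' : Tendsto (fun n => N n * -Y n) atTop (𝓝 (-V)) := by simpa using hY.neg
  have h := (Complex.continuous_re.tendsto _).comp
    (((tendsto_sq_mul_exp_sub hN (tendsto_ofReal_mul hY)).add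
      (tendsto_sq_mul_exp_sub hN (tendsto_ofReal_mul hY'))).div_const 2)
  have e : (((V : ℂ) ^ 2 / 2 + ((-V : ℝ) : ℂ) ^ 2 / 2) / 2).re = V ^ 2 / 2 := by
    rw [show (((V : ℂ) ^ 2 / 2 + ((-V : ℝ) : ℂ) ^ 2 / 2) / 2) = ((V ^ 2 / 2 : ℝ) : ℂ) by
      push_cast; ring, Complex.ofReal_re]
  rw [e] at h
  refine h.congr fun n => ?_
  simp only [Function.comp_apply]
  rw [← Complex.ofReal_re (N n ^ 2 * (Real.cosh (Y n) - 1)), Real.cosh_eq]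
  congr 1
  push_cast
  ring

theorem tendsto_mul_sin (hN : Tendsto N atTop atTop)
    (hu : Tendsto (fun n => N n * u n) atTop (𝓝 U)) :
    Tendsto (fun n => N n * Real.sin (u n)) atTop (𝓝 U) := by
  have h := (Complex.continuous_im.tendsto _).comp
    (tendsto_mul_exp_sub_one hN (tendsto_ofReal_mul_I hu))
  simpa [Function.comp_def, Complex.exp_ofReal_mul_I_im] using h

theorem tendsto_mul_cos_sub_one (hN : Tendsto N atTop atTop)
    (hu : Tendsto (fun n => N n * u n) atTop (𝓝 U)) :
    Tendsto (fun n => N n * (Real.cos (u n) - 1)) atTop (𝓝 0) := by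
  have h := (Complex.continuous_re.tendsto _).comp
    (tendsto_mul_exp_sub_one hN (tendsto_ofReal_mul_I hu))
  simpa [Function.comp_def, Complex.exp_ofReal_mul_I_re] using h

theorem tendsto_sq_mul_cos_sub_one (hN : Tendsto N atTop atTop)
    (hu : Tendsto (fun n => N n * u n) atTop (𝓝 U)) :
    Tendsto (fun n => N n ^ 2 * (Real.cos (u n) - 1)) atTop (𝓝 (-(U ^ 2 / 2))) := by
  have h := (Complex.continuous_re.tendsto _).comp
    (tendsto_sq_mul_exp_sub hN (tendsto_ofReal_mul_I hu))
  have e : (((U : ℂ) * Complex.I) ^ 2 / 2).re = -(U ^ 2 / 2) := by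
    rw [mul_pow, Complex.I_sq, show (U : ℂ) ^ 2 * -1 / 2 = ((-(U ^ 2 / 2) : ℝ) : ℂ) by
      push_cast; ring, Complex.ofReal_re]
  rw [e] at h
  refine h.congr fun n => ?_
  simp only [Function.comp_apply]
  rw [← Complex.ofReal_pow, Complex.re_ofReal_mul]
  simp [Complex.exp_ofReal_mul_I_re]

end Asymptotics

/-! ### Digits -/

section Digits

/-- The sum of the digits below position `p`, divided by `x ^ p`. -/
noncomputable def lowerSum (A : ℕ → ℝ) (p : ℕ) (x : ℝ) : ℝ :=
  (∑ i ∈ Finset.range p, A i * x ^ i) / x ^ p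

/-- Only the top digit survives: the digit of index `i < p` contributes `A i / N^(p - i)`. -/
theorem tendsto_mul_lowerSum {N : ℕ → ℝ} (hN : Tendsto N atTop atTop) (A : ℕ → ℝ) (p : ℕ) :
    Tendsto (fun n => N n * lowerSum A (p + 1) (N n)) atTop (𝓝 (A p)) := by
  have h1 : Tendsto (fun n => ∑ i ∈ Finset.range p, A i * (N n)⁻¹ ^ (p - i)) atTop (𝓝 0) := by
    have hinv := tendsto_inv_atTop_zero.comp hN
    rw [← Finset.sum_const_zero (s := Finset.range p)]
    refine tendsto_finsetSum _ fun i hi => ?_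
    have : p - i ≠ 0 := by have := Finset.mem_range.mp hi; omega
    simpa [this] using (hinv.pow (p - i)).const_mul (A i)
  have h2 := h1.add_const (A p)
  rw [zero_add] at h2
  refine h2.congr' ?_
  filter_upwards [hN.eventually_gt_atTop 0] with n hn
  have hn' := hn.ne'
  rw [lowerSum, Finset.sum_range_succ, pow_succ, ← mul_div_assoc, mul_comm (N n ^ p),
    mul_div_mul_left _ _ hn', add_div, Finset.sum_div, mul_div_cancel_right₀ _ (by positivity)]
  congr 1
  refine Finset.sum_congr rfl fun i hi => ?_
  have hip : i ≤ p := (Finset.mem_range.mp hi).le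
  have e : N n ^ p = N n ^ (p - i) * N n ^ i := by rw [← pow_add, Nat.sub_add_cancel hip]
  rw [e, inv_pow]
  field_simp

theorem sum_div_pow_eq_lowerSum_add (A : ℕ → ℝ) {x : ℝ} (hx : x ≠ 0) {p l : ℕ} (hp : p ≤ l) :
    (∑ i ∈ Finset.range l, A i * x ^ i) / x ^ p =
      lowerSum A p x + ∑ i ∈ Finset.Ico p l, A i * x ^ (i - p) := by
  rw [← Finset.sum_range_add_sum_Ico _ hp, add_div, lowerSum, Finset.sum_div (Finset.Ico p l)]
  congr 1
  refine Finset.sum_congr rfl fun i hi => ?_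
  rw [mul_div_assoc, pow_sub₀ _ hx (Finset.mem_Ico.mp hi).1, div_eq_mul_inv]

/-- Division with small remainders: if `q` is an integer within `B / n` of `j / n`, then the
remainder `j - n q` is a digit bounded by `B`, however large `n` is. The quotient `q` satisfies the
same hypotheses with `2 B`, because `q / n^i` and `j / n^(i+1)` differ by at most `B / n`; the `l`
doublings give `2^l`. -/
theorem exists_digits (l : ℕ) : ∀ (B : ℝ) (n : ℕ) (j : ℤ), 1 ≤ n → |(j : ℝ)| ≤ B * n ^ l →
    (∀ i, 1 ≤ i → i ≤ l → ∃ z : ℤ, |(j : ℝ) / n ^ i - z| ≤ B / n) →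
    ∃ a : ℕ → ℤ, (∀ i, |(a i : ℝ)| ≤ 2 ^ l * B) ∧ j = ∑ i ∈ Finset.range (l + 1), a i * n ^ i := by
  induction l with
  | zero =>
    intro B n j _ hj _
    exact ⟨fun _ => j, fun _ => by simpa using hj, by simp⟩
  | succ l ih =>
    intro B n j hn hj hd
    have hn0 : (0 : ℝ) < n := by exact_mod_cast hn
    have hn1 : (1 : ℝ) ≤ n := by exact_mod_cast hn
    have hB : 0 ≤ B := by
      have h1 := (abs_nonneg _).trans hj
      have h2 : (0 : ℝ) < (n : ℝ) ^ (l + 1) := by positivity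
      exact nonneg_of_mul_nonneg_left h1 h2
    obtain ⟨q, hq⟩ := hd 1 le_rfl (by omega)
    set d : ℤ := j - n * q with hdef
    have hda : |(d : ℝ)| ≤ B := by
      have : (d : ℝ) = n * ((j : ℝ) / n ^ 1 - q) := by rw [hdef]; push_cast; field_simp
      rw [this, abs_mul, abs_of_pos hn0]
      rw [le_div_iff₀ hn0] at hq
      linarith
    have hqj : (q : ℝ) = (j - d) / n := by rw [hdef]; push_cast; field_simp; ring
    have hq1 : |(q : ℝ)| ≤ 2 * B * n ^ l := by
      rw [hqj, abs_div, abs_of_pos hn0, div_le_iff₀ hn0]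
      have h1 := abs_sub (j : ℝ) d
      have h2 : B * 1 ≤ B * (n : ℝ) ^ (l + 1) :=
        mul_le_mul_of_nonneg_left (one_le_pow₀ hn1) hB
      calc |(j : ℝ) - d| ≤ B * n ^ (l + 1) + B * n ^ (l + 1) := by linarith
        _ = 2 * B * n ^ l * n := by ring
    have hq2 : ∀ i, 1 ≤ i → i ≤ l → ∃ z : ℤ, |(q : ℝ) / n ^ i - z| ≤ 2 * B / n := by
      intro i hi1 hil
      obtain ⟨z, hz⟩ := hd (i + 1) (by omega) (by omega)
      refine ⟨z, ?_⟩
      have e : (q : ℝ) / n ^ i - z = ((j : ℝ) / n ^ (i + 1) - z) - d / n ^ (i + 1) := by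
        rw [hqj]; field_simp; ring
      have h1 : |(d : ℝ) / n ^ (i + 1)| ≤ B / n := by
        rw [abs_div, abs_of_pos (by positivity : (0 : ℝ) < (n : ℝ) ^ (i + 1))]
        refine div_le_div₀ hB hda hn0 ?_
        exact le_self_pow₀ hn1 (by omega)
      rw [e]
      refine (abs_sub _ _).trans ?_
      calc _ ≤ B / n + B / n := add_le_add hz h1
        _ = _ := by ring
    obtain ⟨a, ha1, ha2⟩ := ih (2 * B) n q hn hq1 hq2
    refine ⟨fun i => if i = 0 then d else a (i - 1), fun i => ?_, ?_⟩
    · have h2 : (1 : ℝ) ≤ 2 ^ (l + 1) := one_le_pow₀ (by norm_num)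
      dsimp only
      split_ifs
      · exact hda.trans (le_mul_of_one_le_left hB h2)
      · refine (ha1 _).trans (le_of_eq ?_)
        ring
    · rw [Finset.sum_range_succ']
      simp only [Nat.add_eq_zero_iff, one_ne_zero, and_false, if_false, Nat.add_sub_cancel,
        if_true, pow_zero, mul_one]
      have : ∑ i ∈ Finset.range (l + 1), a i * (n : ℤ) ^ (i + 1) = n * q := by
        rw [ha2, Finset.mul_sum]
        exact Finset.sum_congr rfl fun i _ => by ring
      rw [this, hdef]
      ring

theorem sq_div_two_le_cosh_sub_one (y : ℝ) : y ^ 2 / 2 ≤ Real.cosh y - 1 := by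
  have h1 : Real.cosh y = 1 + 2 * Real.sinh (y / 2) ^ 2 := by
    have := Real.cosh_two_mul (y / 2)
    rw [mul_div_cancel₀ _ (two_ne_zero), Real.cosh_sq] at this
    linarith
  have h2 : (y / 2) ^ 2 ≤ Real.sinh (y / 2) ^ 2 := by
    rw [sq_le_sq]
    rcases le_total 0 (y / 2) with h | h
    · rw [abs_of_nonneg h, abs_of_nonneg (Real.sinh_nonneg_iff.mpr h)]
      exact Real.self_le_sinh_iff.mpr h
    · rw [abs_of_nonpos h, abs_of_nonpos (Real.sinh_nonpos_iff.mpr h)]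
      exact neg_le_neg (Real.sinh_le_self_iff.mpr h)
  linarith

/-- The chord bound `1 - cos x ≥ 2x²/π²` on `[-π, π]`, applied after reducing `v` modulo `1`. It
converts bounded corners into angles close to full turns. -/
theorem eight_mul_sq_le_one_sub_cos (v : ℝ) :
    8 * (v - round v) ^ 2 ≤ 1 - Real.cos (2 * Real.pi * v) := by
  have h1 : Real.cos (2 * Real.pi * v) = Real.cos (2 * Real.pi * (v - round v)) := by
    rw [mul_sub, mul_comm (2 * Real.pi) (round v : ℝ), Real.cos_sub_int_mul_two_pi]
  have h2 : |2 * Real.pi * (v - round v)| ≤ Real.pi := by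
    rw [abs_mul, abs_of_pos Real.two_pi_pos]
    nlinarith [abs_sub_round v, Real.pi_pos]
  have h3 := Real.cos_le_one_sub_mul_cos_sq h2
  have h4 : 2 / Real.pi ^ 2 * (2 * Real.pi * (v - round v)) ^ 2 = 8 * (v - round v) ^ 2 := by
    have := Real.pi_ne_zero
    field_simp
    ring
  rw [h1]
  linarith

/-- A bound for `x² (1 - cos (2π v))` makes `v` close to an integer. -/
theorem exists_int_abs_sub_le {x B v : ℝ} (hx : 0 < x)
    (h : x ^ 2 * (1 - Real.cos (2 * Real.pi * v)) ≤ B) :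
    ∃ z : ℤ, |v - z| ≤ √B / x := by
  refine ⟨round v, ?_⟩
  rw [le_div_iff₀ hx]
  refine Real.le_sqrt_of_sq_le ?_
  rw [mul_pow, sq_abs]
  have := mul_le_mul_of_nonneg_left (eight_mul_sq_le_one_sub_cos v) (sq_nonneg x)
  nlinarith [sq_nonneg (v - round v), sq_nonneg ((v - round v) * x)]

theorem abs_le_of_sq_mul_cosh_sub_one_le {x B y : ℝ} (hx : 0 < x)
    (h : x ^ 2 * (Real.cosh y - 1) ≤ B) : |y| ≤ √(2 * B) / x := by
  rw [le_div_iff₀ hx]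
  refine Real.le_sqrt_of_sq_le ?_
  rw [mul_pow, sq_abs]
  have := mul_le_mul_of_nonneg_left (sq_div_two_le_cosh_sub_one y) (sq_nonneg x)
  linarith

end Digits

/-! ### From converging powers to representations of the free group -/

section Assembly

variable {F : Type*} [RCLike F] {k l : ℕ} {G : Subgroup (Matrix.SpecialLinearGroup (Idx k) F)}

theorem exists_cornersConverge
    (hG : IsClosed (G : Set (Matrix.SpecialLinearGroup (Idx k) F))) {s : ℕ → G}
    {m : ℕ → (Fin (l + 1) → ℤ) →+ ℤ} (h1 : ∀ n, m n (Pi.single 0 1) = 1)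
    (h2 : ∀ w, ∃ T : Matrix (Idx k) (Idx k) F,
      Tendsto (fun n => (s n ^ m n w).1.1) atTop (𝓝 T) ∧ (w ≠ 0 → T Idx.first Idx.last ≠ 0))
    (h3 : ∀ B : ℝ, ∃ W : Set (Fin (l + 1) → ℤ), W.Finite ∧ ∀ᶠ n in atTop, ∀ j : ℤ,
      ‖corner (s n ^ j)‖ ≤ B → ∃ w ∈ W, j = m n w) :
    ∃ L : Multiplicative (Fin (l + 1) → ℤ) →* G, CornersConverge s m L := by
  have hlim : ∀ w : Multiplicative (Fin (l + 1) → ℤ), ∃ g : G,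
      Tendsto (fun n => PowersConverge.hom s m n w) atTop (𝓝 g) ∧
        (w.toAdd ≠ 0 → corner g ≠ 0) := by
    intro w
    obtain ⟨T, hT, hne⟩ := h2 w.toAdd
    obtain ⟨g, rfl, hg⟩ := exists_tendsto_of_tendsto_val hG hT
    exact ⟨g, hg, hne⟩
  obtain ⟨L, hL⟩ := exists_monoidHom_of_tendsto (PowersConverge.hom s m) fun w =>
    (hlim w).imp fun g hg => hg.1
  refine ⟨L, h1, fun w => hL (Multiplicative.ofAdd w), fun w hw => ?_, h3⟩
  obtain ⟨g, hg, hne⟩ := hlim (Multiplicative.ofAdd w)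
  rw [tendsto_nhds_unique (hL _) hg]
  exact hne hw

theorem convergesAlgebraically_lift {Γ : Type*} [Group Γ] [TopologicalSpace Γ]
    [IsTopologicalGroup Γ] {ρ : ℕ → FreeGroup (Fin 2) →* Γ} {a b : Γ}
    (ha : Tendsto (fun n => ρ n (FreeGroup.of 0)) atTop (𝓝 a))
    (hb : ∀ᶠ n in atTop, ρ n (FreeGroup.of 1) = b) :
    ConvergesAlgebraically ρ (FreeGroup.lift ![a, b]) := by
  intro γ
  have hof : ∀ i : Fin 2, Tendsto (fun n => ρ n (FreeGroup.of i)) atTop (𝓝 (![a, b] i)) := by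
    intro i
    fin_cases i
    · exact ha
    · exact tendsto_const_nhds.congr' (hb.mono fun n hn => hn.symm)
  induction γ using FreeGroup.induction_on with
  | C1 => simp only [map_one]; exact tendsto_const_nhds
  | of i => simpa using hof i
  | inv_of i _ => simpa using (hof i).inv
  | mul x y hx hy => simp only [map_mul]; exact hx.mul hy

theorem CornersConverge.exists_representations {s : ℕ → G} {m : ℕ → (Fin (l + 1) → ℤ) →+ ℤ}
    {L : Multiplicative (Fin (l + 1) → ℤ) →* G} (h : CornersConverge s m L) (i : Fin k)
    (hl : 1 ≤ l) (hG : G ≤ unitaryGroup F k)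
    (htr : ∀ (p e : Idx k → F) (h : IsFrame p e) (u : ℝ), h.translation u ∈ G)
    {x : ℕ → Fin k → F} {y : ℕ → ℝ} (hs : ∀ n, 1 ≤ n → IsLoxodromicMatrix (s n) (x n) (y n)) :
    ∃ (ρ : ℕ → FreeGroup (Fin 2) →* G) (ρlim : FreeGroup (Fin 2) →* G),
      (∀ n, 1 ≤ n → IsConvexCocompact (ρ n)) ∧
      IsJorgensenSequence l (fun n => restrictToA (ρ n)) ∧
      (∀ n, 1 ≤ n → ρ n (FreeGroup.of 0) = s n) ∧
      ConvergesAlgebraically ρ ρlim ∧ HasFreeProductLimit l ρ ρlim := by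
  obtain ⟨κ, hκ, hev⟩ := h.exists_le
  obtain ⟨t, b, ρ, ht, ht', hb1, hb, hρ, hρb⟩ :=
    exists_freeGroup_representations i hG htr hs hκ hev
  have hpc := h.powersConverge ((eventually_ge_atTop 1).mono hs) ht ht'
  have hρs : ∀ᶠ n in atTop, ρ n (FreeGroup.of 0) = s n :=
    (eventually_ge_atTop 1).mono fun n hn => (hρ n hn).1
  have hs1 : Tendsto (fun n => ρ n (FreeGroup.of 0)) atTop
      (𝓝 (L (Multiplicative.ofAdd (Pi.single 0 1)))) := by
    refine (h.tendsto (Pi.single 0 1)).congr' (hρs.mono fun n hn => ?_)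
    rw [h.apply_single, zpow_one]
    exact hn.symm
  refine ⟨ρ, _, fun n hn => (hρ n hn).2.1, hpc.isJorgensenSequence (fun n hn j => ?_)
    fun n hn => (hρ n hn).2.2, fun n hn => (hρ n hn).1,
    convergesAlgebraically_lift hs1 (hρb.mono fun n hn => hn.1), ?_⟩
  · simp [restrictToA, zpowersHom_apply, (hρ n hn).1]
  · exact hpc.isFreeProductLimit hG (isFrame_basePoint ht i).pos hl (hρb.mono fun n hn => hn.2) hb1
      hb hρs (hρb.mono fun n hn => hn.1)
      ((eventually_ge_atTop 1).mono fun n hn => (hρ n hn).2.1.2.1) (by simp) (by simp)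

/-- The integer with digits `w` in base `n`. -/
def digitHom (l n : ℕ) : (Fin (l + 1) → ℤ) →+ ℤ where
  toFun w := ∑ t, w t * (n : ℤ) ^ (t : ℕ)
  map_zero' := by simp
  map_add' v w := by simp [add_mul, Finset.sum_add_distrib]

/-- The digits of `w` as a sequence of real numbers. -/
def digits (w : Fin (l + 1) → ℤ) (t : ℕ) : ℤ := if h : t < l + 1 then w ⟨t, h⟩ else 0

theorem digits_val (w : Fin (l + 1) → ℤ) (t : Fin (l + 1)) : digits w t = w t := by
  rw [digits, dif_pos t.2]

theorem digitHom_apply (n : ℕ) (w : Fin (l + 1) → ℤ) :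
    digitHom l n w = ∑ t ∈ Finset.range (l + 1), digits w t * (n : ℤ) ^ t := by
  rw [← Fin.sum_univ_eq_sum_range (fun t => digits w t * (n : ℤ) ^ t)]
  simp only [digits_val]
  rfl

theorem digitHom_single (l n : ℕ) : digitHom l n (Pi.single 0 1) = 1 := by
  change ∑ t, (Pi.single 0 1 : Fin (l + 1) → ℤ) t * (n : ℤ) ^ (t : ℕ) = 1
  simp [Pi.single_apply]

theorem finite_box (d : ℕ) (C : ℝ) : {w : Fin d → ℤ | ∀ t, |(w t : ℝ)| ≤ C}.Finite := by
  refine (Set.Finite.pi' (t := fun _ : Fin d => Set.Icc (-⌈C⌉) ⌈C⌉)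
    fun _ => Set.finite_Icc _ _).subset fun w hw t => ?_
  have h : |w t| ≤ ⌈C⌉ := by exact_mod_cast (hw t).trans (Int.le_ceil C)
  exact Set.mem_Icc.mpr (abs_le.mp h)

end Assembly

/-! ### Block rotations -/

section Rotation

variable {k : ℕ}

/-- The other index of the block of `p`. -/
def blockPartner (p : Fin k) : Fin k :=
  if h : (p : ℕ) / 2 = k / 2 then p
  else if h0 : (p : ℕ) % 2 = 0 then ⟨p + 1, by have := p.2; omega⟩ else ⟨p - 1, by have := p.2; omega⟩

theorem blockPartner_div (p : Fin k) : (blockPartner p : ℕ) / 2 = (p : ℕ) / 2 := by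
  unfold blockPartner
  split_ifs
  · rfl
  · dsimp only; omega
  · dsimp only; omega

theorem blockPartner_mod {p : Fin k} (h : (p : ℕ) / 2 ≠ k / 2) :
    (blockPartner p : ℕ) % 2 = 1 - (p : ℕ) % 2 := by
  unfold blockPartner
  rw [dif_neg h]
  split_ifs
  · dsimp only; omega
  · dsimp only; omega

theorem blockPartner_eq_self {p : Fin k} (h : (p : ℕ) / 2 = k / 2) : blockPartner p = p :=
  dif_pos h

theorem blockPartner_blockPartner (p : Fin k) : blockPartner (blockPartner p) = p := by
  by_cases h : (p : ℕ) / 2 = k / 2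
  · rw [blockPartner_eq_self h, blockPartner_eq_self h]
  · have h1 := blockPartner_div p
    have h2 := blockPartner_mod h
    have h3 := blockPartner_div (blockPartner p)
    have h4 := blockPartner_mod (p := blockPartner p) (by rwa [h1])
    exact Fin.ext (by omega)

/-- The diagonal entries of `rotationBlocks`. -/
noncomputable def blockCos (k : ℕ) (θ : ℕ → ℝ) (p : ℕ) : ℝ :=
  if p / 2 = k / 2 then 1 else Real.cos (θ (p / 2 + 1))

/-- The off-diagonal entries of `rotationBlocks`. -/
noncomputable def blockSin (k : ℕ) (θ : ℕ → ℝ) (p : ℕ) : ℝ :=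
  if p / 2 = k / 2 then 0
  else if p % 2 = 0 then Real.sin (θ (p / 2 + 1)) else -Real.sin (θ (p / 2 + 1))

theorem rotationBlocks_mulVec (θ : ℕ → ℝ) (v : Fin k → ℝ) (p : Fin k) :
    (rotationBlocks k θ *ᵥ v) p = blockCos k θ p * v p + blockSin k θ p * v (blockPartner p) := by
  have hp := p.2
  by_cases h : (p : ℕ) / 2 = k / 2
  · rw [Matrix.mulVec, dotProduct, Finset.sum_eq_single p]
    · simp [rotationBlocks, blockCos, blockSin, h]
    · intro q _ hq
      have hq2 := q.2
      have : (p : ℕ) / 2 ≠ (q : ℕ) / 2 := fun h' => hq (Fin.ext (by omega))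
      simp [rotationBlocks, this]
    · simp
  · have hpp : p ≠ blockPartner p := by
      intro h'
      have := blockPartner_mod h
      rw [← h'] at this
      omega
    rw [Matrix.mulVec, dotProduct, Finset.sum_eq_add p (blockPartner p) hpp]
    · have h1 := blockPartner_div p
      have h2 := blockPartner_mod h
      congr 1
      · simp [rotationBlocks, blockCos, h]
      · rcases Nat.mod_two_eq_zero_or_one (p : ℕ) with h0 | h0
        · have : p < blockPartner p := by rw [Fin.lt_def]; omega
          simp [rotationBlocks, blockSin, h, h1, hpp, h0, this]
        · have : ¬ p < blockPartner p := by rw [Fin.lt_def]; omega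
          simp [rotationBlocks, blockSin, h, h1, hpp, h0, this]
    · intro q _ hq
      have hq2 := q.2
      have h1 := blockPartner_div p
      have h2 := blockPartner_mod h
      have : (p : ℕ) / 2 ≠ (q : ℕ) / 2 := fun h' => by
        have h3 : (q : ℕ) ≠ p := fun e => hq.1 (Fin.ext e)
        have h4 : (q : ℕ) ≠ blockPartner p := fun e => hq.2 (Fin.ext e)
        omega
      simp [rotationBlocks, this]
    · simp
    · simp

theorem blockSin_blockPartner (θ : ℕ → ℝ) (p : Fin k) :
    blockSin k θ (blockPartner p) = -blockSin k θ p := by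
  by_cases h : (p : ℕ) / 2 = k / 2
  · simp [blockSin, blockPartner_div, h]
  · have h2 := blockPartner_mod h
    rcases Nat.mod_two_eq_zero_or_one (p : ℕ) with h0 | h0 <;>
      simp [blockSin, blockPartner_div, h, h2, h0]

theorem blockCos_blockPartner (θ : ℕ → ℝ) (p : Fin k) :
    blockCos k θ (blockPartner p) = blockCos k θ p := by
  simp [blockCos, blockPartner_div]

theorem rotationBlocks_mul (θ θ' : ℕ → ℝ) :
    rotationBlocks k θ * rotationBlocks k θ' = rotationBlocks k fun i => θ i + θ' i := by
  refine Matrix.toLin'.injective (LinearMap.ext fun v => ?_)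
  simp only [Matrix.toLin'_mul, LinearMap.comp_apply, Matrix.toLin'_apply]
  funext p
  simp only [rotationBlocks_mulVec, blockPartner_blockPartner, blockCos_blockPartner,
    blockSin_blockPartner]
  have h1 : blockCos k (fun i => θ i + θ' i) p =
      blockCos k θ p * blockCos k θ' p - blockSin k θ p * blockSin k θ' p := by
    simp only [blockCos, blockSin]
    split_ifs <;> simp [Real.cos_add]
  have h2 : blockSin k (fun i => θ i + θ' i) p =
      blockCos k θ p * blockSin k θ' p + blockSin k θ p * blockCos k θ' p := by
    simp only [blockCos, blockSin]
    split_ifs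
    · simp
    · rw [Real.sin_add]; ring
    · rw [Real.sin_add]; ring
  rw [h1, h2]
  ring

theorem rotationBlocks_zero : rotationBlocks k (fun _ => 0) = 1 := by
  refine Matrix.toLin'.injective (LinearMap.ext fun v => ?_)
  simp only [Matrix.toLin'_one, Matrix.toLin'_apply, LinearMap.id_apply]
  funext p
  rw [rotationBlocks_mulVec]
  simp [blockCos, blockSin]

theorem transpose_rotationBlocks (θ : ℕ → ℝ) :
    (rotationBlocks k θ)ᵀ = rotationBlocks k fun i => -θ i := by
  ext p q
  simp only [Matrix.transpose_apply, rotationBlocks, Matrix.of_apply, Real.cos_neg, Real.sin_neg,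
    neg_neg]
  by_cases h : (p : ℕ) / 2 = (q : ℕ) / 2
  · rw [h]
    rcases lt_trichotomy p q with h1 | rfl | h1
    · simp [h1.ne, h1.ne', h1, h1.not_gt]
    · simp
    · simp [h1.ne, h1.ne', h1, h1.not_gt]
  · simp [h, Ne.symm h]

theorem conjTranspose_rotationBlocks_mul (θ : ℕ → ℝ) :
    (rotationBlocks k θ)ᴴ * rotationBlocks k θ = 1 := by
  rw [Matrix.conjTranspose_eq_transpose_of_trivial, transpose_rotationBlocks, rotationBlocks_mul]
  simp [rotationBlocks_zero]

/-- The rotation is the square of the orthogonal rotation by the half angles. -/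
theorem det_rotationBlocks (θ : ℕ → ℝ) : (rotationBlocks k θ).det = 1 := by
  have h1 := congrArg Matrix.det (conjTranspose_rotationBlocks_mul (k := k) fun i => θ i / 2)
  have h2 := congrArg Matrix.det (rotationBlocks_mul (k := k) (fun i => θ i / 2) fun i => θ i / 2)
  rw [Matrix.conjTranspose_eq_transpose_of_trivial, Matrix.det_mul, Matrix.det_transpose,
    Matrix.det_one] at h1
  rw [Matrix.det_mul, h1] at h2
  simpa using h2.symm

end Rotation

/-! ### The real sequence -/

section Flow

variable {F : Type*} [RCLike F] {k : ℕ}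

theorem continuous_loxodromicMatrix (x : Fin k → F) {y : ℝ → ℝ} (hy : Continuous y) {c : ℝ → F}
    (hc : Continuous c) {A : ℝ → Matrix (Fin k) (Fin k) F} (hA : Continuous A) :
    Continuous fun t => loxodromicMatrix x 0 (y t) (c t) (A t) := by
  have h : Continuous fun t => leviMatrix (y t) (c t) (A t) := by
    refine continuous_pi fun i => continuous_pi fun j => ?_
    have h1 : Continuous fun t => (Real.exp (y t) : F) :=
      RCLike.continuous_ofReal.comp (Real.continuous_exp.comp hy)
    have h2 : Continuous fun t => (Real.exp (-y t) : F) :=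
      RCLike.continuous_ofReal.comp (Real.continuous_exp.comp hy.neg)
    have h3 : ∀ i j, Continuous fun t => A t i j := fun i j =>
      (continuous_apply j).comp ((continuous_apply i).comp hA)
    rcases i with _ | i | _ <;> rcases j with _ | j | _ <;>
      simp only [leviMatrix, Matrix.of_apply] <;> first | exact continuous_const | skip
    · exact h1.mul hc
    · exact h3 i j
    · exact h2.mul hc
  exact (continuous_const.matrix_mul h).matrix_mul continuous_const

theorem map_ofAdd_one_zpow {Γ : Type*} [Group Γ] (φ : Multiplicative ℝ →* Γ) (j : ℤ) :
    φ (Multiplicative.ofAdd 1) ^ j = φ (Multiplicative.ofAdd (j : ℝ)) := by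
  rw [← map_zpow, ← ofAdd_zsmul, zsmul_eq_mul, mul_one]

end Flow

/-! ### Real loxodromic matrices and their limits -/

section Real

variable {k : ℕ}

theorem continuous_rotationBlocks {θ : ℝ → ℕ → ℝ} (hθ : ∀ i, Continuous fun t => θ t i) :
    Continuous fun t => rotationBlocks k (θ t) := by
  refine continuous_pi fun p => continuous_pi fun q => ?_
  simp only [rotationBlocks, Matrix.of_apply]
  split_ifs
  · exact continuous_const
  · exact continuous_const
  · exact Real.continuous_cos.comp (hθ _)
  · exact Real.continuous_sin.comp (hθ _)
  · exact (Real.continuous_sin.comp (hθ _)).neg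

/-- The one-parameter group of real loxodromic matrices. -/
noncomputable def realFlow (x : Fin k → ℝ) (y : ℝ) (θ : ℕ → ℝ) :
    Multiplicative ℝ →* Matrix.SpecialLinearGroup (Idx k) ℝ where
  toFun t := ⟨loxodromicMatrix x 0 (t.toAdd * y) 1 (rotationBlocks k fun i => t.toAdd * θ i), by
    rw [det_loxodromicMatrix, det_rotationBlocks, one_pow, one_mul]⟩
  map_one' := Subtype.ext (by
    change loxodromicMatrix x 0 (0 * y) 1 (rotationBlocks k fun i => 0 * θ i) = 1
    simp only [zero_mul, rotationBlocks_zero, loxodromicMatrix_one])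
  map_mul' a b := Subtype.ext (by
    change loxodromicMatrix x 0 ((a.toAdd + b.toAdd) * y) 1
      (rotationBlocks k fun i => (a.toAdd + b.toAdd) * θ i) = loxodromicMatrix x 0 _ 1 _ *
        loxodromicMatrix x 0 _ 1 _
    simp only [loxodromicMatrix_mul, rotationBlocks_mul, add_mul, mul_one])

theorem realFlow_mem (x : Fin k → ℝ) (y : ℝ) (θ : ℕ → ℝ) (t : ℝ) :
    realFlow x y θ (Multiplicative.ofAdd t) ∈ SO1 k := by
  refine mem_SO1_of_continuous (γ := fun t => realFlow x y θ (Multiplicative.ofAdd t)) ?_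
    (fun t v w => hermForm_loxodromicMatrix_mulVec x _ norm_one
      (conjTranspose_rotationBlocks_mul _) v w) (map_one (realFlow x y θ)) t
  exact Continuous.subtype_mk (continuous_loxodromicMatrix x (by fun_prop) continuous_const
    (continuous_rotationBlocks fun i => by fun_prop)) _

theorem translation_mem_SO1 (p e : Idx k → ℝ) (h : IsFrame p e) (u : ℝ) :
    h.translation u ∈ SO1 k :=
  mem_SO1_of_continuous h.continuous_translation h.translation_mem h.translation_zero u

variable {l : ℕ}

/-- The point with entry `N` in the second coordinate of each of the first `l` blocks. -/
def realPoint (k l : ℕ) (N : ℝ) (p : Fin k) : ℝ :=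
  if (p : ℕ) % 2 = 1 ∧ (p : ℕ) / 2 < l then N else 0

theorem realPoint_mul_partner (hl : l ≤ k / 2) (N : ℝ) (p : Fin k) :
    realPoint k l N p * realPoint k l N (blockPartner p) = 0 := by
  by_cases h : (p : ℕ) % 2 = 1 ∧ (p : ℕ) / 2 < l
  · have h1 := blockPartner_mod (p := p) (by omega)
    have : ¬ ((blockPartner p : ℕ) % 2 = 1 ∧ (blockPartner p : ℕ) / 2 < l) := by omega
    simp only [realPoint, if_neg this, mul_zero]
  · simp only [realPoint, if_neg h, zero_mul]

theorem realPoint_eq_mul (N : ℝ) (p : Fin k) : realPoint k l N p = N * realPoint k l 1 p := by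
  simp only [realPoint]
  split_ifs <;> simp

theorem one_le_sum_realPoint_sq (hl : 1 ≤ l) (hlk : l ≤ k / 2) {n : ℕ} (hn : 1 ≤ n) :
    1 ≤ ∑ p, ‖realPoint k l n p‖ ^ 2 := by
  have h1 : (1 : ℝ) ≤ n := by exact_mod_cast hn
  set q : Fin k := ⟨1, by omega⟩ with hq
  have h2 : realPoint k l n q = n := by
    rw [realPoint, if_pos]
    change 1 % 2 = 1 ∧ 1 / 2 < l
    omega
  have h3 := Finset.single_le_sum (f := fun p => ‖realPoint k l n p‖ ^ 2)
    (fun p _ => by positivity) (Finset.mem_univ q)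
  simp only [h2] at h3
  refine le_trans ?_ h3
  rw [Real.norm_eq_abs, sq_abs]
  nlinarith

/-- The point has only one nonzero coordinate in each block, so the sines, which pair the two
coordinates of a block, do not contribute. What remains is a sum of nonnegative terms, one per
block. -/
theorem real_corner (hl : l ≤ k / 2) (N Y : ℝ) (θ : ℕ → ℝ) :
    loxodromicMatrix (realPoint k l N) 0 Y 1 (rotationBlocks k θ) Idx.first Idx.last =
      ∑ p, realPoint k l 1 p *
        (N ^ 2 * (Real.cosh Y - 1) - N ^ 2 * (Real.cos (θ ((p : ℕ) / 2 + 1)) - 1)) := by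
  rw [loxodromicMatrix_first_last]
  change 1 * Real.cosh Y * (∑ p, ‖realPoint k l N p‖ ^ 2) -
    ∑ p, realPoint k l N p * (rotationBlocks k θ *ᵥ realPoint k l N) p = _
  rw [one_mul, Finset.mul_sum, ← Finset.sum_sub_distrib]
  refine Finset.sum_congr rfl fun p _ => ?_
  rw [rotationBlocks_mulVec, Real.norm_eq_abs, sq_abs]
  have h1 := realPoint_mul_partner hl N p
  have h2 : realPoint k l N p ^ 2 = N ^ 2 * realPoint k l 1 p := by
    simp only [realPoint]; split_ifs <;> simp
  have h3 : realPoint k l 1 p * blockCos k θ p =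
      realPoint k l 1 p * Real.cos (θ ((p : ℕ) / 2 + 1)) := by
    simp only [realPoint, blockCos]
    split_ifs with h h'
    · omega
    · rfl
    · simp
    · simp
  linear_combination (Real.cosh Y - blockCos k θ p) * h2 - blockSin k θ p * h1 - N ^ 2 * h3

theorem rotationBlocks_congr {θ θ' : ℕ → ℝ}
    (h : ∀ i, Real.cos (θ (i + 1)) = Real.cos (θ' (i + 1)) ∧
      Real.sin (θ (i + 1)) = Real.sin (θ' (i + 1))) :
    rotationBlocks k θ = rotationBlocks k θ' := by
  ext p q
  simp only [rotationBlocks, Matrix.of_apply, (h _).1, (h _).2]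

/-- The nonconstant entries in the first row and last column, away from the corner, are exponentials
or first-order terms `N (e^z - 1)`, `N sin`, `N (cos - 1)`, and need no explicit limit. The corner
is the only second-order entry, and its limit alone decides faithfulness. -/
theorem exists_tendsto_real {N : ℕ → ℝ} (hN : Tendsto N atTop atTop) (hl : l ≤ k / 2)
    {Y : ℕ → ℝ} {V : ℝ} (hY : Tendsto (fun n => N n * Y n) atTop (𝓝 V)) {u : ℕ → ℕ → ℝ}
    {U : ℕ → ℝ} (hu : ∀ i, Tendsto (fun n => N n * u n (i + 1)) atTop (𝓝 (U i))) :
    ∃ T : Matrix (Idx k) (Idx k) ℝ,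
      Tendsto (fun n => loxodromicMatrix (realPoint k l (N n)) 0 (Y n) 1 (rotationBlocks k (u n)))
        atTop (𝓝 T) ∧
      T Idx.first Idx.last =
        ∑ p : Fin k, realPoint k l 1 p * (V ^ 2 / 2 + U ((p : ℕ) / 2) ^ 2 / 2) := by
  have hzero : ∀ {z : ℕ → ℝ} {Z : ℝ}, Tendsto (fun n => N n * z n) atTop (𝓝 Z) →
      Tendsto z atTop (𝓝 0) := by
    intro z Z hz
    have := (Complex.continuous_re.tendsto _).comp
      (tendsto_zero_of_tendsto_mul hN (tendsto_ofReal_mul hz))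
    simpa [Function.comp_def] using this
  have hY' : Tendsto (fun n => N n * -Y n) atTop (𝓝 (-V)) := by simpa using hY.neg
  have hcos : ∀ {θ : ℕ → ℕ → ℝ} {U : ℕ → ℝ},
      (∀ i, Tendsto (fun n => N n * θ n (i + 1)) atTop (𝓝 (U i))) → ∀ p,
      Tendsto (fun n => N n * (blockCos k (θ n) p - 1)) atTop (𝓝 0) := by
    intro θ U hθ p
    simp only [blockCos]
    split_ifs
    · simp
    · exact tendsto_mul_cos_sub_one hN (hθ _)
  have hsin : ∀ {θ : ℕ → ℕ → ℝ} {U : ℕ → ℝ},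
      (∀ i, Tendsto (fun n => N n * θ n (i + 1)) atTop (𝓝 (U i))) → ∀ p,
      ∃ z, Tendsto (fun n => N n * blockSin k (θ n) p) atTop (𝓝 z) := by
    intro θ U hθ p
    simp only [blockSin]
    split_ifs
    · exact ⟨0, by simp⟩
    · exact ⟨_, tendsto_mul_sin hN (hθ _)⟩
    · refine ⟨_, (tendsto_mul_sin hN (hθ (p / 2))).neg.congr fun n => ?_⟩
      ring
  have hu' : ∀ i, Tendsto (fun n => N n * -u n (i + 1)) atTop (𝓝 (-U i)) := fun i => by
    simpa using (hu i).neg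
  have hexp : ∀ {z : ℕ → ℝ} {Z : ℝ}, Tendsto (fun n => N n * z n) atTop (𝓝 Z) →
      Tendsto (fun n => Real.exp (z n)) atTop (𝓝 1) := fun hz => by
    have := (Real.continuous_exp.tendsto 0).comp (hzero hz)
    rwa [Real.exp_zero] at this
  have hcorner : Tendsto (fun n => loxodromicMatrix (realPoint k l (N n)) 0 (Y n) 1
      (rotationBlocks k (u n)) Idx.first Idx.last) atTop
      (𝓝 (∑ p : Fin k, realPoint k l 1 p * (V ^ 2 / 2 + U ((p : ℕ) / 2) ^ 2 / 2))) := by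
    simp only [real_corner hl]
    refine tendsto_finsetSum _ fun p _ => ?_
    have := (tendsto_sq_mul_cosh_sub_one hN hY).sub
      (tendsto_sq_mul_cos_sub_one hN (hu ((p : ℕ) / 2)))
    rw [sub_neg_eq_add] at this
    exact this.const_mul _
  have hall : ∀ i j : Idx k, ∃ z, Tendsto (fun n => loxodromicMatrix (realPoint k l (N n)) 0 (Y n) 1
      (rotationBlocks k (u n)) i j) atTop (𝓝 z) := by
    intro i j
    rcases i with _ | i | _ <;> rcases j with _ | j | _
    · change ∃ z, Tendsto (fun n => loxodromicMatrix _ 0 _ 1 _ Idx.first Idx.first) atTop (𝓝 z)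
      simp only [loxodromicMatrix_first_first]
      exact ⟨1 * 1, (hexp hY).mul_const 1⟩
    · obtain ⟨z, hz⟩ := hsin (θ := fun n i => -u n i) hu' j
      refine ⟨_, (((hcos (θ := fun n i => -u n i) hu' j).mul_const (realPoint k l 1 j)).add
        (hz.mul_const (realPoint k l 1 (blockPartner j)))).sub
        ((tendsto_mul_real_exp_sub_one hN hY).mul_const (realPoint k l 1 j)) |>.congr fun n => ?_⟩
      have h1 : ∑ i, star (realPoint k l (N n) i) * rotationBlocks k (u n) i j =
          (rotationBlocks k (fun i => -u n i) *ᵥ realPoint k l (N n)) j := by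
        rw [← transpose_rotationBlocks, Matrix.mulVec, dotProduct]
        exact Finset.sum_congr rfl fun i _ => mul_comm _ _
      change _ = loxodromicMatrix _ 0 _ 1 _ Idx.first (Idx.mid j)
      rw [loxodromicMatrix_first_mid, h1, rotationBlocks_mulVec, realPoint_eq_mul (N n) j,
        realPoint_eq_mul (N n) (blockPartner j)]
      change _ = _ - Real.exp (Y n) * 1 * (N n * realPoint k l 1 j)
      ring
    · exact ⟨_, hcorner⟩
    · change ∃ z, Tendsto (fun n => loxodromicMatrix _ 0 _ 1 _ (Idx.mid i) Idx.first) atTop (𝓝 z)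
      simp only [loxodromicMatrix_mid_first]
      exact ⟨0, tendsto_const_nhds⟩
    · change ∃ z, Tendsto (fun n => loxodromicMatrix _ 0 _ 1 _ (Idx.mid i) (Idx.mid j)) atTop (𝓝 z)
      simp only [loxodromicMatrix_mid_mid]
      obtain ⟨z, hz⟩ := hsin hu i
      refine ⟨_, (((hzero (hcos hu i)).add_const 1).mul_const ((Pi.single j 1 : Fin k → ℝ) i)).add
        ((hzero hz).mul_const ((Pi.single j 1 : Fin k → ℝ) (blockPartner i))) |>.congr fun n => ?_⟩
      have := rotationBlocks_mulVec (u n) (Pi.single j 1) i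
      rw [Matrix.mulVec_single_one, Matrix.col_apply] at this
      rw [this]
      ring
    · change ∃ z, Tendsto (fun n => loxodromicMatrix _ 0 _ 1 _ (Idx.mid i) Idx.last) atTop (𝓝 z)
      obtain ⟨z, hz⟩ := hsin hu i
      refine ⟨_, (((tendsto_mul_real_exp_sub_one hN hY').mul_const (realPoint k l 1 i)).sub
        ((hcos hu i).mul_const (realPoint k l 1 i))).sub
        (hz.mul_const (realPoint k l 1 (blockPartner i))) |>.congr fun n => ?_⟩
      have h1 : ∑ j, rotationBlocks k (u n) i j * realPoint k l (N n) j =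
          (rotationBlocks k (u n) *ᵥ realPoint k l (N n)) i := rfl
      rw [loxodromicMatrix_mid_last, h1, rotationBlocks_mulVec, realPoint_eq_mul (N n) i,
        realPoint_eq_mul (N n) (blockPartner i)]
      change _ = Real.exp (-Y n) * 1 * (N n * realPoint k l 1 i) - _
      ring
    · change ∃ z, Tendsto (fun n => loxodromicMatrix _ 0 _ 1 _ Idx.last Idx.first) atTop (𝓝 z)
      simp only [loxodromicMatrix_last_first]
      exact ⟨0, tendsto_const_nhds⟩
    · change ∃ z, Tendsto (fun n => loxodromicMatrix _ 0 _ 1 _ Idx.last (Idx.mid j)) atTop (𝓝 z)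
      simp only [loxodromicMatrix_last_mid]
      exact ⟨0, tendsto_const_nhds⟩
    · change ∃ z, Tendsto (fun n => loxodromicMatrix _ 0 _ 1 _ Idx.last Idx.last) atTop (𝓝 z)
      simp only [loxodromicMatrix_last_last]
      exact ⟨1 * 1, (hexp hY').mul_const 1⟩
  choose T hT using hall
  refine ⟨T, ?_, tendsto_nhds_unique (hT _ _) hcorner⟩
  exact tendsto_pi_nhds.mpr fun i => tendsto_pi_nhds.mpr fun j => hT i j

end Real

/-! ### Quotients of digit expansions modulo integers -/

section DigitExpansion

variable {l : ℕ}

theorem digitHom_div_pow_top (w : Fin (l + 1) → ℤ) (n : ℕ) :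
    ((digitHom l n w : ℤ) : ℝ) / n ^ (l + 1) = lowerSum (fun t => digits w t) (l + 1) n := by
  rw [digitHom_apply, lowerSum]
  push_cast
  rfl

/-- Digits of index at least `p` contribute integers to the quotient by `n^p`, that is, full turns
to the rotation by `2π j / n^p`. -/
theorem exists_sum_div_pow_eq_lowerSum_add_int (a : ℕ → ℤ) {n : ℕ} (hn : 1 ≤ n) {p d : ℕ}
    (hp : p ≤ d) : ∃ z : ℤ, ((∑ t ∈ Finset.range d, a t * (n : ℤ) ^ t : ℤ) : ℝ) / n ^ p =
      lowerSum (fun t => a t) p n + z := by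
  refine ⟨∑ i ∈ Finset.Ico p d, a i * (n : ℤ) ^ (i - p), ?_⟩
  have hn0 : (n : ℝ) ≠ 0 := by positivity
  have := sum_div_pow_eq_lowerSum_add (fun t => (a t : ℝ)) hn0 hp
  push_cast
  exact this

theorem exists_digitHom_div_pow (w : Fin (l + 1) → ℤ) {n : ℕ} (hn : 1 ≤ n) {p : ℕ}
    (hp : p ≤ l + 1) : ∃ z : ℤ, ((digitHom l n w : ℤ) : ℝ) / n ^ p =
      lowerSum (fun t => digits w t) p n + z := by
  rw [digitHom_apply]
  exact exists_sum_div_pow_eq_lowerSum_add_int _ hn hp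

theorem exists_digitHom_eq {B : ℝ} {n : ℕ} {j : ℤ} (hn : 1 ≤ n) (hj : |(j : ℝ)| ≤ B * n ^ l)
    (hd : ∀ i, 1 ≤ i → i ≤ l → ∃ z : ℤ, |(j : ℝ) / n ^ i - z| ≤ B / n) :
    ∃ w ∈ {w : Fin (l + 1) → ℤ | ∀ t, |(w t : ℝ)| ≤ 2 ^ l * B}, j = digitHom l n w := by
  obtain ⟨a, ha1, ha2⟩ := exists_digits l B n j hn hj hd
  refine ⟨fun t => a t, fun t => ha1 t, ?_⟩
  rw [ha2, ← Fin.sum_univ_eq_sum_range (fun t => a t * (n : ℤ) ^ t)]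
  rfl

end DigitExpansion

/-! ### The real sequences of rank `l` -/

section RealSequence

variable {k l : ℕ}

/-- The angles `2π/n, …, 2π/n^l`, followed by zeros. -/
noncomputable def realAngle (l n i : ℕ) : ℝ := if i ≤ l then 2 * Real.pi / (n : ℝ) ^ i else 0

/-- The real sequence of rank `l`. -/
noncomputable def realSequence (k l n : ℕ) : SO1 k :=
  ⟨realFlow (realPoint k l n) (1 / (n : ℝ) ^ (l + 1)) (realAngle l n) (Multiplicative.ofAdd 1),
    realFlow_mem _ _ _ _⟩

theorem realSequence_zpow (n : ℕ) (j : ℤ) : (realSequence k l n ^ j).1.1 =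
    loxodromicMatrix (realPoint k l n) 0 (j * (1 / (n : ℝ) ^ (l + 1))) 1
      (rotationBlocks k fun i => j * realAngle l n i) := by
  rw [SubgroupClass.coe_zpow, realSequence, map_ofAdd_one_zpow]
  rfl

theorem isLoxodromicMatrix_realSequence (hl : 1 ≤ l) (hlk : l ≤ k / 2) (n : ℕ) (hn : 1 ≤ n) :
    IsLoxodromicMatrix (realSequence k l n) (realPoint k l n) (1 / (n : ℝ) ^ (l + 1)) where
  pos := by positivity
  one_le := one_le_sum_realPoint_sq hl hlk hn
  zpow j := ⟨1, _, norm_one, conjTranspose_rotationBlocks_mul _, realSequence_zpow n j⟩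

/-- The exponent with digits `w` has translation length asymptotic to `w_l / n` and, up to full
turns, `i`-th angle asymptotic to `2π w_(i-1) / n`. The corner of the limit is `∑_{i<l} (w_l² + (2π
w_i)²) / 2`, which sees every digit. -/
theorem exists_tendsto_realSequence (hl : 1 ≤ l) (hlk : l ≤ k / 2) (w : Fin (l + 1) → ℤ) :
    ∃ T : Matrix (Idx k) (Idx k) ℝ,
      Tendsto (fun n => (realSequence k l n ^ digitHom l n w).1.1) atTop (𝓝 T) ∧
        (w ≠ 0 → T Idx.first Idx.last ≠ 0) := by
  set A : ℕ → ℝ := fun t => digits w t with hA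
  have hN : Tendsto (fun n : ℕ => (n : ℝ)) atTop atTop := tendsto_natCast_atTop_atTop
  set u : ℕ → ℕ → ℝ := fun n i => if i ≤ l then 2 * Real.pi * lowerSum A i n else 0 with hu
  set U : ℕ → ℝ := fun i => if i + 1 ≤ l then 2 * Real.pi * A i else 0 with hU
  obtain ⟨T, hT, hTc⟩ := exists_tendsto_real hN hlk
    (Y := fun n => lowerSum A (l + 1) n) (V := A l) (tendsto_mul_lowerSum hN A l)
    (u := u) (U := U) (fun i => by
      simp only [hu, hU]
      split_ifs
      · refine ((tendsto_mul_lowerSum hN A i).const_mul (2 * Real.pi)).congr fun n => ?_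
        ring
      · simp)
  refine ⟨T, hT.congr' ?_, fun hw h0 => hw ?_⟩
  · filter_upwards [eventually_ge_atTop 1] with n hn
    rw [realSequence_zpow, mul_one_div, digitHom_div_pow_top]
    congr 1
    refine rotationBlocks_congr fun i => ?_
    simp only [hu, realAngle]
    split_ifs with h
    · obtain ⟨z, hz⟩ := exists_digitHom_div_pow w hn (p := i + 1) (by omega)
      have e : (digitHom l n w : ℝ) * (2 * Real.pi / (n : ℝ) ^ (i + 1)) =
          2 * Real.pi * lowerSum A (i + 1) n + z * (2 * Real.pi) := by
        rw [hA, ← mul_div_assoc, mul_div_right_comm, hz]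
        ring
      rw [e, Real.cos_add_int_mul_two_pi, Real.sin_add_int_mul_two_pi]
      exact ⟨rfl, rfl⟩
    · simp
  · rw [hTc] at h0
    have hpos : ∀ p : Fin k, 0 ≤ realPoint k l 1 p := fun p => by
      simp only [realPoint]; split_ifs <;> norm_num
    have h1 := (Finset.sum_eq_zero_iff_of_nonneg (fun p _ => by
      have := hpos p
      positivity)).mp h0
    have h2 : ∀ i, i < l → A l = 0 ∧ A i = 0 := by
      intro i hi
      have h3 := h1 ⟨2 * i + 1, by omega⟩ (Finset.mem_univ _)
      have h4 : realPoint k l 1 (⟨2 * i + 1, by omega⟩ : Fin k) = 1 := by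
        rw [realPoint, if_pos]
        dsimp only
        omega
      have h5 : (2 * i + 1) / 2 = i := by omega
      rw [h4, one_mul] at h3
      simp only [h5, hU, if_pos (show i + 1 ≤ l by omega)] at h3
      have h6 : A l ^ 2 = 0 := by nlinarith [sq_nonneg (A l), sq_nonneg (2 * Real.pi * A i)]
      have h7 : (2 * Real.pi * A i) ^ 2 = 0 := by
        nlinarith [sq_nonneg (A l), sq_nonneg (2 * Real.pi * A i)]
      refine ⟨by simpa using h6, ?_⟩
      have := Real.pi_ne_zero
      simpa [this] using h7
    funext t
    have h3 : A t = 0 := by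
      rcases (Nat.lt_succ_iff.mp t.2).lt_or_eq with h | h
      · exact (h2 t h).2
      · rw [h]; exact (h2 0 hl).1
    rw [← digits_val w t]
    simpa [hA] using h3

/-- All terms of the corner are nonnegative, so each of them is bounded by `B`. The `cosh` term
bounds `j / n^l`, the cosines put `j / n^i` close to integers, and `exists_digits` concludes. -/
theorem exists_finite_realSequence (hl : 1 ≤ l) (hlk : l ≤ k / 2) (B : ℝ) :
    ∃ W : Set (Fin (l + 1) → ℤ), W.Finite ∧ ∀ᶠ n in atTop, ∀ j : ℤ,
      ‖corner (realSequence k l n ^ j)‖ ≤ B → ∃ w ∈ W, j = digitHom l n w := by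
  refine ⟨_, finite_box (l + 1) (2 ^ l * √(2 * B)), ?_⟩
  filter_upwards [eventually_ge_atTop 1] with n hn j hj
  have hn0 : (0 : ℝ) < n := by exact_mod_cast hn
  rw [corner, realSequence_zpow, real_corner hlk] at hj
  have hB : 0 ≤ B := (norm_nonneg _).trans hj
  have hpos : ∀ p : Fin k, 0 ≤ realPoint k l 1 p := fun p => by
    simp only [realPoint]; split_ifs <;> norm_num
  set Y := (j : ℝ) * (1 / (n : ℝ) ^ (l + 1)) with hY
  have hc1 : 0 ≤ Real.cosh Y - 1 := by linarith [Real.one_le_cosh Y]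
  have hterm : ∀ i, i < l → (n : ℝ) ^ 2 * (Real.cosh Y - 1) ≤ B ∧
      (n : ℝ) ^ 2 * (1 - Real.cos (2 * Real.pi * (j / (n : ℝ) ^ (i + 1)))) ≤ B := by
    intro i hi
    have h3 := Finset.single_le_sum (f := fun p : Fin k => realPoint k l 1 p *
      ((n : ℝ) ^ 2 * (Real.cosh Y - 1) -
        (n : ℝ) ^ 2 * (Real.cos (j * realAngle l n ((p : ℕ) / 2 + 1)) - 1)))
      (fun p _ => mul_nonneg (hpos p) (by
        have h1 := Real.cos_le_one (j * realAngle l n ((p : ℕ) / 2 + 1))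
        have h2 := mul_nonneg (sq_nonneg (n : ℝ)) hc1
        have h3 := mul_nonneg (sq_nonneg (n : ℝ)) (sub_nonneg.mpr h1)
        linarith)) (Finset.mem_univ ⟨2 * i + 1, by omega⟩)
    have h4 : realPoint k l 1 (⟨2 * i + 1, by omega⟩ : Fin k) = 1 := by
      rw [realPoint, if_pos]
      dsimp only
      omega
    have h5 : (2 * i + 1) / 2 = i := by omega
    have h6 : (j : ℝ) * realAngle l n (i + 1) = 2 * Real.pi * (j / (n : ℝ) ^ (i + 1)) := by
      rw [realAngle, if_pos (by omega)]; ring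
    simp only [h4, h5, one_mul, h6] at h3
    have h7 := h3.trans ((le_abs_self _).trans hj)
    have h8 := mul_nonneg (sq_nonneg (n : ℝ)) hc1
    have h9 := mul_nonneg (sq_nonneg (n : ℝ))
      (sub_nonneg.mpr (Real.cos_le_one (2 * Real.pi * (j / (n : ℝ) ^ (i + 1)))))
    constructor <;> linarith
  refine exists_digitHom_eq hn ?_ fun i hi1 hil => ?_
  · have h1 := abs_le_of_sq_mul_cosh_sub_one_le hn0 (hterm 0 hl).1
    rw [hY, mul_one_div, abs_div, abs_of_pos (by positivity : (0 : ℝ) < (n : ℝ) ^ (l + 1)),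
      div_le_div_iff₀ (by positivity) hn0, pow_succ, ← mul_assoc] at h1
    exact le_of_mul_le_mul_right h1 hn0
  · obtain ⟨i, rfl⟩ : ∃ i', i = i' + 1 := ⟨i - 1, by omega⟩
    obtain ⟨z, hz⟩ := exists_int_abs_sub_le hn0 (hterm i (by omega)).2
    refine ⟨z, hz.trans ?_⟩
    gcongr
    linarith

theorem exists_real_representations (hl : 1 ≤ l) (hlk : l ≤ k / 2) :
    ∃ (ρ : ℕ → FreeGroup (Fin 2) →* SO1 k) (ρlim : FreeGroup (Fin 2) →* SO1 k),
      (∀ n, 1 ≤ n → IsConvexCocompact (ρ n)) ∧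
      IsJorgensenSequence l (fun n => restrictToA (ρ n)) ∧
      (∀ n, 1 ≤ n → ρ n (FreeGroup.of 0) = realSequence k l n) ∧
      ConvergesAlgebraically ρ ρlim ∧ HasFreeProductLimit l ρ ρlim := by
  obtain ⟨L, hL⟩ := exists_cornersConverge (isClosed_SO1 k) (digitHom_single l)
    (exists_tendsto_realSequence hl hlk) (exists_finite_realSequence hl hlk)
  exact hL.exists_representations ⟨0, by omega⟩ hl (SO1_le_unitaryGroup k) translation_mem_SO1
    (isLoxodromicMatrix_realSequence hl hlk)

theorem realSequence_eq_realJorgensenMatrix (n : ℕ) :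
    (realSequence k (k / 2) n).1.1 = realJorgensenMatrix k n := by
  have h := realSequence_zpow (k := k) (l := k / 2) n 1
  rw [zpow_one, Int.cast_one, one_mul] at h
  rw [h, realJorgensenMatrix]
  congr 1
  · funext p
    have := p.2
    rw [realPoint]
    congr 1
    refine propext ⟨fun h => h.1, fun h => ⟨h, by omega⟩⟩
  · ext p q
    have hp := p.2
    simp only [rotationBlocks, Matrix.of_apply, one_mul]
    by_cases h : (p : ℕ) / 2 = k / 2
    · simp only [h, if_true]
    · rw [show realAngle (k / 2) n ((p : ℕ) / 2 + 1) = 2 * Real.pi / (n : ℝ) ^ ((p : ℕ) / 2 + 1) from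
        if_pos (by omega)]

end RealSequence

/-! ### Complex loxodromic matrices -/

section Complex

variable {k : ℕ}

theorem conjTranspose_diagonal_exp_mul (θ : Fin k → ℝ) :
    (Matrix.diagonal fun p => Complex.exp (θ p * Complex.I))ᴴ *
      (Matrix.diagonal fun p => Complex.exp (θ p * Complex.I)) = 1 := by
  rw [Matrix.diagonal_conjTranspose, Matrix.diagonal_mul_diagonal, ← Matrix.diagonal_one]
  congr 1
  funext p
  rw [Pi.star_apply, star_mul_self_eq, Complex.norm_exp_ofReal_mul_I]
  simp

/-- The one-parameter group of complex loxodromic matrices. -/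
noncomputable def complexFlow (x : Fin k → ℂ) (y φ : ℝ) (θ : Fin k → ℝ)
    (h : 2 * φ + ∑ p, θ p = 0) : Multiplicative ℝ →* Matrix.SpecialLinearGroup (Idx k) ℂ where
  toFun t := ⟨loxodromicMatrix x 0 (t.toAdd * y) (Complex.exp ((t.toAdd * φ : ℝ) * Complex.I))
    (Matrix.diagonal fun p => Complex.exp ((t.toAdd * θ p : ℝ) * Complex.I)), by
      rw [det_loxodromicMatrix, Matrix.det_diagonal, ← Complex.exp_sum, ← Complex.exp_nat_mul,
        ← Complex.exp_add, ← Finset.sum_mul, ← Complex.exp_zero]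
      congr 1
      have h' : (2 : ℂ) * φ + ∑ p, (θ p : ℂ) = 0 := by exact_mod_cast h
      push_cast
      rw [← Finset.mul_sum]
      linear_combination (t.toAdd : ℂ) * Complex.I * h'⟩
  map_one' := Subtype.ext (by
    change loxodromicMatrix x 0 (0 * y) (Complex.exp ((0 * φ : ℝ) * Complex.I))
      (Matrix.diagonal fun p => Complex.exp ((0 * θ p : ℝ) * Complex.I)) = 1
    simp [loxodromicMatrix_one])
  map_mul' a b := Subtype.ext (by
    change loxodromicMatrix x 0 ((a.toAdd + b.toAdd) * y)
      (Complex.exp (((a.toAdd + b.toAdd) * φ : ℝ) * Complex.I)) (Matrix.diagonal fun p =>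
        Complex.exp (((a.toAdd + b.toAdd) * θ p : ℝ) * Complex.I)) =
      loxodromicMatrix x 0 _ _ _ * loxodromicMatrix x 0 _ _ _
    simp only [loxodromicMatrix_mul, Matrix.diagonal_mul_diagonal, ← Complex.exp_add, ← add_mul,
      ← Complex.ofReal_add])

theorem complexFlow_mem (x : Fin k → ℂ) (y φ : ℝ) (θ : Fin k → ℝ) (h : 2 * φ + ∑ p, θ p = 0)
    (t : Multiplicative ℝ) : complexFlow x y φ θ h t ∈ SU1 k := fun v w =>
  hermForm_loxodromicMatrix_mulVec x _ (Complex.norm_exp_ofReal_mul_I _)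
    (conjTranspose_diagonal_exp_mul _) v w

/-- The generator of `complexFlow`. -/
noncomputable def complexElement (x : Fin k → ℂ) (y φ : ℝ) (θ : Fin k → ℝ)
    (h : 2 * φ + ∑ p, θ p = 0) : SU1 k :=
  ⟨complexFlow x y φ θ h (Multiplicative.ofAdd 1), complexFlow_mem x y φ θ h _⟩

theorem complexElement_zpow (x : Fin k → ℂ) (y φ : ℝ) (θ : Fin k → ℝ) (h : 2 * φ + ∑ p, θ p = 0)
    (j : ℤ) : (complexElement x y φ θ h ^ j).1.1 =
      loxodromicMatrix x 0 (j * y) (Complex.exp ((j * φ : ℝ) * Complex.I))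
        (Matrix.diagonal fun p => Complex.exp ((j * θ p : ℝ) * Complex.I)) := by
  rw [SubgroupClass.coe_zpow, complexElement, map_ofAdd_one_zpow]
  rfl

theorem isLoxodromicMatrix_complexElement {x : Fin k → ℂ} {y φ : ℝ} {θ : Fin k → ℝ}
    (h : 2 * φ + ∑ p, θ p = 0) (hy : 0 < y) (hx : 1 ≤ ∑ p, ‖x p‖ ^ 2) :
    IsLoxodromicMatrix (complexElement x y φ θ h) x y where
  pos := hy
  one_le := hx
  zpow j := ⟨_, _, Complex.norm_exp_ofReal_mul_I _, conjTranspose_diagonal_exp_mul _,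
    complexElement_zpow x y φ θ h j⟩

/-- The point whose coordinates are `N χ`. -/
def complexPoint (χ : Fin k → ℝ) (N : ℝ) (p : Fin k) : ℂ := ((N * χ p : ℝ) : ℂ)

variable {χ : Fin k → ℝ}

theorem one_le_sum_complexPoint_sq {q : Fin k} (hq : χ q = 1) {n : ℕ} (hn : 1 ≤ n) :
    1 ≤ ∑ p, ‖complexPoint χ n p‖ ^ 2 := by
  have h1 : (1 : ℝ) ≤ n := by exact_mod_cast hn
  have h3 := Finset.single_le_sum (f := fun p => ‖complexPoint χ n p‖ ^ 2)
    (fun p _ => by positivity) (Finset.mem_univ q)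
  simp only [complexPoint, hq, mul_one, Complex.norm_real, Real.norm_eq_abs, sq_abs] at h3
  refine le_trans (by nlinarith) (h3.trans (le_of_eq ?_))
  simp only [complexPoint, Complex.norm_real, Real.norm_eq_abs, sq_abs]

/-- The rotations are written relative to the multiplier `c` of the axis, so that `c` factors out
and only the relative angles `u` matter. The condition on `χ` makes it a `0`-`1` vector. -/
theorem complex_corner (hχ : ∀ p, χ p ^ 2 = χ p) (N Y : ℝ) (c : ℂ) (u : Fin k → ℝ) :
    loxodromicMatrix (complexPoint χ N) 0 Y c
        (Matrix.diagonal fun p => c * Complex.exp (u p * Complex.I)) Idx.first Idx.last =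
      c * ∑ p, (χ p : ℂ) * ((N : ℂ) ^ 2 * (Real.cosh Y - 1 : ℝ) -
        (N : ℂ) ^ 2 * (Complex.exp (u p * Complex.I) - 1)) := by
  have hd : ∀ i, ∑ j, (Matrix.diagonal fun p => c * Complex.exp (u p * Complex.I)) i j *
      complexPoint χ N j = c * Complex.exp (u i * Complex.I) * complexPoint χ N i := fun i => by
    simp [Matrix.diagonal_apply]
  rw [loxodromicMatrix_first_last]
  simp only [hd]
  rw [ofReal_sum_norm_sq, Finset.mul_sum, ← Finset.sum_sub_distrib, Finset.mul_sum]
  refine Finset.sum_congr rfl fun p _ => ?_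
  have h1 : star (complexPoint χ N p) = complexPoint χ N p := Complex.conj_ofReal _
  have h2 : complexPoint χ N p * complexPoint χ N p = (N : ℂ) ^ 2 * χ p := by
    have := hχ p
    rw [complexPoint, ← Complex.ofReal_mul, ← Complex.ofReal_pow, ← Complex.ofReal_mul]
    congr 1
    linear_combination N ^ 2 * this
  rw [h1]
  change c * ((Real.cosh Y : ℝ) : ℂ) * _ - _ = _
  push_cast
  linear_combination (c * Complex.cosh Y - c * Complex.exp (u p * Complex.I)) * h2

/-- The real part is a sum of nonnegative terms, as over `ℝ`. The imaginary part yields a second,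
independent bound, which is only needed in maximal rank. -/
theorem complex_corner_bounds (hχ : ∀ p, χ p ^ 2 = χ p) {N Y : ℝ} {c : ℂ} (hc : ‖c‖ = 1)
    {u : Fin k → ℝ} {B : ℝ} (h : ‖loxodromicMatrix (complexPoint χ N) 0 Y c
      (Matrix.diagonal fun p => c * Complex.exp (u p * Complex.I)) Idx.first Idx.last‖ ≤ B) :
    (∀ p, χ p = 1 → N ^ 2 * (Real.cosh Y - 1) ≤ B ∧ N ^ 2 * (1 - Real.cos (u p)) ≤ B) ∧
      |∑ p, χ p * (N ^ 2 * Real.sin (u p))| ≤ B := by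
  rw [complex_corner hχ, norm_mul, hc, one_mul] at h
  have hχ0 : ∀ p, 0 ≤ χ p := fun p => by rw [← hχ p]; positivity
  constructor
  · intro p hp
    have h1 := (Complex.abs_re_le_norm _).trans h
    have h2 : ∀ p, ((χ p : ℂ) * ((N : ℂ) ^ 2 * (Real.cosh Y - 1 : ℝ) -
        (N : ℂ) ^ 2 * (Complex.exp (u p * Complex.I) - 1))).re =
        χ p * (N ^ 2 * (Real.cosh Y - 1) + N ^ 2 * (1 - Real.cos (u p))) := fun p => by
      rw [Complex.re_ofReal_mul, Complex.sub_re, ← Complex.ofReal_pow, Complex.re_ofReal_mul,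
        Complex.re_ofReal_mul, Complex.ofReal_re, Complex.sub_re, Complex.exp_ofReal_mul_I_re,
        Complex.one_re]
      ring
    rw [Complex.re_sum] at h1
    simp only [h2] at h1
    have hA : 0 ≤ N ^ 2 * (Real.cosh Y - 1) :=
      mul_nonneg (sq_nonneg _) (by linarith [Real.one_le_cosh Y])
    have hB : ∀ p, 0 ≤ N ^ 2 * (1 - Real.cos (u p)) := fun p =>
      mul_nonneg (sq_nonneg _) (by linarith [Real.cos_le_one (u p)])
    have h3 := Finset.single_le_sum (f := fun p => χ p * (N ^ 2 * (Real.cosh Y - 1) +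
      N ^ 2 * (1 - Real.cos (u p)))) (fun p _ => mul_nonneg (hχ0 p) (add_nonneg hA (hB p)))
      (Finset.mem_univ p)
    simp only [hp, one_mul] at h3
    have h4 := h3.trans ((le_abs_self _).trans h1)
    have := hB p
    constructor <;> linarith
  · have h1 := (Complex.abs_im_le_norm _).trans h
    have h2 : ∀ p, ((χ p : ℂ) * ((N : ℂ) ^ 2 * (Real.cosh Y - 1 : ℝ) -
        (N : ℂ) ^ 2 * (Complex.exp (u p * Complex.I) - 1))).im =
        -(χ p * (N ^ 2 * Real.sin (u p))) := fun p => by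
      rw [Complex.im_ofReal_mul, Complex.sub_im, ← Complex.ofReal_pow, Complex.im_ofReal_mul,
        Complex.im_ofReal_mul, Complex.ofReal_im, Complex.sub_im, Complex.exp_ofReal_mul_I_im,
        Complex.one_im]
      ring
    rw [Complex.im_sum] at h1
    simp only [h2, Finset.sum_neg_distrib, abs_neg] at h1
    exact h1

/-- In the corner the linear terms `N² u p` are of order `N` and diverge individually in general.
Only their weighted sum is assumed to converge; the second-order remainders converge one by one. -/
theorem exists_tendsto_complex {N : ℕ → ℝ} (hN : Tendsto N atTop atTop)
    (hχ : ∀ p, χ p ^ 2 = χ p) {Y : ℕ → ℝ} {V : ℝ}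
    (hY : Tendsto (fun n => N n * Y n) atTop (𝓝 V)) {c : ℕ → ℂ} {ω : ℂ}
    (hc : Tendsto c atTop (𝓝 ω)) {u : ℕ → Fin k → ℝ} {U : Fin k → ℝ}
    (hu : ∀ p, Tendsto (fun n => N n * u n p) atTop (𝓝 (U p))) {S : ℝ}
    (hS : Tendsto (fun n => N n ^ 2 * ∑ p, χ p * u n p) atTop (𝓝 S)) :
    ∃ T : Matrix (Idx k) (Idx k) ℂ,
      Tendsto (fun n => loxodromicMatrix (complexPoint χ (N n)) 0 (Y n) (c n)
        (Matrix.diagonal fun p => c n * Complex.exp (u n p * Complex.I))) atTop (𝓝 T) ∧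
      T Idx.first Idx.last = ω * (((∑ p, χ p * (V ^ 2 / 2 + U p ^ 2 / 2) : ℝ) : ℂ) -
        (S : ℂ) * Complex.I) := by
  have hY' : Tendsto (fun n => N n * -Y n) atTop (𝓝 (-V)) := by simpa using hY.neg
  have hcast : ∀ {z : ℕ → ℝ} {Z : ℝ}, Tendsto z atTop (𝓝 Z) →
      Tendsto (fun n => (z n : ℂ)) atTop (𝓝 (Z : ℂ)) := fun hz =>
    (Complex.continuous_ofReal.tendsto _).comp hz
  have hexpY : ∀ {z : ℕ → ℝ} {Z : ℝ}, Tendsto (fun n => N n * z n) atTop (𝓝 Z) →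
      Tendsto (fun n => ((Real.exp (z n) : ℝ) : ℂ)) atTop (𝓝 1) := fun hz => by
    have h := (Complex.continuous_exp.tendsto 0).comp
      (tendsto_zero_of_tendsto_mul hN (tendsto_ofReal_mul hz))
    rw [Complex.exp_zero] at h
    refine h.congr fun n => ?_
    simp
  have hexpu : ∀ p, Tendsto (fun n => Complex.exp (u n p * Complex.I)) atTop (𝓝 1) := fun p => by
    have h := (Complex.continuous_exp.tendsto 0).comp
      (tendsto_zero_of_tendsto_mul hN (tendsto_ofReal_mul_I (hu p)))
    rwa [Complex.exp_zero] at h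
  have hcorner : Tendsto (fun n => loxodromicMatrix (complexPoint χ (N n)) 0 (Y n) (c n)
      (Matrix.diagonal fun p => c n * Complex.exp (u n p * Complex.I)) Idx.first Idx.last) atTop
      (𝓝 (ω * (((∑ p, χ p * (V ^ 2 / 2 + U p ^ 2 / 2) : ℝ) : ℂ) - (S : ℂ) * Complex.I))) := by
    simp only [complex_corner hχ]
    refine hc.mul ?_
    have h1 : Tendsto (fun n => ∑ p, (χ p : ℂ) * (((N n ^ 2 * (Real.cosh (Y n) - 1) : ℝ) : ℂ) -
        (N n : ℂ) ^ 2 * (Complex.exp (u n p * Complex.I) - 1 - u n p * Complex.I))) atTop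
        (𝓝 (∑ p, (χ p : ℂ) * (((V ^ 2 / 2 : ℝ) : ℂ) - ((U p : ℂ) * Complex.I) ^ 2 / 2))) :=
      tendsto_finsetSum _ fun p _ => ((hcast (tendsto_sq_mul_cosh_sub_one hN hY)).sub
        (tendsto_sq_mul_exp_sub hN (tendsto_ofReal_mul_I (hu p)))).const_mul _
    have h2 := h1.sub ((hcast hS).mul_const Complex.I)
    have e : ∑ p, (χ p : ℂ) * (((V ^ 2 / 2 : ℝ) : ℂ) - ((U p : ℂ) * Complex.I) ^ 2 / 2) =
        ((∑ p, χ p * (V ^ 2 / 2 + U p ^ 2 / 2) : ℝ) : ℂ) := by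
      push_cast
      refine Finset.sum_congr rfl fun p _ => ?_
      rw [mul_pow, Complex.I_sq]
      ring
    rw [e] at h2
    refine h2.congr fun n => ?_
    push_cast
    rw [Finset.mul_sum, Finset.sum_mul, ← Finset.sum_sub_distrib]
    refine Finset.sum_congr rfl fun p _ => ?_
    ring
  have hall : ∀ i j : Idx k, ∃ z, Tendsto (fun n => loxodromicMatrix (complexPoint χ (N n)) 0 (Y n)
      (c n) (Matrix.diagonal fun p => c n * Complex.exp (u n p * Complex.I)) i j) atTop
      (𝓝 z) := by
    intro i j
    rcases i with _ | i | _ <;> rcases j with _ | j | _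
    · change ∃ z, Tendsto (fun n => loxodromicMatrix _ 0 _ _ _ Idx.first Idx.first) atTop (𝓝 z)
      simp only [loxodromicMatrix_first_first]
      exact ⟨1 * ω, (hexpY hY).mul hc⟩
    · refine ⟨_, ((hc.mul_const (χ j : ℂ)).mul ((tendsto_mul_exp_sub_one hN
        (tendsto_ofReal_mul_I (hu j))).sub (hcast (tendsto_mul_real_exp_sub_one hN hY)))).congr
        fun n => ?_⟩
      change _ = loxodromicMatrix _ 0 _ _ _ Idx.first (Idx.mid j)
      have h1 : ∀ p, star (complexPoint χ (N n) p) = complexPoint χ (N n) p := fun p =>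
        Complex.conj_ofReal _
      rw [loxodromicMatrix_first_mid]
      simp only [h1]
      simp only [Matrix.diagonal_apply, mul_ite, mul_zero, Finset.sum_ite_eq',
        Finset.mem_univ, if_true]
      change _ = _ - ((Real.exp (Y n) : ℝ) : ℂ) * c n * _
      simp only [complexPoint]
      push_cast
      ring
    · exact ⟨_, hcorner⟩
    · change ∃ z, Tendsto (fun n => loxodromicMatrix _ 0 _ _ _ (Idx.mid i) Idx.first) atTop (𝓝 z)
      simp only [loxodromicMatrix_mid_first]
      exact ⟨0, tendsto_const_nhds⟩
    · change ∃ z, Tendsto (fun n => loxodromicMatrix _ 0 _ _ _ (Idx.mid i) (Idx.mid j)) atTop (𝓝 z)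
      simp only [loxodromicMatrix_mid_mid, Matrix.diagonal_apply]
      split_ifs
      · exact ⟨_, hc.mul (hexpu i)⟩
      · exact ⟨0, tendsto_const_nhds⟩
    · refine ⟨_, ((hc.mul_const (χ i : ℂ)).mul ((hcast (tendsto_mul_real_exp_sub_one hN hY')).sub
        (tendsto_mul_exp_sub_one hN (tendsto_ofReal_mul_I (hu i))))).congr fun n => ?_⟩
      change _ = loxodromicMatrix _ 0 _ _ _ (Idx.mid i) Idx.last
      rw [loxodromicMatrix_mid_last]
      simp only [Matrix.diagonal_apply, ite_mul, zero_mul, Finset.sum_ite_eq, Finset.mem_univ,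
        if_true, complexPoint]
      change _ = ((Real.exp (-Y n) : ℝ) : ℂ) * c n * _ - _
      push_cast
      ring
    · change ∃ z, Tendsto (fun n => loxodromicMatrix _ 0 _ _ _ Idx.last Idx.first) atTop (𝓝 z)
      simp only [loxodromicMatrix_last_first]
      exact ⟨0, tendsto_const_nhds⟩
    · change ∃ z, Tendsto (fun n => loxodromicMatrix _ 0 _ _ _ Idx.last (Idx.mid j)) atTop (𝓝 z)
      simp only [loxodromicMatrix_last_mid]
      exact ⟨0, tendsto_const_nhds⟩
    · change ∃ z, Tendsto (fun n => loxodromicMatrix _ 0 _ _ _ Idx.last Idx.last) atTop (𝓝 z)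
      simp only [loxodromicMatrix_last_last]
      exact ⟨1 * ω, (hexpY hY').mul hc⟩
  choose T hT using hall
  refine ⟨T, ?_, tendsto_nhds_unique (hT _ _) hcorner⟩
  exact tendsto_pi_nhds.mpr fun i => tendsto_pi_nhds.mpr fun j => hT i j

end Complex

/-! ### Angles with vanishing sum -/

section Balanced

variable {k l : ℕ}

/-- The sequence `g 0, …, g (l - 1)`, followed by minus its sum, and then by zeros. -/
def balanced (l : ℕ) (g : ℕ → ℝ) (p : ℕ) : ℝ :=
  if p < l then g p else if p = l then -∑ i ∈ Finset.range l, g i else 0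

theorem balanced_of_lt {g : ℕ → ℝ} {p : ℕ} (h : p < l) : balanced l g p = g p := if_pos h

theorem sum_balanced (hlk : l < k) (g : ℕ → ℝ) : ∑ p : Fin k, balanced l g p = 0 := by
  rw [Fin.sum_univ_eq_sum_range (balanced l g),
    ← Finset.sum_subset (Finset.range_subset_range.mpr (Nat.succ_le_iff.mpr hlk)),
    Finset.sum_range_succ, Finset.sum_congr rfl fun p hp => balanced_of_lt (Finset.mem_range.mp hp)]
  · simp [balanced]
  · intro p _ hp
    have : l < p := by simpa using hp
    simp [balanced, this.not_gt, this.ne']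

theorem mul_balanced (c : ℝ) (g : ℕ → ℝ) (p : ℕ) :
    c * balanced l g p = balanced l (fun i => c * g i) p := by
  simp only [balanced, mul_ite, mul_neg, Finset.mul_sum, mul_zero]

/-- Closing up a sequence by minus its sum respects congruence modulo `c`, so the last angle may
also be reduced modulo full turns. -/
theorem exists_balanced_eq_add {g g' : ℕ → ℝ} {c : ℝ}
    (h : ∀ i, i < l → ∃ z : ℤ, g i = g' i + z * c) (p : ℕ) :
    ∃ z : ℤ, balanced l g p = balanced l g' p + z * c := by
  unfold balanced
  split_ifs with h1 h2
  · exact h p h1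
  · choose! z hz using h
    refine ⟨-∑ i ∈ Finset.range l, z i, ?_⟩
    rw [Finset.sum_congr rfl fun i hi => hz i (Finset.mem_range.mp hi), Finset.sum_add_distrib,
      ← Finset.sum_mul]
    push_cast
    ring
  · exact ⟨0, by simp⟩

theorem tendsto_balanced {N : ℕ → ℝ} {g : ℕ → ℕ → ℝ} {U : ℕ → ℝ}
    (h : ∀ i, Tendsto (fun n => N n * g n i) atTop (𝓝 (U i))) (p : ℕ) :
    Tendsto (fun n => N n * balanced l (g n) p) atTop (𝓝 (balanced l U p)) := by
  simp only [mul_balanced]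
  unfold balanced
  split_ifs
  · exact h p
  · exact (tendsto_finsetSum _ fun i _ => h i).neg
  · exact tendsto_const_nhds

theorem exp_ofReal_mul_I_congr {x y : ℝ} (h : ∃ z : ℤ, x = y + z * (2 * Real.pi)) :
    Complex.exp (x * Complex.I) = Complex.exp (y * Complex.I) := by
  obtain ⟨z, rfl⟩ := h
  rw [Complex.exp_eq_exp_iff_exists_int]
  exact ⟨z, by push_cast; ring⟩

end Balanced

/-! ### The complex sequences of rank `l < k` -/

section BalancedSequence

variable {k l : ℕ}

/-- The indicator function of the indices up to `l`. -/
def initialIndicator (k l : ℕ) (p : Fin k) : ℝ := if (p : ℕ) ≤ l then 1 else 0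

theorem initialIndicator_sq (p : Fin k) : initialIndicator k l p ^ 2 = initialIndicator k l p := by
  unfold initialIndicator
  split_ifs <;> norm_num

theorem initialIndicator_of_le {p : Fin k} (h : (p : ℕ) ≤ l) : initialIndicator k l p = 1 :=
  if_pos h

theorem initialIndicator_mul_balanced (g : ℕ → ℝ) (p : Fin k) :
    initialIndicator k l p * balanced l g p = balanced l g p := by
  unfold initialIndicator balanced
  split_ifs <;> first | omega | simp

/-- The complex sequence of rank `l < k`. -/
noncomputable def balancedSequence (hlk : l < k) (n : ℕ) : SU1 k :=
  complexElement (complexPoint (initialIndicator k l) n) (1 / (n : ℝ) ^ (l + 1)) 0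
    (fun p => balanced l (fun i => 2 * Real.pi / (n : ℝ) ^ (i + 1)) p) (by simp [sum_balanced hlk])

theorem balancedSequence_zpow (hlk : l < k) (n : ℕ) (j : ℤ) :
    (balancedSequence hlk n ^ j).1.1 = loxodromicMatrix (complexPoint (initialIndicator k l) n) 0
      (j * (1 / (n : ℝ) ^ (l + 1))) 1 (Matrix.diagonal fun p => 1 * Complex.exp
        ((balanced l (fun i => j * (2 * Real.pi / (n : ℝ) ^ (i + 1))) p : ℝ) * Complex.I)) := by
  rw [balancedSequence, complexElement_zpow]
  simp only [mul_balanced, mul_zero, Complex.ofReal_zero, zero_mul, Complex.exp_zero, one_mul]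

theorem isLoxodromicMatrix_balancedSequence (hlk : l < k) (n : ℕ) (hn : 1 ≤ n) :
    IsLoxodromicMatrix (balancedSequence hlk n) (complexPoint (initialIndicator k l) n)
      (1 / (n : ℝ) ^ (l + 1)) :=
  isLoxodromicMatrix_complexElement _ (by positivity)
    (one_le_sum_complexPoint_sq (initialIndicator_of_le (p := ⟨0, by omega⟩) (Nat.zero_le _)) hn)

/-- The angles sum to zero, so the linear terms in the corner cancel and its limit is the real sum
of squares of the real case. The price is one additional coordinate for the closing angle, whence `l
< k`. -/
theorem exists_tendsto_balancedSequence (hl : 1 ≤ l) (hlk : l < k) (w : Fin (l + 1) → ℤ) :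
    ∃ T : Matrix (Idx k) (Idx k) ℂ,
      Tendsto (fun n => (balancedSequence hlk n ^ digitHom l n w).1.1) atTop (𝓝 T) ∧
        (w ≠ 0 → T Idx.first Idx.last ≠ 0) := by
  set A : ℕ → ℝ := fun t => digits w t with hA
  have hN : Tendsto (fun n : ℕ => (n : ℝ)) atTop atTop := tendsto_natCast_atTop_atTop
  obtain ⟨T, hT, hTc⟩ := exists_tendsto_complex (χ := initialIndicator k l) hN initialIndicator_sq
    (Y := fun n => lowerSum A (l + 1) n) (V := A l) (tendsto_mul_lowerSum hN A l)
    (c := fun _ => 1) (ω := 1) tendsto_const_nhds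
    (u := fun n p => balanced l (fun i => 2 * Real.pi * lowerSum A (i + 1) n) p)
    (U := fun p => balanced l (fun i => 2 * Real.pi * A i) p)
    (fun p => tendsto_balanced (fun i => by
      refine ((tendsto_mul_lowerSum hN A i).const_mul (2 * Real.pi)).congr fun n => ?_
      ring) p) (S := 0) (by simp [initialIndicator_mul_balanced, sum_balanced hlk])
  refine ⟨T, hT.congr' ?_, fun hw h0 => hw ?_⟩
  · filter_upwards [eventually_ge_atTop 1] with n hn
    rw [balancedSequence_zpow, mul_one_div, digitHom_div_pow_top]
    congr 2
    funext p
    congr 1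
    symm
    refine exp_ofReal_mul_I_congr (exists_balanced_eq_add (fun i hi => ?_) p)
    obtain ⟨z, hz⟩ := exists_digitHom_div_pow w hn (p := i + 1) (by omega)
    refine ⟨z, ?_⟩
    rw [hA, ← mul_div_assoc, mul_div_right_comm, hz]
    ring
  · rw [hTc, one_mul, Complex.ofReal_zero, zero_mul, sub_zero, Complex.ofReal_eq_zero] at h0
    have hpos : ∀ p : Fin k, 0 ≤ initialIndicator k l p := fun p => by
      unfold initialIndicator; split_ifs <;> norm_num
    have h1 := (Finset.sum_eq_zero_iff_of_nonneg (fun p _ => by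
      have := hpos p
      positivity)).mp h0
    have h2 : ∀ i, i < l → A l = 0 ∧ A i = 0 := by
      intro i hi
      have h3 := h1 ⟨i, by omega⟩ (Finset.mem_univ _)
      rw [initialIndicator_of_le hi.le, one_mul, balanced_of_lt hi] at h3
      have h6 : A l ^ 2 = 0 := by nlinarith [sq_nonneg (A l), sq_nonneg (2 * Real.pi * A i)]
      have h7 : (2 * Real.pi * A i) ^ 2 = 0 := by
        nlinarith [sq_nonneg (A l), sq_nonneg (2 * Real.pi * A i)]
      refine ⟨by simpa using h6, ?_⟩
      have := Real.pi_ne_zero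
      simpa [this] using h7
    funext t
    have h3 : A t = 0 := by
      rcases (Nat.lt_succ_iff.mp t.2).lt_or_eq with h | h
      · exact (h2 t h).2
      · rw [h]; exact (h2 0 hl).1
    rw [← digits_val w t]
    simpa [hA] using h3

theorem exists_finite_balancedSequence (hlk : l < k) (B : ℝ) :
    ∃ W : Set (Fin (l + 1) → ℤ), W.Finite ∧ ∀ᶠ n in atTop, ∀ j : ℤ,
      ‖corner (balancedSequence hlk n ^ j)‖ ≤ B → ∃ w ∈ W, j = digitHom l n w := by
  refine ⟨_, finite_box (l + 1) (2 ^ l * √(2 * B)), ?_⟩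
  filter_upwards [eventually_ge_atTop 1] with n hn j hj
  have hn0 : (0 : ℝ) < n := by exact_mod_cast hn
  have hB : 0 ≤ B := (norm_nonneg _).trans hj
  rw [corner, balancedSequence_zpow] at hj
  have hb := (complex_corner_bounds initialIndicator_sq norm_one hj).1
  refine exists_digitHom_eq hn ?_ fun i hi1 hil => ?_
  · have h1 := abs_le_of_sq_mul_cosh_sub_one_le hn0
      (hb ⟨0, by omega⟩ (initialIndicator_of_le (Nat.zero_le _))).1
    rw [mul_one_div, abs_div, abs_of_pos (by positivity : (0 : ℝ) < (n : ℝ) ^ (l + 1)),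
      div_le_div_iff₀ (by positivity) hn0, pow_succ, ← mul_assoc] at h1
    exact le_of_mul_le_mul_right h1 hn0
  · obtain ⟨i, rfl⟩ : ∃ i', i = i' + 1 := ⟨i - 1, by omega⟩
    have h2 := (hb ⟨i, by omega⟩ (initialIndicator_of_le (by dsimp only; omega))).2
    rw [balanced_of_lt (by dsimp only; omega), mul_div_left_comm] at h2
    obtain ⟨z, hz⟩ := exists_int_abs_sub_le hn0 h2
    refine ⟨z, hz.trans ?_⟩
    gcongr
    linarith

theorem exists_balanced_representations (hl : 1 ≤ l) (hlk : l < k) :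
    ∃ (ρ : ℕ → FreeGroup (Fin 2) →* SU1 k) (ρlim : FreeGroup (Fin 2) →* SU1 k),
      (∀ n, 1 ≤ n → IsConvexCocompact (ρ n)) ∧
      IsJorgensenSequence l (fun n => restrictToA (ρ n)) ∧
      (∀ n, 1 ≤ n → ρ n (FreeGroup.of 0) = balancedSequence hlk n) ∧
      ConvergesAlgebraically ρ ρlim ∧ HasFreeProductLimit l ρ ρlim := by
  obtain ⟨L, hL⟩ := exists_cornersConverge (isClosed_unitaryGroup ℂ k) (digitHom_single l)
    (exists_tendsto_balancedSequence hl hlk) (exists_finite_balancedSequence hlk)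
  exact hL.exists_representations ⟨0, by omega⟩ hl le_rfl (fun p e h u => h.translation_mem u)
    (isLoxodromicMatrix_balancedSequence hlk)

end BalancedSequence

/-! ### Estimates for lower sums and the sine -/

section LowerSum

theorem lowerSum_zero (A : ℕ → ℝ) (x : ℝ) : lowerSum A 0 x = 0 := by simp [lowerSum]

theorem lowerSum_succ (A : ℕ → ℝ) (p : ℕ) {x : ℝ} (hx : x ≠ 0) :
    lowerSum A (p + 1) x = (lowerSum A p x + A p) / x := by
  rw [lowerSum, lowerSum, Finset.sum_range_succ, pow_succ]
  field_simp

theorem abs_lowerSum_le (A : ℕ → ℝ) {p d : ℕ} (hp : p ≤ d) {x : ℝ} (hx : 1 ≤ x) :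
    |lowerSum A p x| ≤ (∑ i ∈ Finset.range d, |A i|) / x := by
  have hx0 : 0 < x := by linarith
  rcases p with _ | p
  · rw [lowerSum_zero, abs_zero]
    positivity
  · rw [lowerSum, abs_div, abs_of_pos (by positivity : 0 < x ^ (p + 1)),
      div_le_div_iff₀ (by positivity) hx0, pow_succ, ← mul_assoc]
    refine mul_le_mul_of_nonneg_right ?_ hx0.le
    calc |∑ i ∈ Finset.range (p + 1), A i * x ^ i|
        ≤ ∑ i ∈ Finset.range (p + 1), |A i * x ^ i| := Finset.abs_sum_le_sum_abs _ _
      _ ≤ ∑ i ∈ Finset.range (p + 1), |A i| * x ^ p := by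
          refine Finset.sum_le_sum fun i hi => ?_
          rw [abs_mul, abs_of_pos (by positivity : 0 < x ^ i)]
          have := Finset.mem_range.mp hi
          gcongr
          omega
      _ ≤ _ := by
          rw [← Finset.sum_mul]
          refine mul_le_mul_of_nonneg_right (Finset.sum_le_sum_of_subset_of_nonneg
            (Finset.range_subset_range.mpr hp) fun _ _ _ => abs_nonneg _) (by positivity)

theorem lowerSum_add_mul (A C : ℕ → ℝ) (b : ℝ) (p : ℕ) (x : ℝ) :
    lowerSum (fun i => A i + b * C i) p x = lowerSum A p x + b * lowerSum C p x := by
  simp only [lowerSum, add_mul, Finset.sum_add_distrib, add_div, mul_assoc, ← Finset.mul_sum,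
    mul_div_assoc]

/-- A quadratic error suffices: a sum of sines bounded by `O(1/n²)` at arguments of size `O(1/n)`
forces the sum of the arguments to be `O(1/n²)`. -/
theorem abs_sin_sub_le {x : ℝ} (hx : |x| ≤ 1) : |Real.sin x - x| ≤ x ^ 2 := by
  have key : ∀ y : ℝ, 0 < y → y ≤ 1 → |Real.sin y - y| ≤ y ^ 2 := by
    intro y h0 h1
    have h2 := Real.sin_lt h0
    have h3 := Real.sin_gt_sub_cube h0
    rw [abs_of_neg (by linarith)]
    nlinarith [mul_nonneg (sq_nonneg y) (sub_nonneg.mpr h1), sq_nonneg y]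
  rcases lt_trichotomy x 0 with h | rfl | h
  · have := key (-x) (by linarith) (by rwa [abs_of_neg h] at hx)
    rw [Real.sin_neg, ← abs_neg] at this
    simpa [add_comm, sub_eq_add_neg] using this
  · simp
  · exact key x h (by rwa [abs_of_pos h] at hx)

end LowerSum

/-! ### The additional exponent in maximal rank -/

section JorgensenExponent

/-- The weights `0, 3, 1, 1, …`. -/
def angleWeight : ℕ → ℤ
  | 0 => 0
  | 1 => 3
  | _ + 2 => 1

theorem sum_angleWeight (d : ℕ) : ∑ i ∈ Finset.range (d + 1), angleWeight (i + 1) = d + 3 := by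
  induction d with
  | zero => simp [angleWeight]
  | succ d ih =>
    rw [Finset.sum_range_succ, ih]
    push_cast [angleWeight]
    ring

theorem abs_angleWeight_le (p d : ℕ) : |(angleWeight p : ℝ)| ≤ d + 3 := by
  have h : (0 : ℝ) ≤ d := by positivity
  rcases p with _ | _ | p
  · simp [angleWeight]; positivity
  · simp [angleWeight]
  · simp only [angleWeight, Int.cast_one, abs_one]; linarith

/-- The weights sum to `d + 3`. For `x = -Q / (d + 3)` the correction at the closing index is the
integer `Q`, so all rotations can be made close to full turns at the same time. -/
theorem balanced_angleWeight {d p : ℕ} (hp : p ≤ d) (x : ℝ) :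
    balanced d (fun i => x * angleWeight (i + 1)) p =
      x * angleWeight (p + 1) - if p = d then x * (d + 3) else 0 := by
  rcases hp.lt_or_eq with h | rfl
  · rw [balanced_of_lt h, if_neg h.ne, sub_zero]
  · have h := congrArg (fun z : ℤ => (z : ℝ)) (sum_angleWeight p)
    rw [Finset.sum_range_succ] at h
    push_cast at h
    rw [balanced, if_neg (lt_irrefl _), if_pos rfl, if_pos rfl, ← Finset.mul_sum]
    linear_combination -x * h

/-- The numbers `n = (k + 2) s + r` of a residue class, where `k = d + 1`. -/
def residueIndex (d r s : ℕ) : ℕ := (d + 1 + 2) * s + r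

/-- The integral parts of the quotients of `jorgensenExponent` by `n ^ d, …, n ^ 0`. -/
def jorgensenQuotient (d r s : ℕ) : ℕ → ℤ
  | 0 => 2 * s * (residueIndex d r s + r)
  | i + 1 => residueIndex d r s * jorgensenQuotient d r s i - s * angleWeight (d - i)

/-- The integral part of `2 n ^ (k + 1) / (k + 2)` with suitable lower order corrections. -/
def jorgensenExponent (d r s : ℕ) : ℤ := jorgensenQuotient d r s d

/-- The coefficients of the lower order terms of `jorgensenExponent`. -/
noncomputable def jorgensenCoeff (d r i : ℕ) : ℝ :=
  ((if i < d then (r : ℝ) * angleWeight (i + 1) else -2 * (r : ℝ) ^ 2) - angleWeight i) / (d + 3)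

theorem cast_residueIndex (d r s : ℕ) : (residueIndex d r s : ℝ) = (d + 3) * s + r := by
  rw [residueIndex]; push_cast; ring

/-- Since `s = (n - r) / (d + 3)` for `n = residueIndex d r s`, subtracting `s` times a weight in
the recursion produces the fractional part `-weight / (d + 3)`, up to a term of order `1/n`
collected in `jorgensenCoeff`. This fraction cancels the contribution `weight / 2 · j / n^(d+2)` to
the rotation number, as `j / n^(d+2)` tends to `2 / (d + 3)`. -/
theorem jorgensenExponent_div_pow (d r s : ℕ) (hn : 1 ≤ residueIndex d r s) {p : ℕ} (hp : p ≤ d) :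
    (jorgensenExponent d r s : ℝ) / (residueIndex d r s : ℝ) ^ p =
      lowerSum (jorgensenCoeff d r) p (residueIndex d r s) + jorgensenQuotient d r s (d - p) -
        angleWeight p / (d + 3) := by
  have hn0 : (residueIndex d r s : ℝ) ≠ 0 := by positivity
  have hD : (d + 3 : ℝ) ≠ 0 := by positivity
  induction p with
  | zero => simp [lowerSum_zero, jorgensenExponent, angleWeight]
  | succ p ih =>
    have h := ih (by omega)
    obtain ⟨i, hi⟩ : ∃ i, d - p = i + 1 := ⟨d - p - 1, by omega⟩
    have hi1 : d - (p + 1) = i := by omega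
    have hi2 : d - i = p + 1 := by omega
    rw [hi, jorgensenQuotient, hi2] at h
    rw [hi1, pow_succ, ← div_div, h, lowerSum_succ _ _ hn0, jorgensenCoeff, if_pos (by omega)]
    push_cast
    have hs : (s : ℝ) = (residueIndex d r s - r) / (d + 3) := by
      rw [cast_residueIndex]; field_simp; ring
    rw [hs]
    field_simp
    ring

/-- The initial quotient `2 s (n + r)` equals `2 (n² - r²) / (d + 3)`. It has no term linear in `n`,
so the leading term `2 n^(d+2) / (d + 3)` is followed by terms of order `n^d` only; a term in
`n^(d+1)` would make the imaginary part of the corner unbounded. -/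
theorem jorgensenExponent_eq (d r s : ℕ) (hn : 1 ≤ residueIndex d r s) :
    (jorgensenExponent d r s : ℝ) =
      lowerSum (jorgensenCoeff d r) (d + 1) (residueIndex d r s) * residueIndex d r s ^ (d + 1) +
        2 / (d + 3) * residueIndex d r s ^ (d + 2) := by
  have hn0 : (residueIndex d r s : ℝ) ≠ 0 := by positivity
  have hD : (d + 3 : ℝ) ≠ 0 := by positivity
  have h := jorgensenExponent_div_pow d r s hn le_rfl
  rw [Nat.sub_self, jorgensenQuotient, div_eq_iff (by positivity)] at h
  rw [h, lowerSum_succ _ _ hn0, jorgensenCoeff, if_neg (lt_irrefl _)]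
  push_cast
  have hs : (s : ℝ) = (residueIndex d r s - r) / (d + 3) := by
    rw [cast_residueIndex]; field_simp; ring
  rw [hs]
  field_simp
  ring

/-- The exponents `∑ aᵢ nⁱ + Q m`, where `m = jorgensenExponent`. -/
def jorgensenHom (d r s : ℕ) : (Fin (d + 1 + 1) → ℤ) →+ ℤ where
  toFun w := digitHom d (residueIndex d r s) (fun t => w t.castSucc) +
    w (Fin.last _) * jorgensenExponent d r s
  map_zero' := by
    change digitHom d _ 0 + 0 * _ = 0
    simp
  map_add' v w := by
    change digitHom d _ ((fun t => v t.castSucc) + fun t => w t.castSucc) + (_ + _) * _ = _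
    rw [map_add]
    ring

theorem jorgensenHom_apply (d r s : ℕ) (w : Fin (d + 1 + 1) → ℤ) :
    jorgensenHom d r s w = digitHom d (residueIndex d r s) (fun t => w t.castSucc) +
      w (Fin.last _) * jorgensenExponent d r s := rfl

theorem jorgensenHom_single (d r s : ℕ) : jorgensenHom d r s (Pi.single 0 1) = 1 := by
  have h : (fun t : Fin (d + 1) => (Pi.single 0 1 : Fin (d + 1 + 1) → ℤ) t.castSucc) =
      Pi.single 0 1 := by
    funext t
    simp only [Pi.single_apply, Fin.castSucc_eq_zero_iff]
  rw [jorgensenHom_apply, h, digitHom_single]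
  simp

/-- The coefficients of `jorgensenHom` in base `n`. -/
noncomputable def jorgensenDigits (d r : ℕ) (w : Fin (d + 1 + 1) → ℤ) (i : ℕ) : ℝ :=
  digits (fun t : Fin (d + 1) => w t.castSucc) i + w (Fin.last _) * jorgensenCoeff d r i

theorem jorgensenHom_eq (d r s : ℕ) (hn : 1 ≤ residueIndex d r s) (w : Fin (d + 1 + 1) → ℤ) :
    (jorgensenHom d r s w : ℝ) =
      lowerSum (jorgensenDigits d r w) (d + 1) (residueIndex d r s) *
        residueIndex d r s ^ (d + 1) +
        w (Fin.last _) * (2 / (d + 3)) * residueIndex d r s ^ (d + 2) := by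
  have hn0 : (residueIndex d r s : ℝ) ≠ 0 := by positivity
  have h := digitHom_div_pow_top (fun t : Fin (d + 1) => w t.castSucc) (residueIndex d r s)
  rw [div_eq_iff (by positivity)] at h
  unfold jorgensenDigits
  rw [lowerSum_add_mul, ← digitHom_div_pow_top, jorgensenHom_apply]
  push_cast
  rw [jorgensenExponent_eq d r s hn, digitHom_div_pow_top, h]
  ring

/-- Modulo integers the base-`n` digits contribute only their lower sums, while each copy of the
additional exponent shifts the quotient by minus the weight over `d + 3`. -/
theorem exists_jorgensenHom_div_pow (d r s : ℕ) (hn : 1 ≤ residueIndex d r s)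
    (w : Fin (d + 1 + 1) → ℤ) {p : ℕ} (hp : p ≤ d) :
    ∃ z : ℤ, (jorgensenHom d r s w : ℝ) / (residueIndex d r s : ℝ) ^ p =
      lowerSum (jorgensenDigits d r w) p (residueIndex d r s) -
        w (Fin.last _) / (d + 3) * angleWeight p + z := by
  obtain ⟨z, hz⟩ := exists_digitHom_div_pow (fun t : Fin (d + 1) => w t.castSucc) hn (p := p)
    (by omega)
  refine ⟨z + w (Fin.last _) * jorgensenQuotient d r s (d - p), ?_⟩
  unfold jorgensenDigits
  rw [lowerSum_add_mul, jorgensenHom_apply]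
  push_cast
  rw [add_div, hz, mul_div_assoc, jorgensenExponent_div_pow d r s hn hp]
  ring

end JorgensenExponent

/-! ### The complex sequence of maximal rank -/

section ComplexSequence

variable {d : ℕ}

theorem balanced_add (l : ℕ) (g g' : ℕ → ℝ) (p : ℕ) :
    balanced l (fun i => g i + g' i) p = balanced l g p + balanced l g' p := by
  unfold balanced
  split_ifs
  · rfl
  · rw [Finset.sum_add_distrib]; ring
  · simp

/-- The perturbation of the first angle makes the total `2π / n^(d+2)`, so `φ = -π / n^(d+2)`.
Relative to `φ` the extra rotations are the weights `3, 1, …, 1` times `π / n^(d+2)`; the `-1` here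
is the share of `φ`. -/
theorem complexAngle_eq (hd : 1 ≤ d) (n : ℕ) (p : Fin (d + 1)) :
    complexAngle (d + 1) n p = balanced d (fun i => 2 * Real.pi / (n : ℝ) ^ (i + 1)) p +
      (angleWeight (p + 1) - 1) * (Real.pi / (n : ℝ) ^ (d + 2)) := by
  have hp := p.2
  rcases p with ⟨_ | p, hp'⟩
  · simp only [complexAngle, balanced, angleWeight, Nat.zero_add, if_true]
    rw [if_neg (by omega), if_pos (by omega)]
    push_cast
    ring
  · simp only [complexAngle, balanced, angleWeight]
    by_cases h : p + 1 = d
    · rw [if_pos (by omega), if_neg (by omega), if_pos h, Finset.sum_Ico_eq_sum_range]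
      simp [add_comm]
    · rw [if_neg (by omega), if_neg (by omega), if_pos (by omega)]
      simp

theorem sum_angleWeight_fin (d : ℕ) :
    ∑ p : Fin (d + 1), (angleWeight (p + 1) : ℝ) = d + 3 := by
  rw [Fin.sum_univ_eq_sum_range (fun p => (angleWeight (p + 1) : ℝ))]
  exact_mod_cast sum_angleWeight d

theorem sum_complexAngle (hd : 1 ≤ d) (n : ℕ) :
    ∑ p, complexAngle (d + 1) n p = 2 * (Real.pi / (n : ℝ) ^ (d + 2)) := by
  simp only [complexAngle_eq hd, Finset.sum_add_distrib, sum_balanced (Nat.lt_succ_self d),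
    ← Finset.sum_mul, Finset.sum_sub_distrib, sum_angleWeight_fin]
  simp only [Finset.sum_const, Finset.card_univ, Fintype.card_fin, nsmul_eq_mul]
  push_cast
  ring

/-- The complex sequence of maximal rank. -/
noncomputable def complexSequence (d n : ℕ) : SU1 (d + 1) :=
  complexElement (complexPoint (fun _ => 1) n) (1 / (n : ℝ) ^ (d + 1 + 2))
    (-(∑ p, complexAngle (d + 1) n p) / 2) (complexAngle (d + 1) n) (by ring)

theorem complexSequence_eq_complexJorgensenMatrix (d n : ℕ) :
    (complexSequence d n).1.1 = complexJorgensenMatrix (d + 1) n := by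
  have h := complexElement_zpow (complexPoint (fun _ : Fin (d + 1) => 1) n)
    (1 / (n : ℝ) ^ (d + 1 + 2)) (-(∑ p, complexAngle (d + 1) n p) / 2) (complexAngle (d + 1) n)
    (by ring) 1
  rw [zpow_one] at h
  rw [complexSequence, h, complexJorgensenMatrix]
  simp only [Int.cast_one, one_mul]
  congr 1
  funext p
  simp [complexPoint]

theorem isLoxodromicMatrix_complexSequence (d n : ℕ) (hn : 1 ≤ n) :
    IsLoxodromicMatrix (complexSequence d n) (complexPoint (fun _ => 1) n)
      (1 / (n : ℝ) ^ (d + 1 + 2)) :=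
  isLoxodromicMatrix_complexElement _ (by positivity) (one_le_sum_complexPoint_sq (q := 0) rfl hn)

/-- The rotation numbers of the powers of `complexSequence`, relative to the axis. -/
noncomputable def rotationNumber (d n : ℕ) (j : ℤ) (p : ℕ) : ℝ :=
  balanced d (fun i => j / (n : ℝ) ^ (i + 1)) p + angleWeight (p + 1) / 2 * (j / (n : ℝ) ^ (d + 2))

theorem sum_rotationNumber (d n : ℕ) (j : ℤ) :
    ∑ p : Fin (d + 1), rotationNumber d n j p = (d + 3) / 2 * (j / (n : ℝ) ^ (d + 2)) := by
  simp only [rotationNumber, Finset.sum_add_distrib, sum_balanced (Nat.lt_succ_self d),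
    ← Finset.sum_mul, ← Finset.sum_div, sum_angleWeight_fin, zero_add]

theorem complexSequence_zpow (hd : 1 ≤ d) (n : ℕ) (j : ℤ) : (complexSequence d n ^ j).1.1 =
    loxodromicMatrix (complexPoint (fun _ => 1) n) 0 (j / (n : ℝ) ^ (d + 3))
      (Complex.exp ((-Real.pi * (j / (n : ℝ) ^ (d + 2)) : ℝ) * Complex.I))
      (Matrix.diagonal fun p : Fin (d + 1) =>
        Complex.exp ((-Real.pi * (j / (n : ℝ) ^ (d + 2)) : ℝ) * Complex.I) *
          Complex.exp ((2 * Real.pi * rotationNumber d n j p : ℝ) * Complex.I)) := by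
  rw [complexSequence, complexElement_zpow, sum_complexAngle hd]
  simp only [← Complex.exp_add, ← add_mul, ← Complex.ofReal_add]
  have e1 : (j : ℝ) * (-(2 * (Real.pi / (n : ℝ) ^ (d + 2))) / 2) =
      -Real.pi * (j / (n : ℝ) ^ (d + 2)) := by ring
  rw [mul_one_div, e1]
  congr 2
  funext p
  congr 3
  rw [complexAngle_eq hd, mul_add, mul_balanced, rotationNumber, mul_add, mul_balanced]
  have e2 : (fun i : ℕ => (j : ℝ) * (2 * Real.pi / (n : ℝ) ^ (i + 1))) =
      fun i => 2 * Real.pi * (j / (n : ℝ) ^ (i + 1)) := by funext i; ring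
  rw [e2]
  ring

/-- Up to a unit factor the limiting corner has real part `∑_p (V² + U_p²) / 2` with `V = 2Q / (d +
3)` and `U_p = 2π · balanced d A p`, and imaginary part `-π (d + 3) A_d`. The real part detects `Q`
and `A_0, …, A_(d-1)`; the imaginary part detects the remaining digit `A_d`. -/
theorem exists_tendsto_complexSequence (hd : 1 ≤ d) {ν : ℕ → ℕ} (hν : Tendsto ν atTop atTop)
    {j : ℕ → ℤ} {A : ℕ → ℝ} {Q : ℤ}
    (hj : ∀ᶠ s in atTop, (j s : ℝ) = lowerSum A (d + 1) (ν s) * (ν s : ℝ) ^ (d + 1) +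
      Q * (2 / (d + 3)) * (ν s : ℝ) ^ (d + 2))
    (hI : ∀ᶠ s in atTop, ∀ i, i < d → ∃ z : ℤ, (j s : ℝ) / (ν s : ℝ) ^ (i + 1) =
      lowerSum A (i + 1) (ν s) - Q / (d + 3) * angleWeight (i + 1) + z) :
    ∃ T : Matrix (Idx (d + 1)) (Idx (d + 1)) ℂ,
      Tendsto (fun s => (complexSequence d (ν s) ^ j s).1.1) atTop (𝓝 T) ∧
        (T Idx.first Idx.last = 0 → Q = 0 ∧ ∀ i, i ≤ d → A i = 0) := by
  have hD : (d + 3 : ℝ) ≠ 0 := by positivity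
  have hN : Tendsto (fun s => (ν s : ℝ)) atTop atTop := tendsto_natCast_atTop_atTop.comp hν
  have hinv : Tendsto (fun s => (ν s : ℝ)⁻¹) atTop (𝓝 0) := tendsto_inv_atTop_zero.comp hN
  have hN0 : ∀ᶠ s in atTop, (ν s : ℝ) ≠ 0 := (hN.eventually_gt_atTop 0).mono fun s h => h.ne'
  have hA := tendsto_mul_lowerSum hN A
  have hA0 : Tendsto (fun s => lowerSum A (d + 1) (ν s)) atTop (𝓝 0) := by
    have h := hinv.mul (hA d)
    rw [zero_mul] at h
    refine h.congr' (hN0.mono fun s hs => ?_)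
    rw [inv_mul_cancel_left₀ hs]
  have hβ : ∀ᶠ s in atTop, (j s : ℝ) / (ν s : ℝ) ^ (d + 2) =
      lowerSum A (d + 1) (ν s) * (ν s : ℝ)⁻¹ + Q * (2 / (d + 3)) := by
    filter_upwards [hj, hN0] with s hs h0
    rw [hs]
    field_simp
    ring
  have hβ' : Tendsto (fun s => (j s : ℝ) / (ν s : ℝ) ^ (d + 2)) atTop (𝓝 (Q * (2 / (d + 3)))) := by
    have h := (hA0.mul hinv).add_const ((Q : ℝ) * (2 / (d + 3)))
    rw [zero_mul, zero_add] at h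
    exact h.congr' (hβ.mono fun s hs => hs.symm)
  obtain ⟨T, hT, hTc⟩ := exists_tendsto_complex (k := d + 1) (χ := fun _ => 1) hN
    (fun _ => one_pow 2) (Y := fun s => (j s : ℝ) / (ν s : ℝ) ^ (d + 3)) (V := Q * (2 / (d + 3)))
    (hβ'.congr' (hN0.mono fun s hs => by field_simp; ring))
    (c := fun s => Complex.exp ((-Real.pi * ((j s : ℝ) / (ν s : ℝ) ^ (d + 2)) : ℝ) * Complex.I))
    (((Complex.continuous_exp.comp ((Complex.continuous_ofReal.comp
      (continuous_const.mul continuous_id)).mul continuous_const)).tendsto _).comp hβ')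
    (u := fun s p => 2 * Real.pi * (balanced d (fun i => lowerSum A (i + 1) (ν s)) p +
      angleWeight (p + 1) / 2 * (lowerSum A (d + 1) (ν s) * (ν s : ℝ)⁻¹)))
    (U := fun p => 2 * Real.pi * (balanced d A p + angleWeight (p + 1) / 2 * 0))
    (fun p => by
      refine (((tendsto_balanced hA p).add (hA0.const_mul
        ((angleWeight (p + 1) : ℝ) / 2))).const_mul (2 * Real.pi)).congr' (hN0.mono fun s hs => ?_)
      field_simp)
    -- The balanced parts cancel in the sum. What remains is the sum of the weights, `d + 3`, times
    -- the deviation of `j / n^(d+2)` from its limit, which is asymptotic to `A d / n²`.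
    (S := Real.pi * (d + 3) * A d) (by
      refine ((hA d).const_mul (Real.pi * (d + 3))).congr' (hN0.mono fun s hs => ?_)
      simp only [one_mul, ← Finset.mul_sum, Finset.sum_add_distrib,
        sum_balanced (Nat.lt_succ_self d), ← Finset.sum_mul, ← Finset.sum_div,
        sum_angleWeight_fin]
      field_simp
      ring)
  refine ⟨T, hT.congr' ?_, fun h0 => ?_⟩
  · filter_upwards [hβ, hI] with s hs hz
    rw [complexSequence_zpow hd]
    congr 2
    funext p
    congr 1
    symm
    refine exp_ofReal_mul_I_congr ?_
    obtain ⟨z, hz⟩ := exists_balanced_eq_add (l := d)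
      (g := fun i => (j s : ℝ) / (ν s : ℝ) ^ (i + 1)) (g' := fun i => lowerSum A (i + 1) (ν s) + (-(Q : ℝ) / (d + 3)) * angleWeight (i + 1))
      (c := 1) (fun i hi => (hz i hi).imp fun z hz => by rw [hz]; ring) p
    rw [balanced_add, balanced_angleWeight (Nat.lt_succ_iff.mp p.2)] at hz
    -- The full turn `Q` at the closing index is the correction from `balanced_angleWeight`.
    refine ⟨z + if (p : ℕ) = d then Q else 0, ?_⟩
    rw [rotationNumber, hz, hs]
    split_ifs
    · push_cast
      field_simp
      ring
    · push_cast
      field_simp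
      ring
  · rw [hTc] at h0
    have h1 := (mul_eq_zero.mp h0).resolve_left (Complex.exp_ne_zero _)
    have hre := congrArg Complex.re h1
    have him := congrArg Complex.im h1
    simp only [Complex.sub_re, Complex.ofReal_re, Complex.re_ofReal_mul, Complex.I_re, mul_zero,
      sub_zero, Complex.zero_re, one_mul, add_zero] at hre
    simp only [Complex.sub_im, Complex.ofReal_im, Complex.im_ofReal_mul, Complex.I_im, mul_one,
      zero_sub, Complex.zero_im, neg_eq_zero, mul_eq_zero, Real.pi_ne_zero, false_or, hD] at him
    have h2 := (Finset.sum_eq_zero_iff_of_nonneg (fun p _ => by positivity)).mp hre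
    have h3 : ∀ p : Fin (d + 1), (Q : ℝ) * (2 / (d + 3)) = 0 ∧
        2 * Real.pi * balanced d A p = 0 := fun p => by
      have h4 := h2 p (Finset.mem_univ p)
      have h5 : ((Q : ℝ) * (2 / (d + 3))) ^ 2 = 0 := by
        nlinarith [sq_nonneg ((Q : ℝ) * (2 / (d + 3))), sq_nonneg (2 * Real.pi * balanced d A p)]
      have h6 : (2 * Real.pi * balanced d A p) ^ 2 = 0 := by
        nlinarith [sq_nonneg ((Q : ℝ) * (2 / (d + 3))), sq_nonneg (2 * Real.pi * balanced d A p)]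
      exact ⟨pow_eq_zero_iff two_ne_zero |>.mp h5, pow_eq_zero_iff two_ne_zero |>.mp h6⟩
    constructor
    · have h4 := (h3 0).1
      have : (2 / (d + 3) : ℝ) ≠ 0 := by positivity
      simpa [this] using h4
    · intro i hi
      rcases hi.lt_or_eq with h | rfl
      · have h4 := (h3 ⟨i, by omega⟩).2
        rw [balanced_of_lt h] at h4
        simpa [Real.pi_ne_zero] using h4
      · exact him

end ComplexSequence

/-! ### Bounded powers of the complex sequence -/

section ComplexFinite

variable {d : ℕ}

/-- Each rotation number is within `O(1/n)` of an integer by the real part of the corner. The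
imaginary part improves this to `O(1/n²)` for their sum, which is a multiple of `j / n^(d+2)`
because the balanced parts cancel. The condition `hnB` keeps the reduced angles in `[-1, 1]`. -/
theorem rotationNumber_bounds (hd : 1 ≤ d) {B : ℝ} {n : ℕ} {j : ℤ} (hn : 1 ≤ n)
    (hnB : 2 * Real.pi * √B ≤ n) (h : ‖corner (complexSequence d n ^ j)‖ ≤ B) :
    |(j : ℝ) / (n : ℝ) ^ (d + 2)| ≤ √(2 * B) ∧
    (∀ i, i < d → ∃ z : ℤ, |(j : ℝ) / (n : ℝ) ^ (i + 1) +
      angleWeight (i + 1) / 2 * (j / (n : ℝ) ^ (d + 2)) - z| ≤ √B / n) ∧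
    ∃ Q : ℤ, |(d + 3) / 2 * ((j : ℝ) / (n : ℝ) ^ (d + 2)) - Q| ≤
      (B + (d + 1) * (2 * Real.pi * √B) ^ 2) / (n : ℝ) ^ 2 := by
  have hn0 : (0 : ℝ) < n := by exact_mod_cast hn
  have hB : 0 ≤ B := (norm_nonneg _).trans h
  rw [corner, complexSequence_zpow hd] at h
  obtain ⟨hb, hs⟩ := complex_corner_bounds (fun _ => one_pow 2)
    (Complex.norm_exp_ofReal_mul_I _) h
  have hz : ∀ p : Fin (d + 1), ∃ z : ℤ, |rotationNumber d n j p - z| ≤ √B / n := fun p =>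
    exists_int_abs_sub_le hn0 (hb p rfl).2
  refine ⟨?_, fun i hi => ?_, ?_⟩
  · have h1 := abs_le_of_sq_mul_cosh_sub_one_le hn0 (hb 0 rfl).1
    rw [pow_succ (n : ℝ) (d + 2), ← div_div, abs_div, abs_of_pos hn0] at h1
    exact (div_le_div_iff_of_pos_right hn0).mp h1
  · obtain ⟨z, hz⟩ := hz ⟨i, by omega⟩
    refine ⟨z, ?_⟩
    rwa [rotationNumber, balanced_of_lt (by simpa using hi)] at hz
  · choose z hz using hz
    refine ⟨∑ p, z p, ?_⟩
    have e : ((d : ℝ) + 3) / 2 * ((j : ℝ) / (n : ℝ) ^ (d + 2)) - ((∑ p, z p : ℤ) : ℝ) =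
        ∑ p : Fin (d + 1), (rotationNumber d n j p - z p) := by
      rw [Finset.sum_sub_distrib, sum_rotationNumber]
      push_cast
      rfl
    rw [e]
    set ε : Fin (d + 1) → ℝ := fun p => 2 * Real.pi * (rotationNumber d n j p - z p) with hε
    have hεb : ∀ p, |ε p| ≤ 2 * Real.pi * √B / n := fun p => by
      rw [hε, abs_mul, abs_of_pos Real.two_pi_pos, mul_div_assoc]
      exact mul_le_mul_of_nonneg_left (hz p) Real.two_pi_pos.le
    have hsin : ∀ p : Fin (d + 1), Real.sin (2 * Real.pi * rotationNumber d n j p) = Real.sin (ε p) := fun p => by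
      change _ = Real.sin (2 * Real.pi * (rotationNumber d n j p - z p))
      rw [mul_sub, mul_comm (2 * Real.pi) (z p : ℝ), Real.sin_sub_int_mul_two_pi]
    simp only [one_mul, hsin, ← Finset.mul_sum] at hs
    rw [abs_mul, abs_of_pos (by positivity : (0 : ℝ) < (n : ℝ) ^ 2)] at hs
    have h1 : |∑ p, Real.sin (ε p) - ∑ p, ε p| ≤ (d + 1) * (2 * Real.pi * √B / n) ^ 2 := by
      rw [← Finset.sum_sub_distrib]
      refine (Finset.abs_sum_le_sum_abs _ _).trans ((Finset.sum_le_card_nsmul _ _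
        ((2 * Real.pi * √B / n) ^ 2) fun p _ => ?_).trans (by simp))
      refine (abs_sin_sub_le ((hεb p).trans ((div_le_one hn0).mpr hnB))).trans ?_
      rw [← sq_abs]
      exact pow_le_pow_left₀ (abs_nonneg _) (hεb p) 2
    have h2 : |∑ p, Real.sin (ε p)| ≤ B / (n : ℝ) ^ 2 := by
      rw [le_div_iff₀ (by positivity), mul_comm]
      exact hs
    have h3 : |∑ p, ε p| ≤ B / (n : ℝ) ^ 2 + (d + 1) * (2 * Real.pi * √B / n) ^ 2 := by
      have := abs_sub_abs_le_abs_sub (∑ p, ε p) (∑ p, Real.sin (ε p))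
      rw [abs_sub_comm] at this
      linarith
    rw [hε, ← Finset.mul_sum, abs_mul, abs_of_pos Real.two_pi_pos] at h3
    rw [add_div, mul_div_assoc, ← div_pow]
    refine le_trans ?_ h3
    exact le_mul_of_one_le_left (abs_nonneg _) (by linarith [Real.pi_gt_three])

/-- The integer close to the sum of the rotation numbers is the multiplicity `Q` of
`jorgensenExponent` in `j`. After subtracting it the rest is `O(n^d)` with quotients close to
integers, so it has bounded digits in base `n`. -/
theorem exists_finite_complexSequence (hd : 1 ≤ d) (r : ℕ) (B : ℝ) :
    ∃ W : Set (Fin (d + 1 + 1) → ℤ), W.Finite ∧ ∀ᶠ s in atTop, ∀ j : ℤ,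
      ‖corner (complexSequence d (residueIndex d r s) ^ j)‖ ≤ B →
        ∃ w ∈ W, j = jorgensenHom d r s w := by
  -- `E / n²` bounds the distance of the sum of rotation numbers from `Q`, `C / n` bounds the lower
  -- sums of the correction coefficients, `P` bounds `|Q|`, and `R` is the constant with which
  -- `exists_digits` is applied to `j - Q · jorgensenExponent`.
  set E := B + (d + 1) * (2 * Real.pi * √B) ^ 2 with hE
  set C := ∑ i ∈ Finset.range (d + 1), |jorgensenCoeff d r i| with hC
  set P := (d + 3) / 2 * √(2 * B) + E with hP
  set R := √B + 2 * E + P * C with hR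
  refine ⟨_, finite_box (d + 1 + 1) (2 ^ d * R + P), ?_⟩
  have hν : Tendsto (fun s => (residueIndex d r s : ℝ)) atTop atTop :=
    tendsto_atTop_mono (fun s => by
      rw [cast_residueIndex]
      have h1 : (0 : ℝ) ≤ s := by positivity
      have h2 : (0 : ℝ) ≤ r := by positivity
      have h3 : (0 : ℝ) ≤ d * s := by positivity
      linarith) tendsto_natCast_atTop_atTop
  filter_upwards [hν.eventually_ge_atTop 1, hν.eventually_ge_atTop (2 * Real.pi * √B)]
    with s hs1 hsB j hj
  have hn : 1 ≤ residueIndex d r s := by exact_mod_cast hs1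
  have hB : 0 ≤ B := (norm_nonneg _).trans hj
  obtain ⟨hβ, hrot, Q, hQ⟩ := rotationNumber_bounds hd hn hsB hj
  set n := residueIndex d r s with hn'
  have hn0 : (0 : ℝ) < n := by linarith
  set β := (j : ℝ) / (n : ℝ) ^ (d + 2) with hβ'
  have hE0 : 0 ≤ E := by positivity
  have hC0 : 0 ≤ C := Finset.sum_nonneg fun _ _ => abs_nonneg _
  have hD : (d + 3 : ℝ) ≠ 0 := by positivity
  have hQ1 : |(d + 3) / 2 * β - Q| ≤ E / n := by
    refine hQ.trans ?_
    rw [div_le_div_iff₀ (by positivity) hn0]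
    exact mul_le_mul_of_nonneg_left (by nlinarith) hE0
  have hQP : |(Q : ℝ)| ≤ P := by
    have h1 : |(d + 3) / 2 * β| ≤ (d + 3) / 2 * √(2 * B) := by
      rw [abs_mul, abs_of_pos (by positivity : (0 : ℝ) < (d + 3) / 2)]
      exact mul_le_mul_of_nonneg_left hβ (by positivity)
    have h2 : E / n ≤ E := div_le_self hE0 hs1
    have h3 := abs_sub_abs_le_abs_sub (Q : ℝ) ((d + 3) / 2 * β)
    rw [abs_sub_comm] at h3
    linarith
  have hP0 : 0 ≤ P := (abs_nonneg _).trans hQP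
  have hQc : ∀ {p : ℕ}, p ≤ d + 1 →
      |(Q : ℝ) * lowerSum (jorgensenCoeff d r) p n| ≤ P * C / n := fun hp => by
    rw [abs_mul, mul_div_assoc]
    exact mul_le_mul hQP (abs_lowerSum_le _ hp hs1) (abs_nonneg _) hP0
  have hj1 : |((j - Q * jorgensenExponent d r s : ℤ) : ℝ)| ≤ R * (n : ℝ) ^ d := by
    have e : ((j - Q * jorgensenExponent d r s : ℤ) : ℝ) =
        2 / (d + 3) * ((d + 3) / 2 * β - Q) * (n : ℝ) ^ (d + 2) -
          Q * lowerSum (jorgensenCoeff d r) (d + 1) n * (n : ℝ) ^ (d + 1) := by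
      push_cast
      rw [jorgensenExponent_eq d r s hn, hβ', ← hn']
      field_simp
      ring
    have h1 : |2 / (d + 3) * ((d + 3) / 2 * β - Q) * (n : ℝ) ^ (d + 2)| ≤ E * (n : ℝ) ^ d := by
      rw [abs_mul, abs_mul, abs_of_pos (by positivity : (0 : ℝ) < 2 / (d + 3)),
        abs_of_pos (by positivity : (0 : ℝ) < (n : ℝ) ^ (d + 2))]
      have h2 : (2 / (d + 3) : ℝ) ≤ 1 := by
        rw [div_le_one (by positivity)]
        have : (0 : ℝ) ≤ d := by positivity
        linarith
      have h3 : 2 / (d + 3) * |(d + 3) / 2 * β - Q| ≤ E / (n : ℝ) ^ 2 :=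
        (mul_le_of_le_one_left (abs_nonneg _) h2).trans hQ
      refine (mul_le_mul_of_nonneg_right h3 (by positivity)).trans (le_of_eq ?_)
      rw [pow_add]
      field_simp
    have h2 : |(Q : ℝ) * lowerSum (jorgensenCoeff d r) (d + 1) n * (n : ℝ) ^ (d + 1)| ≤
        P * C * (n : ℝ) ^ d := by
      rw [abs_mul, abs_of_pos (by positivity : (0 : ℝ) < (n : ℝ) ^ (d + 1))]
      refine (mul_le_mul_of_nonneg_right (hQc le_rfl) (by positivity)).trans (le_of_eq ?_)
      rw [pow_succ]
      field_simp
    rw [e]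
    refine (abs_sub _ _).trans ?_
    rw [hR, add_mul, add_mul, two_mul, add_mul]
    have h3 : 0 ≤ √B * (n : ℝ) ^ d := by positivity
    have h4 : 0 ≤ E * (n : ℝ) ^ d := by positivity
    linarith
  obtain ⟨a, ha, hja⟩ := exists_digitHom_eq hn hj1 fun p hp1 hpd => by
    obtain ⟨i, rfl⟩ : ∃ i, p = i + 1 := ⟨p - 1, by omega⟩
    obtain ⟨z, hz⟩ := hrot i (by omega)
    refine ⟨z - Q * jorgensenQuotient d r s (d - (i + 1)), ?_⟩
    -- The fractional parts of `j` and of `Q` copies of the additional exponent agree up to the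
    -- deviation of `(d + 3) / 2 · β` from `Q`.
    have e : ((j - Q * jorgensenExponent d r s : ℤ) : ℝ) / (n : ℝ) ^ (i + 1) -
        ((z - Q * jorgensenQuotient d r s (d - (i + 1)) : ℤ) : ℝ) =
        (j / (n : ℝ) ^ (i + 1) + angleWeight (i + 1) / 2 * β - z) -
          angleWeight (i + 1) / (d + 3) * ((d + 3) / 2 * β - Q) -
          Q * lowerSum (jorgensenCoeff d r) (i + 1) n := by
      push_cast
      rw [sub_div, mul_div_assoc, jorgensenExponent_div_pow d r s hn hpd]
      field_simp
      ring
    have h1 : |(angleWeight (i + 1) : ℝ) / (d + 3) * ((d + 3) / 2 * β - Q)| ≤ E / n := by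
      rw [abs_mul, abs_div, abs_of_pos (by positivity : (0 : ℝ) < d + 3)]
      exact (mul_le_of_le_one_left (abs_nonneg _) ((div_le_one (by positivity)).mpr
        (abs_angleWeight_le _ d))).trans hQ1
    rw [e]
    refine (abs_sub _ _).trans ?_
    have h2 := abs_sub ((j : ℝ) / (n : ℝ) ^ (i + 1) + angleWeight (i + 1) / 2 * β - z)
      (angleWeight (i + 1) / (d + 3) * ((d + 3) / 2 * β - Q))
    have h3 := hQc (Nat.le_succ_of_le hpd)
    have h4 : 0 ≤ E / n := by positivity
    have h5 : R / n = √B / n + 2 * (E / n) + P * C / n := by rw [hR]; ring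
    linarith
  refine ⟨Fin.snoc a Q, fun t => ?_, ?_⟩
  · have hR0 : 0 ≤ R := by positivity
    refine Fin.lastCases ?_ (fun t => ?_) t
    · rw [Fin.snoc_last]
      have : 0 ≤ 2 ^ d * R := by positivity
      linarith
    · rw [Fin.snoc_castSucc]
      linarith [ha t]
  · rw [jorgensenHom_apply]
    simp only [Fin.snoc_castSucc, Fin.snoc_last]
    rw [← hn', ← hja]
    ring

end ComplexFinite

/-! ### Representations along residue classes modulo `k + 2` -/

section ComplexRepresentations

variable {d : ℕ}

theorem tendsto_residueIndex (d r : ℕ) : Tendsto (residueIndex d r) atTop atTop :=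
  tendsto_atTop_mono (fun s => by
    rw [residueIndex, id, add_mul]
    omega) tendsto_id

theorem exists_cornersConverge_complexSequence (hd : 1 ≤ d) (r : ℕ) :
    ∃ L, CornersConverge (fun s => complexSequence d (residueIndex d r s)) (jorgensenHom d r) L := by
  refine exists_cornersConverge (isClosed_unitaryGroup ℂ (d + 1)) (jorgensenHom_single d r)
    (fun w => ?_) (exists_finite_complexSequence hd r)
  have hn := (tendsto_residueIndex d r).eventually_ge_atTop 1
  obtain ⟨T, hT, hne⟩ := exists_tendsto_complexSequence hd (tendsto_residueIndex d r)
    (j := fun s => jorgensenHom d r s w) (A := jorgensenDigits d r w) (Q := w (Fin.last _))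
    (hn.mono fun s hs => jorgensenHom_eq d r s hs w)
    (hn.mono fun s hs i hi => exists_jorgensenHom_div_pow d r s hs w (Nat.succ_le_of_lt hi))
  refine ⟨T, hT, fun hw h0 => hw ?_⟩
  obtain ⟨hQ, hA⟩ := hne h0
  funext t
  refine Fin.lastCases hQ (fun t => ?_) t
  have h := hA t (Nat.lt_succ_iff.mp t.2)
  rw [jorgensenDigits, hQ, Int.cast_zero, zero_mul, add_zero, digits_val] at h
  exact_mod_cast h

/-- The exponent `1` has the digits `1, 0, 0, …` and `Q = 0`, so no residue condition enters and the
generators converge along all `n`. -/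
theorem exists_tendsto_complexSequence_self (hd : 1 ≤ d) :
    ∃ a, Tendsto (complexSequence d) atTop (𝓝 a) := by
  obtain ⟨T, hT, -⟩ := exists_tendsto_complexSequence hd tendsto_id (j := fun _ => 1)
    (A := fun i => digits (Pi.single 0 1 : Fin (d + 1) → ℤ) i) (Q := 0) (by
      filter_upwards [eventually_ge_atTop 1] with n hn
      have h := digitHom_div_pow_top (Pi.single 0 1 : Fin (d + 1) → ℤ) n
      rw [digitHom_single, div_eq_iff (by positivity)] at h
      simpa using h) (by
      filter_upwards [eventually_ge_atTop 1] with n hn i hi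
      obtain ⟨z, hz⟩ := exists_digitHom_div_pow (Pi.single 0 1 : Fin (d + 1) → ℤ) hn (p := i + 1)
        (by omega)
      refine ⟨z, ?_⟩
      rw [digitHom_single] at hz
      simpa using hz)
  obtain ⟨a, -, ha⟩ := exists_tendsto_of_tendsto_val (isClosed_unitaryGroup ℂ (d + 1)) hT
  refine ⟨a, ha.congr fun n => ?_⟩
  simp

theorem eventually_of_forall_residueIndex {p : ℕ → Prop}
    (h : ∀ r, r < d + 3 → ∀ᶠ s in atTop, p (residueIndex d r s)) : ∀ᶠ n in atTop, p n := by
  have h1 : ∀ᶠ s in atTop, ∀ r ∈ Finset.range (d + 3), p (residueIndex d r s) :=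
    (Filter.eventually_all_finset _).mpr fun r hr => h r (Finset.mem_range.mp hr)
  filter_upwards [(Nat.tendsto_div_const_atTop (show d + 3 ≠ 0 by omega)).eventually h1] with n hn
  have h2 := hn (n % (d + 3)) (Finset.mem_range.mpr (Nat.mod_lt _ (by omega)))
  rwa [residueIndex, Nat.div_add_mod] at h2

/-- The minimum of the bounds for the finitely many residue classes works for all large `n`. -/
theorem exists_le_corner_complexSequence (hd : 1 ≤ d) : ∃ κ : ℝ, 0 < κ ∧
    ∀ᶠ n in atTop, ∀ j : ℤ, j ≠ 0 → κ ≤ ‖corner (complexSequence d n ^ j)‖ := by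
  have h1 : ∀ r, ∃ κ : ℝ, 0 < κ ∧ ∀ᶠ s in atTop, ∀ j : ℤ, j ≠ 0 →
      κ ≤ ‖corner (complexSequence d (residueIndex d r s) ^ j)‖ := fun r => by
    obtain ⟨L, hL⟩ := exists_cornersConverge_complexSequence hd r
    exact hL.exists_le
  choose κ hκ hev using h1
  obtain ⟨r₀, -, hr₀⟩ := Finset.exists_min_image (Finset.range (d + 3)) κ ⟨0, by simp⟩
  exact ⟨κ r₀, hκ r₀, eventually_of_forall_residueIndex fun r hr => (hev r).mono fun s hs j hj =>
    (hr₀ r (Finset.mem_range.mpr hr)).trans (hs j hj)⟩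

theorem exists_complex_representations (hd : 1 ≤ d) :
    ∃ (ρ : ℕ → FreeGroup (Fin 2) →* SU1 (d + 1)) (ρlim : FreeGroup (Fin 2) →* SU1 (d + 1)),
      (∀ n, 1 ≤ n → IsConvexCocompact (ρ n)) ∧
      IsJorgensenSequence (d + 1) (fun n => restrictToA (ρ n)) ∧
      (∀ n, 1 ≤ n → ρ n (FreeGroup.of 0) = complexSequence d (residueIndex d 0 n)) ∧
      ConvergesAlgebraically ρ ρlim ∧ HasFreeProductLimit (d + 1) ρ ρlim := by
  obtain ⟨L, hL⟩ := exists_cornersConverge_complexSequence hd 0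
  exact hL.exists_representations 0 (by omega) le_rfl (fun p e h u => h.translation_mem u)
    fun n hn => isLoxodromicMatrix_complexSequence d _ (by rw [residueIndex]; nlinarith)

/-- A common lower bound for the corners allows one base point and one `b` for all residue classes.
Only the exponents, and hence possibly the geometric limit, depend on the class. -/
theorem exists_complex_representations_residue (hd : 1 ≤ d) :
    ∃ (ρ : ℕ → FreeGroup (Fin 2) →* SU1 (d + 1)) (ρlim : FreeGroup (Fin 2) →* SU1 (d + 1)),
      (∀ n, 1 ≤ n → IsConvexCocompact (ρ n)) ∧
      (∀ n, 1 ≤ n → ρ n (FreeGroup.of 0) = complexSequence d n) ∧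
      ConvergesAlgebraically ρ ρlim ∧
      ∀ r, HasFreeProductLimit (d + 1) (fun s => ρ (residueIndex d r s)) ρlim := by
  obtain ⟨κ, hκ, hev⟩ := exists_le_corner_complexSequence hd
  obtain ⟨t, b, ρ, ht, ht', hb1, hb, hρ, hρb⟩ := exists_freeGroup_representations (0 : Fin (d + 1))
    le_rfl (fun p e h u => h.translation_mem u) (isLoxodromicMatrix_complexSequence d) hκ hev
  obtain ⟨a, ha⟩ := exists_tendsto_complexSequence_self hd
  have hρa : ∀ᶠ n in atTop, ρ n (FreeGroup.of 0) = complexSequence d n :=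
    (eventually_ge_atTop 1).mono fun n hn => (hρ n hn).1
  refine ⟨ρ, _, fun n hn => (hρ n hn).2.1, fun n hn => (hρ n hn).1,
    convergesAlgebraically_lift (ha.congr' (hρa.mono fun n hn => hn.symm))
      (hρb.mono fun n hn => hn.1), fun r => ?_⟩
  have hν := tendsto_residueIndex d r
  obtain ⟨L, hL⟩ := exists_cornersConverge_complexSequence hd r
  have hpc := hL.powersConverge ((hν.eventually_ge_atTop 1).mono fun s hs =>
    isLoxodromicMatrix_complexSequence d _ hs) ht ht'
  -- The limit of the generators does not depend on the class, so the algebraic limit is the same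
  -- for all of them.
  have haL : a = L (Multiplicative.ofAdd (Pi.single 0 1)) := by
    refine tendsto_nhds_unique (ha.comp hν) ((hL.tendsto (Pi.single 0 1)).congr fun s => ?_)
    rw [hL.apply_single, zpow_one]
    rfl
  exact hpc.isFreeProductLimit le_rfl (isFrame_basePoint ht (0 : Fin (d + 1))).pos (by omega)
    ((hν.eventually hρb).mono fun s hs => hs.2) hb1 hb (hν.eventually hρa)
    ((hν.eventually hρb).mono fun s hs => hs.1)
    ((hν.eventually_ge_atTop 1).mono fun s hs => (hρ _ hs).2.1.2.1) (by simpa using haL) (by simp)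

end ComplexRepresentations

theorem theoremD (k : ℕ) (hk : 2 ≤ k) :
    -- real hyperbolic case
    (∀ l : ℕ, 1 ≤ l → l ≤ k / 2 →
      ∃ (ρ : ℕ → FreeGroup (Fin 2) →* SO1 k) (ρlim : FreeGroup (Fin 2) →* SO1 k),
        (∀ n, 1 ≤ n → IsConvexCocompact (ρ n)) ∧
        IsJorgensenSequence l (fun n => restrictToA (ρ n)) ∧
        (l = k / 2 → ∀ n, 1 ≤ n →
          (ρ n (FreeGroup.of 0)).1.1 = realJorgensenMatrix k n) ∧
        ConvergesAlgebraically ρ ρlim ∧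
        HasFreeProductLimit l ρ ρlim) ∧
    -- complex hyperbolic case
    (∀ l : ℕ, 1 ≤ l → l ≤ k →
      ∃ (ρ : ℕ → FreeGroup (Fin 2) →* SU1 k) (ρlim : FreeGroup (Fin 2) →* SU1 k),
        (∀ n, 1 ≤ n → IsConvexCocompact (ρ n)) ∧
        IsJorgensenSequence l (fun n => restrictToA (ρ n)) ∧
        (l = k → ∀ n, 1 ≤ n →
          (ρ n (FreeGroup.of 0)).1.1 = complexJorgensenMatrix k ((k + 2) * n)) ∧
        ConvergesAlgebraically ρ ρlim ∧
        HasFreeProductLimit l ρ ρlim) ∧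
    -- complex hyperbolic case, the whole sequence of maximal rank
    (∃ (ρ : ℕ → FreeGroup (Fin 2) →* SU1 k) (ρlim : FreeGroup (Fin 2) →* SU1 k),
        (∀ n, 1 ≤ n → IsConvexCocompact (ρ n)) ∧
        (∀ n, 1 ≤ n → (ρ n (FreeGroup.of 0)).1.1 = complexJorgensenMatrix k n) ∧
        ConvergesAlgebraically ρ ρlim ∧
        ∀ r : ℕ, HasFreeProductLimit k (fun m => ρ ((k + 2) * m + r)) ρlim) := by
  refine ⟨fun l hl hlk => ?_, fun l hl hlk => ?_, ?_⟩
  · obtain ⟨ρ, ρlim, hcc, hj, hs, ha, hg⟩ := exists_real_representations hl hlk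
    refine ⟨ρ, ρlim, hcc, hj, fun h n hn => ?_, ha, hg⟩
    subst h
    rw [hs n hn, realSequence_eq_realJorgensenMatrix]
  -- Below maximal rank the balanced sequence is used; the prescribed matrices matter only for `l =
  -- k`, along the residue class of `0`.
  · rcases hlk.lt_or_eq with h | rfl
    · obtain ⟨ρ, ρlim, hcc, hj, -, ha, hg⟩ := exists_balanced_representations hl h
      exact ⟨ρ, ρlim, hcc, hj, fun h' => absurd h' h.ne, ha, hg⟩
    · obtain ⟨d, rfl⟩ : ∃ d, l = d + 1 := ⟨l - 1, by omega⟩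
      obtain ⟨ρ, ρlim, hcc, hj, hs, ha, hg⟩ := exists_complex_representations (d := d) (by omega)
      refine ⟨ρ, ρlim, hcc, hj, fun _ n hn => ?_, ha, hg⟩
      rw [hs n hn, complexSequence_eq_complexJorgensenMatrix]
      rfl
  · obtain ⟨d, rfl⟩ : ∃ d, k = d + 1 := ⟨k - 1, by omega⟩
    obtain ⟨ρ, ρlim, hcc, hs, ha, hg⟩ := exists_complex_representations_residue (d := d) (by omega)
    refine ⟨ρ, ρlim, hcc, fun n hn => ?_, ha, hg⟩
    rw [hs n hn, complexSequence_eq_complexJorgensenMatrix]
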